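/- Let $N\ge 3$, let $q>0$ be real with $q\ne1$, and work over $\Bbbk=\mathbb R$ or $\mathbb C$. Indices run from $1$ to $N$, repeated upper and lower indices are summed, and $i'=N+1-i$. Put $\varrho_i=\frac N2-i$ for $i<\frac{N+1}2$, $\varrho_i=0$ for $i=\frac{N+1}2$, $\varrho_i=\frac N2-i+1$ for $i>\frac{N+1}2$; $C^{ij}=C_{ij}=q^{-\varrho_i}\delta_{i,j'}$; $K^{kl}_{ij}=C^{kl}C_{ij}$; $$R^{kl}_{ij}=q^{\delta_{k,l}-\delta_{k,l'}}\delta_{i,l}\delta_{j,k}+(q-q^{-1})\,\theta_{il}\,\bigl(\delta_{i,k}\delta_{j,l}-K^{kl}_{ij}\bigr),$$ where $\theta_{il}=1$ if $i<l$ and $0$ otherwise; and $R^-=R-(q-q^{-1})\,\mathrm{id}+(q-q^{-1})K$ (the inverse of $R$). Let $X$ be the algebra generated by $x_1,\dots,x_N$ with relations $(R^-)^{kl}_{ij}x_kx_l=q^{-1}x_ix_j+\frac{q^{N-1}-q^{N-3}}{1+q^{N-2}}K^{kl}_{ij}x_kx_l$ and $C^{kl}x_kx_l=1$ (the quantum Euclidean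 sphere). The quantum group $\mathrm O_q(N)$ is generated by $u^i_j$ with relations $R^{kl}_{ij}u^s_ku^t_l=R^{st}_{kl}u^k_iu^l_j$, $C^{kl}u^i_ku^j_l=C^{ij}$, $C_{ij}u^i_ku^j_l=C_{kl}$, with $\Delta u^i_j=u^i_k\otimes u^k_j$ and $\varepsilon(u^i_j)=\delta_{ij}$; it coacts on $X$ by $x_k\mapsto x_i\otimes u^i_k$. Let $(\Gamma,\mathrm d)=(\Gamma_+,\mathrm d)$ be the first order differential calculus on $X$ determined by $$\mathrm dx_i\cdot x_j=(R^-)^{kl}_{ij}x_k\mathrm dx_l+(q-1)x_i\mathrm dx_j+\tfrac{q^N-q^{N-2}}{1-q^{N-1}}K^{kl}_{ij}x_k\mathrm dx_l+\tfrac{(1-q)(1+q^{N-2})}{1-q^{N-1}}C^{kl}x_ix_jx_k\mathrm dx_l ,$$ put $\eta=C^{kl}x_k\mathrm dx_l$, and let either $\gamma_i=\mathrm dx_i-\frac{1+q^{N-2}}{1-q^{N-1}}x_i\eta$ for all $i$, or $\gamma_i=\mathrm dx_i+q\frac{1+q^{N-2}}{1-q^{N-1}}x_i\eta$ for all $i$.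 A *higher order differential calculus extending* $\Gamma$ is a graded algebra whose components of degree $0$ and $1$ are $X$ and $\Gamma$ (with the given bimodule structure), with a linear map $\mathrm d$ of degree $1$ that extends $\mathrm d:X\to\Gamma$, satisfies the graded Leibniz rule and $\mathrm d\,\mathrm d=0$. It is *covariant* if the coaction of $\mathrm O_q(N)$ on $X$ extends to a coaction on it by an algebra homomorphism commuting with $\mathrm d$. It is *universal* if it maps uniquely, compatibly with all the structure, to every higher order differential calculus extending $\Gamma$. In $\Gamma\otimes_X\Gamma$ put $$\begin{aligned}[\mathrm I]_{ij}&=(R^-)^{kl}_{ij}\,\mathrm dx_k\otimes\mathrm dx_l+q\,\mathrm dx_i\otimes\mathrm dx_j-q\tfrac{(1-q)(1+q^{N-2})}{1-q^{N-1}}\,x_i\eta\otimes\mathrm dx_j-\tfrac{(1-q)(1+q^{N-2})}{1-q^{N-1}}(R^-)^{kl}_{ij}\,x_k\eta\otimes\mathrm dx_l\\&\quad-\tfrac{(1+q^2)(1+q^{N-2})^2}{(1-q^{N-1})^2}\,x_ix_jC^{kl}x_k\eta\otimes\mathrm dx_l+q^{N-2}\tfrac{(1+q)(1+q^2)(1+q^{N-2})}{(1-q^{N-1})^2}K^{kl}_{ij}\,x_k\eta\otimes\mathrm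 dx_l,\\ [\mathrm{II}]&=C^{mn}\,\mathrm dx_m\otimes\mathrm dx_n+2q\tfrac{1+q^{N-2}}{(1-q)(1-q^{N-1})}C^{kl}x_k\eta\otimes\mathrm dx_l.\end{aligned}$$ Then the following hold. 1. For every real $\alpha$ there is exactly one $X$-bimodule endomorphism $\sigma$ of $\Gamma\otimes_X\Gamma$ with $\sigma(\gamma_i\otimes\gamma_j)=\alpha\,(R^-)^{kl}_{ij}\,\gamma_k\otimes\gamma_l$ for all $i,j$. 2. For this $\sigma$, the map $\mathrm{id}-\sigma$ annihilates $[\mathrm{II}]$ and all $[\mathrm I]_{ij}$ if and only if $\alpha=q$. 3. The quotient of the tensor algebra $\bigoplus_n\Gamma^{\otimes_Xn}$ by the two-sided ideal generated by $\ker(\mathrm{id}-\sigma)$ carries (with the canonical maps of $X$ and $\Gamma$ into it) the structure of a higher order differential calculus extending $\Gamma$ if and only if $\alpha=q$; and it carries the structure of a covariant one if and only if $\alpha=q$. 4. There is a universal higher order differential calculus extending $\Gamma$, which is covariant, and in which the kernel of the multiplication map $\Gamma\otimes_X\Gamma\to\Gamma\wedge\Gamma$ is the left $X$-submodule generated by $[\mathrm{II}]$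 and all $[\mathrm I]_{ij}$. -/

import Mathlib

open scoped TensorProduct
open MulOpposite

set_option linter.unusedSectionVars false

universe u

noncomputable section

namespace QSphere

/-! ### Bimodules, balanced tensor products and tensor algebras over a noncommutative algebra

An `A`-bimodule is a left `A`-module which is also a left `Aᵐᵒᵖ`-module, with commuting actions:
the right multiplication `m · a` is `op a • m`. -/

section Bimodules

variable (𝕜 : Type u) [Field 𝕜] (A : Type u) [Ring A] [Algebra 𝕜 A]
variable (M : Type u) [AddCommGroup M] [Module 𝕜 M] [Module A M] [Module Aᵐᵒᵖ M]
  [SMulCommClass A Aᵐᵒᵖ M] [IsScalarTower 𝕜 A M] [IsScalarTower 𝕜 Aᵐᵒᵖ M]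

/-- The subspace of `M ⊗ M` (over the ground field) spanned by all `m a ⊗ n - m ⊗ a n`. -/
def balancedRel : Submodule 𝕜 (M ⊗[𝕜] M) :=
  Submodule.span 𝕜 {t | ∃ (m n : M) (a : A), t = (op a • m) ⊗ₜ[𝕜] n - m ⊗ₜ[𝕜] (a • n)}

/-- The tensor product `M ⊗_A M` of a bimodule with itself over the noncommutative algebra `A`. -/
def BTensor : Type u := (M ⊗[𝕜] M) ⧸ balancedRel 𝕜 A M

instance : AddCommGroup (BTensor 𝕜 A M) :=
  inferInstanceAs (AddCommGroup ((M ⊗[𝕜] M) ⧸ balancedRel 𝕜 A M))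

instance : Module 𝕜 (BTensor 𝕜 A M) :=
  inferInstanceAs (Module 𝕜 ((M ⊗[𝕜] M) ⧸ balancedRel 𝕜 A M))

/-- The canonical projection `M ⊗ M → M ⊗_A M`. -/
def BTensor.mk : (M ⊗[𝕜] M) →ₗ[𝕜] BTensor 𝕜 A M := (balancedRel 𝕜 A M).mkQ

theorem BTensor.mk_surjective : Function.Surjective (BTensor.mk 𝕜 A M) :=
  (balancedRel 𝕜 A M).mkQ_surjective

variable {M} in
/-- The elementary tensor `m ⊗_A n`. -/
def btmul (m n : M) : BTensor 𝕜 A M := BTensor.mk 𝕜 A M (m ⊗ₜ[𝕜] n)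

variable {𝕜 A M} in
@[elab_as_elim]
theorem BTensor.induction {p : BTensor 𝕜 A M → Prop} (h0 : p 0)
    (ht : ∀ m n, p (btmul 𝕜 A m n)) (ha : ∀ s t, p s → p t → p (s + t))
    (t : BTensor 𝕜 A M) : p t := by
  obtain ⟨t, rfl⟩ := BTensor.mk_surjective 𝕜 A M t
  induction t with
  | zero => simpa using h0
  | tmul m n => exact ht m n
  | add s t hs ht' => rw [map_add]; exact ha _ _ hs ht'

theorem btmul_balanced (m n : M) (a : A) :
    btmul 𝕜 A (op a • m) n = btmul 𝕜 A m (a • n) :=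
  (Submodule.Quotient.eq (balancedRel 𝕜 A M)).2 (Submodule.subset_span ⟨m, n, a, rfl⟩)

/-- Left multiplication by `a` on the first tensor factor. -/
def BTensor.lact (a : A) : BTensor 𝕜 A M →ₗ[𝕜] BTensor 𝕜 A M :=
  (balancedRel 𝕜 A M).mapQ (balancedRel 𝕜 A M)
    (LinearMap.rTensor M (Algebra.lsmul 𝕜 𝕜 M a)) (by
      rw [balancedRel, Submodule.span_le]
      rintro _ ⟨m, n, b, rfl⟩
      refine Submodule.subset_span ⟨a • m, n, b, ?_⟩
      simp [smul_comm a (op b) m])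

/-- Right multiplication by `a` on the second tensor factor. -/
def BTensor.ract (a : Aᵐᵒᵖ) : BTensor 𝕜 A M →ₗ[𝕜] BTensor 𝕜 A M :=
  (balancedRel 𝕜 A M).mapQ (balancedRel 𝕜 A M)
    (LinearMap.lTensor M (Algebra.lsmul 𝕜 𝕜 M a)) (by
      rw [balancedRel, Submodule.span_le]
      rintro _ ⟨m, n, b, rfl⟩
      refine Submodule.subset_span ⟨m, a • n, b, ?_⟩
      simp [smul_comm b a n])

theorem BTensor.lact_btmul (a : A) (m n : M) :
    BTensor.lact 𝕜 A M a (btmul 𝕜 A m n) = btmul 𝕜 A (a • m) n := rfl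

theorem BTensor.ract_btmul (a : Aᵐᵒᵖ) (m n : M) :
    BTensor.ract 𝕜 A M a (btmul 𝕜 A m n) = btmul 𝕜 A m (a • n) := rfl

theorem btmul_add_left (m m' n : M) :
    btmul 𝕜 A (m + m') n = btmul 𝕜 A m n + btmul 𝕜 A m' n := by
  simp [btmul, TensorProduct.add_tmul]

theorem btmul_add_right (m n n' : M) :
    btmul 𝕜 A m (n + n') = btmul 𝕜 A m n + btmul 𝕜 A m n' := by
  simp [btmul, TensorProduct.tmul_add]

theorem btmul_zero_left (n : M) : btmul 𝕜 A (0 : M) n = 0 := by simp [btmul]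

theorem btmul_zero_right (m : M) : btmul 𝕜 A m (0 : M) = 0 := by simp [btmul]

instance : Module A (BTensor 𝕜 A M) where
  smul a t := BTensor.lact 𝕜 A M a t
  one_smul t := by
    change BTensor.lact 𝕜 A M 1 t = t
    induction t using BTensor.induction with
    | h0 => simp
    | ht m n => simp [BTensor.lact_btmul]
    | ha s t hs ht => simp [hs, ht]
  mul_smul a b t := by
    change BTensor.lact 𝕜 A M (a * b) t = BTensor.lact 𝕜 A M a (BTensor.lact 𝕜 A M b t)
    induction t using BTensor.induction with
    | h0 => simp
    | ht m n => simp [BTensor.lact_btmul, mul_smul]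
    | ha s t hs ht => simp [hs, ht]
  smul_zero a := map_zero (BTensor.lact 𝕜 A M a)
  smul_add a := map_add (BTensor.lact 𝕜 A M a)
  add_smul a b t := by
    change BTensor.lact 𝕜 A M (a + b) t = BTensor.lact 𝕜 A M a t + BTensor.lact 𝕜 A M b t
    induction t using BTensor.induction with
    | h0 => simp
    | ht m n => simp [BTensor.lact_btmul, add_smul, btmul_add_left]
    | ha s t hs ht => simp only [map_add, hs, ht]; abel
  zero_smul t := by
    change BTensor.lact 𝕜 A M 0 t = 0
    induction t using BTensor.induction with
    | h0 => simp
    | ht m n => simp [BTensor.lact_btmul, btmul_zero_left]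
    | ha s t hs ht => simp [hs, ht]

instance : Module Aᵐᵒᵖ (BTensor 𝕜 A M) where
  smul a t := BTensor.ract 𝕜 A M a t
  one_smul t := by
    change BTensor.ract 𝕜 A M 1 t = t
    induction t using BTensor.induction with
    | h0 => simp
    | ht m n => simp [BTensor.ract_btmul]
    | ha s t hs ht => simp [hs, ht]
  mul_smul a b t := by
    change BTensor.ract 𝕜 A M (a * b) t = BTensor.ract 𝕜 A M a (BTensor.ract 𝕜 A M b t)
    induction t using BTensor.induction with
    | h0 => simp
    | ht m n => simp [BTensor.ract_btmul, mul_smul]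
    | ha s t hs ht => simp [hs, ht]
  smul_zero a := map_zero (BTensor.ract 𝕜 A M a)
  smul_add a := map_add (BTensor.ract 𝕜 A M a)
  add_smul a b t := by
    change BTensor.ract 𝕜 A M (a + b) t = BTensor.ract 𝕜 A M a t + BTensor.ract 𝕜 A M b t
    induction t using BTensor.induction with
    | h0 => simp
    | ht m n => simp [BTensor.ract_btmul, add_smul, btmul_add_right]
    | ha s t hs ht => simp only [map_add, hs, ht]; abel
  zero_smul t := by
    change BTensor.ract 𝕜 A M 0 t = 0
    induction t using BTensor.induction with
    | h0 => simp
    | ht m n => simp [BTensor.ract_btmul, btmul_zero_right]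
    | ha s t hs ht => simp [hs, ht]

variable {𝕜 A M} in
/-- For a `𝕜`-algebra `L`, an algebra map `i : A → L` and a bimodule map `j : M → L`, the
induced map `M ⊗_A M → L`, `m ⊗ n ↦ j m * j n`. -/
def wedge₂ {L : Type u} [Ring L] [Algebra 𝕜 L] (i : A →ₐ[𝕜] L) (j : M →ₗ[𝕜] L)
    (hl : ∀ a m, j (a • m) = i a * j m) (hr : ∀ a m, j (op a • m) = j m * i a) :
    BTensor 𝕜 A M →ₗ[𝕜] L :=
  (balancedRel 𝕜 A M).liftQ (TensorProduct.lift ((LinearMap.mul 𝕜 L).compl₁₂ j j)) (by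
    rw [balancedRel, Submodule.span_le]
    rintro _ ⟨m, n, a, rfl⟩
    simp [hl, hr, mul_assoc])

/-- Defining relations of the tensor algebra: on generators `a ∈ A` and `m ∈ M`, the algebra
structure of `A`, the vector space structure of `M` and both module structures of `M`. -/
inductive TensorRel : FreeAlgebra 𝕜 (A ⊕ M) → FreeAlgebra 𝕜 (A ⊕ M) → Prop
  | add_zero (a b : A) : TensorRel (FreeAlgebra.ι 𝕜 (.inl (a + b)))
      (FreeAlgebra.ι 𝕜 (.inl a) + FreeAlgebra.ι 𝕜 (.inl b))
  | scalar (c : 𝕜) : TensorRel (FreeAlgebra.ι 𝕜 (.inl (algebraMap 𝕜 A c)))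
      (algebraMap 𝕜 _ c)
  | mul (a b : A) : TensorRel (FreeAlgebra.ι 𝕜 (.inl (a * b)))
      (FreeAlgebra.ι 𝕜 (.inl a) * FreeAlgebra.ι 𝕜 (.inl b))
  | add_one (m n : M) : TensorRel (FreeAlgebra.ι 𝕜 (.inr (m + n)))
      (FreeAlgebra.ι 𝕜 (.inr m) + FreeAlgebra.ι 𝕜 (.inr n))
  | left (a : A) (m : M) : TensorRel (FreeAlgebra.ι 𝕜 (.inr (a • m)))
      (FreeAlgebra.ι 𝕜 (.inl a) * FreeAlgebra.ι 𝕜 (.inr m))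
  | right (a : A) (m : M) : TensorRel (FreeAlgebra.ι 𝕜 (.inr (op a • m)))
      (FreeAlgebra.ι 𝕜 (.inr m) * FreeAlgebra.ι 𝕜 (.inl a))

/-- The tensor algebra `A ⊕ M ⊕ (M ⊗_A M) ⊕ (M ⊗_A M ⊗_A M) ⊕ …` of the bimodule `M`, as the
universal algebra with an algebra map from `A` and a compatible bimodule map from `M`. -/
def BTensorAlgebra : Type u := RingQuot (TensorRel 𝕜 A M)

instance : Ring (BTensorAlgebra 𝕜 A M) := inferInstanceAs (Ring (RingQuot (TensorRel 𝕜 A M)))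

instance : Algebra 𝕜 (BTensorAlgebra 𝕜 A M) :=
  inferInstanceAs (Algebra 𝕜 (RingQuot (TensorRel 𝕜 A M)))

/-- The projection from the free algebra. -/
def BTensorAlgebra.proj : FreeAlgebra 𝕜 (A ⊕ M) →ₐ[𝕜] BTensorAlgebra 𝕜 A M :=
  RingQuot.mkAlgHom 𝕜 (TensorRel 𝕜 A M)

variable {𝕜 A M} in
theorem BTensorAlgebra.proj_rel {x y : FreeAlgebra 𝕜 (A ⊕ M)} (h : TensorRel 𝕜 A M x y) :
    BTensorAlgebra.proj 𝕜 A M x = BTensorAlgebra.proj 𝕜 A M y :=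
  RingQuot.mkAlgHom_rel 𝕜 h

/-- The class of a generator. -/
def BTensorAlgebra.gen (z : A ⊕ M) : BTensorAlgebra 𝕜 A M :=
  BTensorAlgebra.proj 𝕜 A M (FreeAlgebra.ι 𝕜 z)

/-- The embedding of `A` in degree zero. -/
def BTensorAlgebra.ι₀ : A →ₐ[𝕜] BTensorAlgebra 𝕜 A M where
  toFun a := BTensorAlgebra.gen 𝕜 A M (.inl a)
  map_one' := by
    have := BTensorAlgebra.proj_rel (TensorRel.scalar (A := A) (M := M) (1 : 𝕜))
    simpa [BTensorAlgebra.gen] using this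
  map_mul' a b := by
    have := BTensorAlgebra.proj_rel (TensorRel.mul (𝕜 := 𝕜) (M := M) a b)
    simpa [BTensorAlgebra.gen] using this
  map_zero' := by
    have := BTensorAlgebra.proj_rel (TensorRel.scalar (A := A) (M := M) (0 : 𝕜))
    simpa [BTensorAlgebra.gen] using this
  map_add' a b := by
    have := BTensorAlgebra.proj_rel (TensorRel.add_zero (𝕜 := 𝕜) (M := M) a b)
    simpa [BTensorAlgebra.gen] using this
  commutes' c := by
    have := BTensorAlgebra.proj_rel (TensorRel.scalar (A := A) (M := M) c)
    simpa [BTensorAlgebra.gen] using this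

theorem BTensorAlgebra.gen_left (a : A) (m : M) :
    BTensorAlgebra.gen 𝕜 A M (.inr (a • m)) =
      BTensorAlgebra.ι₀ 𝕜 A M a * BTensorAlgebra.gen 𝕜 A M (.inr m) := by
  have := BTensorAlgebra.proj_rel (TensorRel.left (𝕜 := 𝕜) a m)
  rw [map_mul] at this
  exact this

/-- The embedding of `M` in degree one. -/
def BTensorAlgebra.ι₁ : M →ₗ[𝕜] BTensorAlgebra 𝕜 A M where
  toFun m := BTensorAlgebra.gen 𝕜 A M (.inr m)
  map_add' m n := by
    have := BTensorAlgebra.proj_rel (TensorRel.add_one (𝕜 := 𝕜) (A := A) m n)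
    simpa [BTensorAlgebra.gen] using this
  map_smul' c m := by
    rw [← algebraMap_smul A c m, BTensorAlgebra.gen_left, AlgHom.commutes, Algebra.smul_def]
    rfl

theorem BTensorAlgebra.ι₁_left (a : A) (m : M) :
    BTensorAlgebra.ι₁ 𝕜 A M (a • m) = BTensorAlgebra.ι₀ 𝕜 A M a * BTensorAlgebra.ι₁ 𝕜 A M m :=
  BTensorAlgebra.gen_left 𝕜 A M a m

theorem BTensorAlgebra.ι₁_right (a : A) (m : M) :
    BTensorAlgebra.ι₁ 𝕜 A M (op a • m) =
      BTensorAlgebra.ι₁ 𝕜 A M m * BTensorAlgebra.ι₀ 𝕜 A M a := by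
  have := BTensorAlgebra.proj_rel (TensorRel.right (𝕜 := 𝕜) a m)
  rw [map_mul] at this
  exact this

/-- The canonical map from `M ⊗_A M` to the tensor algebra. -/
def BTensorAlgebra.ι₂ : BTensor 𝕜 A M →ₗ[𝕜] BTensorAlgebra 𝕜 A M :=
  wedge₂ (BTensorAlgebra.ι₀ 𝕜 A M) (BTensorAlgebra.ι₁ 𝕜 A M)
    (BTensorAlgebra.ι₁_left 𝕜 A M) (BTensorAlgebra.ι₁_right 𝕜 A M)

variable {𝕜 A M}

/-- The map `id - σ` on `M ⊗_A M`. -/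
abbrev idSub (σ : BTensor 𝕜 A M →ₗ[A] BTensor 𝕜 A M) : BTensor 𝕜 A M →ₗ[A] BTensor 𝕜 A M :=
  LinearMap.id - σ

/-- The relations `t = 0` in the tensor algebra, for all `t ∈ M ⊗_A M` with `(id - σ) t = 0`. -/
def ExteriorRel (σ : BTensor 𝕜 A M →ₗ[A] BTensor 𝕜 A M) (a b : BTensorAlgebra 𝕜 A M) : Prop :=
  ∃ t : BTensor 𝕜 A M, idSub σ t = 0 ∧ a = BTensorAlgebra.ι₂ 𝕜 A M t ∧ b = 0

/-- Antisymmetrisation: the quotient of the tensor algebra of `M` by the two-sided ideal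
generated by the kernel of `id - σ` on `M ⊗_A M`. -/
def ExteriorAlg (σ : BTensor 𝕜 A M →ₗ[A] BTensor 𝕜 A M) : Type u :=
  RingQuot (ExteriorRel σ)

instance (σ : BTensor 𝕜 A M →ₗ[A] BTensor 𝕜 A M) : Ring (ExteriorAlg σ) :=
  inferInstanceAs (Ring (RingQuot (ExteriorRel σ)))

instance (σ : BTensor 𝕜 A M →ₗ[A] BTensor 𝕜 A M) : Algebra 𝕜 (ExteriorAlg σ) :=
  inferInstanceAs (Algebra 𝕜 (RingQuot (ExteriorRel σ)))

/-- The quotient map onto the antisymmetrised algebra. -/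
def ExteriorAlg.mk (σ : BTensor 𝕜 A M →ₗ[A] BTensor 𝕜 A M) :
    BTensorAlgebra 𝕜 A M →ₐ[𝕜] ExteriorAlg σ :=
  RingQuot.mkAlgHom 𝕜 (ExteriorRel σ)

/-- A higher order differential calculus with underlying algebra `L` which extends the first
order differential calculus `δ : A → M`: a graded algebra whose components of degree `0` and `1`
are `A` and `M`, with a differential `d` of degree `1` extending `δ`. -/
structure HigherCalculus (δ : A →ₗ[𝕜] M) (L : Type u) [Ring L] [Algebra 𝕜 L] where
  /-- the homogeneous components -/
  deg : ℕ → Submodule 𝕜 L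
  graded : SetLike.GradedMonoid deg
  internal : DirectSum.IsInternal deg
  /-- the identification of `A` with the component of degree `0` -/
  i₀ : A →ₐ[𝕜] L
  i₀_injective : Function.Injective i₀
  range_i₀ : LinearMap.range i₀.toLinearMap = deg 0
  /-- the identification of `M` with the component of degree `1` -/
  i₁ : M →ₗ[𝕜] L
  i₁_injective : Function.Injective i₁
  range_i₁ : LinearMap.range i₁ = deg 1
  i₁_left : ∀ a m, i₁ (a • m) = i₀ a * i₁ m
  i₁_right : ∀ a m, i₁ (op a • m) = i₁ m * i₀ a
  /-- the differential -/
  d : L →ₗ[𝕜] L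
  d_deg : ∀ n, ∀ a ∈ deg n, d a ∈ deg (n + 1)
  d_extends : ∀ a, d (i₀ a) = i₁ (δ a)
  leibniz : ∀ n, ∀ a ∈ deg n, ∀ b, d (a * b) = d a * b + (-1 : 𝕜) ^ n • (a * d b)
  d_d : ∀ a, d (d a) = 0

/-- The map `M ⊗_A M → L` sending `m ⊗ n` to the two-form `m ∧ n`. -/
def HigherCalculus.wedge {δ : A →ₗ[𝕜] M} {L : Type u} [Ring L] [Algebra 𝕜 L]
    (S : HigherCalculus δ L) : BTensor 𝕜 A M →ₗ[𝕜] L :=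
  wedge₂ S.i₀ S.i₁ S.i₁_left S.i₁_right

/-- A calculus extending `δ` is universal if it maps uniquely to every calculus extending `δ`. -/
def HigherCalculus.IsUniversal {δ : A →ₗ[𝕜] M} {L : Type u} [Ring L] [Algebra 𝕜 L]
    (U : HigherCalculus δ L) : Prop :=
  ∀ (L' : Type u) [Ring L'] [Algebra 𝕜 L'] (S : HigherCalculus δ L'),
    ∃! φ : L →ₐ[𝕜] L', (∀ a, φ (U.i₀ a) = S.i₀ a) ∧ (∀ m, φ (U.i₁ m) = S.i₁ m) ∧
      ∀ z, φ (U.d z) = S.d (φ z)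

end Bimodules

/-! ### R-matrix and metric of `O_q(N)`

The index `i ∈ {1, …, N}` is `i - 1 : Fin N`, and `i' = N + 1 - i` is `Fin.rev i`. -/

section Matrices

variable {N : ℕ} (q : ℝ)

/-- The constants `ϱ_i`. -/
def rho (i : Fin N) : ℝ :=
  if 2 * ((i : ℕ) + 1) < N + 1 then (N : ℝ) / 2 - ((i : ℕ) + 1)
  else if 2 * ((i : ℕ) + 1) = N + 1 then 0
  else (N : ℝ) / 2 - ((i : ℕ) + 1) + 1

/-- The metric `C^{ij} = C_{ij}`. -/
def metric (i j : Fin N) : ℝ := if i = j.rev then q ^ (-rho i) else 0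

/-- `K^{kl}_{ij} = C^{kl} C_{ij}`. -/
def Kmat (k l i j : Fin N) : ℝ := metric q k l * metric q i j

/-- The R-matrix `R^{kl}_{ij}`. -/
def Rmat (k l i j : Fin N) : ℝ :=
  (if i = l ∧ j = k then
    q ^ ((if k = l then 1 else 0 : ℤ) - (if k = l.rev then 1 else 0 : ℤ)) else 0)
  + (q - q⁻¹) * (if i < l then (if i = k ∧ j = l then 1 else 0) - Kmat q k l i j else 0)

/-- The inverse R-matrix `(R⁻)^{kl}_{ij}`, where `R⁻ = R - (q - q⁻¹) I + (q - q⁻¹) K`. -/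
def Rinv (k l i j : Fin N) : ℝ :=
  Rmat q k l i j - (q - q⁻¹) * (if k = i ∧ l = j then 1 else 0) + (q - q⁻¹) * Kmat q k l i j

end Matrices

section Sphere

variable (𝕜 : Type u) [RCLike 𝕜] (N : ℕ) (q : ℝ)

/-! ### The quantum group `O_q(N)` -/

/-- Relations of `O_q(N)` on generators `u^i_j = ι (i, j)`: `R u₁ u₂ = u₁ u₂ R`,
`u C uᵗ = C`, `uᵗ C u = C`. -/
inductive OqRel : FreeAlgebra 𝕜 (Fin N × Fin N) → FreeAlgebra 𝕜 (Fin N × Fin N) → Prop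
  | ruu (s t i j : Fin N) : OqRel
      (∑ k, ∑ l, (Rmat q k l i j : 𝕜) • (FreeAlgebra.ι 𝕜 (s, k) * FreeAlgebra.ι 𝕜 (t, l)))
      (∑ k, ∑ l, (Rmat q s t k l : 𝕜) • (FreeAlgebra.ι 𝕜 (k, i) * FreeAlgebra.ι 𝕜 (l, j)))
  | upper (i j : Fin N) : OqRel
      (∑ k, ∑ l, (metric q k l : 𝕜) • (FreeAlgebra.ι 𝕜 (i, k) * FreeAlgebra.ι 𝕜 (j, l)))
      (algebraMap 𝕜 _ (metric q i j : 𝕜))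
  | lower (k l : Fin N) : OqRel
      (∑ i, ∑ j, (metric q i j : 𝕜) • (FreeAlgebra.ι 𝕜 (i, k) * FreeAlgebra.ι 𝕜 (j, l)))
      (algebraMap 𝕜 _ (metric q k l : 𝕜))

/-- The coordinate algebra of `O_q(N)`. -/
def Oq : Type u := RingQuot (OqRel 𝕜 N q)

instance : Ring (Oq 𝕜 N q) := inferInstanceAs (Ring (RingQuot (OqRel 𝕜 N q)))

instance : Algebra 𝕜 (Oq 𝕜 N q) := inferInstanceAs (Algebra 𝕜 (RingQuot (OqRel 𝕜 N q)))

/-- The projection from the free algebra. -/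
def Oq.proj : FreeAlgebra 𝕜 (Fin N × Fin N) →ₐ[𝕜] Oq 𝕜 N q :=
  RingQuot.mkAlgHom 𝕜 (OqRel 𝕜 N q)

variable {𝕜 N q} in
theorem Oq.proj_rel {x y : FreeAlgebra 𝕜 (Fin N × Fin N)} (h : OqRel 𝕜 N q x y) :
    Oq.proj 𝕜 N q x = Oq.proj 𝕜 N q y :=
  RingQuot.mkAlgHom_rel 𝕜 h

variable {𝕜 N q} in
/-- An algebra map on `O_q(N)` from an algebra map on the free algebra respecting relations. -/
def Oq.lift {B : Type u} [Ring B] [Algebra 𝕜 B] (f : FreeAlgebra 𝕜 (Fin N × Fin N) →ₐ[𝕜] B)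
    (h : ∀ ⦃x y⦄, OqRel 𝕜 N q x y → f x = f y) : Oq 𝕜 N q →ₐ[𝕜] B :=
  RingQuot.liftAlgHom 𝕜 ⟨f, h⟩

variable {N}

/-- The matrix entries `u^i_j`. -/
def uu (i j : Fin N) : Oq 𝕜 N q := Oq.proj 𝕜 N q (FreeAlgebra.ι 𝕜 (i, j))

theorem uu_ruu (s t i j : Fin N) :
    ∑ k, ∑ l, (Rmat q k l i j : 𝕜) • (uu 𝕜 q s k * uu 𝕜 q t l) =
      ∑ k, ∑ l, (Rmat q s t k l : 𝕜) • (uu 𝕜 q k i * uu 𝕜 q l j) := by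
  have := Oq.proj_rel (OqRel.ruu (𝕜 := 𝕜) (q := q) s t i j)
  simp only [map_sum, map_smul, map_mul] at this
  exact this

theorem uu_upper (i j : Fin N) :
    ∑ k, ∑ l, (metric q k l : 𝕜) • (uu 𝕜 q i k * uu 𝕜 q j l) =
      algebraMap 𝕜 _ (metric q i j : 𝕜) := by
  have := Oq.proj_rel (OqRel.upper (𝕜 := 𝕜) (q := q) i j)
  simp only [map_sum, map_smul, map_mul, AlgHom.commutes] at this
  exact this

theorem uu_lower (k l : Fin N) :
    ∑ i, ∑ j, (metric q i j : 𝕜) • (uu 𝕜 q i k * uu 𝕜 q j l) =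
      algebraMap 𝕜 _ (metric q k l : 𝕜) := by
  have := Oq.proj_rel (OqRel.lower (𝕜 := 𝕜) (q := q) k l)
  simp only [map_sum, map_smul, map_mul, AlgHom.commutes] at this
  exact this

theorem sum4_swap {α β : Type*} [Fintype α] [AddCommMonoid β] (f : α → α → α → α → β) :
    ∑ a, ∑ b, ∑ c, ∑ d, f a b c d = ∑ c, ∑ d, ∑ a, ∑ b, f a b c d := by
  calc ∑ a, ∑ b, ∑ c, ∑ d, f a b c d
      = ∑ p : α × α, ∑ r : α × α, f p.1 p.2 r.1 r.2 := by simp only [Fintype.sum_prod_type]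
    _ = ∑ r : α × α, ∑ p : α × α, f p.1 p.2 r.1 r.2 := Finset.sum_comm
    _ = ∑ c, ∑ d, ∑ a, ∑ b, f a b c d := by simp only [Fintype.sum_prod_type]

theorem comul_mul (s k t l : Fin N) :
    (∑ a, uu 𝕜 q s a ⊗ₜ[𝕜] uu 𝕜 q a k) * (∑ b, uu 𝕜 q t b ⊗ₜ[𝕜] uu 𝕜 q b l) =
      ∑ a, ∑ b, (uu 𝕜 q s a * uu 𝕜 q t b) ⊗ₜ[𝕜] (uu 𝕜 q a k * uu 𝕜 q b l) := by
  simp only [Finset.sum_mul_sum, Algebra.TensorProduct.tmul_mul_tmul]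

/-- The comultiplication `u^i_j ↦ ∑_k u^i_k ⊗ u^k_j`. -/
def comul : Oq 𝕜 N q →ₐ[𝕜] Oq 𝕜 N q ⊗[𝕜] Oq 𝕜 N q :=
  Oq.lift (FreeAlgebra.lift 𝕜
    (fun p : Fin N × Fin N => ∑ k, uu 𝕜 q p.1 k ⊗ₜ[𝕜] uu 𝕜 q k p.2)) (by
    intro x y h
    induction h with
    | ruu s t i j =>
      simp only [map_sum, map_smul, map_mul, FreeAlgebra.lift_ι_apply, comul_mul,
        Finset.smul_sum]
      rw [sum4_swap]
      have h1 : ∀ a b : Fin N, ∑ k, ∑ l, (Rmat q k l i j : 𝕜) •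
          ((uu 𝕜 q s a * uu 𝕜 q t b) ⊗ₜ[𝕜] (uu 𝕜 q a k * uu 𝕜 q b l)) =
          ∑ k, ∑ l, ((Rmat q a b k l : 𝕜) • (uu 𝕜 q s a * uu 𝕜 q t b)) ⊗ₜ[𝕜]
            (uu 𝕜 q k i * uu 𝕜 q l j) := by
        intro a b
        simp only [TensorProduct.smul_tmul, ← TensorProduct.tmul_smul, ← TensorProduct.tmul_sum,
          uu_ruu]
      have h2 : ∀ c d : Fin N, ∑ a, ∑ b, ((Rmat q a b c d : 𝕜) •
          (uu 𝕜 q s a * uu 𝕜 q t b)) ⊗ₜ[𝕜] (uu 𝕜 q c i * uu 𝕜 q d j) =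
          ∑ a, ∑ b, (Rmat q s t a b : 𝕜) • ((uu 𝕜 q a c * uu 𝕜 q b d) ⊗ₜ[𝕜]
            (uu 𝕜 q c i * uu 𝕜 q d j)) := by
        intro c d
        simp only [← TensorProduct.sum_tmul, uu_ruu]
        simp only [TensorProduct.sum_tmul, TensorProduct.smul_tmul']
      simp only [h1]
      rw [sum4_swap]
      simp only [h2]
      rw [sum4_swap]
    | upper i j =>
      simp only [map_sum, map_smul, map_mul, FreeAlgebra.lift_ι_apply, comul_mul,
        Finset.smul_sum, AlgHom.commutes]
      rw [sum4_swap]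
      simp only [← TensorProduct.tmul_smul, ← TensorProduct.tmul_sum, uu_upper]
      simp only [Algebra.algebraMap_eq_smul_one (A := Oq 𝕜 N q), TensorProduct.tmul_smul,
        TensorProduct.smul_tmul', ← TensorProduct.sum_tmul]
      rw [uu_upper, Algebra.algebraMap_eq_smul_one, Algebra.algebraMap_eq_smul_one, ← TensorProduct.smul_tmul',
        Algebra.TensorProduct.one_def]
    | lower k l =>
      simp only [map_sum, map_smul, map_mul, FreeAlgebra.lift_ι_apply, comul_mul,
        Finset.smul_sum, AlgHom.commutes]
      rw [sum4_swap]
      simp only [TensorProduct.smul_tmul', ← TensorProduct.sum_tmul, uu_lower]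
      simp only [Algebra.algebraMap_eq_smul_one (A := Oq 𝕜 N q), ← TensorProduct.smul_tmul',
        ← TensorProduct.tmul_smul, ← TensorProduct.tmul_sum]
      rw [uu_lower, Algebra.algebraMap_eq_smul_one, Algebra.algebraMap_eq_smul_one, TensorProduct.tmul_smul,
        Algebra.TensorProduct.one_def])

/-- The counit `u^i_j ↦ δ_{ij}`. -/
def counit : Oq 𝕜 N q →ₐ[𝕜] 𝕜 :=
  Oq.lift (FreeAlgebra.lift 𝕜
    (fun p : Fin N × Fin N => if p.1 = p.2 then (1 : 𝕜) else 0)) (by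
    intro x y h
    induction h with
    | ruu s t i j =>
      simp only [map_sum, map_smul, map_mul, FreeAlgebra.lift_ι_apply]
      simp
    | upper i j =>
      simp only [map_sum, map_smul, map_mul, FreeAlgebra.lift_ι_apply, AlgHom.commutes]
      simp
    | lower k l =>
      simp only [map_sum, map_smul, map_mul, FreeAlgebra.lift_ι_apply, AlgHom.commutes]
      simp)

/-! ### The quantum Euclidean sphere -/

variable (N)

/-- The relations of the quantum Euclidean sphere on generators `x_1, …, x_N`. -/
inductive SphereRel : FreeAlgebra 𝕜 (Fin N) → FreeAlgebra 𝕜 (Fin N) → Prop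
  | comm (i j : Fin N) : SphereRel
      (∑ k, ∑ l, (Rinv q k l i j : 𝕜) • (FreeAlgebra.ι 𝕜 k * FreeAlgebra.ι 𝕜 l))
      (((q⁻¹ : ℝ) : 𝕜) • (FreeAlgebra.ι 𝕜 i * FreeAlgebra.ι 𝕜 j) +
        (((q ^ (N - 1) - q ^ (N - 3)) / (1 + q ^ (N - 2)) : ℝ) : 𝕜) •
          ∑ k, ∑ l, (Kmat q k l i j : 𝕜) • (FreeAlgebra.ι 𝕜 k * FreeAlgebra.ι 𝕜 l))
  | norm : SphereRel
      (∑ k, ∑ l, (metric q k l : 𝕜) • (FreeAlgebra.ι 𝕜 k * FreeAlgebra.ι 𝕜 l)) 1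

/-- The coordinate algebra `X` of the quantum Euclidean sphere. -/
def Sphere : Type u := RingQuot (SphereRel 𝕜 N q)

instance : Ring (Sphere 𝕜 N q) := inferInstanceAs (Ring (RingQuot (SphereRel 𝕜 N q)))

instance : Algebra 𝕜 (Sphere 𝕜 N q) :=
  inferInstanceAs (Algebra 𝕜 (RingQuot (SphereRel 𝕜 N q)))

variable {N}

/-- The generators `x_i` of `X`. -/
def coord (i : Fin N) : Sphere 𝕜 N q :=
  RingQuot.mkAlgHom 𝕜 (SphereRel 𝕜 N q) (FreeAlgebra.ι 𝕜 i)

/-! ### The first order calculus `Γ₊` -/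

variable (N)

/-- The enveloping algebra `X ⊗ Xᵒᵖ`; `X`-bimodules are left modules over it. -/
def Env : Type u := Sphere 𝕜 N q ⊗[𝕜] (Sphere 𝕜 N q)ᵐᵒᵖ

instance : Ring (Env 𝕜 N q) := inferInstanceAs (Ring (Sphere 𝕜 N q ⊗[𝕜] (Sphere 𝕜 N q)ᵐᵒᵖ))

instance : Algebra 𝕜 (Env 𝕜 N q) :=
  inferInstanceAs (Algebra 𝕜 (Sphere 𝕜 N q ⊗[𝕜] (Sphere 𝕜 N q)ᵐᵒᵖ))

/-- The inclusion of the left factor `X`. -/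
def Env.left : Sphere 𝕜 N q →ₐ[𝕜] Env 𝕜 N q :=
  (Algebra.TensorProduct.includeLeft :
    Sphere 𝕜 N q →ₐ[𝕜] Sphere 𝕜 N q ⊗[𝕜] (Sphere 𝕜 N q)ᵐᵒᵖ)

/-- The inclusion of the right factor `Xᵒᵖ`. -/
def Env.right : (Sphere 𝕜 N q)ᵐᵒᵖ →ₐ[𝕜] Env 𝕜 N q :=
  (Algebra.TensorProduct.includeRight :
    (Sphere 𝕜 N q)ᵐᵒᵖ →ₐ[𝕜] Sphere 𝕜 N q ⊗[𝕜] (Sphere 𝕜 N q)ᵐᵒᵖ)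

theorem Env.left_mul_right (a : Sphere 𝕜 N q) (b : (Sphere 𝕜 N q)ᵐᵒᵖ) :
    Env.left 𝕜 N q a * Env.right 𝕜 N q b = Env.right 𝕜 N q b * Env.left 𝕜 N q a := by
  have h : ((a ⊗ₜ[𝕜] 1) * (1 ⊗ₜ[𝕜] b) : Sphere 𝕜 N q ⊗[𝕜] (Sphere 𝕜 N q)ᵐᵒᵖ) =
      (1 ⊗ₜ[𝕜] b) * (a ⊗ₜ[𝕜] 1) := by
    simp only [Algebra.TensorProduct.tmul_mul_tmul, one_mul, mul_one]
  exact h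

/-- The free `X`-bimodule on symbols `d x`, one for each `x ∈ X`. -/
abbrev PreForms : Type u := Sphere 𝕜 N q →₀ Env 𝕜 N q

variable {N}

/-- The element `a · d x · b` of the free bimodule. -/
def preForm (a x b : Sphere 𝕜 N q) : PreForms 𝕜 N q := 
  Finsupp.single x (Env.left 𝕜 N q a * Env.right 𝕜 N q (op b))

variable (N)

/-- The elements of the free bimodule which vanish in `Γ₊`: linearity of `d`, the Leibniz rule,
and the rule for moving `x_j` from the right of `d x_i` to the left. -/
inductive FormRel : PreForms 𝕜 N q → Prop
  | add (x y : Sphere 𝕜 N q) : FormRel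
      (preForm 𝕜 q 1 (x + y) 1 - (preForm 𝕜 q 1 x 1 + preForm 𝕜 q 1 y 1))
  | smul (c : 𝕜) (x : Sphere 𝕜 N q) : FormRel
      (preForm 𝕜 q 1 (c • x) 1 - c • preForm 𝕜 q 1 x 1)
  | leibniz (x y : Sphere 𝕜 N q) : FormRel
      (preForm 𝕜 q 1 (x * y) 1 - (preForm 𝕜 q 1 x y + preForm 𝕜 q x y 1))
  | bimod (i j : Fin N) : FormRel
      (preForm 𝕜 q 1 (coord 𝕜 q i) (coord 𝕜 q j) -
        ((∑ k, ∑ l, (Rinv q k l i j : 𝕜) • preForm 𝕜 q (coord 𝕜 q k) (coord 𝕜 q l) 1)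
        + ((q - 1 : ℝ) : 𝕜) • preForm 𝕜 q (coord 𝕜 q i) (coord 𝕜 q j) 1
        + (((q ^ N - q ^ (N - 2)) / (1 - q ^ (N - 1)) : ℝ) : 𝕜) •
            (∑ k, ∑ l, (Kmat q k l i j : 𝕜) • preForm 𝕜 q (coord 𝕜 q k) (coord 𝕜 q l) 1)
        + (((1 - q) * (1 + q ^ (N - 2)) / (1 - q ^ (N - 1)) : ℝ) : 𝕜) •
            (∑ k, ∑ l, (metric q k l : 𝕜) •
              preForm 𝕜 q (coord 𝕜 q i * coord 𝕜 q j * coord 𝕜 q k) (coord 𝕜 q l) 1)))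

/-- The sub-bimodule generated by the relations. -/
def formRel : Submodule (Env 𝕜 N q) (PreForms 𝕜 N q) :=
  Submodule.span (Env 𝕜 N q) {z | FormRel 𝕜 N q z}

/-- The bimodule of one-forms of the calculus `Γ₊`. -/
def OneForms : Type u := PreForms 𝕜 N q ⧸ formRel 𝕜 N q

instance : AddCommGroup (OneForms 𝕜 N q) :=
  inferInstanceAs (AddCommGroup (PreForms 𝕜 N q ⧸ formRel 𝕜 N q))

instance : Module (Env 𝕜 N q) (OneForms 𝕜 N q) :=
  inferInstanceAs (Module (Env 𝕜 N q) (PreForms 𝕜 N q ⧸ formRel 𝕜 N q))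

instance : Module 𝕜 (OneForms 𝕜 N q) :=
  Module.compHom _ (algebraMap 𝕜 (Env 𝕜 N q))

instance : Module (Sphere 𝕜 N q) (OneForms 𝕜 N q) :=
  Module.compHom _ (Env.left 𝕜 N q).toRingHom

instance : Module (Sphere 𝕜 N q)ᵐᵒᵖ (OneForms 𝕜 N q) :=
  Module.compHom _ (Env.right 𝕜 N q).toRingHom

variable {N}

theorem scalar_smul_def (c : 𝕜) (w : OneForms 𝕜 N q) :
    c • w = (algebraMap 𝕜 (Env 𝕜 N q) c) • w := rfl

theorem left_smul_def (a : Sphere 𝕜 N q) (w : OneForms 𝕜 N q) :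
    a • w = Env.left 𝕜 N q a • w := rfl

theorem right_smul_def (b : (Sphere 𝕜 N q)ᵐᵒᵖ) (w : OneForms 𝕜 N q) :
    b • w = Env.right 𝕜 N q b • w := rfl

instance : SMulCommClass (Sphere 𝕜 N q) (Sphere 𝕜 N q)ᵐᵒᵖ (OneForms 𝕜 N q) where
  smul_comm a b w := by
    simp only [left_smul_def, right_smul_def, smul_smul, Env.left_mul_right]

instance : IsScalarTower 𝕜 (Sphere 𝕜 N q) (OneForms 𝕜 N q) where
  smul_assoc c a w := by
    rw [scalar_smul_def, left_smul_def, left_smul_def, smul_smul, ← Algebra.smul_def, map_smul]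

instance : IsScalarTower 𝕜 (Sphere 𝕜 N q)ᵐᵒᵖ (OneForms 𝕜 N q) where
  smul_assoc c b w := by
    rw [scalar_smul_def, right_smul_def, right_smul_def, smul_smul, ← Algebra.smul_def,
      map_smul]

/-- The class in `Γ₊` of an element of the free bimodule. -/
def OneForms.mk (z : PreForms 𝕜 N q) : OneForms 𝕜 N q := Submodule.Quotient.mk z

theorem OneForms.mk_eq {z w : PreForms 𝕜 N q} (h : FormRel 𝕜 N q (z - w)) :
    OneForms.mk 𝕜 q z = OneForms.mk 𝕜 q w :=
  (Submodule.Quotient.eq (formRel 𝕜 N q)).2 (Submodule.subset_span h)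

/-- The differential `d : X → Γ₊`. -/
def diff : Sphere 𝕜 N q →ₗ[𝕜] OneForms 𝕜 N q where
  toFun x := OneForms.mk 𝕜 q (preForm 𝕜 q 1 x 1)
  map_add' x y := OneForms.mk_eq 𝕜 q (.add x y)
  map_smul' c x := by
    rw [OneForms.mk_eq 𝕜 q (.smul c x), RingHom.id_apply, scalar_smul_def,
      ← algebraMap_smul (Env 𝕜 N q) c (preForm 𝕜 q 1 x 1)]
    rfl

/-- `d x_i`. -/
abbrev dx (i : Fin N) : OneForms 𝕜 N q := diff 𝕜 q (coord 𝕜 q i)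

/-- The invariant one-form `η = C^{kl} x_k d x_l`. -/
def eta : OneForms 𝕜 N q :=
  ∑ k, ∑ l, (metric q k l : 𝕜) • coord 𝕜 q k • dx 𝕜 q l

/-- The basis `γ⁺_i = d x_i + α⁺ x_i η`. -/
def gammaPlus (i : Fin N) : OneForms 𝕜 N q :=
  dx 𝕜 q i + ((-((1 + q ^ (N - 2)) / (1 - q ^ (N - 1))) : ℝ) : 𝕜) • coord 𝕜 q i • eta 𝕜 q

/-- The basis `γ⁻_i = d x_i + α⁻ x_i η`. -/
def gammaMinus (i : Fin N) : OneForms 𝕜 N q :=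
  dx 𝕜 q i + ((q * ((1 + q ^ (N - 2)) / (1 - q ^ (N - 1))) : ℝ) : 𝕜) • coord 𝕜 q i • eta 𝕜 q

/-! ### Two-tensors, braiding, covariance -/

variable (N) in
/-- `Γ₊ ⊗_X Γ₊`. -/
abbrev TwoTensors : Type u := BTensor 𝕜 (Sphere 𝕜 N q) (OneForms 𝕜 N q)

variable {𝕜 q} in
/-- The tensor `ω ⊗_X ω'`. -/
abbrev tens (ω ω' : OneForms 𝕜 N q) : TwoTensors 𝕜 N q := btmul 𝕜 (Sphere 𝕜 N q) ω ω'

variable {𝕜 q} in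
/-- `σ` is an `X`-bimodule endomorphism of `Γ₊ ⊗_X Γ₊` with
`σ (γ_i ⊗ γ_j) = α (R⁻)^{kl}_{ij} γ_k ⊗ γ_l`. -/
structure IsBraiding (α : ℝ) (γ : Fin N → OneForms 𝕜 N q)
    (σ : TwoTensors 𝕜 N q →ₗ[Sphere 𝕜 N q] TwoTensors 𝕜 N q) : Prop where
  right_linear : ∀ (a : Sphere 𝕜 N q) (t : TwoTensors 𝕜 N q), σ (op a • t) = op a • σ t
  apply_gamma : ∀ i j, σ (tens (γ i) (γ j)) =
    (α : 𝕜) • ∑ k, ∑ l, (Rinv q k l i j : 𝕜) • tens (γ k) (γ l)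

/-- The tensors `[I]_{ij}`. -/
def tensorI (i j : Fin N) : TwoTensors 𝕜 N q :=
  (∑ k, ∑ l, (Rinv q k l i j : 𝕜) • tens (dx 𝕜 q k) (dx 𝕜 q l))
  + (q : 𝕜) • tens (dx 𝕜 q i) (dx 𝕜 q j)
  - ((q * ((1 - q) * (1 + q ^ (N - 2)) / (1 - q ^ (N - 1))) : ℝ) : 𝕜) •
      coord 𝕜 q i • tens (eta 𝕜 q) (dx 𝕜 q j)
  - (((1 - q) * (1 + q ^ (N - 2)) / (1 - q ^ (N - 1)) : ℝ) : 𝕜) •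
      (∑ k, ∑ l, (Rinv q k l i j : 𝕜) • coord 𝕜 q k • tens (eta 𝕜 q) (dx 𝕜 q l))
  - (((1 + q ^ 2) * (1 + q ^ (N - 2)) ^ 2 / (1 - q ^ (N - 1)) ^ 2 : ℝ) : 𝕜) •
      (coord 𝕜 q i * coord 𝕜 q j) •
        (∑ k, ∑ l, (metric q k l : 𝕜) • coord 𝕜 q k • tens (eta 𝕜 q) (dx 𝕜 q l))
  + ((q ^ (N - 2) * ((1 + q) * (1 + q ^ 2) * (1 + q ^ (N - 2)) / (1 - q ^ (N - 1)) ^ 2) : ℝ) : 𝕜) •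
      (∑ k, ∑ l, (Kmat q k l i j : 𝕜) • coord 𝕜 q k • tens (eta 𝕜 q) (dx 𝕜 q l))

variable (N) in
/-- The tensor `[II]`. -/
def tensorII : TwoTensors 𝕜 N q :=
  (∑ m, ∑ n, (metric q m n : 𝕜) • tens (dx 𝕜 q m) (dx 𝕜 q n))
  + ((2 * q * ((1 + q ^ (N - 2)) / ((1 - q) * (1 - q ^ (N - 1)))) : ℝ) : 𝕜) •
      (∑ k, ∑ l, (metric q k l : 𝕜) • coord 𝕜 q k • tens (eta 𝕜 q) (dx 𝕜 q l))

variable {𝕜 q} in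
/-- Covariance under `O_q(N)`: the coaction `x_k ↦ x_i ⊗ u^i_k` of `O_q(N)` on `X` extends to a
coaction on the calculus by an algebra homomorphism commuting with the differential. -/
def IsCovariant {L : Type u} [Ring L] [Algebra 𝕜 L]
    (S : HigherCalculus (diff 𝕜 q : Sphere 𝕜 N q →ₗ[𝕜] OneForms 𝕜 N q) L) : Prop :=
  ∃ Φ : L →ₐ[𝕜] L ⊗[𝕜] Oq 𝕜 N q,
    (∀ k, Φ (S.i₀ (coord 𝕜 q k)) = ∑ i, S.i₀ (coord 𝕜 q i) ⊗ₜ[𝕜] uu 𝕜 q i k) ∧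
    (∀ z, Φ (S.d z) = LinearMap.rTensor (Oq 𝕜 N q) S.d (Φ z)) ∧
    (∀ z, TensorProduct.assoc 𝕜 L (Oq 𝕜 N q) (Oq 𝕜 N q)
        (LinearMap.rTensor (Oq 𝕜 N q) Φ.toLinearMap (Φ z)) =
      LinearMap.lTensor L (comul 𝕜 q).toLinearMap (Φ z)) ∧
    (∀ z, TensorProduct.rid 𝕜 L (LinearMap.lTensor L (counit 𝕜 q).toLinearMap (Φ z)) = z)

variable {𝕜 q} in
/-- A differential calculus on the algebra obtained by antisymmetrisation with `σ`, extending
`Γ₊` along the canonical maps of `X` and `Γ₊` into that algebra (which determine the grading). -/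
def IsAntisymCalculus (σ : TwoTensors 𝕜 N q →ₗ[Sphere 𝕜 N q] TwoTensors 𝕜 N q)
    (S : HigherCalculus (diff 𝕜 q : Sphere 𝕜 N q →ₗ[𝕜] OneForms 𝕜 N q) (ExteriorAlg σ)) : Prop :=
  (∀ x, S.i₀ x = ExteriorAlg.mk σ (BTensorAlgebra.ι₀ 𝕜 _ _ x)) ∧
  (∀ ω, S.i₁ ω = ExteriorAlg.mk σ (BTensorAlgebra.ι₁ 𝕜 _ _ ω))

end Sphere

end QSphere

end

/-! The matrices R and R⁻ enter only through a few tensor identities: the quadratic relation,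
Yang–Baxter, the eigenvalue on the metric, and the sliding of a contraction through a crossing.
`IsBraidPair` collects them for a pair (Q, Q') with parameters p, z. One such pair is (R⁻, R) with p
= q, z = q^(N-2); exchanging the matrices and inverting p and z gives another. The exchange
preserves the sphere, the calculus and the normalisation β of the inner form, and it turns γ⁻ into
γ⁺, so each argument is made once and serves both frames (`isParam_minus`, `IsParam.swap`).

In the frame the bimodule relation is homogeneous, γ_i x_j = Q^{kl}_{ij} x_k γ_l (`frame_mul`), and
[η, x_j] = β dx_j, so d is the commutator with β⁻¹η (`diff_eq_commutator`). By Yang–Baxter the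
matrices of right multiplication satisfy the sphere relations, so that γ is a left basis of Γ
(`IsParam.exists_coordinates`). By Yang–Baxter again, αR⁻ on the frame extends to exactly one
bimodule endomorphism (`existsUnique_isBraiding`).

Let τ be the bimodule map equal to pQ on γ ⊗ γ, and let t = C^{ij} γ_i ⊗ γ_j. The tensors u_l = p
γ_l ⊗ η + η ⊗ γ_l + c x_l t are fixed by τ, and [II] is a nonzero multiple of C^{kl} x_k u_l.
Commuting [II] past coordinates produces the u_l, and commuting these once more produces (p + Q)(γ ⊗
γ) minus a multiple of C t, which span the fixed points of τ as a left module. Hence the fixed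
points form the smallest sub-bimodule containing [II] (`IsTwist.mem_of_fixed`), and this is the left
span of [I] and [II] (`IsTwist.fixed_iff`). Now σ is (α/q)τ for γ⁻ and (α/q)τ⁻¹ for γ⁺, so σ[II] =
(α/q)[II] in both cases; as [II] ≠ 0 (`tensorII_ne_zero`), σ fixes it only for α = q, and then σ has
the same fixed points as τ.

In every calculus [II] becomes zero (`HigherCalculus.wedge_tensorII`). The operation y ↦ C^{kl} x_k
y x_l multiplies it by 1 + β according to the Leibniz rule and d² = 0, but by another scalar
according to the frame relations; the two differ by a nonzero multiple of 1 - p³z. Conversely, once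
the sub-bimodule generated by [II] is divided out, the u_l vanish and η² is central, so the graded
commutator with β⁻¹η has square zero and defines a calculus. Its relations are forced in any
calculus, hence it is universal. A representation on X × Γ × (Γ ⊗ Γ) shows that the quotient by
ker(id - σ) loses nothing in degrees 0 and 1 and kills exactly ker(id - σ) in degree 2
(`ExteriorAlg.wedge₂_eq_zero_iff`); with the vanishing of [II] this gives the necessity of α = q.
The coaction descends because the form of [II] is coinvariant, and it commutes with d because η is
coinvariant (`IsUniversalBraiding.isCovariant`). -/

noncomputable section

namespace QSphere

/-! ### The R-matrix acting on arrays, and truncated contractions with the metric. -/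

section Braid

variable {F : Type*} [Field F] {N : ℕ}

/-- Abstract form of the weights `c i = q ^ (-rho i)` of the metric. -/
structure IsMetricWeight (q : F) (c : Fin N → F) : Prop where
  q_ne : q ≠ 0
  mul_rev : ∀ i, c i * c i.rev = 1
  sq_of_lt : ∀ i : Fin N, 2 * (i : ℕ) + 1 < N → c i ^ 2 = q ^ (2 * (i : ℤ) + 2 - N)
  of_eq : ∀ i : Fin N, 2 * (i : ℕ) + 1 = N → c i = 1
  sq_of_gt : ∀ i : Fin N, N < 2 * (i : ℕ) + 1 → c i ^ 2 = q ^ (2 * (i : ℤ) - N)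

variable (q : F) (c : Fin N → F)

/-- The swap weight. -/
def swapWeight (i j : Fin N) : F := (if i = j then q else 1) * (if i = j.rev then q⁻¹ else 1)

/-- The contraction with the metric over the indices `l ≥ b`. -/
def capFrom (b : ℕ) (w : Fin N → Fin N → F) : F :=
  ∑ l : Fin N, if b ≤ (l : ℕ) then c l.rev * w l.rev l else 0

/-- The R-matrix as an operator on two-index arrays. -/
def braid (w : Fin N → Fin N → F) (i j : Fin N) : F :=
  swapWeight q i j * w j i + (q - q⁻¹) * (if i < j then w i j else 0)
    - (if j = i.rev then (q - q⁻¹) * c i * capFrom c (i + 1) w else 0)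

theorem capFrom_of_le {b : ℕ} (hb : N ≤ b) (w : Fin N → Fin N → F) : capFrom c b w = 0 := by
  apply Finset.sum_eq_zero
  intro l _
  rw [if_neg]
  have := l.isLt
  omega

theorem sum_from_succ (f : Fin N → F) (l : Fin N) :
    (∑ i : Fin N, if (l : ℕ) ≤ (i : ℕ) then f i else 0) =
      (∑ i : Fin N, if (l : ℕ) + 1 ≤ (i : ℕ) then f i else 0) + f l := by
  have : f l = ∑ i : Fin N, if i = l then f i else 0 := by simp
  rw [this, ← Finset.sum_add_distrib]
  refine Finset.sum_congr rfl fun i _ => ?_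
  rcases lt_trichotomy i l with h | h | h
  · have h' : (i : ℕ) < l := h
    rw [if_neg (by omega), if_neg (by omega), if_neg (by rintro rfl; omega)]; simp
  · subst h; simp
  · have h' : (l : ℕ) < i := h
    rw [if_pos (by omega), if_pos (by omega), if_neg (by rintro rfl; omega)]; simp

theorem capFrom_succ (w : Fin N → Fin N → F) (l : Fin N) :
    capFrom c l w = capFrom c (l + 1) w + c l.rev * w l.rev l :=
  sum_from_succ (fun l => c l.rev * w l.rev l) l

/-- Downward induction on a cut `b ≤ N`. -/
theorem cut_induction {P : ℕ → Prop} (h0 : P N) (hs : ∀ l : Fin N, P (l + 1) → P l) {b : ℕ}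
    (hb : b ≤ N) : P b := by
  obtain ⟨m, hm⟩ := Nat.exists_eq_add_of_le hb
  clear hb
  induction m generalizing b with
  | zero => rw [add_zero] at hm; exact hm ▸ h0
  | succ m ih => exact hs ⟨b, by omega⟩ (ih (b := b + 1) (by omega))

/-- The coefficient in the formula for truncated contractions. -/
def cutWeight (N : ℕ) (b : ℕ) : F :=
  if 2 * b ≤ N then q ^ ((N : ℤ) - 2 * b - 1) else q ^ ((N : ℤ) - 2 * b + 1)

variable {q c}

theorem IsMetricWeight.rev_mul (hc : IsMetricWeight q c) (i : Fin N) : c i.rev * c i = 1 := by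
  rw [mul_comm]; exact hc.mul_rev i

theorem rev_val (i : Fin N) : (i.rev : ℕ) = N - 1 - i := by
  rw [Fin.val_rev]; omega

/-- The metric part of R contributes a truncated contraction to each antidiagonal entry, so
contractions over `l ≥ b` form a closed system under `braid`. Lowering the cut by one adds one
antidiagonal entry, and the powers of q telescope. At `b = 0` only the eigenvalue q^(1-N) of R on
the metric remains. -/
theorem capFrom_braid (hc : IsMetricWeight q c) (w : Fin N → Fin N → F) {b : ℕ} (hb : b ≤ N) :
    capFrom c b (braid q c w) = q ^ (1 - (N : ℤ)) * capFrom c 0 w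
      + (if N < 2 * b then (q - q⁻¹) * capFrom c b w else 0)
      - cutWeight q N b * capFrom c (N - b) w := by
  have hq := hc.q_ne
  refine cut_induction (P := fun b => capFrom c b (braid q c w) = q ^ (1 - (N : ℤ)) * capFrom c 0 w
      + (if N < 2 * b then (q - q⁻¹) * capFrom c b w else 0)
      - cutWeight q N b * capFrom c (N - b) w) ?_ ?_ hb
  · simp only [capFrom_of_le c le_rfl, Nat.sub_self, cutWeight]
    rcases Nat.eq_zero_or_pos N with h | h
    · subst h; simp [capFrom]
    · rw [if_neg (show ¬ 2 * N ≤ N by omega)]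
      have : (N : ℤ) - 2 * N + 1 = 1 - N := by ring
      rw [this]; simp
  · intro l ih
    have hl := l.isLt
    have hr := rev_val l
    rw [capFrom_succ, ih, capFrom_succ c w l]
    have h1 := capFrom_succ c w l.rev
    rw [Fin.rev_rev, show ((l.rev : ℕ) + 1) = N - l by omega, show (l.rev : ℕ) = N - (l + 1) by omega] at h1
    rw [h1]
    simp only [braid, Fin.rev_rev, if_true]
    rw [show ((l.rev : ℕ) + 1) = N - l by omega]
    have e1 := hc.mul_rev l
    -- The exponents of the weights can be half-integral, so only their squares are integral powers
    -- of q; the relation `c l * c l.rev = 1` turns such a square into a ratio of weights.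
    have hs : ∀ {m : ℤ}, c l.rev ^ 2 = q ^ m → c l.rev = q ^ m * c l := by
      intro m hm
      calc c l.rev = c l.rev ^ 2 * c l := by rw [pow_two, mul_assoc, hc.rev_mul, mul_one]
        _ = _ := by rw [hm]
    rcases lt_trichotomy (2 * (l : ℕ) + 1) N with h | h | h
    · have e2 := hc.sq_of_gt l.rev (by omega)
      rw [show (2 * ((l.rev : ℕ) : ℤ) - N) = N - 2 * l - 2 by omega] at e2
      have hne : l ≠ l.rev := by intro hh; have := congrArg Fin.val hh; omega
      rw [if_neg (show ¬ N < 2 * ((l : ℕ) + 1) by omega), if_neg (show ¬ N < 2 * (l : ℕ) by omega),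
        if_neg (show ¬ l.rev < l by rw [Fin.lt_def]; omega)]
      simp only [cutWeight, swapWeight, if_neg hne.symm, if_true]
      rw [if_pos (show 2 * ((l : ℕ) + 1) ≤ N by omega), if_pos (show 2 * (l : ℕ) ≤ N by omega)]
      have e3 := hs e2
      have z1 : q ^ ((N : ℤ) - 2 * ((l + 1 : ℕ) : ℤ) - 1) = q ^ ((N : ℤ) - 2 * l - 2) * q⁻¹ := by
        rw [← zpow_sub_one₀ hq]; congr 1; push_cast; ring
      have z2 : q ^ ((N : ℤ) - 2 * (l : ℤ) - 1) = q ^ ((N : ℤ) - 2 * l - 2) * q := by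
        rw [← zpow_add_one₀ hq]; congr 1; ring
      rw [z1, z2, ← e2]
      linear_combination (- q⁻¹ * w l l.rev * c l.rev) * e1
    · have hrl : l.rev = l := by apply Fin.ext; omega
      rw [if_neg (show ¬ N < 2 * (l : ℕ) by omega), if_pos (show N < 2 * ((l : ℕ) + 1) by omega)]
      simp only [hrl, lt_irrefl, if_false, cutWeight, swapWeight, if_true]
      rw [if_neg (show ¬ 2 * ((l : ℕ) + 1) ≤ N by omega), if_pos (show 2 * (l : ℕ) ≤ N by omega),
        hc.of_eq l h]
      have z1 : (N : ℤ) - 2 * ((l + 1 : ℕ) : ℤ) + 1 = 0 := by omega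
      have z2 : (N : ℤ) - 2 * (l : ℤ) - 1 = 0 := by omega
      rw [z1, z2, show N - (l : ℕ) = l + 1 by omega]
      field_simp
      ring
    · have hlt : l.rev < l := by rw [Fin.lt_def]; omega
      rw [if_pos (show N < 2 * ((l : ℕ) + 1) by omega), if_pos hlt]
      simp only [cutWeight, swapWeight, if_neg hlt.ne, if_true]
      rw [if_neg (show ¬ 2 * ((l : ℕ) + 1) ≤ N by omega)]
      have key : c l.rev ^ 2 = q ^ ((N : ℤ) - 2 * l) := by
        rw [hc.sq_of_lt l.rev (by omega)]; congr 1; omega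
      have z1 : q ^ ((N : ℤ) - 2 * ((l + 1 : ℕ) : ℤ) + 1) = q ^ ((N : ℤ) - 2 * l) * q⁻¹ := by
        rw [← zpow_sub_one₀ hq]; congr 1; push_cast; ring
      -- The cut `2 * l = N` is separate: `cutWeight` changes branch between `l` and `l + 1`, and
      -- the cuts `l` and `N - l` coincide.
      rcases (show N ≤ 2 * (l : ℕ) by omega).eq_or_lt with h2 | h2
      · have h3 : (N : ℤ) - 2 * (l : ℤ) = 0 := by omega
        rw [h3, zpow_zero] at z1 key
        rw [if_neg (show ¬ N < 2 * (l : ℕ) by omega), if_pos (show 2 * (l : ℕ) ≤ N by omega), z1, h3,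
          zero_sub, zpow_neg_one, show N - (l : ℕ) = l by omega, capFrom_succ c w l]
        linear_combination (- q⁻¹ * w l l.rev * c l.rev) * e1 + q⁻¹ * w l l.rev * c l * key
          - (q - q⁻¹) * (capFrom c (l + 1) w + c l.rev * w l.rev l) * key
      rw [if_pos h2, if_neg (show ¬ 2 * (l : ℕ) ≤ N by omega)]
      have z2 : q ^ ((N : ℤ) - 2 * (l : ℤ) + 1) = q ^ ((N : ℤ) - 2 * l) * q := by
        rw [← zpow_add_one₀ hq]
      rw [z1, z2, ← key]
      linear_combination (- q⁻¹ * w l l.rev * c l.rev) * e1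

/-- Complementary cuts lie on opposite branches of `cutWeight`, with opposite exponents. At the
middle cut both lie on the same branch, and the value is q⁻¹ instead. -/
theorem cutWeight_mul (hq : q ≠ 0) {b : ℕ} (hb : b ≤ N) (h : 2 * b ≠ N) :
    cutWeight q N b * cutWeight q N (N - b) = 1 := by
  rcases Nat.lt_or_gt_of_ne h with h | h
  · rw [cutWeight, cutWeight, if_pos (show 2 * b ≤ N by omega),
      if_neg (show ¬ 2 * (N - b) ≤ N by omega), ← zpow_add₀ hq, ← zpow_zero q]
    congr 1; push_cast [hb]; ring
  · rw [cutWeight, cutWeight, if_neg (show ¬ 2 * b ≤ N by omega),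
      if_pos (show 2 * (N - b) ≤ N by omega), ← zpow_add₀ hq, ← zpow_zero q]
    congr 1; push_cast [hb]; ring

theorem cutWeight_half {b : ℕ} (h : 2 * b = N) : cutWeight q N b = q⁻¹ := by
  rw [cutWeight, if_pos h.le, ← zpow_neg_one]; congr 1; omega

/-- The difference of `capFrom_braid` at two consecutive cuts isolates a single antidiagonal entry.
-/
theorem capFrom_braid_step (hc : IsMetricWeight q c) (w : Fin N → Fin N → F) (l : Fin N) :
    c l.rev * braid q c w l.rev l = (q - q⁻¹) * ((if N < 2 * (l : ℕ) then capFrom c l w else 0)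
      - (if N < 2 * ((l : ℕ) + 1) then capFrom c (l + 1) w else 0))
      - cutWeight q N l * capFrom c (N - l) w
      + cutWeight q N (l + 1) * capFrom c (N - (l + 1)) w := by
  have h1 := capFrom_braid hc w (b := l) (by omega)
  have h2 := capFrom_braid hc w (b := l + 1) (by omega)
  have h3 := capFrom_succ c (braid q c w) l
  split_ifs at * <;> linear_combination h1 - h2 - h3

theorem swapWeight_of_ne {i j : Fin N} (h : i ≠ j) (h' : j ≠ i.rev) : swapWeight q i j = 1 := by
  rw [swapWeight, if_neg h, if_neg (fun e => h' (by rw [e, Fin.rev_rev])), one_mul]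

theorem swapWeight_self {i : Fin N} (h : i ≠ i.rev) : swapWeight q i i = q := by
  rw [swapWeight, if_pos rfl, if_neg h, mul_one]

theorem swapWeight_rev {i : Fin N} (h : i ≠ i.rev) : swapWeight q i i.rev = q⁻¹ := by
  rw [swapWeight, if_neg h, if_pos (by rw [Fin.rev_rev]), one_mul]

theorem swapWeight_rev' {i : Fin N} (h : i ≠ i.rev) : swapWeight q i.rev i = q⁻¹ := by
  rw [swapWeight, if_neg h.symm, if_pos rfl, one_mul]

theorem swapWeight_fixed (hq : q ≠ 0) {i : Fin N} (h : i = i.rev) : swapWeight q i i = 1 := by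
  rw [swapWeight, if_pos rfl, if_pos h, mul_inv_cancel₀ hq]

theorem braid_of_ne {i j : Fin N} (h : j ≠ i.rev) (w : Fin N → Fin N → F) : braid q c w i j =
    swapWeight q i j * w j i + (q - q⁻¹) * (if i < j then w i j else 0) := by
  rw [braid, if_neg h, sub_zero]

theorem braid_rev (i : Fin N) (w : Fin N → Fin N → F) : braid q c w i i.rev =
    swapWeight q i i.rev * w i.rev i + (q - q⁻¹) * (if i < i.rev then w i i.rev else 0)
      - (q - q⁻¹) * c i * capFrom c (i + 1) w := by
  rw [braid, if_pos rfl]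

theorem braid_rev' (i : Fin N) (w : Fin N → Fin N → F) : braid q c w i.rev i =
    swapWeight q i.rev i * w i i.rev + (q - q⁻¹) * (if i.rev < i then w i.rev i else 0)
      - (q - q⁻¹) * c i.rev * capFrom c (N - i) w := by
  rw [braid, if_pos (Fin.rev_rev i).symm, show (i.rev : ℕ) + 1 = N - i by have := rev_val i; omega]

variable (q c) in
/-- `braid` on the first two indices. -/
def braid₁₂ (w : Fin N → Fin N → Fin N → F) (i j k : Fin N) : F :=
  braid q c (fun a b => w a b k) i j

variable (q c) in
/-- `braid` on the last two indices. -/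
def braid₂₃ (w : Fin N → Fin N → Fin N → F) (i j k : Fin N) : F := braid q c (w i) j k

variable (c) in
/-- The truncated contraction of the first and the third index. -/
def capOuter (b : ℕ) (w : Fin N → Fin N → Fin N → F) (k : Fin N) : F :=
  ∑ l : Fin N, if b ≤ (l : ℕ) then c l.rev * w l.rev k l else 0

variable (c) in
/-- The truncated contraction of the first two indices. -/
def capLeft (b : ℕ) (w : Fin N → Fin N → Fin N → F) (k : Fin N) : F :=
  capFrom c b (fun i j => w i j k)

variable (c) in
/-- The truncated contraction of the last two indices. -/
def capRight (b : ℕ) (w : Fin N → Fin N → Fin N → F) (k : Fin N) : F := capFrom c b (w k)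

theorem capOuter_succ (w : Fin N → Fin N → Fin N → F) (k l : Fin N) :
    capOuter c l w k = capOuter c (l + 1) w k + c l.rev * w l.rev k l :=
  sum_from_succ (fun l => c l.rev * w l.rev k l) l

theorem capLeft_succ (w : Fin N → Fin N → Fin N → F) (k l : Fin N) :
    capLeft c l w k = capLeft c (l + 1) w k + c l.rev * w l.rev l k :=
  capFrom_succ c _ l

theorem capRight_succ (w : Fin N → Fin N → Fin N → F) (k l : Fin N) :
    capRight c l w k = capRight c (l + 1) w k + c l.rev * w k l.rev l :=
  capFrom_succ c _ l

theorem capOuter_of_le {b : ℕ} (hb : N ≤ b) (w : Fin N → Fin N → Fin N → F) (k : Fin N) :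
    capOuter c b w k = 0 := by
  apply Finset.sum_eq_zero
  intro l _
  rw [if_neg]
  have := l.isLt
  omega

theorem capLeft_of_le {b : ℕ} (hb : N ≤ b) (w : Fin N → Fin N → Fin N → F) (k : Fin N) :
    capLeft c b w k = 0 := capFrom_of_le c hb _

theorem capRight_of_le {b : ℕ} (hb : N ≤ b) (w : Fin N → Fin N → Fin N → F) (k : Fin N) :
    capRight c b w k = 0 := capFrom_of_le c hb _

theorem lt_rev_iff {k l : Fin N} : k < l.rev ↔ (k : ℕ) + l + 1 < N := by
  have := l.isLt
  rw [Fin.lt_def, rev_val]; omega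

theorem rev_lt_iff {k l : Fin N} : l.rev < k ↔ N < (k : ℕ) + l + 1 := by
  have := l.isLt
  rw [Fin.lt_def, rev_val]; omega

theorem eq_rev_iff {k l : Fin N} : k = l.rev ↔ (k : ℕ) + l + 1 = N := by
  have := l.isLt
  rw [Fin.ext_iff, rev_val]; omega

/-- The strand k passes between the two contracted strands, which gives `capOuter`. The corrections
come from the two places `l = k` and `l = k.rev` where the swap weight is not 1, from the range
where the order term of R is active, and from the metric term of R, met only at `l = k`. -/
theorem capRight_braid₁₂ (hc : IsMetricWeight q c) (w : Fin N → Fin N → Fin N → F) (k : Fin N)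
    {b : ℕ} (hb : b ≤ N) : capRight c b (braid₁₂ q c w) k = capOuter c b w k
      + (if b ≤ (k : ℕ) ∧ 2 * (k : ℕ) + 1 ≠ N then (q⁻¹ - 1) * (c k.rev * w k.rev k k) else 0)
      + (if b + k < N ∧ 2 * (k : ℕ) + 1 ≠ N then (q - 1) * (c k * w k k k.rev) else 0)
      + (if b + k < N then (q - q⁻¹) * (capRight c b w k - capRight c (N - 1 - k) w k) else 0)
      - (if b ≤ (k : ℕ) then (q - q⁻¹) * capLeft c (k + 1) w k else 0) := by
  have hq := hc.q_ne
  have hk := k.isLt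
  refine cut_induction (P := fun b => capRight c b (braid₁₂ q c w) k = capOuter c b w k
      + (if b ≤ (k : ℕ) ∧ 2 * (k : ℕ) + 1 ≠ N then (q⁻¹ - 1) * (c k.rev * w k.rev k k) else 0)
      + (if b + k < N ∧ 2 * (k : ℕ) + 1 ≠ N then (q - 1) * (c k * w k k k.rev) else 0)
      + (if b + k < N then (q - q⁻¹) * (capRight c b w k - capRight c (N - 1 - k) w k) else 0)
      - (if b ≤ (k : ℕ) then (q - q⁻¹) * capLeft c (k + 1) w k else 0)) ?_ ?_ hb
  · simp (disch := omega) only [capRight_of_le le_rfl, capOuter_of_le le_rfl, if_neg]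
    ring
  · intro l ih
    have hl := l.isLt
    rw [capRight_succ, ih, capOuter_succ]
    clear ih hb
    have hs := capRight_succ (c := c) w k l
    by_cases h1 : l = k
    · subst h1
      rcases lt_trichotomy (2 * (l : ℕ) + 1) N with h2 | h2 | h2
      · have h3 : l ≠ l.rev := fun h => by rw [eq_rev_iff] at h; omega
        simp (disch := omega) only [braid₁₂, braid_rev, swapWeight_rev h3, lt_rev_iff, if_neg, if_pos]
        rw [hs, capLeft]
        linear_combination (- (q - q⁻¹) * capFrom c (l + 1) fun a b => w a b l) * hc.mul_rev l
      · have h3 : l = l.rev := eq_rev_iff.2 (by omega)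
        have e : braid₁₂ q c w l l.rev l = w l l l - (q - q⁻¹) * capLeft c (l + 1) w l := by
          rw [braid₁₂, braid_rev, ← h3, swapWeight_fixed hq h3, if_neg (lt_irrefl l),
            hc.of_eq l h2, capLeft]; ring
        rw [e, ← h3, hc.of_eq l h2, show N - 1 - (l : ℕ) = l by omega]
        simp (disch := omega) only [if_neg, if_pos]
        ring
      · have h3 : l ≠ l.rev := fun h => by rw [eq_rev_iff] at h; omega
        simp (disch := omega) only [braid₁₂, braid_rev, swapWeight_rev h3, lt_rev_iff, if_neg, if_pos]
        rw [capLeft]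
        linear_combination (- (q - q⁻¹) * capFrom c (l + 1) fun a b => w a b l) * hc.mul_rev l
    · have h5 : ¬ (l : ℕ) = k := fun h => h1 (Fin.ext h)
      by_cases h2 : (k : ℕ) + l + 1 = N
      · obtain rfl : k = l.rev := eq_rev_iff.2 h2
        have h3 : l.rev ≠ l := fun h => h1 h.symm
        have e : braid₁₂ q c w l.rev l.rev l = q * w l.rev l.rev l := by
          rw [braid₁₂, braid_of_ne (by rw [Fin.rev_rev]; exact h3),
            swapWeight_self (by rw [Fin.rev_rev]; exact h3), if_neg (lt_irrefl _)]; ring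
        rw [e, show N - 1 - (l.rev : ℕ) = l by omega, Fin.rev_rev]
        rcases Nat.lt_or_gt_of_ne h5 with h6 | h6 <;>
        · simp (disch := omega) only [if_neg, if_pos]
          ring
      · have e : braid₁₂ q c w k l.rev l = w l.rev k l
            + (q - q⁻¹) * (if (k : ℕ) + l + 1 < N then w k l.rev l else 0) := by
          have h3 : l.rev ≠ k.rev := fun h => h1 (Fin.rev_injective h)
          rw [braid₁₂, braid_of_ne h3, swapWeight_of_ne (fun h => h2 (eq_rev_iff.1 h)) h3]
          simp only [lt_rev_iff, one_mul]
        rw [e]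
        rcases Nat.lt_or_gt_of_ne h5 with h6 | h6 <;> rcases Nat.lt_or_gt_of_ne h2 with h7 | h7 <;>
          by_cases h8 : 2 * (k : ℕ) + 1 = N <;>
        · simp (disch := omega) only [if_neg, if_pos, hs]
          ring

/-- Reversal of the tensor factors combined with the involution of the indices. -/
def flip (w : Fin N → Fin N → Fin N → F) (i j k : Fin N) : F := w k.rev j.rev i.rev

theorem swapWeight_flip (i j : Fin N) : swapWeight q j.rev i.rev = swapWeight q i j := by
  have h1 : j.rev = i.rev ↔ i = j := by rw [Fin.rev_inj]; exact eq_comm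
  have h2 : j.rev = i.rev.rev ↔ i = j.rev := by rw [Fin.rev_rev]; exact eq_comm
  simp only [swapWeight, h1, h2]

/-- R is invariant under reversing the order of the factors together with i ↦ i'. Statements about
the last two indices therefore follow from those about the first two. -/
theorem braid_flip (w : Fin N → Fin N → F) (i j : Fin N) :
    braid q c (fun a b => w b.rev a.rev) i j = braid q c w j.rev i.rev := by
  by_cases h : j = i.rev
  · subst h
    rw [braid_rev, Fin.rev_rev, braid_rev]
    simp only [Fin.rev_rev, capFrom]
  · have h' : i.rev ≠ j.rev.rev := by rw [Fin.rev_rev]; exact fun e => h e.symm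
    rw [braid_of_ne h, braid_of_ne h', swapWeight_flip]
    simp only [Fin.rev_lt_rev]

theorem braid₂₃_flip (w : Fin N → Fin N → Fin N → F) :
    braid₂₃ q c (flip w) = flip (braid₁₂ q c w) := by
  funext i j k
  exact braid_flip (fun a b => w a b i.rev) j k

theorem flip_flip (w : Fin N → Fin N → Fin N → F) : flip (flip w) = w := by
  funext i j k
  simp [flip]

theorem braid₁₂_flip (w : Fin N → Fin N → Fin N → F) :
    braid₁₂ q c (flip w) = flip (braid₂₃ q c w) := by
  rw [← flip_flip (braid₁₂ q c (flip w)), ← braid₂₃_flip, flip_flip]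

theorem capRight_flip (w : Fin N → Fin N → Fin N → F) (b : ℕ) (k : Fin N) :
    capRight c b (flip w) k = capLeft c b w k.rev := by
  simp only [capRight, capLeft, capFrom, flip, Fin.rev_rev]

theorem capLeft_flip (w : Fin N → Fin N → Fin N → F) (b : ℕ) (k : Fin N) :
    capLeft c b (flip w) k = capRight c b w k.rev := by
  simp only [capRight, capLeft, capFrom, flip, Fin.rev_rev]

theorem capOuter_flip (w : Fin N → Fin N → Fin N → F) (b : ℕ) (k : Fin N) :
    capOuter c b (flip w) k = capOuter c b w k.rev := by
  simp only [capOuter, flip, Fin.rev_rev]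

theorem capLeft_braid₂₃ (hc : IsMetricWeight q c) (w : Fin N → Fin N → Fin N → F) (k : Fin N)
    {b : ℕ} (hb : b ≤ N) : capLeft c b (braid₂₃ q c w) k = capOuter c b w k
      + (if b ≤ (k : ℕ) ∧ 2 * (k : ℕ) + 1 ≠ N then (q - 1) * (c k.rev * w k.rev k k) else 0)
      + (if b + k < N ∧ 2 * (k : ℕ) + 1 ≠ N then (q⁻¹ - 1) * (c k * w k k k.rev) else 0)
      + (if b ≤ (k : ℕ) then (q - q⁻¹) * (capLeft c b w k - capLeft c k w k) else 0)
      - (if b + k < N then (q - q⁻¹) * capRight c (N - k) w k else 0) := by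
  have h := capRight_braid₁₂ hc (flip w) k.rev hb
  have hk := k.isLt
  have hr := rev_val k
  rw [braid₁₂_flip, capRight_flip, capRight_flip, capLeft_flip, capOuter_flip, capRight_flip] at h
  simp only [flip, Fin.rev_rev] at h
  have e1 : b ≤ (k.rev : ℕ) ↔ b + k < N := by omega
  have e2 : b + (k.rev : ℕ) < N ↔ b ≤ k := by omega
  have e3 : 2 * (k.rev : ℕ) + 1 ≠ N ↔ 2 * (k : ℕ) + 1 ≠ N := by omega
  simp only [e1, e2, e3] at h
  rw [h, show (k.rev : ℕ) + 1 = N - k by omega, show N - 1 - (k.rev : ℕ) = k by omega]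
  ring

/-- Under `N ≤ b + k` the index `k.rev` lies below the cut, so the metric term of R never
contributes; this is the only range that the braid relation needs. -/
theorem capOuter_braid₂₃ (hc : IsMetricWeight q c) (w : Fin N → Fin N → Fin N → F) (k : Fin N)
    {b : ℕ} (hb : b ≤ N) (hk : N ≤ b + k) : capOuter c b (braid₂₃ q c w) k = capLeft c b w k
      + (if b ≤ (k : ℕ) then (q - 1) * (c k.rev * w k.rev k k) else 0)
      + (q - q⁻¹) * capOuter c (max b (k + 1)) w k := by
  have hq := hc.q_ne
  have hk' := k.isLt
  revert hk
  refine cut_induction (P := fun b => N ≤ b + k → capOuter c b (braid₂₃ q c w) k = capLeft c b w k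
      + (if b ≤ (k : ℕ) then (q - 1) * (c k.rev * w k.rev k k) else 0)
      + (q - q⁻¹) * capOuter c (max b (k + 1)) w k) ?_ ?_ hb
  · intro _
    rw [capOuter_of_le le_rfl, capLeft_of_le le_rfl, capOuter_of_le (le_max_left _ _),
      if_neg (by omega)]
    ring
  · intro l ih hk
    have hl := l.isLt
    rw [capOuter_succ, ih (by omega), capLeft_succ]
    have h0 : l ≠ k.rev := fun h => by rw [eq_rev_iff] at h; omega
    have e : braid₂₃ q c w l.rev k l = swapWeight q k l * w l.rev l k
        + (q - q⁻¹) * (if k < l then w l.rev k l else 0) := by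
      rw [braid₂₃, braid_of_ne h0]
    have hs := capOuter_succ (c := c) w k l
    rw [e]
    rcases lt_trichotomy (l : ℕ) k with h | h | h
    · rw [swapWeight_of_ne (fun h' => by omega) h0, if_neg (show ¬ k < l by rw [Fin.lt_def]; omega)]
      simp (disch := omega) only [if_pos, max_eq_right]
      ring
    · obtain rfl : l = k := Fin.ext h
      rw [swapWeight_self h0, if_neg (lt_irrefl l)]
      simp (disch := omega) only [if_pos, if_neg, max_eq_right]
      ring
    · rw [swapWeight_of_ne (fun h' => by omega) h0, if_pos (show k < l by rw [Fin.lt_def]; omega)]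
      simp (disch := omega) only [if_neg, max_eq_left]
      rw [hs]
      ring

end Braid

/-! ### The Yang–Baxter equation for R. -/

section BraidRelation

variable {F : Type*} [Field F] {N : ℕ} {q : F} {c : Fin N → F}

theorem capLeft_braid₁₂_step (hc : IsMetricWeight q c) (w : Fin N → Fin N → Fin N → F)
    (k l : Fin N) :
    c l.rev * braid₁₂ q c w l.rev l k = (q - q⁻¹) * ((if N < 2 * (l : ℕ) then capLeft c l w k else 0)
      - (if N < 2 * ((l : ℕ) + 1) then capLeft c (l + 1) w k else 0))
      - cutWeight q N l * capLeft c (N - l) w k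
      + cutWeight q N (l + 1) * capLeft c (N - (l + 1)) w k :=
  capFrom_braid_step hc _ l

/-- The truncated contraction of the first two indices slides through two crossings, up to
correction terms. -/
theorem capLeft_braid₂₃_braid₁₂ (hc : IsMetricWeight q c) (w : Fin N → Fin N → Fin N → F)
    (k : Fin N) {b : ℕ} (hb : b ≤ N) :
    capLeft c b (braid₂₃ q c (braid₁₂ q c w)) k = capRight c b w k
      + (if N ≤ b + k then (q - q⁻¹) * (capOuter c b w k
          + (if b ≤ (k : ℕ) then (q - 1) * (c k.rev * w k.rev k k) else 0)) else 0)
      - (if b ≤ (k : ℕ) then (q - q⁻¹) * cutWeight q N b * capLeft c (N - b) w k else 0)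
      + (if N ≤ b + k ∧ b ≤ (k : ℕ) then (q - q⁻¹) ^ 2 *
          ((if N < 2 * b then capLeft c b w k else 0) - capLeft c k w k) else 0) := by
  have hq := hc.q_ne
  have hk := k.isLt
  refine cut_induction (P := fun b =>
    capLeft c b (braid₂₃ q c (braid₁₂ q c w)) k = capRight c b w k
      + (if N ≤ b + k then (q - q⁻¹) * (capOuter c b w k
          + (if b ≤ (k : ℕ) then (q - 1) * (c k.rev * w k.rev k k) else 0)) else 0)
      - (if b ≤ (k : ℕ) then (q - q⁻¹) * cutWeight q N b * capLeft c (N - b) w k else 0)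
      + (if N ≤ b + k ∧ b ≤ (k : ℕ) then (q - q⁻¹) ^ 2 *
          ((if N < 2 * b then capLeft c b w k else 0) - capLeft c k w k) else 0)) ?_ ?_ hb
  · simp (disch := omega) only [capRight_of_le le_rfl, capLeft_of_le le_rfl, capOuter_of_le le_rfl,
      if_neg, if_pos]
    ring
  · intro l ih
    have hl := l.isLt
    rw [capLeft_succ, ih]
    clear ih hb
    have hr := capRight_succ (c := c) w k l
    have hle := capLeft_succ (c := c) w k l
    have ho := capOuter_succ (c := c) w k l
    have hst := capLeft_braid₁₂_step hc w k l
    by_cases h1 : l = k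
    · subst h1
      by_cases h2 : l = l.rev
      · have h3 := eq_rev_iff.1 h2
        have e : braid₂₃ q c (braid₁₂ q c w) l.rev l l = braid₁₂ q c w l.rev l l
            - (q - q⁻¹) * (capRight c (l + 1) (braid₁₂ q c w) l) := by
          rw [braid₂₃, ← h2, braid, if_pos h2, swapWeight_fixed hq h2, if_neg (lt_irrefl l),
            hc.of_eq l (by omega), capRight]
          ring
        have hH := capRight_braid₁₂ hc w l (b := l + 1) (by omega)
        have hcl : c l.rev = 1 := by rw [← h2]; exact hc.of_eq l (by omega)
        have e2 : braid₁₂ q c w l.rev l l = w l l l - (q - q⁻¹) * capLeft c (l + 1) w l := by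
          rw [braid₁₂, ← h2, braid, if_pos h2, swapWeight_fixed hq h2, if_neg (lt_irrefl l),
            hc.of_eq l (by omega), capLeft]
          ring
        have hg : cutWeight q N l = 1 := by
          rw [cutWeight, if_pos (by omega), ← zpow_zero q]; congr 1; omega
        rw [e, e2, hH, hr, ho, hg, hcl, ← h2, show N - (l : ℕ) = l + 1 by omega]
        simp (disch := omega) only [if_pos, if_neg]
        ring
      · have h3 : ¬ (l : ℕ) + l + 1 = N := fun h => h2 (eq_rev_iff.2 h)
        have e : braid₂₃ q c (braid₁₂ q c w) l.rev l l = q * braid₁₂ q c w l.rev l l := by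
          rw [braid₂₃, braid_of_ne h2, swapWeight_self h2, if_neg (lt_irrefl l)]
          ring
        have e2 : braid₁₂ q c w l.rev l l = q⁻¹ * w l l.rev l
            + (q - q⁻¹) * (if N < (l : ℕ) + l + 1 then w l.rev l l else 0)
            - (q - q⁻¹) * c l.rev * capLeft c (N - l) w l := by
          rw [braid₁₂, braid_rev', swapWeight_rev' h2]
          simp only [rev_lt_iff, capLeft]
        rcases Nat.lt_or_gt_of_ne h3 with h4 | h4
        · have hg : q * c l.rev ^ 2 = cutWeight q N l := by
            have hlr := rev_val l
            rw [hc.sq_of_gt l.rev (by omega), cutWeight, if_pos (by omega), ← zpow_one_add₀ hq]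
            congr 1; omega
          rw [e, e2, hr]
          simp (disch := omega) only [if_pos, if_neg]
          linear_combination (-(q - q⁻¹) * capLeft c (N - l) w l) * hg
            + c l.rev * w l l.rev l * mul_inv_cancel₀ hq
        · rcases (show N ≤ 2 * (l : ℕ) by omega).eq_or_lt with h5 | h5
          · have hg : c l.rev ^ 2 = 1 := by
              have hlr := rev_val l
              rw [hc.sq_of_lt l.rev (by omega), ← zpow_zero q]
              congr 1; omega
            rw [e, e2, hr, ho, cutWeight_half h5.symm, show N - (l : ℕ) = l by omega]
            simp (disch := omega) only [if_pos, if_neg]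
            linear_combination (-(q - q⁻¹) * q * capLeft c l w l) * hg
              + c l.rev * w l l.rev l * mul_inv_cancel₀ hq
          · have hg : q * c l.rev ^ 2 = cutWeight q N l := by
              have hlr := rev_val l
              rw [hc.sq_of_lt l.rev (by omega), cutWeight, if_neg (by omega), ← zpow_one_add₀ hq]
              congr 1; omega
            rw [e, e2, hr, ho]
            simp (disch := omega) only [if_pos, if_neg]
            linear_combination (-(q - q⁻¹) * capLeft c (N - l) w l) * hg
              + c l.rev * w l l.rev l * mul_inv_cancel₀ hq
    · have h5 : ¬ (l : ℕ) = k := fun h => h1 (Fin.ext h)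
      by_cases h2 : (k : ℕ) + l + 1 = N
      · obtain rfl : l = k.rev := eq_rev_iff.2 (by omega)
        have h3 : k ≠ k.rev := fun h => h1 h.symm
        have h0 := rev_val k
        have e : braid₂₃ q c (braid₁₂ q c w) k k.rev k = q⁻¹ * braid₁₂ q c w k k k.rev
            + (q - q⁻¹) * (if N < (k : ℕ) + k + 1 then braid₁₂ q c w k k.rev k else 0)
            - (q - q⁻¹) * c k.rev * capRight c (N - k) (braid₁₂ q c w) k := by
          rw [braid₂₃, braid_rev', swapWeight_rev' h3]
          simp only [rev_lt_iff, capRight]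
        have e1 : braid₁₂ q c w k k k.rev = q * w k k k.rev := by
          rw [braid₁₂, braid_of_ne h3, swapWeight_self h3, if_neg (lt_irrefl k)]
          ring
        have hH := capRight_braid₁₂ hc w k (b := N - k) (by omega)
        have hD := capLeft_succ (c := c) w k k
        rw [Fin.rev_rev] at *
        rw [e, e1, hH, hr, show (k.rev : ℕ) + 1 = N - k by omega] at *
        rcases Nat.lt_or_gt_of_ne (show (k : ℕ) + k + 1 ≠ N by omega) with h4 | h4
        · simp (disch := omega) only [if_pos, if_neg]
          linear_combination c k * w k k k.rev * inv_mul_cancel₀ hq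
            - (q - q⁻¹) * capOuter c (N - k) w k * hc.mul_rev k
        · simp (disch := omega) only [if_pos, if_neg] at hst ⊢
          linear_combination c k * w k k k.rev * inv_mul_cancel₀ hq + (q - q⁻¹) * hst
            - (q - q⁻¹) * (capOuter c (N - k) w k + (q⁻¹ - 1) * (c k.rev * w k.rev k k)
              - (q - q⁻¹) * capLeft c (k + 1) w k) * hc.mul_rev k - (q - q⁻¹) ^ 2 * hD
      · have h0 : l ≠ k.rev := fun h => h2 (by rw [eq_rev_iff] at h; omega)
        have h3 : k ≠ l.rev := fun h => h2 (eq_rev_iff.1 h)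
        have e2 : braid₁₂ q c w l.rev k l = w k l.rev l
            + (q - q⁻¹) * (if N < (k : ℕ) + l + 1 then w l.rev k l else 0) := by
          rw [braid₁₂, braid_of_ne (by rw [Fin.rev_rev]; exact fun h => h1 h.symm),
            swapWeight_of_ne h3.symm (by rw [Fin.rev_rev]; exact fun h => h1 h.symm)]
          simp only [rev_lt_iff, one_mul]
        have e : braid₂₃ q c (braid₁₂ q c w) l.rev l k = braid₁₂ q c w l.rev k l
            + (q - q⁻¹) * (if (l : ℕ) < k then braid₁₂ q c w l.rev l k else 0) := by
          rw [braid₂₃, braid_of_ne (fun h => h0 (by rw [h, Fin.rev_rev])),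
            swapWeight_of_ne h1 (fun h => h0 (by rw [h, Fin.rev_rev]))]
          simp only [Fin.lt_def, one_mul]
        rw [e, e2, hr]
        rcases Nat.lt_or_gt_of_ne h5 with h6 | h6 <;> rcases Nat.lt_or_gt_of_ne h2 with h7 | h7
        · simp (disch := omega) only [if_pos, if_neg] at hst ⊢
          linear_combination (q - q⁻¹) * hst
        · simp (disch := omega) only [if_pos] at hst ⊢
          rw [ho]
          linear_combination (q - q⁻¹) * hst
        · simp (disch := omega) only [if_neg]
          ring
        · simp (disch := omega) only [if_pos, if_neg]
          rw [ho]
          ring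

theorem capLeft_braid₁₂ (hc : IsMetricWeight q c) (w : Fin N → Fin N → Fin N → F) (k : Fin N)
    {b : ℕ} (hb : b ≤ N) : capLeft c b (braid₁₂ q c w) k =
      q ^ (1 - (N : ℤ)) * capLeft c 0 w k + (if N < 2 * b then (q - q⁻¹) * capLeft c b w k else 0)
      - cutWeight q N b * capLeft c (N - b) w k :=
  capFrom_braid hc _ hb

theorem capRight_braid₂₃ (hc : IsMetricWeight q c) (w : Fin N → Fin N → Fin N → F) (k : Fin N)
    {b : ℕ} (hb : b ≤ N) : capRight c b (braid₂₃ q c w) k =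
      q ^ (1 - (N : ℤ)) * capRight c 0 w k + (if N < 2 * b then (q - q⁻¹) * capRight c b w k else 0)
      - cutWeight q N b * capRight c (N - b) w k :=
  capFrom_braid hc _ hb

/-- For the full contraction all correction terms disappear, and a cap slides freely through two
crossings. -/
theorem capLeft_braid₂₃_braid₁₂_zero (hc : IsMetricWeight q c) (w : Fin N → Fin N → Fin N → F)
    (k : Fin N) : capLeft c 0 (braid₂₃ q c (braid₁₂ q c w)) k = capRight c 0 w k := by
  have hk := k.isLt
  rw [capLeft_braid₂₃_braid₁₂ hc w k (Nat.zero_le N), capLeft_of_le (by omega)]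
  simp (disch := omega) only [if_pos, if_neg]
  ring

/-- Truncated contractions are used because both sides of Yang–Baxter reduce, through the sliding
formulas, to truncated contractions of `w` itself. What remains to compare depends on the position
of k relative to the cut and to its mirror image; the products of `cutWeight` at complementary cuts
cancel. -/
theorem capLeft_braid_relation (hc : IsMetricWeight q c) (w : Fin N → Fin N → Fin N → F)
    (k : Fin N) {b : ℕ} (hb : b ≤ N) :
    capLeft c b (braid₁₂ q c (braid₂₃ q c (braid₁₂ q c w))) k =
      capLeft c b (braid₂₃ q c (braid₁₂ q c (braid₂₃ q c w))) k := by
  have hq := hc.q_ne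
  have hk := k.isLt
  rw [capLeft_braid₁₂ hc _ k hb, capLeft_braid₂₃_braid₁₂_zero hc, capLeft_braid₂₃_braid₁₂ hc w k hb,
    capLeft_braid₂₃_braid₁₂ hc w k (Nat.sub_le N b), capLeft_braid₂₃_braid₁₂ hc _ k hb,
    capRight_braid₂₃ hc w k hb, Nat.sub_sub_self hb]
  rcases Nat.lt_or_ge (b + k) N with h1 | h1 <;> rcases Nat.lt_or_ge k b with h2 | h2
  · simp (disch := omega) only [if_neg]
    split_ifs <;> ring
  · rw [capLeft_braid₂₃ hc w k (Nat.sub_le N b)]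
    simp (disch := omega) only [if_pos, if_neg]
    ring
  · rw [capOuter_braid₂₃ hc w k hb h1, max_eq_left (by omega)]
    simp (disch := omega) only [if_pos, if_neg]
    linear_combination (q - q⁻¹) * capLeft c b w k * cutWeight_mul hq hb (by omega)
  · have e : braid₂₃ q c w k.rev k k = q * w k.rev k k := by
      have h3 : k ≠ k.rev := fun h => by rw [eq_rev_iff] at h; omega
      rw [braid₂₃, braid_of_ne h3, swapWeight_self h3, if_neg (lt_irrefl k)]
      ring
    have hZ := capOuter_succ (c := c) w k k
    rw [capOuter_braid₂₃ hc w k hb h1, max_eq_right (by omega), e,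
      capLeft_braid₂₃ hc w k hb, capLeft_braid₂₃ hc w k (Nat.sub_le N b),
      capLeft_braid₂₃ hc w k hk.le]
    have hi := mul_inv_cancel₀ hq
    rcases lt_trichotomy N (2 * b) with h3 | h3 | h3
    · have hg := cutWeight_mul hq hb (by omega)
      simp (disch := omega) only [if_pos, if_neg]
      linear_combination (q - q⁻¹) * capLeft c b w k * hg + (q - q⁻¹) ^ 2 * hZ
        - (q - q⁻¹) * (c k.rev * w k.rev k k) * hi
    · rw [show N - b = b by omega, cutWeight_half h3.symm]
      simp (disch := omega) only [if_pos, if_neg]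
      linear_combination (q - q⁻¹) ^ 2 * hZ
        + (q - q⁻¹) * (capLeft c b w k - c k.rev * w k.rev k k) * hi
    · have hg := cutWeight_mul hq hb (by omega)
      simp (disch := omega) only [if_pos, if_neg]
      linear_combination (q - q⁻¹) * capLeft c b w k * hg + (q - q⁻¹) ^ 2 * hZ
        - (q - q⁻¹) * (c k.rev * w k.rev k k) * hi

/-- An entry with indices (i, i', k) is, up to the nonzero weight `c i`, the difference of the
contractions at two consecutive cuts. -/
theorem braid_relation_left (hc : IsMetricWeight q c) (w : Fin N → Fin N → Fin N → F)
    (i k : Fin N) : braid₁₂ q c (braid₂₃ q c (braid₁₂ q c w)) i i.rev k =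
      braid₂₃ q c (braid₁₂ q c (braid₂₃ q c w)) i i.rev k := by
  have hi := i.rev.isLt
  have h1 := capLeft_braid_relation hc w k (b := i.rev) (by omega)
  have h2 := capLeft_braid_relation hc w k (b := i.rev + 1) (by omega)
  rw [capLeft_succ, capLeft_succ, h2, Fin.rev_rev] at h1
  have h3 : c i ≠ 0 := left_ne_zero_of_mul_eq_one (hc.mul_rev i)
  exact mul_left_cancel₀ h3 (add_left_cancel h1)

theorem braid_relation_right (hc : IsMetricWeight q c) (w : Fin N → Fin N → Fin N → F)
    (i k : Fin N) : braid₁₂ q c (braid₂₃ q c (braid₁₂ q c w)) k i i.rev =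
      braid₂₃ q c (braid₁₂ q c (braid₂₃ q c w)) k i i.rev := by
  have h := braid_relation_left hc (flip w) i k.rev
  rw [braid₁₂_flip, braid₂₃_flip, braid₁₂_flip, braid₂₃_flip, braid₁₂_flip, braid₂₃_flip] at h
  simpa only [flip, Fin.rev_rev] using h.symm

/-- Here the dual indices i, i' stand at the outer places, so no contraction isolates the entry.
Both sides are expanded; the only nontrivial terms are the contractions produced when i and i'
become neighbours, and these match by comparing consecutive cuts at k and at k'. -/
theorem braid_relation_outer (hc : IsMetricWeight q c) (w : Fin N → Fin N → Fin N → F)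
    {i k : Fin N} (h1 : k ≠ i) (h2 : k ≠ i.rev) :
    braid₁₂ q c (braid₂₃ q c (braid₁₂ q c w)) i k i.rev =
      braid₂₃ q c (braid₁₂ q c (braid₂₃ q c w)) i k i.rev := by
  have hq := hc.q_ne
  have hi := i.isLt
  have h3 : i ≠ k.rev := fun h => h2 (by rw [h, Fin.rev_rev])
  have h4 : i.rev ≠ k.rev := fun h => h1 (Fin.rev_injective h).symm
  have a1 : ∀ v, braid₁₂ q c v i k i.rev = v k i i.rev
      + (q - q⁻¹) * (if i < k then v i k i.rev else 0) := fun v => by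
    rw [braid₁₂, braid_of_ne h2, swapWeight_of_ne h1.symm h2, one_mul]
  have a2 : ∀ v, braid₂₃ q c v i k i.rev = v i i.rev k
      + (q - q⁻¹) * (if k < i.rev then v i k i.rev else 0) := fun v => by
    rw [braid₂₃, braid_of_ne h4, swapWeight_of_ne h2 h4, one_mul]
  have a3 : ∀ v, braid₁₂ q c v k i.rev i = v i.rev k i
      + (q - q⁻¹) * (if k < i.rev then v k i.rev i else 0) := fun v => by
    rw [braid₁₂, braid_of_ne h4, swapWeight_of_ne h2 h4, one_mul]
  have a4 : ∀ v, braid₁₂ q c v k i i.rev = v i k i.rev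
      + (q - q⁻¹) * (if k < i then v k i i.rev else 0) := fun v => by
    rw [braid₁₂, braid_of_ne h3, swapWeight_of_ne h1 h3, one_mul]
  have a5 : ∀ v, braid₂₃ q c v i.rev i k = v i.rev k i
      + (q - q⁻¹) * (if i < k then v i.rev i k else 0) := fun v => by
    rw [braid₂₃, braid_of_ne h2, swapWeight_of_ne h1.symm h2, one_mul]
  have a6 : ∀ v, braid₂₃ q c v i i.rev k = v i k i.rev
      + (q - q⁻¹) * (if i.rev < k then v i i.rev k else 0) := fun v => by
    rw [braid₂₃, braid_of_ne (by rw [Fin.rev_rev]; exact h1),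
      swapWeight_of_ne h2.symm (by rw [Fin.rev_rev]; exact h1), one_mul]
  have b1 : ∀ v, braid₂₃ q c v k i i.rev = swapWeight q i i.rev * v k i.rev i
      + (q - q⁻¹) * (if i < i.rev then v k i i.rev else 0)
      - (q - q⁻¹) * c i * capRight c (i + 1) v k := fun v => braid_rev i _
  have b2 : ∀ v, braid₁₂ q c v i i.rev k = swapWeight q i i.rev * v i.rev i k
      + (q - q⁻¹) * (if i < i.rev then v i i.rev k else 0)
      - (q - q⁻¹) * c i * capLeft c (i + 1) v k := fun v => braid_rev i _
  rw [a1 (braid₂₃ q c (braid₁₂ q c w)), a2 (braid₁₂ q c (braid₂₃ q c w)), b1 (braid₁₂ q c w),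
    a2 (braid₁₂ q c w), b2 (braid₂₃ q c w), a1 (braid₂₃ q c w), a3, a4, b2 w, a1 w, a5, a6, b1 w,
    a2 w, capRight_braid₁₂ hc w k (by omega), capLeft_braid₂₃ hc w k (by omega)]
  have s1 := capLeft_succ (c := c) w k k
  have s2 := capRight_succ (c := c) w k k.rev
  have hr := rev_val k
  have hir := rev_val i
  have n1 : (k : ℕ) ≠ i := fun h => h1 (Fin.ext h)
  have n2 : (k : ℕ) + i + 1 ≠ N := fun h => h2 (eq_rev_iff.2 h)
  rw [show (k.rev : ℕ) = N - 1 - k by omega, show N - 1 - (k : ℕ) + 1 = N - k by omega,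
    Fin.rev_rev] at s2
  simp only [Fin.lt_def]
  rcases Nat.lt_or_gt_of_ne n1 with h5 | h5 <;> rcases Nat.lt_or_gt_of_ne n2 with h6 | h6 <;>
    rcases Nat.lt_or_ge i i.rev with h8 | h8
  · simp (disch := omega) only [if_pos, if_neg]
    linear_combination (q - q⁻¹) ^ 2 * c i * s2
  · simp (disch := omega) only [if_pos, if_neg]
    linear_combination (q - q⁻¹) ^ 2 * c i * s2
  · exfalso; omega
  · simp (disch := omega) only [if_neg]
  · by_cases h0 : 2 * (k : ℕ) + 1 = N
    · have h7 : k.rev = k := (eq_rev_iff.2 (by omega)).symm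
      rw [h7] at s1 s2
      simp (disch := omega) only [if_pos, if_neg]
      linear_combination (q - q⁻¹) ^ 2 * c i * (s2 - s1)
    · simp (disch := omega) only [if_pos, if_neg]
      linear_combination (q - q⁻¹) ^ 2 * c i * (s2 - s1)
  · exfalso; omega
  · simp (disch := omega) only [if_pos, if_neg]
    linear_combination - (q - q⁻¹) ^ 2 * c i * s1
  · simp (disch := omega) only [if_pos, if_neg]
    linear_combination - (q - q⁻¹) ^ 2 * c i * s1

/-- If no two of the three places carry dual indices, the metric part is absent and R is of Hecke
type, which leaves a finite check over the possible orderings. The remaining entries are covered by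
the three preceding lemmas. -/
theorem braid_relation (hc : IsMetricWeight q c) (w : Fin N → Fin N → Fin N → F) :
    braid₁₂ q c (braid₂₃ q c (braid₁₂ q c w)) = braid₂₃ q c (braid₁₂ q c (braid₂₃ q c w)) := by
  funext i j k
  by_cases h1 : j = i.rev
  · rw [h1]; exact braid_relation_left hc w i k
  by_cases h2 : k = j.rev
  · rw [h2]; exact braid_relation_right hc w j i
  by_cases h3 : k = i.rev
  · rw [h3]
    refine braid_relation_outer hc w (fun h => h2 ?_) h1
    rw [h3, h]
  have h1' : i ≠ j.rev := fun h => h1 (by rw [h, Fin.rev_rev])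
  have h2' : j ≠ k.rev := fun h => h2 (by rw [h, Fin.rev_rev])
  have h3' : i ≠ k.rev := fun h => h3 (by rw [h, Fin.rev_rev])
  simp only [braid₁₂, braid₂₃, braid_of_ne h1, braid_of_ne h2, braid_of_ne h3,
    braid_of_ne h1', braid_of_ne h2', swapWeight, if_neg h1', if_neg h2',
    if_neg h3', if_neg h1, if_neg h2, mul_one]
  clear h1 h2 h3 h1' h2' h3'
  have hq := hc.q_ne
  rcases lt_trichotomy i j with h4 | h4 | h4 <;> rcases lt_trichotomy j k with h5 | h5 | h5 <;>
    rcases lt_trichotomy i k with h6 | h6 | h6 <;>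
    first
    | (exfalso; omega)
    | (subst_vars
       simp (disch := omega) only [if_pos, if_neg, if_true, lt_irrefl, if_false]
       first
       | done
       | ring1
       | (field_simp; done)
       | (field_simp; ring1))

end BraidRelation

/-! ### The quadratic relation, from which R⁻ is seen to be the inverse of R. -/

section BraidInverse

variable {F : Type*} [Field F] {N : ℕ} {q : F} {c : Fin N → F}

/-- The quadratic relation of the R-matrix modulo the metric. -/
theorem braid_braid (hc : IsMetricWeight q c) (w : Fin N → Fin N → F) (i j : Fin N) :
    braid q c (braid q c w) i j = w i j + (q - q⁻¹) * braid q c w i j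
      - (q - q⁻¹) * q ^ (1 - (N : ℤ)) * (if j = i.rev then c i else 0) * capFrom c 0 w := by
  have hq := hc.q_ne
  have hi := mul_inv_cancel₀ hq
  by_cases h : j = i.rev
  · subst h
    have hlt := i.isLt
    have hir := rev_val i
    have h1 := capFrom_braid hc w (b := i + 1) (by omega)
    have h2 := capFrom_succ c w i.rev
    rw [show (i.rev : ℕ) = N - (i + 1) by omega, show N - ((i : ℕ) + 1) + 1 = N - i by omega,
      Fin.rev_rev] at h2
    have h3 := hc.mul_rev i
    -- The halves i < i' and i > i' use different branches of `cutWeight`, but in both its value at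
    -- `i + 1` is `c i.rev ^ 2 * q⁻¹`; this is the computation they share.
    have key {x : F} (hx : x = c i.rev ^ 2 * q⁻¹) :
        q⁻¹ * (q⁻¹ * w i i.rev - (q - q⁻¹) * c i.rev * capFrom c (N - i) w)
          + (q - q⁻¹) * c i * x * (capFrom c (N - i) w + c i * w i i.rev) = w i i.rev := by
      rw [hx]
      linear_combination ((q - q⁻¹) * q⁻¹ * c i.rev * capFrom c (N - i) w
        + (q - q⁻¹) * q⁻¹ * w i i.rev * (c i * c i.rev + 1)) * h3 + w i i.rev * hi
    rw [if_pos rfl, braid_rev i (braid q c w), h1, h2]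
    rcases lt_trichotomy (2 * (i : ℕ) + 1) N with h4 | h4 | h4
    · have hne : i ≠ i.rev := fun h => by rw [eq_rev_iff] at h; omega
      have hg : cutWeight q N (i + 1) = c i.rev ^ 2 * q⁻¹ := by
        rw [hc.sq_of_gt i.rev (by omega), cutWeight, if_pos (by omega), ← zpow_sub_one₀ hq]
        congr 1; push_cast; omega
      rw [braid_rev', braid_rev, swapWeight_rev hne, swapWeight_rev' hne]
      simp (disch := omega) only [lt_rev_iff, rev_lt_iff, if_pos, if_neg]
      linear_combination key hg
    · have hrl : i.rev = i := (eq_rev_iff.2 (by omega)).symm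
      have hg : cutWeight q N (i + 1) = 1 := by
        rw [cutWeight, if_neg (by omega), ← zpow_zero q]
        congr 1; push_cast; omega
      have hs : braid q c w i i = w i i - (q - q⁻¹) * c i * capFrom c (i + 1) w := by
        rw [braid, swapWeight_fixed hq hrl.symm, if_pos hrl.symm, if_neg (lt_irrefl i)]; ring
      rw [hrl, hs, swapWeight_fixed hq hrl.symm, hg, hc.of_eq i h4,
        show N - (i : ℕ) = i + 1 by omega]
      simp (disch := omega) only [lt_irrefl, if_false, if_pos]
      ring
    · have hne : i ≠ i.rev := fun h => by rw [eq_rev_iff] at h; omega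
      have hg : cutWeight q N (i + 1) = c i.rev ^ 2 * q⁻¹ := by
        rw [hc.sq_of_lt i.rev (by omega), cutWeight, if_neg (by omega), ← zpow_sub_one₀ hq]
        congr 1; push_cast; omega
      rw [braid_rev', braid_rev, swapWeight_rev hne, swapWeight_rev' hne]
      simp (disch := omega) only [lt_rev_iff, rev_lt_iff, if_pos, if_neg]
      linear_combination key hg
  · have h' : i ≠ j.rev := fun e => h (by rw [e, Fin.rev_rev])
    rw [braid_of_ne h, braid_of_ne h', braid_of_ne h, if_neg h]
    simp only [swapWeight, if_neg h', if_neg h, mul_one]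
    rcases lt_trichotomy i j with h4 | h4 | h4
    · rw [if_neg h4.ne, if_neg h4.ne', if_pos h4, if_neg h4.not_gt]; ring
    · subst h4
      simp only [if_true, lt_irrefl, if_false]
      linear_combination (w i i) * hi
    · rw [if_neg h4.ne, if_neg h4.ne', if_pos h4, if_neg h4.not_gt]; simp only [if_neg h4.not_gt]; ring

end BraidInverse

/-! ### Braid matrices acting on arrays with values in a vector space. -/

section BraidPair

variable {F : Type*} [Field F] {N : ℕ} {V W : Type*} [AddCommGroup V] [Module F V]
  [AddCommGroup W] [Module F W]

/-- A four-index matrix `Q^{kl}_{ij}` acting on two-index arrays. -/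
def act (Q : Fin N → Fin N → Fin N → Fin N → F) (v : Fin N → Fin N → V) (i j : Fin N) : V :=
  ∑ k, ∑ l, Q k l i j • v k l

/-- `act` on the first two indices. -/
def act₁₂ (Q : Fin N → Fin N → Fin N → Fin N → F) (v : Fin N → Fin N → Fin N → V)
    (i j k : Fin N) : V := act Q (fun a b => v a b k) i j

/-- `act` on the last two indices. -/
def act₂₃ (Q : Fin N → Fin N → Fin N → Fin N → F) (v : Fin N → Fin N → Fin N → V)
    (i j k : Fin N) : V := act Q (v i) j k

/-- The contraction of a two-index array with the metric. -/
def tr (C : Fin N → Fin N → F) (v : Fin N → Fin N → V) : V := ∑ k, ∑ l, C k l • v k l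

/-- The contraction of the first two indices. -/
def tr₁₂ (C : Fin N → Fin N → F) (v : Fin N → Fin N → Fin N → V) (k : Fin N) : V :=
  tr C (fun i j => v i j k)

/-- The contraction of the last two indices. -/
def tr₂₃ (C : Fin N → Fin N → F) (v : Fin N → Fin N → Fin N → V) (i : Fin N) : V := tr C (v i)

variable (Q Q' : Fin N → Fin N → Fin N → Fin N → F) (C : Fin N → Fin N → F)

theorem map_act {G : Type*} [FunLike G V W] [LinearMapClass G F V W] (f : G)
    (v : Fin N → Fin N → V) (i j : Fin N) :
    f (act Q v i j) = act Q (fun a b => f (v a b)) i j := by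
  simp only [act, map_sum, map_smul]

theorem map_tr {G : Type*} [FunLike G V W] [LinearMapClass G F V W] (f : G)
    (v : Fin N → Fin N → V) : f (tr C v) = tr C (fun a b => f (v a b)) := by
  simp only [tr, map_sum, map_smul]

theorem map_act₁₂ {G : Type*} [FunLike G V W] [LinearMapClass G F V W] (f : G)
    (v : Fin N → Fin N → Fin N → V) (i j k : Fin N) :
    f (act₁₂ Q v i j k) = act₁₂ Q (fun a b c => f (v a b c)) i j k := map_act Q f _ i j

theorem map_act₂₃ {G : Type*} [FunLike G V W] [LinearMapClass G F V W] (f : G)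
    (v : Fin N → Fin N → Fin N → V) (i j k : Fin N) :
    f (act₂₃ Q v i j k) = act₂₃ Q (fun a b c => f (v a b c)) i j k := map_act Q f _ j k

theorem act_add (v w : Fin N → Fin N → V) (i j : Fin N) :
    act Q (fun a b => v a b + w a b) i j = act Q v i j + act Q w i j := by
  simp only [act, smul_add, Finset.sum_add_distrib]

theorem act_sub (v w : Fin N → Fin N → V) (i j : Fin N) :
    act Q (fun a b => v a b - w a b) i j = act Q v i j - act Q w i j := by
  simp only [act, smul_sub, Finset.sum_sub_distrib]

theorem act_smul (r : F) (v : Fin N → Fin N → V) (i j : Fin N) :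
    act Q (fun a b => r • v a b) i j = r • act Q v i j := by
  simp only [act, Finset.smul_sum, smul_comm r]

theorem tr_add (v w : Fin N → Fin N → V) :
    tr C (fun a b => v a b + w a b) = tr C v + tr C w := by
  simp only [tr, smul_add, Finset.sum_add_distrib]

theorem tr_sub (v w : Fin N → Fin N → V) :
    tr C (fun a b => v a b - w a b) = tr C v - tr C w := by
  simp only [tr, smul_sub, Finset.sum_sub_distrib]

theorem tr_smul (r : F) (v : Fin N → Fin N → V) : tr C (fun a b => r • v a b) = r • tr C v := by
  simp only [tr, Finset.smul_sum, smul_comm r]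

theorem act_smul_const (w : Fin N → Fin N → F) (v : V) (i j : Fin N) :
    act Q (fun a b => w a b • v) i j = act Q w i j • v := by
  simp only [act, Finset.sum_smul, smul_assoc]

/-- Linear functionals separate points, so a matrix identity on scalar arrays holds on arrays with
values in any vector space, in particular in an algebra or in the two-tensors. -/
theorem eq_of_dual {v w : V} (h : ∀ f : Module.Dual F V, f v = f w) : v = w := by
  rw [← sub_eq_zero, ← Module.forall_dual_apply_eq_zero_iff F]
  intro f
  rw [map_sub, h, sub_self]

/-- An R-matrix `Q` of orthogonal type with its inverse `Q'` and metric `C`. -/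
structure IsBraidPair (p z : F) : Prop where
  p_ne : p ≠ 0
  z_ne : z ≠ 0
  symm : ∀ k l i j, Q k l i j = Q i j k l
  skein : ∀ k l i j, Q' k l i j =
    Q k l i j + (p - p⁻¹) * ((if k = i ∧ l = j then 1 else 0) - C k l * C i j)
  metric_sq : ∀ i k, ∑ j, C i j * C j k = if i = k then 1 else 0
  act_act_field : ∀ v : Fin N → Fin N → F, act Q (act Q' v) = v
  act_act_field' : ∀ v : Fin N → Fin N → F, act Q' (act Q v) = v
  tr_act_field : ∀ v : Fin N → Fin N → F, tr C (act Q v) = p * z * tr C v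
  tr_slide_field : ∀ v : Fin N → Fin N → Fin N → F, tr₁₂ C (act₂₃ Q' v) = tr₂₃ C (act₁₂ Q v)
  yang_baxter_field : ∀ v : Fin N → Fin N → Fin N → F,
    act₁₂ Q (act₂₃ Q (act₁₂ Q v)) = act₂₃ Q (act₁₂ Q (act₂₃ Q v))

variable {Q Q' C} {p z : F}

theorem sum_pair_ite (i j : Fin N) (v : Fin N → Fin N → V) :
    (∑ k, ∑ l, (if k = i ∧ l = j then (1 : F) else 0) • v k l) = v i j := by
  simp only [ite_and, ite_smul, one_smul, zero_smul, Finset.sum_ite_irrel, Finset.sum_const_zero,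
    Finset.sum_ite_eq', Finset.mem_univ, if_true]

namespace IsBraidPair

theorem act_act (h : IsBraidPair Q Q' C p z) (v : Fin N → Fin N → V) : act Q (act Q' v) = v := by
  funext i j
  refine eq_of_dual (F := F) fun f => ?_
  rw [map_act]
  simp only [map_act]
  exact congrFun₂ (h.act_act_field _) i j

theorem act_act' (h : IsBraidPair Q Q' C p z) (v : Fin N → Fin N → V) : act Q' (act Q v) = v := by
  funext i j
  refine eq_of_dual (F := F) fun f => ?_
  rw [map_act]
  simp only [map_act]
  exact congrFun₂ (h.act_act_field' _) i j

theorem act_skein (h : IsBraidPair Q Q' C p z) (v : Fin N → Fin N → V) (i j : Fin N) :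
    act Q' v i j = act Q v i j + (p - p⁻¹) • (v i j - C i j • tr C v) := by
  have e : ∀ k l, Q' k l i j • v k l = Q k l i j • v k l
      + ((p - p⁻¹) • ((if k = i ∧ l = j then (1 : F) else 0) • v k l)
      - (p - p⁻¹) • (C i j • (C k l • v k l))) := by
    intro k l
    rw [h.skein]; module
  simp only [act, e, Finset.sum_add_distrib, Finset.sum_sub_distrib, ← Finset.smul_sum,
    sum_pair_ite, smul_sub, tr]

theorem tr_act (h : IsBraidPair Q Q' C p z) (v : Fin N → Fin N → V) :
    tr C (act Q v) = (p * z) • tr C v := by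
  refine eq_of_dual (F := F) fun f => ?_
  rw [map_tr, map_smul, map_tr]
  simp only [map_act]
  exact h.tr_act_field _

theorem tr_act' (h : IsBraidPair Q Q' C p z) (v : Fin N → Fin N → V) :
    tr C (act Q' v) = (p * z)⁻¹ • tr C v := by
  have := h.tr_act (act Q' v)
  rw [h.act_act] at this
  rw [this, inv_smul_smul₀ (mul_ne_zero h.p_ne h.z_ne)]

theorem symm' (h : IsBraidPair Q Q' C p z) (k l i j : Fin N) : Q' k l i j = Q' i j k l := by
  rw [h.skein, h.skein, h.symm, mul_comm (C k l)]
  simp only [eq_comm]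

theorem tr_slide (h : IsBraidPair Q Q' C p z) (v : Fin N → Fin N → Fin N → V) :
    tr₁₂ C (act₂₃ Q' v) = tr₂₃ C (act₁₂ Q v) := by
  funext k
  refine eq_of_dual (F := F) fun f => ?_
  rw [tr₁₂, tr₂₃, map_tr, map_tr]
  simp only [act₁₂, act₂₃, map_act]
  exact congrFun (h.tr_slide_field fun a b c => f (v a b c)) k

theorem yang_baxter (h : IsBraidPair Q Q' C p z) (v : Fin N → Fin N → Fin N → V) :
    act₁₂ Q (act₂₃ Q (act₁₂ Q v)) = act₂₃ Q (act₁₂ Q (act₂₃ Q v)) := by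
  funext i j k
  refine eq_of_dual (F := F) fun f => ?_
  simp only [map_act₁₂, map_act₂₃]
  exact congrFun₃ (h.yang_baxter_field fun a b c => f (v a b c)) i j k

theorem act₁₂_act₁₂ (h : IsBraidPair Q Q' C p z) (v : Fin N → Fin N → Fin N → V) :
    act₁₂ Q (act₁₂ Q' v) = v := by
  funext i j k
  exact congrFun₂ (h.act_act fun a b => v a b k) i j

theorem act₁₂_act₁₂' (h : IsBraidPair Q Q' C p z) (v : Fin N → Fin N → Fin N → V) :
    act₁₂ Q' (act₁₂ Q v) = v := by
  funext i j k
  exact congrFun₂ (h.act_act' fun a b => v a b k) i j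

theorem act₂₃_act₂₃ (h : IsBraidPair Q Q' C p z) (v : Fin N → Fin N → Fin N → V) :
    act₂₃ Q (act₂₃ Q' v) = v := by
  funext i j k
  exact congrFun₂ (h.act_act (v i)) j k

theorem act₂₃_act₂₃' (h : IsBraidPair Q Q' C p z) (v : Fin N → Fin N → Fin N → V) :
    act₂₃ Q' (act₂₃ Q v) = v := by
  funext i j k
  exact congrFun₂ (h.act_act' (v i)) j k

theorem snake_left (h : IsBraidPair Q Q' C p z) (v : Fin N → V) :
    tr₁₂ C (fun i j k => C j k • v i) = v := by
  funext k
  simp only [tr₁₂, tr, smul_smul, ← Finset.sum_smul, h.metric_sq, ite_smul, one_smul, zero_smul,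
    Finset.sum_ite_eq', Finset.mem_univ, if_true]

theorem snake_right (h : IsBraidPair Q Q' C p z) (v : Fin N → V) :
    tr₂₃ C (fun i j k => C i j • v k) = v := by
  funext i
  have e : ∀ j k, C j k • C i j • v k = (C i j * C j k) • v k := fun j k => by
    rw [smul_smul, mul_comm]
  simp only [tr₂₃, tr, e]
  rw [Finset.sum_comm]
  simp only [← Finset.sum_smul, h.metric_sq, ite_smul, one_smul, zero_smul,
    Finset.sum_ite_eq, Finset.mem_univ, if_true]

/-- Replace each matrix by the other through the skein relation: the identity and metric terms on
the two sides cancel by the snake identities. -/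
theorem tr_slide' (h : IsBraidPair Q Q' C p z) (v : Fin N → Fin N → Fin N → V) :
    tr₁₂ C (act₂₃ Q v) = tr₂₃ C (act₁₂ Q' v) := by
  funext k
  have e1 : act₂₃ Q v = fun i j k => act₂₃ Q' v i j k
      - ((p - p⁻¹) • (v i j k - C j k • tr₂₃ C v i)) := by
    funext i j k
    rw [act₂₃, act₂₃, h.act_skein, add_sub_assoc]
    simp [tr₂₃]
  have e2 : act₁₂ Q' v = fun i j k => act₁₂ Q v i j k
      + (p - p⁻¹) • (v i j k - C i j • tr₁₂ C v k) := by
    funext i j k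
    rw [act₁₂, act₁₂, h.act_skein]; rfl
  have e3 := congrFun (h.tr_slide v) k
  have e4 := congrFun (h.snake_left (tr₂₃ C v)) k
  have e5 := congrFun (h.snake_right (tr₁₂ C v)) k
  rw [e1, e2]
  simp only [tr₁₂, tr₂₃, tr_add, tr_sub, tr_smul] at e3 e4 e5 ⊢
  rw [e3, e4, e5]
  module

/-- Both sides are inverses of the two sides of Yang–Baxter for Q. -/
theorem yang_baxter' (h : IsBraidPair Q Q' C p z) (v : Fin N → Fin N → Fin N → V) :
    act₁₂ Q' (act₂₃ Q' (act₁₂ Q' v)) = act₂₃ Q' (act₁₂ Q' (act₂₃ Q' v)) := by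
  have := h.yang_baxter (act₁₂ Q' (act₂₃ Q' (act₁₂ Q' v)))
  rw [h.act₁₂_act₁₂, h.act₂₃_act₂₃, h.act₁₂_act₁₂] at this
  conv_rhs => rw [this]
  rw [h.act₂₃_act₂₃', h.act₁₂_act₁₂', h.act₂₃_act₂₃']

/-- The pair with both R-matrices exchanged. -/
theorem swap (h : IsBraidPair Q Q' C p z) : IsBraidPair Q' Q C p⁻¹ z⁻¹ where
  p_ne := inv_ne_zero h.p_ne
  z_ne := inv_ne_zero h.z_ne
  symm := h.symm'
  skein k l i j := by rw [h.skein, inv_inv]; ring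
  metric_sq := h.metric_sq
  act_act_field := h.act_act'
  act_act_field' := h.act_act
  tr_act_field v := by rw [h.tr_act', mul_inv]; rfl
  tr_slide_field := h.tr_slide'
  yang_baxter_field := h.yang_baxter'

/-- This is the transpose of `tr_slide'`: evaluating that identity on delta arrays gives matrix
entries, and the symmetry of Q and Q' exchanges their upper and lower indices. -/
theorem cup_slide (h : IsBraidPair Q Q' C p z) (v : Fin N → V) :
    act₂₃ Q (fun i j k => C i j • v k) = act₁₂ Q' (fun i j k => C j k • v i) := by
  have key : ∀ i j k m, ∑ b, C i b * Q b m j k = ∑ b, C b k * Q' m b i j := by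
    intro i j k m
    have := congrFun (h.tr_slide' (V := F) fun a b c =>
      if a = i then if b = j then if c = k then 1 else 0 else 0 else 0) m
    simpa [tr₁₂, tr₂₃, act₁₂, act₂₃, tr, act, Finset.sum_ite_irrel, h.symm j k _ m,
      h.symm' i j m] using this
  funext i j k
  have e1 : ∀ b m, Q b m j k • C i b • v m = (C i b * Q b m j k) • v m := fun b m => by
    rw [smul_smul, mul_comm]
  have e2 : ∀ m b, Q' m b i j • C b k • v m = (C b k * Q' m b i j) • v m := fun b m => by
    rw [smul_smul, mul_comm]
  simp only [act₁₂, act₂₃, act, e1, e2]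
  rw [Finset.sum_comm]
  simp only [← Finset.sum_smul, key]

end IsBraidPair

end BraidPair

/-! ### The concrete matrices of O_q(N) form a braid pair. -/

section Instance

variable (𝕜 : Type u) [RCLike 𝕜] {N : ℕ} (q : ℝ)

/-- The weights `q ^ (-ϱ_i)` of the metric as scalars. -/
def weight (i : Fin N) : 𝕜 := ((q ^ (-rho i) : ℝ) : 𝕜)

/-- The metric with scalar entries. -/
def metricS (k l : Fin N) : 𝕜 := (metric q k l : 𝕜)

/-- The R-matrix with scalar entries. -/
def RmatS (k l i j : Fin N) : 𝕜 := (Rmat q k l i j : 𝕜)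

/-- The inverse R-matrix with scalar entries. -/
def RinvS (k l i j : Fin N) : 𝕜 := (Rinv q k l i j : 𝕜)

variable {q}

theorem rho_rev (i : Fin N) : rho i.rev = - rho i := by
  have h := rev_val i
  have hi := i.isLt
  have hc : ((i.rev : ℕ) : ℝ) = N - 1 - i := by
    rw [h, Nat.cast_sub (by omega), Nat.cast_sub (by omega)]; simp
  rw [rho, rho, hc]
  split_ifs <;> first | omega | ring

theorem weight_isMetricWeight (hq : 0 < q) :
    IsMetricWeight (q : 𝕜) (weight 𝕜 q : Fin N → 𝕜) where
  q_ne := by exact_mod_cast hq.ne'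
  mul_rev i := by
    rw [weight, weight, rho_rev, ← RCLike.ofReal_mul, ← Real.rpow_add hq]
    simp
  sq_of_lt i h := by
    rw [weight, ← RCLike.ofReal_pow, ← RCLike.ofReal_zpow, ← Real.rpow_mul_natCast hq.le,
      ← Real.rpow_intCast, rho, if_pos (by omega)]
    congr 2; push_cast; ring
  of_eq i h := by
    rw [weight, rho, if_neg (by omega), if_pos (by omega)]; simp
  sq_of_gt i h := by
    rw [weight, ← RCLike.ofReal_pow, ← RCLike.ofReal_zpow, ← Real.rpow_mul_natCast hq.le,
      ← Real.rpow_intCast, rho, if_neg (by omega), if_neg (by omega)]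
    congr 2; push_cast; ring

variable {𝕜}

theorem metricS_apply (k l : Fin N) :
    metricS 𝕜 q k l = if k = l.rev then weight 𝕜 q k else 0 := by
  rw [metricS, metric]; split_ifs <;> simp [weight]

theorem RmatS_apply (k l i j : Fin N) : RmatS 𝕜 q k l i j =
    (if i = l ∧ j = k then
      (q : 𝕜) ^ ((if k = l then 1 else 0 : ℤ) - (if k = l.rev then 1 else 0 : ℤ)) else 0)
    + ((q : 𝕜) - (q : 𝕜)⁻¹) * (if i < l then (if i = k ∧ j = l then 1 else 0)
      - metricS 𝕜 q k l * metricS 𝕜 q i j else 0) := by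
  rw [RmatS, Rmat, Kmat]
  simp only [metricS]
  split_ifs <;> push_cast <;> rfl

theorem RinvS_apply (k l i j : Fin N) : RinvS 𝕜 q k l i j =
    RmatS 𝕜 q k l i j - ((q : 𝕜) - (q : 𝕜)⁻¹) * (if k = i ∧ l = j then 1 else 0)
      + ((q : 𝕜) - (q : 𝕜)⁻¹) * (metricS 𝕜 q k l * metricS 𝕜 q i j) := by
  rw [RinvS, Rinv, Kmat]
  simp only [metricS, RmatS]
  split_ifs <;> push_cast <;> rfl

theorem swapWeight_eq (hq : (q : 𝕜) ≠ 0) (i j : Fin N) : swapWeight (q : 𝕜) i j =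
    (q : 𝕜) ^ ((if j = i then 1 else 0 : ℤ) - (if j = i.rev then 1 else 0 : ℤ)) := by
  rw [swapWeight]
  have h : i = j.rev ↔ j = i.rev := by
    rw [eq_rev_iff, eq_rev_iff]; omega
  simp only [h, eq_comm (a := j) (b := i)]
  split_ifs <;> simp [hq]

theorem metricS_sum (f : Fin N → Fin N → 𝕜) :
    ∑ k, ∑ l, metricS 𝕜 q k l * f k l = ∑ l : Fin N, weight 𝕜 q l.rev * f l.rev l := by
  rw [Finset.sum_comm]
  simp only [metricS_apply, ite_mul, zero_mul, Finset.sum_ite_eq', Finset.mem_univ, if_true]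

theorem tr_metricS (v : Fin N → Fin N → 𝕜) :
    tr (metricS 𝕜 q) v = capFrom (weight 𝕜 q) 0 v := by
  simp only [tr, smul_eq_mul, metricS_sum, capFrom, Nat.zero_le, if_true]

/-- Connects the index definition of R with `braid`: the factor θ_{il} in front of K becomes the
truncation `l > i` of the contraction. -/
theorem act_RmatS (hq : 0 < q) (v : Fin N → Fin N → 𝕜) :
    act (RmatS 𝕜 q) v = braid (q : 𝕜) (weight 𝕜 q) v := by
  funext i j
  have hq' : (q : 𝕜) ≠ 0 := by exact_mod_cast hq.ne'
  have e : ∀ k l, RmatS 𝕜 q k l i j * v k l =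
      (if i = l ∧ j = k then swapWeight (q : 𝕜) i j * v j i else 0)
      + (if i = k ∧ j = l then ((q : 𝕜) - (q : 𝕜)⁻¹) * (if i < j then v i j else 0) else 0)
      - ((q : 𝕜) - (q : 𝕜)⁻¹) * metricS 𝕜 q i j * (metricS 𝕜 q k l * (if i < l then v k l else 0)) := by
    intro k l
    rw [RmatS_apply, swapWeight_eq hq']
    by_cases h1 : i = l ∧ j = k
    · obtain ⟨rfl, rfl⟩ := h1
      by_cases h2 : i = j
      · subst h2; simp
      · simp only [h2, false_and, and_self, if_true, if_false]
        split_ifs <;> ring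
    · rw [if_neg h1, if_neg h1]
      by_cases h2 : i = k ∧ j = l
      · obtain ⟨rfl, rfl⟩ := h2
        simp only [and_self, if_true]
        split_ifs <;> ring
      · rw [if_neg h2, if_neg h2]
        split_ifs <;> ring
  simp only [act, smul_eq_mul, e, Finset.sum_add_distrib, Finset.sum_sub_distrib,
    ← Finset.mul_sum, metricS_sum]
  rw [braid, capFrom, metricS_apply]
  have h : i = j.rev ↔ j = i.rev := by
    rw [eq_rev_iff, eq_rev_iff]; omega
  simp only [ite_and, Finset.sum_ite_irrel, Finset.sum_const_zero, Finset.sum_ite_eq,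
    Finset.mem_univ, if_true, h, mul_ite, mul_zero, Fin.lt_def, Nat.succ_le_iff]
  split_ifs <;> simp

theorem metricS_eq_zero {k l : Fin N} (h : k ≠ l.rev) : metricS 𝕜 q k l = 0 := by
  rw [metricS_apply, if_neg h]

theorem RmatS_symm (k l i j : Fin N) : RmatS 𝕜 q k l i j = RmatS 𝕜 q i j k l := by
  have h1 : (if i = l ∧ j = k then
      (q : 𝕜) ^ ((if k = l then 1 else 0 : ℤ) - (if k = l.rev then 1 else 0 : ℤ)) else 0) =
      if k = j ∧ l = i then
      (q : 𝕜) ^ ((if i = j then 1 else 0 : ℤ) - (if i = j.rev then 1 else 0 : ℤ)) else 0 := by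
    by_cases h : i = l ∧ j = k
    · obtain ⟨rfl, rfl⟩ := h
      have h : j = i.rev ↔ i = j.rev := by
        rw [eq_rev_iff, eq_rev_iff]; omega
      simp only [h, eq_comm (a := j) (b := i)]
    · rw [if_neg h, if_neg (fun e => h ⟨e.2.symm, e.1.symm⟩)]
  rw [RmatS_apply, RmatS_apply, h1, mul_comm (metricS 𝕜 q k l)]
  congr 2
  by_cases h2 : i = k ∧ j = l
  · obtain ⟨rfl, rfl⟩ := h2; rfl
  · have h2' : ¬ (k = i ∧ l = j) := fun e => h2 ⟨e.1.symm, e.2.symm⟩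
    simp only [if_neg h2, if_neg h2']
    by_cases h3 : k = l.rev
    · by_cases h4 : i = j.rev
      · have : i < l ↔ k < j := by
          rw [h3, h4, rev_lt_iff, rev_lt_iff]; omega
        simp only [this]
      · simp [metricS_eq_zero h4]
    · simp [metricS_eq_zero h3]

theorem act_RinvS (v : Fin N → Fin N → 𝕜) (i j : Fin N) : act (RinvS 𝕜 q) v i j =
    act (RmatS 𝕜 q) v i j - ((q : 𝕜) - (q : 𝕜)⁻¹) * v i j
      + ((q : 𝕜) - (q : 𝕜)⁻¹) * metricS 𝕜 q i j * tr (metricS 𝕜 q) v := by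
  have e : ∀ k l, RinvS 𝕜 q k l i j * v k l = RmatS 𝕜 q k l i j * v k l
      - ((q : 𝕜) - (q : 𝕜)⁻¹) * ((if k = i ∧ l = j then (1 : 𝕜) else 0) • v k l)
      + ((q : 𝕜) - (q : 𝕜)⁻¹) * metricS 𝕜 q i j * (metricS 𝕜 q k l * v k l) := by
    intro k l
    rw [RinvS_apply, smul_eq_mul]; ring
  simp only [act, tr, smul_eq_mul, e, Finset.sum_add_distrib, Finset.sum_sub_distrib,
    ← Finset.mul_sum]
  simp only [← smul_eq_mul (a := ite _ _ _), sum_pair_ite]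

theorem tr_act_RmatS (hq : 0 < q) (v : Fin N → Fin N → 𝕜) :
    tr (metricS 𝕜 q) (act (RmatS 𝕜 q) v) =
      (q : 𝕜) ^ (1 - (N : ℤ)) * tr (metricS 𝕜 q) v := by
  rw [tr_metricS, tr_metricS, act_RmatS hq,
    capFrom_braid (weight_isMetricWeight 𝕜 hq) v (Nat.zero_le N), Nat.sub_zero,
    capFrom_of_le _ le_rfl, if_neg (by omega)]
  ring

theorem act_RinvS_act_RmatS (hq : 0 < q) (v : Fin N → Fin N → 𝕜) :
    act (RinvS 𝕜 q) (act (RmatS 𝕜 q) v) = v := by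
  funext i j
  have hc := weight_isMetricWeight 𝕜 (N := N) hq
  have h : i = j.rev ↔ j = i.rev := by
    rw [eq_rev_iff, eq_rev_iff]; omega
  rw [act_RinvS, tr_act_RmatS hq, act_RmatS hq, act_RmatS hq, braid_braid hc, tr_metricS,
    metricS_apply]
  simp only [h]
  ring

theorem act_RmatS_act_RinvS (hq : 0 < q) (v : Fin N → Fin N → 𝕜) :
    act (RmatS 𝕜 q) (act (RinvS 𝕜 q) v) = v := by
  let f : (Fin N → Fin N → Fin N → Fin N → 𝕜) → Module.End 𝕜 (Fin N → Fin N → 𝕜) := fun Q =>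
    { toFun := act Q
      map_add' := fun v w => funext₂ fun i j => act_add Q v w i j
      map_smul' := fun r v => funext₂ fun i j => act_smul Q r v i j }
  have h : f (RinvS 𝕜 q) * f (RmatS 𝕜 q) = 1 :=
    LinearMap.ext fun v => act_RinvS_act_RmatS hq v
  -- A one-sided inverse in the endomorphism ring of a finite-dimensional space is two-sided.
  exact LinearMap.congr_fun (mul_eq_one_comm.1 h) v

theorem tr_act_RinvS (hq : 0 < q) (hN : 2 ≤ N) (v : Fin N → Fin N → 𝕜) :
    tr (metricS 𝕜 q) (act (RinvS 𝕜 q) v) = (q * q ^ (N - 2) : 𝕜) * tr (metricS 𝕜 q) v := by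
  have hq' : (q : 𝕜) ≠ 0 := by exact_mod_cast hq.ne'
  have h := tr_act_RmatS hq (act (RinvS 𝕜 q) v)
  rw [act_RmatS_act_RinvS hq] at h
  rw [h, ← mul_assoc, ← pow_succ', ← zpow_natCast, ← zpow_add₀ hq',
    show (((N - 2 + 1 : ℕ) : ℤ) + (1 - N)) = 0 by omega, zpow_zero, one_mul]

theorem act₁₂_RmatS (hq : 0 < q) (v : Fin N → Fin N → Fin N → 𝕜) :
    act₁₂ (RmatS 𝕜 q) v = braid₁₂ (q : 𝕜) (weight 𝕜 q) v := by
  funext i j k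
  exact congrFun₂ (act_RmatS hq _) i j

theorem act₂₃_RmatS (hq : 0 < q) (v : Fin N → Fin N → Fin N → 𝕜) :
    act₂₃ (RmatS 𝕜 q) v = braid₂₃ (q : 𝕜) (weight 𝕜 q) v := by
  funext i j k
  exact congrFun₂ (act_RmatS hq _) j k

theorem yang_baxter_RinvS (hq : 0 < q) (v : Fin N → Fin N → Fin N → 𝕜) :
    act₁₂ (RinvS 𝕜 q) (act₂₃ (RinvS 𝕜 q) (act₁₂ (RinvS 𝕜 q) v)) =
      act₂₃ (RinvS 𝕜 q) (act₁₂ (RinvS 𝕜 q) (act₂₃ (RinvS 𝕜 q) v)) := by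
  have h1 : ∀ w : Fin N → Fin N → Fin N → 𝕜, act₁₂ (RinvS 𝕜 q) (act₁₂ (RmatS 𝕜 q) w) = w :=
    fun w => funext₃ fun i j k => congrFun₂ (act_RinvS_act_RmatS hq fun a b => w a b k) i j
  have h2 : ∀ w : Fin N → Fin N → Fin N → 𝕜, act₂₃ (RinvS 𝕜 q) (act₂₃ (RmatS 𝕜 q) w) = w :=
    fun w => funext₃ fun i j k => congrFun₂ (act_RinvS_act_RmatS hq (w i)) j k
  have h3 : ∀ w : Fin N → Fin N → Fin N → 𝕜, act₁₂ (RmatS 𝕜 q) (act₁₂ (RinvS 𝕜 q) w) = w :=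
    fun w => funext₃ fun i j k => congrFun₂ (act_RmatS_act_RinvS hq fun a b => w a b k) i j
  have h4 : ∀ w : Fin N → Fin N → Fin N → 𝕜, act₂₃ (RmatS 𝕜 q) (act₂₃ (RinvS 𝕜 q) w) = w :=
    fun w => funext₃ fun i j k => congrFun₂ (act_RmatS_act_RinvS hq (w i)) j k
  have := braid_relation (weight_isMetricWeight 𝕜 hq)
    (act₁₂ (RinvS 𝕜 q) (act₂₃ (RinvS 𝕜 q) (act₁₂ (RinvS 𝕜 q) v)))
  simp only [← act₁₂_RmatS hq, ← act₂₃_RmatS hq] at this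
  rw [h3, h4, h3] at this
  conv_rhs => rw [this]
  rw [h2, h1, h2]

theorem tr_slide_RmatS (hq : 0 < q) (v : Fin N → Fin N → Fin N → 𝕜) :
    tr₁₂ (metricS 𝕜 q) (act₂₃ (RmatS 𝕜 q) v) = tr₂₃ (metricS 𝕜 q) (act₁₂ (RinvS 𝕜 q) v) := by
  have h3 : act₁₂ (RmatS 𝕜 q) (act₁₂ (RinvS 𝕜 q) v) = v :=
    funext₃ fun i j k => congrFun₂ (act_RmatS_act_RinvS hq fun a b => v a b k) i j
  funext k
  have := capLeft_braid₂₃_braid₁₂_zero (weight_isMetricWeight 𝕜 hq) (act₁₂ (RinvS 𝕜 q) v) k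
  rw [← act₁₂_RmatS hq, ← act₂₃_RmatS hq, h3, capLeft, capRight, ← tr_metricS, ← tr_metricS] at this
  exact this

/-- R⁻ is taken as the first matrix because the relations of the sphere and of the calculus are
written with R⁻; its eigenvalue q^(N-1) on the metric is p z. -/
theorem isBraidPair (hq : 0 < q) (hN : 2 ≤ N) :
    IsBraidPair (RinvS 𝕜 q) (RmatS 𝕜 q : Fin N → Fin N → Fin N → Fin N → 𝕜) (metricS 𝕜 q) (q : 𝕜)
      ((q : 𝕜) ^ (N - 2)) where
  p_ne := by exact_mod_cast hq.ne'
  z_ne := pow_ne_zero _ (by exact_mod_cast hq.ne')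
  symm k l i j := by
    rw [RinvS_apply, RinvS_apply, RmatS_symm, mul_comm (metricS 𝕜 q k l)]
    simp only [eq_comm]
  skein k l i j := by rw [RinvS_apply]; ring
  metric_sq i k := by
    have h := (weight_isMetricWeight 𝕜 (N := N) hq).mul_rev i
    rw [Finset.sum_eq_single i.rev]
    · simp only [metricS_apply, Fin.rev_rev, Fin.rev_inj, if_true]
      split_ifs with hk
      · exact h
      · exact mul_zero _
    · intro j _ hj
      rw [metricS_eq_zero (fun e => hj (by rw [e, Fin.rev_rev])), zero_mul]
    · simp
  act_act_field := act_RinvS_act_RmatS hq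
  act_act_field' := act_RmatS_act_RinvS hq
  tr_act_field := tr_act_RinvS hq hN
  tr_slide_field := tr_slide_RmatS hq
  yang_baxter_field := yang_baxter_RinvS hq

end Instance

/-! ### Universal properties of the tensor algebra of a bimodule and of its quotient by ker(id - σ).
-/

section TensorAlgebra

variable {𝕜 : Type u} [Field 𝕜] {A : Type u} [Ring A] [Algebra 𝕜 A]
variable {M : Type u} [AddCommGroup M] [Module 𝕜 M] [Module A M] [Module Aᵐᵒᵖ M]
  [SMulCommClass A Aᵐᵒᵖ M] [IsScalarTower 𝕜 A M] [IsScalarTower 𝕜 Aᵐᵒᵖ M]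
variable {L : Type u} [Ring L] [Algebra 𝕜 L]

theorem wedge₂_btmul (i : A →ₐ[𝕜] L) (j : M →ₗ[𝕜] L) (hl : ∀ a m, j (a • m) = i a * j m)
    (hr : ∀ a m, j (op a • m) = j m * i a) (m n : M) :
    wedge₂ i j hl hr (btmul 𝕜 A m n) = j m * j n := by
  exact (Submodule.liftQ_apply _ _ _).trans (by simp)

theorem smul_btmul (a : A) (m n : M) : a • btmul 𝕜 A m n = btmul 𝕜 A (a • m) n := rfl

theorem op_smul_btmul (a : Aᵐᵒᵖ) (m n : M) : a • btmul 𝕜 A m n = btmul 𝕜 A m (a • n) := rfl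

theorem wedge₂_smul (i : A →ₐ[𝕜] L) (j : M →ₗ[𝕜] L) (hl : ∀ a m, j (a • m) = i a * j m)
    (hr : ∀ a m, j (op a • m) = j m * i a) (a : A) (t : BTensor 𝕜 A M) :
    wedge₂ i j hl hr (a • t) = i a * wedge₂ i j hl hr t := by
  induction t using BTensor.induction with
  | h0 => simp
  | ht m n => rw [smul_btmul, wedge₂_btmul, wedge₂_btmul, hl, mul_assoc]
  | ha s t hs ht => rw [smul_add, map_add, map_add, hs, ht, mul_add]

theorem wedge₂_op_smul (i : A →ₐ[𝕜] L) (j : M →ₗ[𝕜] L) (hl : ∀ a m, j (a • m) = i a * j m)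
    (hr : ∀ a m, j (op a • m) = j m * i a) (a : A) (t : BTensor 𝕜 A M) :
    wedge₂ i j hl hr (op a • t) = wedge₂ i j hl hr t * i a := by
  induction t using BTensor.induction with
  | h0 => simp
  | ht m n => rw [op_smul_btmul, wedge₂_btmul, wedge₂_btmul, hr, mul_assoc]
  | ha s t hs ht => rw [smul_add, map_add, map_add, hs, ht, add_mul]

instance : SMulCommClass A Aᵐᵒᵖ (BTensor 𝕜 A M) where
  smul_comm a b t := by
    induction t using BTensor.induction with
    | h0 => simp
    | ht m n => rfl
    | ha s t hs ht => simp only [smul_add, hs, ht]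

instance : IsScalarTower 𝕜 A (BTensor 𝕜 A M) where
  smul_assoc c a t := by
    induction t using BTensor.induction with
    | h0 => simp
    | ht m n =>
      rw [smul_btmul, smul_btmul, smul_assoc]
      rfl
    | ha s t hs ht => simp only [smul_add, hs, ht]

instance : IsScalarTower 𝕜 Aᵐᵒᵖ (BTensor 𝕜 A M) where
  smul_assoc c a t := by
    induction t using BTensor.induction with
    | h0 => simp
    | ht m n =>
      rw [op_smul_btmul, op_smul_btmul, smul_assoc]
      simp only [btmul, TensorProduct.tmul_smul, map_smul]
    | ha s t hs ht => simp only [smul_add, hs, ht]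

namespace BTensorAlgebra

/-- The algebra map on the tensor algebra determined by an algebra map on `A` and a compatible
linear map on `M`. -/
def lift (i : A →ₐ[𝕜] L) (j : M →ₗ[𝕜] L) (hl : ∀ a m, j (a • m) = i a * j m)
    (hr : ∀ a m, j (op a • m) = j m * i a) : BTensorAlgebra 𝕜 A M →ₐ[𝕜] L :=
  RingQuot.liftAlgHom 𝕜 ⟨FreeAlgebra.lift 𝕜 (Sum.elim i j), by
    intro x y h
    induction h <;> simp [hl, hr]⟩

theorem lift_ι₀ (i : A →ₐ[𝕜] L) (j : M →ₗ[𝕜] L) (hl : ∀ a m, j (a • m) = i a * j m)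
    (hr : ∀ a m, j (op a • m) = j m * i a) (a : A) : lift i j hl hr (ι₀ 𝕜 A M a) = i a :=
  (RingQuot.liftAlgHom_mkAlgHom_apply 𝕜 _ _ _).trans (FreeAlgebra.lift_ι_apply _ _)

theorem lift_ι₁ (i : A →ₐ[𝕜] L) (j : M →ₗ[𝕜] L) (hl : ∀ a m, j (a • m) = i a * j m)
    (hr : ∀ a m, j (op a • m) = j m * i a) (m : M) : lift i j hl hr (ι₁ 𝕜 A M m) = j m :=
  (RingQuot.liftAlgHom_mkAlgHom_apply 𝕜 _ _ _).trans (FreeAlgebra.lift_ι_apply _ _)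

theorem lift_ι₂ (i : A →ₐ[𝕜] L) (j : M →ₗ[𝕜] L) (hl : ∀ a m, j (a • m) = i a * j m)
    (hr : ∀ a m, j (op a • m) = j m * i a) (t : BTensor 𝕜 A M) :
    lift i j hl hr (ι₂ 𝕜 A M t) = wedge₂ i j hl hr t := by
  induction t using BTensor.induction with
  | h0 => simp
  | ht m n => rw [ι₂, wedge₂_btmul, wedge₂_btmul, map_mul, lift_ι₁, lift_ι₁]
  | ha s t hs ht => rw [map_add, map_add, map_add, hs, ht]

theorem proj_surjective : Function.Surjective (proj 𝕜 A M) := RingQuot.mkAlgHom_surjective 𝕜 _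

theorem hom_ext {f g : BTensorAlgebra 𝕜 A M →ₐ[𝕜] L} (h₀ : ∀ a, f (ι₀ 𝕜 A M a) = g (ι₀ 𝕜 A M a))
    (h₁ : ∀ m, f (ι₁ 𝕜 A M m) = g (ι₁ 𝕜 A M m)) : f = g := by
  refine RingQuot.ringQuot_ext' _ _ _ (FreeAlgebra.hom_ext (funext fun z => ?_))
  rcases z with a | m
  · exact h₀ a
  · exact h₁ m

end BTensorAlgebra

namespace ExteriorAlg

variable {σ : BTensor 𝕜 A M →ₗ[A] BTensor 𝕜 A M}

variable (σ) in
/-- The embedding of `A`. -/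
def ι₀ : A →ₐ[𝕜] ExteriorAlg σ := (mk σ).comp (BTensorAlgebra.ι₀ 𝕜 A M)

variable (σ) in
/-- The embedding of `M`. -/
def ι₁ : M →ₗ[𝕜] ExteriorAlg σ := (mk σ).toLinearMap ∘ₗ BTensorAlgebra.ι₁ 𝕜 A M

theorem ι₁_left (a : A) (m : M) : ι₁ σ (a • m) = ι₀ σ a * ι₁ σ m := by
  simp [ι₀, ι₁, BTensorAlgebra.ι₁_left]

theorem ι₁_right (a : A) (m : M) : ι₁ σ (op a • m) = ι₁ σ m * ι₀ σ a := by
  simp [ι₀, ι₁, BTensorAlgebra.ι₁_right]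

theorem wedge₂_eq_mk (t : BTensor 𝕜 A M) :
    wedge₂ (ι₀ σ) (ι₁ σ) ι₁_left ι₁_right t = mk σ (BTensorAlgebra.ι₂ 𝕜 A M t) := by
  induction t using BTensor.induction with
  | h0 => simp
  | ht m n => rw [BTensorAlgebra.ι₂, wedge₂_btmul, wedge₂_btmul, map_mul]; rfl
  | ha s t hs ht => rw [map_add, map_add, map_add, hs, ht]

theorem mk_ι₂_eq_zero {t : BTensor 𝕜 A M} (h : idSub σ t = 0) :
    mk σ (BTensorAlgebra.ι₂ 𝕜 A M t) = 0 :=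
  (RingQuot.mkAlgHom_rel 𝕜 ⟨t, h, rfl, rfl⟩).trans (map_zero (mk σ))

theorem wedge₂_eq_zero {t : BTensor 𝕜 A M} (h : idSub σ t = 0) :
    wedge₂ (ι₀ σ) (ι₁ σ) ι₁_left ι₁_right t = 0 := by
  rw [wedge₂_eq_mk, mk_ι₂_eq_zero h]

/-- The algebra map on the antisymmetrised algebra determined by an algebra map on `A` and a
compatible linear map on `M` whose products vanish on the kernel of `id - σ`. -/
def lift (i : A →ₐ[𝕜] L) (j : M →ₗ[𝕜] L) (hl : ∀ a m, j (a • m) = i a * j m)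
    (hr : ∀ a m, j (op a • m) = j m * i a)
    (hσ : ∀ t, idSub σ t = 0 → wedge₂ i j hl hr t = 0) : ExteriorAlg σ →ₐ[𝕜] L :=
  RingQuot.liftAlgHom 𝕜 ⟨BTensorAlgebra.lift i j hl hr, by
    rintro _ _ ⟨t, ht, rfl, rfl⟩
    rw [BTensorAlgebra.lift_ι₂, hσ t ht, map_zero]⟩

theorem lift_mk (i : A →ₐ[𝕜] L) (j : M →ₗ[𝕜] L) (hl : ∀ a m, j (a • m) = i a * j m)
    (hr : ∀ a m, j (op a • m) = j m * i a)
    (hσ : ∀ t, idSub σ t = 0 → wedge₂ i j hl hr t = 0) (z : BTensorAlgebra 𝕜 A M) :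
    lift i j hl hr hσ (mk σ z) = BTensorAlgebra.lift i j hl hr z :=
  RingQuot.liftAlgHom_mkAlgHom_apply 𝕜 _ _ _

theorem lift_ι₀ (i : A →ₐ[𝕜] L) (j : M →ₗ[𝕜] L) (hl : ∀ a m, j (a • m) = i a * j m)
    (hr : ∀ a m, j (op a • m) = j m * i a)
    (hσ : ∀ t, idSub σ t = 0 → wedge₂ i j hl hr t = 0) (a : A) :
    lift i j hl hr hσ (ι₀ σ a) = i a :=
  (lift_mk ..).trans (BTensorAlgebra.lift_ι₀ ..)

theorem lift_ι₁ (i : A →ₐ[𝕜] L) (j : M →ₗ[𝕜] L) (hl : ∀ a m, j (a • m) = i a * j m)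
    (hr : ∀ a m, j (op a • m) = j m * i a)
    (hσ : ∀ t, idSub σ t = 0 → wedge₂ i j hl hr t = 0) (m : M) :
    lift i j hl hr hσ (ι₁ σ m) = j m :=
  (lift_mk ..).trans (BTensorAlgebra.lift_ι₁ ..)

theorem hom_ext {f g : ExteriorAlg σ →ₐ[𝕜] L} (h₀ : ∀ a, f (ι₀ σ a) = g (ι₀ σ a))
    (h₁ : ∀ m, f (ι₁ σ m) = g (ι₁ σ m)) : f = g :=
  RingQuot.ringQuot_ext' _ _ _ (BTensorAlgebra.hom_ext (f := f.comp (mk σ))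
    (g := g.comp (mk σ)) h₀ h₁)

theorem mk_surjective : Function.Surjective (mk σ) := RingQuot.mkAlgHom_surjective 𝕜 _

/-- A subspace which contains `1` and is stable under left multiplication by generators is
everything. -/
theorem eq_top_of_mul_mem {S : Submodule 𝕜 (ExteriorAlg σ)} (h1 : 1 ∈ S)
    (h₀ : ∀ a, ∀ z ∈ S, ι₀ σ a * z ∈ S) (h₁ : ∀ m, ∀ z ∈ S, ι₁ σ m * z ∈ S) : S = ⊤ := by
  let T : Subalgebra 𝕜 (ExteriorAlg σ) :=
    { carrier := {w | ∀ z ∈ S, w * z ∈ S}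
      mul_mem' := fun {a b} ha hb z hz => by rw [mul_assoc]; exact ha _ (hb _ hz)
      add_mem' := fun {a b} ha hb z hz => by rw [add_mul]; exact S.add_mem (ha _ hz) (hb _ hz)
      algebraMap_mem' := fun r z hz => by
        rw [← Algebra.smul_def]; exact S.smul_mem _ hz }
  have hT : ∀ w, w ∈ T := by
    intro w
    obtain ⟨w, rfl⟩ := mk_surjective w
    obtain ⟨w, rfl⟩ := BTensorAlgebra.proj_surjective w
    induction w using FreeAlgebra.induction with
    | grade0 r => rw [AlgHom.commutes, AlgHom.commutes]; exact T.algebraMap_mem r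
    | grade1 z =>
      rcases z with a | m
      · exact h₀ a
      · exact h₁ m
    | mul a b ha hb => rw [map_mul, map_mul]; exact T.mul_mem ha hb
    | add a b ha hb => rw [map_add, map_add]; exact T.add_mem ha hb
  refine eq_top_iff.2 fun w _ => ?_
  rw [← mul_one w]
  exact hT w 1 h1

end ExteriorAlg

end TensorAlgebra

/-! ### The antisymmetrised algebra: low degrees, grading, inner differentials. -/

section Calculus

open Polynomial

variable {𝕜 : Type u} [Field 𝕜] {A : Type u} [Ring A] [Algebra 𝕜 A]
variable {M : Type u} [AddCommGroup M] [Module 𝕜 M] [Module A M] [Module Aᵐᵒᵖ M]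
  [SMulCommClass A Aᵐᵒᵖ M] [IsScalarTower 𝕜 A M] [IsScalarTower 𝕜 Aᵐᵒᵖ M]

/-- The map `m ⊗ · : M → M ⊗_A M`. -/
def btmulLeft (m : M) : M →ₗ[𝕜] BTensor 𝕜 A M where
  toFun := btmul 𝕜 A m
  map_add' := btmul_add_right 𝕜 A M m
  map_smul' c n := by simp [btmul]

section Representation

variable (π : BTensor 𝕜 A M →ₗ[A] BTensor 𝕜 A M)

/-- The action of `A` on `A × M × (M ⊗_A M)`. -/
def truncLeft : A →ₐ[𝕜] Module.End 𝕜 (A × M × BTensor 𝕜 A M) := Algebra.lsmul 𝕜 𝕜 _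

/-- The action of `M` on `A × M × (M ⊗_A M)`, with products in degree two twisted by `π`. -/
def truncMul : M →ₗ[𝕜] Module.End 𝕜 (A × M × BTensor 𝕜 A M) where
  toFun m :=
    { toFun := fun x => (0, op x.1 • m, π (btmul 𝕜 A m x.2.1))
      map_add' := fun x y => by
        simp [add_smul, btmul_add_right]
      map_smul' := fun c x => by
        have : btmul 𝕜 A m (c • x.2.1) = c • btmul 𝕜 A m x.2.1 := (btmulLeft (A := A) m).map_smul c _
        simp only [Prod.smul_fst, Prod.smul_snd, RingHom.id_apply, op_smul, smul_assoc, this,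
          Prod.smul_mk, smul_zero]
        rw [← algebraMap_smul A c (btmul 𝕜 A m x.2.1), map_smul, algebraMap_smul] }
  map_add' m n := by
    ext x <;> simp [btmul_add_left]
  map_smul' c m := by
    have h : ∀ n : M, btmul 𝕜 A (c • m) n = algebraMap 𝕜 A c • btmul 𝕜 A m n := fun n => by
      rw [smul_btmul, algebraMap_smul]
    refine LinearMap.ext fun x => Prod.ext ?_ (Prod.ext ?_ ?_)
    · simp
    · exact smul_comm (op x.1) c m
    · simp only [h, algebraMap_smul]
      simp

/-- The representation of the tensor algebra on `A × M × (M ⊗_A M)`. -/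
def truncRep : BTensorAlgebra 𝕜 A M →ₐ[𝕜] Module.End 𝕜 (A × M × BTensor 𝕜 A M) :=
  BTensorAlgebra.lift truncLeft (truncMul π)
    (fun a m => by
      refine LinearMap.ext fun x => Prod.ext ?_ (Prod.ext ?_ ?_)
      · simp [truncLeft, truncMul]
      · exact (smul_comm a (op x.1) m).symm
      · simp [truncLeft, truncMul, ← smul_btmul])
    (fun a m => by
      refine LinearMap.ext fun x => Prod.ext ?_ (Prod.ext ?_ ?_)
      · simp [truncLeft, truncMul]
      · exact (mul_smul (op x.1) (op a) m).symm
      · simp [truncLeft, truncMul, btmul_balanced])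

theorem truncRep_ι₀ (a : A) (x : A × M × BTensor 𝕜 A M) :
    truncRep π (BTensorAlgebra.ι₀ 𝕜 A M a) x = a • x := by
  rw [truncRep, BTensorAlgebra.lift_ι₀]; rfl

theorem truncRep_ι₁ (m : M) (x : A × M × BTensor 𝕜 A M) :
    truncRep π (BTensorAlgebra.ι₁ 𝕜 A M m) x = (0, op x.1 • m, π (btmul 𝕜 A m x.2.1)) := by
  rw [truncRep, BTensorAlgebra.lift_ι₁]; rfl

theorem truncRep_ι₂ (t : BTensor 𝕜 A M) (x : A × M × BTensor 𝕜 A M) :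
    truncRep π (BTensorAlgebra.ι₂ 𝕜 A M t) x = (0, 0, π (op x.1 • t)) := by
  induction t using BTensor.induction with
  | h0 => simp; rfl
  | ht m n =>
    rw [BTensorAlgebra.ι₂, wedge₂_btmul, map_mul, Module.End.mul_apply, truncRep_ι₁, truncRep_ι₁]
    simp [op_smul_btmul]
  | ha s t hs ht => simp [map_add, hs, ht]

end Representation

/-- Acting on (1, 0, 0) recovers the tensor. Consequently every identity in M ⊗_A M can be proved by
multiplying elements of a ring, which is how all later tensor identities are obtained. -/
theorem BTensorAlgebra.ι₂_injective : Function.Injective (BTensorAlgebra.ι₂ 𝕜 A M) := by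
  refine (injective_iff_map_eq_zero _).2 fun t ht => ?_
  have := truncRep_ι₂ LinearMap.id t ((1 : A), (0 : M), (0 : BTensor 𝕜 A M))
  rw [ht, map_zero] at this
  simpa using (congrArg (fun x => x.2.2) this).symm

namespace ExteriorAlg

variable {σ : BTensor 𝕜 A M →ₗ[A] BTensor 𝕜 A M}

/-- The representation of the antisymmetrised algebra on `A × M × (M ⊗_A M)`. -/
def rep (hσ : ∀ (a : A) (t : BTensor 𝕜 A M), σ (op a • t) = op a • σ t) :
    ExteriorAlg σ →ₐ[𝕜] Module.End 𝕜 (A × M × BTensor 𝕜 A M) :=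
  RingQuot.liftAlgHom 𝕜 ⟨truncRep (idSub σ), by
    rintro _ _ ⟨t, ht, rfl, rfl⟩
    refine LinearMap.ext fun x => ?_
    -- With degree two twisted by id - σ, the tensor t acts by t ↦ (id - σ)(t a). Right linearity of
    -- σ makes this vanish for t in the kernel, so the representation descends.
    have : idSub σ (op x.1 • t) = op x.1 • idSub σ t := by simp [hσ, smul_sub]
    rw [truncRep_ι₂, this, ht]
    simp⟩

theorem rep_mk (hσ : ∀ (a : A) (t : BTensor 𝕜 A M), σ (op a • t) = op a • σ t)
    (z : BTensorAlgebra 𝕜 A M) : rep hσ (mk σ z) = truncRep (idSub σ) z :=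
  RingQuot.liftAlgHom_mkAlgHom_apply 𝕜 _ _ _

theorem ι₀_injective (hσ : ∀ (a : A) (t : BTensor 𝕜 A M), σ (op a • t) = op a • σ t) :
    Function.Injective (ι₀ σ) := by
  refine (injective_iff_map_eq_zero _).2 fun a ha => ?_
  have := truncRep_ι₀ (idSub σ) a ((1 : A), (0 : M), (0 : BTensor 𝕜 A M))
  rw [← rep_mk hσ, show mk σ (BTensorAlgebra.ι₀ 𝕜 A M a) = 0 from ha, map_zero] at this
  simpa using (congrArg (fun x => x.1) this).symm

theorem ι₁_injective (hσ : ∀ (a : A) (t : BTensor 𝕜 A M), σ (op a • t) = op a • σ t) :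
    Function.Injective (ι₁ σ) := by
  refine (injective_iff_map_eq_zero _).2 fun m hm => ?_
  have := truncRep_ι₁ (idSub σ) m ((1 : A), (0 : M), (0 : BTensor 𝕜 A M))
  rw [← rep_mk hσ, show mk σ (BTensorAlgebra.ι₁ 𝕜 A M m) = 0 from hm, map_zero] at this
  simpa using (congrArg (fun x => x.2.1) this).symm

/-- The two-sided ideal meets degree two in ker(id - σ) and nothing more: the descended
representation maps the class of t, applied to (1, 0, 0), to (id - σ) t. -/
theorem wedge₂_eq_zero_iff (hσ : ∀ (a : A) (t : BTensor 𝕜 A M), σ (op a • t) = op a • σ t)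
    {t : BTensor 𝕜 A M} :
    wedge₂ (ι₀ σ) (ι₁ σ) ι₁_left ι₁_right t = 0 ↔ idSub σ t = 0 := by
  refine ⟨fun h => ?_, wedge₂_eq_zero⟩
  rw [wedge₂_eq_mk] at h
  have := truncRep_ι₂ (idSub σ) t ((1 : A), (0 : M), (0 : BTensor 𝕜 A M))
  rw [← rep_mk hσ, h, map_zero] at this
  simpa using (congrArg (fun x => x.2.2) this).symm

/-! ### The grading -/

variable (σ) in
/-- The algebra map `z ↦ ∑ z_n X^n` recording homogeneous components. -/
def components : ExteriorAlg σ →ₐ[𝕜] (ExteriorAlg σ)[X] :=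
  lift (Polynomial.CAlgHom.comp (ι₀ σ)) ((monomial 1).restrictScalars 𝕜 ∘ₗ ι₁ σ)
    (fun a m => by simp [ι₁_left, C_mul_monomial])
    (fun a m => by simp [ι₁_right, monomial_mul_C])
    (fun t ht => by
      have key : ∀ t : BTensor 𝕜 A M, wedge₂ (L := (ExteriorAlg σ)[X])
          (Polynomial.CAlgHom.comp (ι₀ σ)) ((monomial 1).restrictScalars 𝕜 ∘ₗ ι₁ σ)
          (fun a m => by simp [ι₁_left, C_mul_monomial])
          (fun a m => by simp [ι₁_right, monomial_mul_C]) t =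
          monomial 2 (wedge₂ (ι₀ σ) (ι₁ σ) ι₁_left ι₁_right t) := by
        intro t
        induction t using BTensor.induction with
        | h0 => simp
        | ht m n => rw [wedge₂_btmul, wedge₂_btmul]; simp [monomial_mul_monomial]
        | ha s t hs ht => rw [map_add, map_add, map_add, hs, ht]
      rw [key, wedge₂_eq_zero ht, map_zero])

theorem components_ι₀ (a : A) : components σ (ι₀ σ a) = C (ι₀ σ a) := lift_ι₀ ..

theorem components_ι₁ (m : M) : components σ (ι₁ σ m) = monomial 1 (ι₁ σ m) := lift_ι₁ ..

variable (σ) in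
/-- The homogeneous component of degree `n`. -/
def deg (n : ℕ) : Submodule 𝕜 (ExteriorAlg σ) where
  carrier := {z | components σ z = monomial n z}
  add_mem' {a b} ha hb := by
    rw [Set.mem_ofPred_eq, map_add, map_add, ha, hb]
  zero_mem' := by simp
  smul_mem' c z hz := by
    rw [Set.mem_ofPred_eq, map_smul, hz, smul_monomial]

theorem mem_deg {n : ℕ} {z : ExteriorAlg σ} : z ∈ deg σ n ↔ components σ z = monomial n z :=
  Iff.rfl

theorem ι₀_mem (a : A) : ι₀ σ a ∈ deg σ 0 := components_ι₀ a

theorem ι₁_mem (m : M) : ι₁ σ m ∈ deg σ 1 := components_ι₁ m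

instance : SetLike.GradedMonoid (deg σ) where
  one_mem := by rw [mem_deg, map_one]; rfl
  mul_mem m n a b ha hb := by
    rw [mem_deg] at *
    rw [map_mul, ha, hb, monomial_mul_monomial]

/-- Products with generators shift the coefficients in a controlled way, so the four claims pass
through an induction together; the claim about degree one needs the one about degree zero. -/
theorem coeff_mem (z : ExteriorAlg σ) : (∀ n, (components σ z).coeff n ∈ deg σ n) ∧
    (components σ z).coeff 0 ∈ LinearMap.range (ι₀ σ).toLinearMap ∧
    (components σ z).coeff 1 ∈ LinearMap.range (ι₁ σ) ∧ (components σ z).eval 1 = z := by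
  let S : Submodule 𝕜 (ExteriorAlg σ) :=
    { carrier := {z | (∀ n, (components σ z).coeff n ∈ deg σ n) ∧
        (components σ z).coeff 0 ∈ LinearMap.range (ι₀ σ).toLinearMap ∧
        (components σ z).coeff 1 ∈ LinearMap.range (ι₁ σ) ∧ (components σ z).eval 1 = z}
      zero_mem' := by
        simp only [Set.mem_ofPred_eq, map_zero, coeff_zero, eval_zero, zero_mem, implies_true,
          and_self]
      add_mem' := fun {a b} ha hb => by
        simp only [Set.mem_ofPred_eq, map_add, coeff_add, eval_add]
        exact ⟨fun n => add_mem (ha.1 n) (hb.1 n), add_mem ha.2.1 hb.2.1,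
          add_mem ha.2.2.1 hb.2.2.1, by rw [ha.2.2.2, hb.2.2.2]⟩
      smul_mem' := fun c z hz => by
        simp only [Set.mem_ofPred_eq, map_smul, coeff_smul, eval_smul]
        exact ⟨fun n => Submodule.smul_mem _ _ (hz.1 n), Submodule.smul_mem _ _ hz.2.1,
          Submodule.smul_mem _ _ hz.2.2.1, by rw [hz.2.2.2]⟩ }
  have hS : S = ⊤ := by
    refine eq_top_of_mul_mem ?_ ?_ ?_
    · refine ⟨fun n => ?_, ⟨1, ?_⟩, ⟨0, ?_⟩, ?_⟩
      · rw [map_one, coeff_one]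
        split_ifs with h
        · subst h; exact SetLike.GradedOne.one_mem
        · exact zero_mem _
      · simp
      · simp [coeff_one]
      · simp
    · rintro a z ⟨h1, ⟨b, hb⟩, ⟨m, hm⟩, h4⟩
      simp only [S, Submodule.mem_mk, AddSubmonoid.mem_mk, AddSubsemigroup.mem_mk,
        Set.mem_ofPred_eq, map_mul, components_ι₀, coeff_C_mul, eval_C_mul]
      refine ⟨fun n => ?_, ⟨a * b, ?_⟩, ⟨a • m, ?_⟩, by rw [h4]⟩
      · have := SetLike.GradedMul.mul_mem (ι₀_mem a) (h1 n)
        rwa [zero_add] at this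
      · rw [← hb]; simp
      · rw [← hm, ι₁_left]
    · rintro m z ⟨h1, ⟨b, hb⟩, -, h4⟩
      simp only [S, Submodule.mem_mk, AddSubmonoid.mem_mk, AddSubsemigroup.mem_mk,
        Set.mem_ofPred_eq, map_mul, components_ι₁]
      rw [← C_mul_X_eq_monomial, mul_assoc, X_mul, ← mul_assoc]
      refine ⟨fun n => ?_, ⟨0, ?_⟩, ⟨op b • m, ?_⟩, ?_⟩
      · cases n with
        | zero => rw [coeff_mul_X_zero]; exact zero_mem _
        | succ n =>
          rw [coeff_mul_X, coeff_C_mul, add_comm]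
          exact SetLike.GradedMul.mul_mem (ι₁_mem m) (h1 n)
      · rw [coeff_mul_X_zero, map_zero]
      · rw [coeff_mul_X, coeff_C_mul, ← hb, ι₁_right]; rfl
      · rw [eval_mul_X, eval_C_mul, h4, mul_one]
  exact (hS ▸ Submodule.mem_top : z ∈ S)

theorem range_ι₀ : LinearMap.range (ι₀ σ).toLinearMap = deg σ 0 := by
  refine le_antisymm ?_ fun z hz => ?_
  · rintro _ ⟨a, rfl⟩; exact ι₀_mem a
  · have := (coeff_mem z).2.1
    rwa [mem_deg.1 hz, coeff_monomial_same] at this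

theorem range_ι₁ : LinearMap.range (ι₁ σ) = deg σ 1 := by
  refine le_antisymm ?_ fun z hz => ?_
  · rintro _ ⟨a, rfl⟩; exact ι₁_mem a
  · have := (coeff_mem z).2.2.1
    rwa [mem_deg.1 hz, coeff_monomial_same] at this

theorem isInternal_deg : DirectSum.IsInternal (deg σ) := by
  have key : ∀ (x : DirectSum ℕ fun n => deg σ n) (n : ℕ),
      (components σ (DirectSum.coeAddMonoidHom (deg σ) x)).coeff n = x n := by
    intro x n
    induction x using DirectSum.induction_on with
    | zero => simp
    | of i z =>
      rw [DirectSum.coeAddMonoidHom_of, mem_deg.1 z.2, coeff_monomial, DirectSum.coe_of_apply]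
      split_ifs <;> rfl
    | add x y hx hy => rw [map_add, map_add, coeff_add, hx, hy]; simp
  refine ⟨fun x y hxy => ?_, fun z => ?_⟩
  · refine DFinsupp.ext fun n => Subtype.ext ?_
    exact (key x n).symm.trans ((by rw [hxy]) : _ = _) |>.trans (key y n)
  · obtain ⟨h1, -, -, h4⟩ := coeff_mem z
    refine ⟨∑ n ∈ (components σ z).support, DirectSum.of (fun n => deg σ n) n ⟨_, h1 n⟩, ?_⟩
    rw [map_sum]
    simp only [DirectSum.coeAddMonoidHom_of]
    conv_rhs => rw [← h4, eval_eq_sum, Polynomial.sum]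
    simp

/-! ### Inner differentials -/

theorem wedge₂_neg {L : Type u} [Ring L] [Algebra 𝕜 L] (i : A →ₐ[𝕜] L) (j : M →ₗ[𝕜] L)
    (hl : ∀ a m, j (a • m) = i a * j m) (hr : ∀ a m, j (op a • m) = j m * i a)
    (hl' : ∀ a m, (-j) (a • m) = i a * (-j) m) (hr' : ∀ a m, (-j) (op a • m) = (-j) m * i a)
    (t : BTensor 𝕜 A M) : wedge₂ i (-j) hl' hr' t = wedge₂ i j hl hr t := by
  induction t using BTensor.induction with
  | h0 => simp
  | ht m n => rw [wedge₂_btmul, wedge₂_btmul]; simp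
  | ha s t hs ht => rw [map_add, map_add, hs, ht]

variable (σ) in
/-- The parity automorphism. -/
def parity : ExteriorAlg σ →ₐ[𝕜] ExteriorAlg σ :=
  lift (ι₀ σ) (-ι₁ σ) (fun a m => by simp [ι₁_left]) (fun a m => by simp [ι₁_right])
    (fun t ht => by rw [wedge₂_neg _ _ ι₁_left ι₁_right, wedge₂_eq_zero ht])

theorem parity_ι₀ (a : A) : parity σ (ι₀ σ a) = ι₀ σ a := lift_ι₀ ..

theorem parity_ι₁ (m : M) : parity σ (ι₁ σ m) = - ι₁ σ m := lift_ι₁ ..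

theorem parity_parity (z : ExteriorAlg σ) : parity σ (parity σ z) = z := by
  have : (parity σ).comp (parity σ) = AlgHom.id 𝕜 _ :=
    hom_ext (fun a => by simp [parity_ι₀]) (fun m => by simp [parity_ι₁])
  exact DFunLike.congr_fun this z

/-- Links the algebraic sign automorphism to the grading: substituting X = -1 puts the sign (-1)^n
on degree n. -/
theorem parity_eq_eval (z : ExteriorAlg σ) : parity σ z = (components σ z).eval (-1) := by
  let S : Submodule 𝕜 (ExteriorAlg σ) :=
    { carrier := {z | parity σ z = (components σ z).eval (-1)}
      zero_mem' := by simp only [Set.mem_ofPred_eq, map_zero, eval_zero]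
      add_mem' := fun {a b} ha hb => by
        simp only [Set.mem_ofPred_eq, map_add, eval_add] at *
        rw [ha, hb]
      smul_mem' := fun c z hz => by
        simp only [Set.mem_ofPred_eq, map_smul, eval_smul] at *
        rw [hz] }
  have hS : S = ⊤ := by
    refine eq_top_of_mul_mem ?_ ?_ ?_
    · change parity σ 1 = _
      simp
    · intro a z (hz : parity σ z = _)
      change parity σ _ = _
      rw [map_mul, map_mul, parity_ι₀, components_ι₀, eval_C_mul, hz]
    · intro m z (hz : parity σ z = _)
      change parity σ _ = _
      rw [map_mul, map_mul, parity_ι₁, components_ι₁, ← C_mul_X_eq_monomial, mul_assoc, X_mul,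
        ← mul_assoc, eval_mul_X, eval_C_mul, hz]
      simp
  exact (hS ▸ Submodule.mem_top : z ∈ S)

theorem parity_of_mem {n : ℕ} {z : ExteriorAlg σ} (hz : z ∈ deg σ n) :
    parity σ z = (-1 : 𝕜) ^ n • z := by
  rw [parity_eq_eval, mem_deg.1 hz, eval_monomial]
  rcases n.even_or_odd with h | h <;> simp [h.neg_one_pow]

variable (σ) in
/-- The inner derivation `z ↦ w z - (-1)^{|z|} z w`. -/
def innerD (w : M) : ExteriorAlg σ →ₗ[𝕜] ExteriorAlg σ :=
  LinearMap.mulLeft 𝕜 (ι₁ σ w) - LinearMap.mulRight 𝕜 (ι₁ σ w) ∘ₗ (parity σ).toLinearMap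

theorem innerD_apply (w : M) (z : ExteriorAlg σ) :
    innerD σ w z = ι₁ σ w * z - parity σ z * ι₁ σ w := rfl

variable (σ) in
/-- The calculus with an inner differential on the antisymmetrised algebra. -/
def calculus {δ : A →ₗ[𝕜] M} (hσ : ∀ (a : A) (t : BTensor 𝕜 A M), σ (op a • t) = op a • σ t)
    (w : M) (hδ : ∀ a, δ a = op a • w - a • w)
    (hw : ∀ z, ι₁ σ w * ι₁ σ w * z = z * (ι₁ σ w * ι₁ σ w)) :
    HigherCalculus δ (ExteriorAlg σ) where
  deg := deg σ
  graded := inferInstance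
  internal := isInternal_deg
  i₀ := ι₀ σ
  i₀_injective := ι₀_injective hσ
  range_i₀ := range_ι₀
  i₁ := ι₁ σ
  i₁_injective := ι₁_injective hσ
  range_i₁ := range_ι₁
  i₁_left := ι₁_left
  i₁_right := ι₁_right
  d := innerD σ w
  d_deg n a ha := by
    rw [innerD_apply, parity_of_mem ha]
    refine sub_mem ?_ ?_
    · rw [add_comm]; exact SetLike.GradedMul.mul_mem (ι₁_mem w) ha
    · exact SetLike.GradedMul.mul_mem (Submodule.smul_mem _ _ ha) (ι₁_mem w)
  d_extends a := by
    rw [innerD_apply, parity_ι₀, hδ, map_sub, ι₁_left, ι₁_right]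
  leibniz n a ha b := by
    rw [innerD_apply, innerD_apply, innerD_apply, ← smul_mul_assoc, map_mul, parity_of_mem ha]
    noncomm_ring
  -- The mixed terms cancel and leave w²a - aw², which vanishes by the centrality of w².
  d_d a := by
    simp only [innerD_apply, map_sub, map_mul, parity_ι₁, parity_parity]
    have := hw a
    rw [mul_assoc] at this
    noncomm_ring
    rw [this]
    abel

/-- The kernel of the wedge product of an inner calculus. -/
theorem calculus_wedge_eq_zero_iff {δ : A →ₗ[𝕜] M}
    (hσ : ∀ (a : A) (t : BTensor 𝕜 A M), σ (op a • t) = op a • σ t)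
    (w : M) (hδ : ∀ a, δ a = op a • w - a • w)
    (hw : ∀ z, ι₁ σ w * ι₁ σ w * z = z * (ι₁ σ w * ι₁ σ w)) (t : BTensor 𝕜 A M) :
    (calculus σ hσ w hδ hw).wedge t = 0 ↔ idSub σ t = 0 :=
  wedge₂_eq_zero_iff hσ

end ExteriorAlg

end Calculus

/-! ### Universality of an inner calculus. -/

section Universality

variable {𝕜 : Type u} [Field 𝕜] {A : Type u} [Ring A] [Algebra 𝕜 A]
variable {M : Type u} [AddCommGroup M] [Module 𝕜 M] [Module A M] [Module Aᵐᵒᵖ M]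
  [SMulCommClass A Aᵐᵒᵖ M] [IsScalarTower 𝕜 A M] [IsScalarTower 𝕜 Aᵐᵒᵖ M]

/-- An inner calculus is universal if the kernel of `id - σ` vanishes in every calculus. -/
theorem ExteriorAlg.calculus_isUniversal {σ : BTensor 𝕜 A M →ₗ[A] BTensor 𝕜 A M} {δ : A →ₗ[𝕜] M}
    (hσ : ∀ (a : A) (t : BTensor 𝕜 A M), σ (op a • t) = op a • σ t)
    (w : M) (hδ : ∀ a, δ a = op a • w - a • w)
    (hw : ∀ z, ι₁ σ w * ι₁ σ w * z = z * (ι₁ σ w * ι₁ σ w))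
    (hspan : Submodule.span A (Set.range δ) = ⊤)
    (hker : ∀ (L : Type u) [Ring L] [Algebra 𝕜 L] (S : HigherCalculus δ L) (t : BTensor 𝕜 A M),
      idSub σ t = 0 → S.wedge t = 0) :
    (calculus σ hσ w hδ hw).IsUniversal := by
  intro L' _ _ S
  let φ : ExteriorAlg σ →ₐ[𝕜] L' := lift S.i₀ S.i₁ S.i₁_left S.i₁_right (hker L' S)
  have hφ₀ : ∀ a, φ (ι₀ σ a) = S.i₀ a := fun a => lift_ι₀ ..
  have hφ₁ : ∀ m, φ (ι₁ σ m) = S.i₁ m := fun m => lift_ι₁ ..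
  set U := calculus σ hσ w hδ hw with hU
  refine ⟨φ, ⟨hφ₀, hφ₁, ?_⟩, fun ψ hψ => hom_ext (fun a => (hψ.1 a).trans (hφ₀ a).symm)
    (fun m => (hψ.2.1 m).trans (hφ₁ m).symm)⟩
  -- The locus where φ commutes with the differentials contains 1 and is stable under left
  -- multiplication by A and by exact one-forms. Since exact forms generate M as a left module, it
  -- is everything.
  let T : Submodule 𝕜 (ExteriorAlg σ) := LinearMap.eqLocus (φ.toLinearMap ∘ₗ U.d)
    (S.d ∘ₗ φ.toLinearMap)
  have hT : ∀ {z}, z ∈ T ↔ φ (U.d z) = S.d (φ z) := Iff.rfl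
  have h₀ : ∀ a, ∀ z ∈ T, ι₀ σ a * z ∈ T := by
    intro a z hz
    rw [hT] at *
    have e1 := U.leibniz 0 (ι₀ σ a) (ι₀_mem a) z
    have e2 := S.leibniz 0 (S.i₀ a) (S.range_i₀ ▸ ⟨a, rfl⟩) (φ z)
    have e3 : U.d (ι₀ σ a) = ι₁ σ (δ a) := U.d_extends a
    rw [e1, e3, map_mul, hφ₀, e2, S.d_extends]
    simp only [map_add, map_mul, pow_zero, one_smul, hφ₀, hφ₁, hz]
  have htop : T = ⊤ := by
    refine eq_top_of_mul_mem ?_ h₀ fun m => ?_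
    · have h1 : δ 1 = 0 := by rw [hδ]; simp
      have e3 : U.d (ι₀ σ 1) = ι₁ σ (δ 1) := U.d_extends 1
      rw [hT, ← map_one (ι₀ σ), hφ₀, S.d_extends, e3, h1]
      simp
    · have hm : m ∈ Submodule.span A (Set.range δ) := hspan ▸ Submodule.mem_top
      induction hm using Submodule.span_induction with
      | mem x hx =>
        obtain ⟨b, rfl⟩ := hx
        intro z hz
        rw [hT] at *
        have e1 := U.leibniz 1 (ι₁ σ (δ b)) (ι₁_mem _) z
        have e2 := S.leibniz 1 (S.i₁ (δ b)) (S.range_i₁ ▸ ⟨_, rfl⟩) (φ z)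
        have e3 : U.d (ι₁ σ (δ b)) = 0 := by
          have : U.d (ι₀ σ b) = ι₁ σ (δ b) := U.d_extends b
          rw [← this, U.d_d]
        rw [e1, e3, map_mul, hφ₁, e2, ← S.d_extends, S.d_d]
        simp only [S.d_extends, zero_mul, zero_add, map_smul, map_mul, hφ₁, hz]
      | zero => intro z hz; rw [map_zero, zero_mul]; exact zero_mem _
      | add x y _ _ hx hy =>
        intro z hz; rw [map_add, add_mul]; exact add_mem (hx z hz) (hy z hz)
      | smul a x _ hx => intro z hz; rw [ι₁_left, mul_assoc]; exact h₀ _ _ (hx z hz)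
  intro z
  exact hT.1 (htop ▸ Submodule.mem_top)

end Universality

/-! ### Universal property of the quantum sphere. -/

section SphereAPI

variable {𝕜 : Type u} [RCLike 𝕜] {N : ℕ} {q : ℝ} {B : Type u} [Ring B] [Algebra 𝕜 B]

/-- The algebra map on the sphere determined by elements satisfying the defining relations. -/
def Sphere.lift (y : Fin N → B)
    (h1 : ∀ i j, act (RinvS 𝕜 q) (fun k l => y k * y l) i j = (q : 𝕜)⁻¹ • (y i * y j) +
      (((q ^ (N - 1) - q ^ (N - 3)) / (1 + q ^ (N - 2)) : ℝ) : 𝕜) • metricS 𝕜 q i j • (1 : B))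
    (h2 : tr (metricS 𝕜 q) (fun k l => y k * y l) = 1) : Sphere 𝕜 N q →ₐ[𝕜] B :=
  RingQuot.liftAlgHom 𝕜 ⟨FreeAlgebra.lift 𝕜 y, by
    intro a b h
    induction h with
    | comm i j =>
      have e := h1 i j
      rw [← h2] at e
      simp only [map_sum, map_smul, map_add, map_mul, FreeAlgebra.lift_ι_apply, Kmat]
      simp only [act, tr, RinvS, metricS, Finset.smul_sum, smul_smul] at e
      simp only [Finset.smul_sum, smul_smul]
      rw [e]
      simp only [RCLike.ofReal_inv, mul_comm (RCLike.ofReal (metric q i j))]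
    | norm =>
      simp only [map_sum, map_smul, map_mul, FreeAlgebra.lift_ι_apply, map_one]
      exact h2⟩

theorem Sphere.lift_coord (y : Fin N → B)
    (h1 : ∀ i j, act (RinvS 𝕜 q) (fun k l => y k * y l) i j = (q : 𝕜)⁻¹ • (y i * y j) +
      (((q ^ (N - 1) - q ^ (N - 3)) / (1 + q ^ (N - 2)) : ℝ) : 𝕜) • metricS 𝕜 q i j • (1 : B))
    (h2 : tr (metricS 𝕜 q) (fun k l => y k * y l) = 1) (i : Fin N) :
    Sphere.lift y h1 h2 (coord 𝕜 q i) = y i :=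
  (RingQuot.liftAlgHom_mkAlgHom_apply 𝕜 _ _ _).trans (FreeAlgebra.lift_ι_apply _ _)

theorem coord_norm : tr (metricS 𝕜 q) (fun k l : Fin N => coord 𝕜 q k * coord 𝕜 q l) = 1 := by
  have := RingQuot.mkAlgHom_rel 𝕜 (SphereRel.norm (𝕜 := 𝕜) (N := N) (q := q))
  simp only [map_sum, map_smul, map_mul, map_one] at this
  exact this

theorem coord_comm (i j : Fin N) :
    act (RinvS 𝕜 q) (fun k l => coord 𝕜 q k * coord 𝕜 q l) i j =
      (q : 𝕜)⁻¹ • (coord 𝕜 q i * coord 𝕜 q j) +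
      (((q ^ (N - 1) - q ^ (N - 3)) / (1 + q ^ (N - 2)) : ℝ) : 𝕜) • metricS 𝕜 q i j •
        (1 : Sphere 𝕜 N q) := by
  have e := RingQuot.mkAlgHom_rel 𝕜 (SphereRel.comm (𝕜 := 𝕜) (q := q) i j)
  simp only [map_sum, map_smul, map_mul, map_add] at e
  refine Eq.trans e ?_
  rw [← coord_norm]
  simp only [tr, metricS, Kmat, Finset.smul_sum, smul_smul]
  simp only [RCLike.ofReal_inv, RCLike.ofReal_mul, mul_comm (RCLike.ofReal (metric q i j))]
  rfl

theorem Sphere.induction {p : Sphere 𝕜 N q → Prop} (h1 : ∀ c : 𝕜, p (algebraMap 𝕜 _ c))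
    (hx : ∀ i, p (coord 𝕜 q i)) (ha : ∀ a b, p a → p b → p (a + b))
    (hm : ∀ a b, p a → p b → p (a * b)) (a : Sphere 𝕜 N q) : p a := by
  obtain ⟨a, rfl⟩ := RingQuot.mkAlgHom_surjective 𝕜 (SphereRel 𝕜 N q) a
  induction a using FreeAlgebra.induction with
  | grade0 r => rw [AlgHom.commutes]; exact h1 r
  | grade1 i => exact hx i
  | mul a b ha hb => rw [map_mul]; exact hm _ _ ha hb
  | add a b h h' => rw [map_add]; exact ha _ _ h h'

theorem Sphere.hom_ext {f g : Sphere 𝕜 N q →ₐ[𝕜] B}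
    (h : ∀ i, f (coord 𝕜 q i) = g (coord 𝕜 q i)) : f = g :=
  RingQuot.ringQuot_ext' _ _ _ (FreeAlgebra.hom_ext (funext h))

end SphereAPI

/-! ### The bimodule of one-forms: generation by the dx_i and universal property. -/

section OneFormsAPI

variable {𝕜 : Type u} [RCLike 𝕜] {N : ℕ} {q : ℝ}

theorem diff_mul (x y : Sphere 𝕜 N q) : diff 𝕜 q (x * y) = op y • diff 𝕜 q x + x • diff 𝕜 q y := by
  have := OneForms.mk_eq 𝕜 q (.leibniz x y)
  refine this.trans ?_
  change OneForms.mk 𝕜 q _ + OneForms.mk 𝕜 q _ = _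
  congr 1
  · rw [right_smul_def]
    change _ = OneForms.mk 𝕜 q (Env.right 𝕜 N q (op y) • preForm 𝕜 q 1 x 1)
    simp [preForm]
  · rw [left_smul_def]
    change _ = OneForms.mk 𝕜 q (Env.left 𝕜 N q x • preForm 𝕜 q 1 y 1)
    simp [preForm]

theorem mk_preForm (a x b : Sphere 𝕜 N q) :
    OneForms.mk 𝕜 q (preForm 𝕜 q a x b) = a • op b • diff 𝕜 q x := by
  rw [left_smul_def, right_smul_def]
  change _ = OneForms.mk 𝕜 q (Env.left 𝕜 N q a • Env.right 𝕜 N q (op b) • preForm 𝕜 q 1 x 1)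
  simp [preForm]

variable (𝕜 N q) in
/-- The projection from the free bimodule as a linear map. -/
def OneForms.mkₗ : PreForms 𝕜 N q →ₗ[Env 𝕜 N q] OneForms 𝕜 N q := (formRel 𝕜 N q).mkQ

theorem OneForms.mkₗ_smul (c : 𝕜) (z : PreForms 𝕜 N q) :
    OneForms.mkₗ 𝕜 N q (c • z) = c • OneForms.mkₗ 𝕜 N q z := by
  rw [← algebraMap_smul (Env 𝕜 N q) c z, map_smul]; rfl

theorem OneForms.mkₗ_preForm (a x b : Sphere 𝕜 N q) :
    OneForms.mkₗ 𝕜 N q (preForm 𝕜 q a x b) = a • op b • diff 𝕜 q x := mk_preForm a x b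

theorem dx_mul_coord (i j : Fin N) : op (coord 𝕜 q j) • dx 𝕜 q i =
    act (RinvS 𝕜 q) (fun k l => coord 𝕜 q k • dx 𝕜 q l) i j
    + ((q : 𝕜) - 1) • coord 𝕜 q i • dx 𝕜 q j
    + (((q ^ N - q ^ (N - 2)) / (1 - q ^ (N - 1)) : ℝ) : 𝕜) • metricS 𝕜 q i j • eta 𝕜 q
    + (((1 - q) * (1 + q ^ (N - 2)) / (1 - q ^ (N - 1)) : ℝ) : 𝕜) •
      (coord 𝕜 q i * coord 𝕜 q j) • eta 𝕜 q := by
  have e : OneForms.mkₗ 𝕜 N q _ = OneForms.mkₗ 𝕜 N q _ := OneForms.mk_eq 𝕜 q (.bimod i j)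
  simp only [map_add, map_sum, OneForms.mkₗ_smul, OneForms.mkₗ_preForm, op_one, one_smul] at e
  rw [e, eta, Finset.smul_sum]
  congr 1
  · congr 2
    · simp
    · simp only [metricS, Finset.smul_sum, smul_smul, Kmat]
      simp only [RCLike.ofReal_mul, mul_comm]
  · simp only [Finset.smul_sum, mul_smul, smul_comm (_ : Sphere 𝕜 N q) (_ : 𝕜)]

theorem diff_algebraMap (c : 𝕜) : diff 𝕜 q (algebraMap 𝕜 (Sphere 𝕜 N q) c) = 0 := by
  have h : diff 𝕜 q (1 : Sphere 𝕜 N q) = 0 := by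
    have := diff_mul (𝕜 := 𝕜) (q := q) (1 : Sphere 𝕜 N q) 1
    rw [mul_one, op_one, one_smul, one_smul] at this
    simpa using this
  rw [Algebra.algebraMap_eq_smul_one, map_smul, h, smul_zero]

theorem eta_mem_span :
    eta 𝕜 q ∈ Submodule.span (Sphere 𝕜 N q) (Set.range (dx 𝕜 q : Fin N → OneForms 𝕜 N q)) := by
  refine sum_mem fun k _ => sum_mem fun l _ => ?_
  rw [← algebraMap_smul (Sphere 𝕜 N q)]
  exact Submodule.smul_mem _ _ (Submodule.smul_mem _ _ (Submodule.subset_span ⟨l, rfl⟩))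

@[elab_as_elim]
theorem Env.induction {p : Env 𝕜 N q → Prop} (h0 : p 0)
    (ht : ∀ a b, p (Env.left 𝕜 N q a * Env.right 𝕜 N q (op b)))
    (ha : ∀ e f, p e → p f → p (e + f)) (e : Env 𝕜 N q) : p e := by
  refine TensorProduct.induction_on (motive := p) e h0 (fun a b => ?_) ha
  have : (a ⊗ₜ[𝕜] b : Env 𝕜 N q) = Env.left 𝕜 N q a * Env.right 𝕜 N q (op b.unop) := by
    change _ = (a ⊗ₜ[𝕜] (1 : (Sphere 𝕜 N q)ᵐᵒᵖ)) * ((1 : Sphere 𝕜 N q) ⊗ₜ[𝕜] op b.unop)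
    rw [Algebra.TensorProduct.tmul_mul_tmul, mul_one, one_mul, op_unop]
  rw [this]
  exact ht a b.unop

/-- The differentials `d x_i` generate `Γ₊` as a left module. -/
theorem span_dx : Submodule.span (Sphere 𝕜 N q)
    (Set.range (dx 𝕜 q : Fin N → OneForms 𝕜 N q)) = ⊤ := by
  set S := Submodule.span (Sphere 𝕜 N q) (Set.range (dx 𝕜 q : Fin N → OneForms 𝕜 N q)) with hS
  have hk : ∀ (c : 𝕜) {m : OneForms 𝕜 N q}, m ∈ S → c • m ∈ S := fun c m hm => by
    rw [← algebraMap_smul (Sphere 𝕜 N q)]; exact S.smul_mem _ hm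
  have hdx : ∀ i, dx 𝕜 q i ∈ S := fun i => Submodule.subset_span ⟨i, rfl⟩
  have hright : ∀ (a : Sphere 𝕜 N q), ∀ m ∈ S, op a • m ∈ S := by
    intro a
    induction a using Sphere.induction with
    | h1 c =>
      intro m hm
      have : op (algebraMap 𝕜 (Sphere 𝕜 N q) c) • m = c • m := by
        rw [← MulOpposite.algebraMap_apply, algebraMap_smul]
      rw [this]
      exact hk c hm
    | hx j =>
      intro m hm
      induction hm using Submodule.span_induction with
      | mem x hx =>
        obtain ⟨i, rfl⟩ := hx
        rw [dx_mul_coord]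
        refine add_mem (add_mem (add_mem ?_ ?_) ?_) ?_
        · exact sum_mem fun k _ => sum_mem fun l _ => hk _ (S.smul_mem _ (hdx l))
        · exact hk _ (S.smul_mem _ (hdx j))
        · exact hk _ (hk _ eta_mem_span)
        · exact hk _ (S.smul_mem _ eta_mem_span)
      | zero => rw [smul_zero]; exact zero_mem _
      | add x y _ _ hx hy => rw [smul_add]; exact add_mem hx hy
      | smul a x _ hx => rw [← smul_comm a (op _) x]; exact S.smul_mem _ hx
    | ha a b ha hb =>
      intro m hm; rw [op_add, add_smul]; exact add_mem (ha m hm) (hb m hm)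
    | hm a b ha hb =>
      intro m hm; rw [op_mul, mul_smul]; exact hb _ (ha m hm)
  have hd : ∀ a : Sphere 𝕜 N q, diff 𝕜 q a ∈ S := by
    intro a
    induction a using Sphere.induction with
    | h1 c => rw [diff_algebraMap]; exact zero_mem _
    | hx i => exact hdx i
    | ha a b ha hb => rw [map_add]; exact add_mem ha hb
    | hm a b ha hb =>
      rw [diff_mul]; exact add_mem (hright _ _ ha) (S.smul_mem _ hb)
  refine eq_top_iff.2 fun m _ => ?_
  obtain ⟨z, rfl⟩ := (formRel 𝕜 N q).mkQ_surjective m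
  change OneForms.mkₗ 𝕜 N q z ∈ S
  induction z using Finsupp.induction_linear with
  | zero => rw [map_zero]; exact zero_mem _
  | add x y hx hy => rw [map_add]; exact add_mem (hx trivial) (hy trivial)
  | single x e =>
    induction e using Env.induction with
    | h0 => rw [Finsupp.single_zero, map_zero]; exact zero_mem _
    | ha e f he hf => rw [Finsupp.single_add, map_add]; exact add_mem (he trivial) (hf trivial)
    | ht a b =>
      have : OneForms.mkₗ 𝕜 N q (preForm 𝕜 q a x b) ∈ S := by
        rw [OneForms.mkₗ_preForm]
        exact S.smul_mem _ (hright _ _ (hd x))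
      exact this

section Lift

variable {B : Type u} [Ring B] [Algebra 𝕜 B]

/-- Right multiplication as an action of the opposite algebra. -/
def opAct (f : Sphere 𝕜 N q →ₐ[𝕜] B) : (Sphere 𝕜 N q)ᵐᵒᵖ →ₐ[𝕜] Module.End 𝕜 B :=
  (Algebra.lsmul 𝕜 𝕜 B).comp (AlgHom.op f)

/-- The action of the enveloping algebra on an algebra over `X`. -/
def envAct (f : Sphere 𝕜 N q →ₐ[𝕜] B) : Env 𝕜 N q →ₐ[𝕜] Module.End 𝕜 B :=
  Algebra.TensorProduct.lift ((Algebra.lmul 𝕜 B).comp f) (opAct f)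
    (fun a b => LinearMap.ext fun x => by simp [opAct, mul_assoc])

theorem envAct_left_mul_right (f : Sphere 𝕜 N q →ₐ[𝕜] B) (a b : Sphere 𝕜 N q) (y : B) :
    envAct f (Env.left 𝕜 N q a * Env.right 𝕜 N q (op b)) y = f a * y * f b := by
  have h1 : envAct f (Env.left 𝕜 N q a) = Algebra.lmul 𝕜 B (f a) :=
    (Algebra.TensorProduct.lift_tmul ..).trans (by simp)
  have h2 : envAct f (Env.right 𝕜 N q (op b)) = opAct f (op b) :=
    (Algebra.TensorProduct.lift_tmul ..).trans (by rw [map_one, one_mul])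
  rw [map_mul, h1, h2]
  simp [opAct, mul_assoc]

/-- The bimodule map on `Γ₊` determined by an algebra map `f` on `X` and a derivation. -/
theorem OneForms.exists_lift (f : Sphere 𝕜 N q →ₐ[𝕜] B) (D : Sphere 𝕜 N q →ₗ[𝕜] B)
    (hD : ∀ x y, D (x * y) = D x * f y + f x * D y)
    (hb : ∀ i j, D (coord 𝕜 q i) * f (coord 𝕜 q j) =
      act (RinvS 𝕜 q) (fun k l => f (coord 𝕜 q k) * D (coord 𝕜 q l)) i j
      + ((q : 𝕜) - 1) • (f (coord 𝕜 q i) * D (coord 𝕜 q j))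
      + (((q ^ N - q ^ (N - 2)) / (1 - q ^ (N - 1)) : ℝ) : 𝕜) • metricS 𝕜 q i j •
        tr (metricS 𝕜 q) (fun k l => f (coord 𝕜 q k) * D (coord 𝕜 q l))
      + (((1 - q) * (1 + q ^ (N - 2)) / (1 - q ^ (N - 1)) : ℝ) : 𝕜) •
        (f (coord 𝕜 q i) * f (coord 𝕜 q j) *
          tr (metricS 𝕜 q) (fun k l => f (coord 𝕜 q k) * D (coord 𝕜 q l)))) :
    ∃ g : OneForms 𝕜 N q →ₗ[𝕜] B, (∀ a m, g (a • m) = f a * g m) ∧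
      (∀ a m, g (op a • m) = g m * f a) ∧ ∀ a, g (diff 𝕜 q a) = D a := by
  -- B becomes an X-bimodule through f. Bimodule maps out of the free bimodule are then arbitrary
  -- functions on X, and D respects the relations by assumption.
  let : Module (Env 𝕜 N q) B := Module.compHom B (envAct f).toRingHom
  have hs : ∀ (e : Env 𝕜 N q) (y : B), e • y = envAct f e y := fun _ _ => rfl
  let g₀ : PreForms 𝕜 N q →ₗ[Env 𝕜 N q] B := Finsupp.linearCombination (Env 𝕜 N q) D
  have hg₀ : ∀ a x b, g₀ (preForm 𝕜 q a x b) = f a * D x * f b := fun a x b => by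
    rw [preForm, Finsupp.linearCombination_single, hs, envAct_left_mul_right]
  have hgs : ∀ (c : 𝕜) z, g₀ (c • z) = c • g₀ z := fun c z => by
    rw [← algebraMap_smul (Env 𝕜 N q) c z, map_smul, hs, AlgHom.commutes]; rfl
  have hrel : formRel 𝕜 N q ≤ LinearMap.ker g₀ := by
    refine Submodule.span_le.2 ?_
    rintro _ (⟨x, y⟩ | ⟨c, x⟩ | ⟨x, y⟩ | ⟨i, j⟩)
    · simp [hg₀]
    · simp [hg₀, hgs]
    · simp [hg₀, hD]
    · simp only [SetLike.mem_coe, LinearMap.mem_ker, map_sub, map_add, map_sum, hgs, hg₀, map_one,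
        one_mul, mul_one]
      rw [hb, sub_eq_zero]
      simp only [act, tr, RinvS, metricS, Kmat, map_mul, Finset.mul_sum,
        Finset.smul_sum, smul_smul, mul_smul_comm, mul_assoc]
      simp only [mul_comm ((RCLike.ofReal (metric q i j) : 𝕜))]
  let g₁ : OneForms 𝕜 N q →ₗ[Env 𝕜 N q] B := (formRel 𝕜 N q).liftQ g₀ hrel
  have hd : ∀ a, g₁ (diff 𝕜 q a) = D a := fun a => by
    have : g₁ (diff 𝕜 q a) = g₀ (preForm 𝕜 q 1 a 1) := Submodule.liftQ_apply ..
    rw [this, hg₀]; simp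
  refine ⟨⟨⟨g₁, map_add g₁⟩, fun c m => ?_⟩, fun a m => ?_, fun a m => ?_, hd⟩
  · change g₁ (c • m) = c • g₁ m
    rw [scalar_smul_def, map_smul, hs, AlgHom.commutes]; rfl
  · change g₁ (a • m) = f a * g₁ m
    have := envAct_left_mul_right f a 1 (g₁ m)
    rw [op_one, map_one, mul_one, map_one, mul_one] at this
    rw [left_smul_def, map_smul, hs, this]
  · change g₁ (op a • m) = g₁ m * f a
    have := envAct_left_mul_right f 1 a (g₁ m)
    rw [map_one, one_mul, map_one, one_mul] at this
    rw [right_smul_def, map_smul, hs, this]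

end Lift

end OneFormsAPI

/-! ### Computations with coordinates, the frame and η in an arbitrary algebra. -/

section RingLevel

variable {F : Type*} [Field F] {N : ℕ} {T : Type*} [Ring T] [Algebra F T]

/-- The parameters are generic. -/
structure IsGeneric (p z : F) : Prop where
  p_ne : p ≠ 0
  z_ne : z ≠ 0
  one_sub_p : 1 - p ≠ 0
  one_add_p : 1 + p ≠ 0
  one_add_sq : 1 + p ^ 2 ≠ 0
  one_add_z : 1 + z ≠ 0
  one_sub_pz : 1 - p * z ≠ 0
  one_sub_sq : 1 - p ^ 2 * z ≠ 0
  one_sub_cube : 1 - p ^ 3 * z ≠ 0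

/-- The coefficient of the metric in the commutation relations of the sphere. -/
def kappaC (p z : F) : F := (p - p⁻¹) * z / (1 + z)

/-- The coefficient in the definition of the frame `γ`. -/
def alphaC (p z : F) : F := p * (1 + z) / (1 - p * z)

/-- The normalisation of `η`: the differential is `b⁻¹ [η, ·]`. -/
def betaC (p z : F) : F := (1 - p) * (1 - p * z) / (p * (1 + z))

/-- The coefficient expressing `η` through the frame. -/
def gC (p z : F) : F := (1 - p * z) / (1 + p)

/-- The coefficient in the fixed tensors of the braiding. -/
def cC (p z : F) : F := (p ^ 2 - 1) * gC p z / (1 - p ^ 2 * z)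

theorem IsGeneric.inv {p z : F} (h : IsGeneric p z) : IsGeneric p⁻¹ z⁻¹ := by
  obtain ⟨h1, h2, h3, h4, h5, h6, h7, h8, h9⟩ := h
  refine ⟨inv_ne_zero h1, inv_ne_zero h2, ?_, ?_, ?_, ?_, ?_, ?_, ?_⟩ <;> field_simp
  · exact div_ne_zero (fun h => h3 (by linear_combination -h)) h1
  · exact div_ne_zero (fun h => h4 (by linear_combination h)) h1
  · exact div_ne_zero (fun h => h5 (by linear_combination h)) (pow_ne_zero _ h1)
  · exact div_ne_zero (fun h => h6 (by linear_combination h)) h2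
  · exact div_ne_zero (fun h => h7 (by linear_combination -h)) (mul_ne_zero h1 h2)
  · exact div_ne_zero (fun h => h8 (by linear_combination -h)) (mul_ne_zero (pow_ne_zero _ h1) h2)
  · exact div_ne_zero (fun h => h9 (by linear_combination -h)) (mul_ne_zero (pow_ne_zero _ h1) h2)

/-- Both frames see the same inner form, because β is unchanged when p and z are inverted. -/
theorem betaC_inv {p z : F} (h : IsGeneric p z) : betaC p⁻¹ z⁻¹ = betaC p z := by
  have h6 : 1 + z⁻¹ = (1 + z) / z := by
    have := h.z_ne; field_simp; ring
  obtain ⟨h1, h2, h3, h4, h5, h6', h7, h8, h9⟩ := h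
  rw [betaC, betaC, h6]
  field_simp
  ring

variable (Q : Fin N → Fin N → Fin N → Fin N → F) (C : Fin N → Fin N → F) (p z : F)

/-- Elements satisfying the relations of the quantum sphere. -/
structure IsSphere (x : Fin N → T) : Prop where
  comm : ∀ i j, act Q (fun k l => x k * x l) i j =
    p⁻¹ • (x i * x j) + kappaC p z • C i j • (1 : T)
  norm : tr C (fun k l => x k * x l) = 1

/-- Elements satisfying the bimodule relations of the first order calculus. -/
def IsForms (x dx : Fin N → T) : Prop :=
  ∀ i j, dx i * x j = act Q (fun k l => x k * dx l) i j + (p - 1) • (x i * dx j)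
    + ((p ^ 2 - 1) * z / (1 - p * z)) • C i j • tr C (fun k l => x k * dx l)
    + ((1 - p) * (1 + z) / (1 - p * z)) • (x i * x j * tr C (fun k l => x k * dx l))

variable {Q C p z} {Q' : Fin N → Fin N → Fin N → Fin N → F}

theorem mul_act (y : T) (v : Fin N → Fin N → T) (i j : Fin N) :
    y * act Q v i j = act Q (fun a b => y * v a b) i j :=
  map_act Q (LinearMap.mulLeft F y) v i j

theorem act_mul (y : T) (v : Fin N → Fin N → T) (i j : Fin N) :
    act Q v i j * y = act Q (fun a b => v a b * y) i j :=
  map_act Q (LinearMap.mulRight F y) v i j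

theorem mul_tr (y : T) (v : Fin N → Fin N → T) : y * tr C v = tr C (fun a b => y * v a b) :=
  map_tr C (LinearMap.mulLeft F y) v

theorem tr_mul (y : T) (v : Fin N → Fin N → T) : tr C v * y = tr C (fun a b => v a b * y) :=
  map_tr C (LinearMap.mulRight F y) v

/-- Rewriting Q' through the skein relation gives relations of the same shape, with p and z replaced
by their inverses. This self-duality is what allows γ⁺ and γ⁻ to be treated together. -/
theorem IsSphere.swap (h : IsBraidPair Q Q' C p z) (hg : IsGeneric p z) {x : Fin N → T}
    (hx : IsSphere Q C p z x) : IsSphere Q' C p⁻¹ z⁻¹ x where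
  comm i j := by
    have h6 : 1 + z⁻¹ = (1 + z) / z := by
      have := hg.z_ne; field_simp; ring
    rw [h.act_skein, hx.comm, hx.norm, kappaC, kappaC, h6]
    obtain ⟨h1, h2, h3, h4, h5, h6', h7, h8, h9⟩ := hg
    match_scalars
    · field_simp
      ring
    · field_simp
      ring
  norm := hx.norm

theorem IsForms.swap (h : IsBraidPair Q Q' C p z) (hg : IsGeneric p z) {x dx : Fin N → T}
    (hd : IsForms Q C p z x dx) : IsForms Q' C p⁻¹ z⁻¹ x dx := by
  intro i j
  have h7' : 1 - p⁻¹ * z⁻¹ = - (1 - p * z) / (p * z) := by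
    have := hg.z_ne; have := hg.p_ne; field_simp; ring
  have h6 : 1 + z⁻¹ = (1 + z) / z := by
    have := hg.z_ne; field_simp; ring
  rw [h.act_skein, hd, h7', h6]
  obtain ⟨h1, h2, h3, h4, h5, h6', h7, h8, h9⟩ := hg
  match_scalars
  · field_simp
  · field_simp
    ring
  · field_simp
    ring
  · field_simp
    ring

/-- The contraction `C^{kl} x_k w_{…} y_l` with the identity on the left. -/
theorem tr_metric_left (h : IsBraidPair Q Q' C p z) (v : Fin N → T) (j : Fin N) :
    tr C (fun a b => C j a • v b) = v j := congrFun (h.snake_right v) j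

theorem tr_metric_right (h : IsBraidPair Q Q' C p z) (v : Fin N → T) (j : Fin N) :
    tr C (fun a b => C b j • v a) = v j := congrFun (h.snake_left v) j

section OneFormLevel

variable {x dx : Fin N → T}

/-- Moving the contracted index through: `C^{kl} x_k Q(x v)_{lj}`. -/
theorem tr_mul_act (h : IsBraidPair Q Q' C p z) (hx : IsSphere Q C p z x) (v : Fin N → T)
    (j : Fin N) : tr C (fun k l => x k * act Q (fun a b => x a * v b) l j) =
      p • (x j * tr C (fun a b => x a * v b)) + (kappaC p z - (p - p⁻¹)) • v j := by
  have e1 := congrFun (h.tr_slide' fun a b c => x a * (x b * v c)) j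
  have e2 : act₁₂ Q' (fun a b c => x a * (x b * v c)) j = fun k c =>
      p • (x j * (x k * v c)) + (kappaC p z - (p - p⁻¹)) • (C j k • v c) := by
    funext k c
    have e3 : (fun a b => x a * (x b * v c)) = fun a b => x a * x b * v c :=
      funext₂ fun a b => (mul_assoc _ _ _).symm
    rw [act₁₂, e3, h.act_skein, ← act_mul, hx.comm, ← tr_mul, hx.norm]
    simp only [add_mul, smul_mul_assoc, one_mul, mul_assoc]
    module
  simp only [tr₁₂, tr₂₃, act₂₃, ← mul_act, e2] at e1
  rw [e1, tr_add, tr_smul, tr_smul, tr_metric_left h, ← mul_tr]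

theorem betaC_eq (hg : IsGeneric p z) : kappaC p z - (p - p⁻¹) + (p - 1) = betaC p z := by
  obtain ⟨h1, h2, h3, h4, h5, h6, h7, h8, h9⟩ := hg
  rw [kappaC, betaC]
  field_simp
  ring

/-- Sliding x_j through the contraction defining η leaves x_j η with coefficient 1 by the choice of
constants in the calculus. The rest is β dx_j, so d is inner. -/
theorem eta_mul (h : IsBraidPair Q Q' C p z) (hg : IsGeneric p z) (hx : IsSphere Q C p z x)
    (hd : IsForms Q C p z x dx) (j : Fin N) : tr C (fun k l => x k * dx l) * x j =
      x j * tr C (fun k l => x k * dx l) + betaC p z • dx j := by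
  set η := tr C (fun k l => x k * dx l) with hη
  have e : ∀ k l, x k * dx l * x j = x k * act Q (fun a b => x a * dx b) l j
      + (p - 1) • (x k * x l * dx j) + ((p ^ 2 - 1) * z / (1 - p * z)) • (C l j • (x k * η))
      + ((1 - p) * (1 + z) / (1 - p * z)) • (x k * x l * (x j * η)) := by
    intro k l
    rw [mul_assoc, hd]
    simp only [mul_add, mul_smul_comm, mul_assoc, ← hη]
  conv_lhs => rw [hη, tr_mul]
  simp only [e, tr_add, tr_smul, tr_mul_act h hx, ← tr_mul, hx.norm,
    tr_metric_right h fun k => x k * η, ← betaC_eq hg, ← hη, one_mul]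
  obtain ⟨h1, h2, h3, h4, h5, h6, h7, h8, h9⟩ := hg
  match_scalars
  · field_simp
    ring
  · ring

variable (C p z x dx) in
/-- The frame `γ_i = d x_i + α x_i η`. -/
def frame (i : Fin N) : T := dx i + alphaC p z • (x i * tr C (fun k l => x k * dx l))

/-- The constant α is chosen so that the correction x_i η absorbs the metric and cubic terms in the
relation for dx_i x_j. -/
theorem frame_mul (h : IsBraidPair Q Q' C p z) (hg : IsGeneric p z) (hx : IsSphere Q C p z x)
    (hd : IsForms Q C p z x dx) (i j : Fin N) : frame C p z x dx i * x j =
      act Q (fun k l => x k * frame C p z x dx l) i j := by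
  set η := tr C (fun k l => x k * dx l) with hη
  have e : ∀ k l, x k * frame C p z x dx l = x k * dx l + alphaC p z • (x k * x l * η) := by
    intro k l
    rw [frame, mul_add, mul_smul_comm, mul_assoc]
  simp only [e, act_add, act_smul, ← act_mul, hx.comm]
  rw [frame, add_mul, hd, smul_mul_assoc, mul_assoc (x i) (tr C _), eta_mul h hg hx hd, ← hη]
  simp only [mul_add, add_mul, smul_mul_assoc, mul_smul_comm, one_mul, ← mul_assoc]
  obtain ⟨h1, h2, h3, h4, h5, h6, h7, h8, h9⟩ := hg
  simp only [alphaC, betaC, kappaC]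
  match_scalars
  · ring
  · field_simp
    ring
  · field_simp
  · field_simp
    ring

/-- Recovers η from the frame, so that from here on γ can be the primary datum and dx_i = γ_i - α
x_i η a derived one. -/
theorem tr_mul_frame (hg : IsGeneric p z) (hx : IsSphere Q C p z x) :
    gC p z • tr C (fun k l => x k * frame C p z x dx l) = tr C (fun k l => x k * dx l) := by
  simp only [frame, mul_add, mul_smul_comm, ← mul_assoc, tr_add, tr_smul, ← tr_mul, hx.norm,
    one_mul]
  obtain ⟨h1, h2, h3, h4, h5, h6, h7, h8, h9⟩ := hg
  simp only [alphaC, gC]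
  match_scalars
  field_simp
  ring

end OneFormLevel

section FrameLevel

variable {x γ : Fin N → T} {η : T}

theorem gC_ne_zero (hg : IsGeneric p z) : gC p z ≠ 0 := div_ne_zero hg.one_sub_pz hg.one_add_p

theorem betaC_ne_zero (hg : IsGeneric p z) : betaC p z ≠ 0 :=
  div_ne_zero (mul_ne_zero hg.one_sub_p hg.one_sub_pz) (mul_ne_zero hg.p_ne hg.one_add_z)

theorem tr_mul_eq (hg : IsGeneric p z) (hη : η = gC p z • tr C (fun k l => x k * γ l)) :
    tr C (fun k l => x k * γ l) = (gC p z)⁻¹ • η := by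
  rw [hη, inv_smul_smul₀ (gC_ne_zero hg)]

theorem eta_mul_frame (h : IsBraidPair Q Q' C p z) (hg : IsGeneric p z) (hx : IsSphere Q C p z x)
    (hγ : ∀ i j, γ i * x j = act Q (fun k l => x k * γ l) i j)
    (hη : η = gC p z • tr C (fun k l => x k * γ l)) (j : Fin N) :
    η * x j = p • (x j * η) + betaC p z • γ j := by
  rw [hη, smul_mul_assoc, tr_mul]
  simp only [mul_assoc, hγ]
  rw [tr_mul_act h hx, mul_smul_comm]
  obtain ⟨h1, h2, h3, h4, h5, h6, h7, h8, h9⟩ := hg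
  simp only [betaC, kappaC, gC]
  match_scalars
  · ring
  · field_simp
    ring

theorem tr_mul_form (hg : IsGeneric p z) (hx : IsSphere Q C p z x)
    (hη : η = gC p z • tr C (fun k l => x k * γ l)) :
    tr C (fun k l => x k * (γ l - alphaC p z • (x l * η))) = η := by
  simp only [mul_sub, mul_smul_comm, ← mul_assoc, tr_sub, tr_smul, ← tr_mul, hx.norm,
    one_mul, tr_mul_eq hg hη]
  obtain ⟨h1, h2, h3, h4, h5, h6, h7, h8, h9⟩ := hg
  simp only [alphaC, gC]
  match_scalars
  field_simp
  ring

theorem eta_commutator (h : IsBraidPair Q Q' C p z) (hg : IsGeneric p z) (hx : IsSphere Q C p z x)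
    (hγ : ∀ i j, γ i * x j = act Q (fun k l => x k * γ l) i j)
    (hη : η = gC p z • tr C (fun k l => x k * γ l)) (j : Fin N) :
    η * x j - x j * η = betaC p z • (γ j - alphaC p z • (x j * η)) := by
  rw [eta_mul_frame h hg hx hγ hη]
  obtain ⟨h1, h2, h3, h4, h5, h6, h7, h8, h9⟩ := hg
  simp only [alphaC, betaC]
  match_scalars
  · field_simp
    ring
  · ring

/-- A frame with its commutation rules gives the bimodule relations of the calculus. -/
theorem isForms_of_frame (h : IsBraidPair Q Q' C p z) (hg : IsGeneric p z)
    (hx : IsSphere Q C p z x) (hγ : ∀ i j, γ i * x j = act Q (fun k l => x k * γ l) i j)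
    (hη : η = gC p z • tr C (fun k l => x k * γ l)) :
    IsForms Q C p z x (fun i => γ i - alphaC p z • (x i * η)) := by
  intro i j
  have e : ∀ k l, x k * (γ l - alphaC p z • (x l * η)) =
      x k * γ l - alphaC p z • (x k * x l * η) := by
    intro k l
    rw [mul_sub, mul_smul_comm, mul_assoc]
  rw [tr_mul_form hg hx hη]
  simp only [e, act_sub, act_smul, ← act_mul, hx.comm]
  rw [sub_mul, hγ, smul_mul_assoc, mul_assoc (x i) η, eta_mul_frame h hg hx hγ hη]
  simp only [mul_add, add_mul, smul_mul_assoc, mul_smul_comm, one_mul, ← mul_assoc]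
  obtain ⟨h1, h2, h3, h4, h5, h6, h7, h8, h9⟩ := hg
  simp only [alphaC, betaC, kappaC]
  match_scalars
  · ring
  · field_simp
    ring
  · field_simp
    ring
  · field_simp
    ring

/-! ### Two-forms -/

/-- A coordinate moves to the left past two frame elements by two crossings; this turns statements
about two-forms into braid identities. -/
theorem frame_frame_mul (hγ : ∀ i j, γ i * x j = act Q (fun k l => x k * γ l) i j)
    (i j k : Fin N) : γ i * γ j * x k =
      act₂₃ Q (act₁₂ Q (fun a b c => x a * (γ b * γ c))) i j k := by
  have e : (fun a b => γ i * (x a * γ b)) =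
      act₁₂ Q (fun a b c => x a * (γ b * γ c)) i := by
    funext a b
    rw [← mul_assoc, hγ, act_mul, act₁₂]
    simp only [mul_assoc]
  rw [mul_assoc, hγ, mul_act, e, act₂₃]

theorem frame_eta (hγ : ∀ i j, γ i * x j = act Q (fun k l => x k * γ l) i j)
    (hη : η = gC p z • tr C (fun k l => x k * γ l)) (i : Fin N) : γ i * η =
      gC p z • tr₂₃ C (act₁₂ Q (fun a b c => x a * (γ b * γ c))) i := by
  rw [hη, mul_smul_comm, mul_tr, tr₂₃]
  congr 2
  funext a b
  rw [← mul_assoc, hγ, act_mul, act₁₂]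
  simp only [mul_assoc]

theorem eta_frame (hη : η = gC p z • tr C (fun k l => x k * γ l)) (i : Fin N) : η * γ i =
    gC p z • tr₁₂ C (fun a b c => x a * (γ b * γ c)) i := by
  rw [hη, smul_mul_assoc, tr_mul, tr₁₂]
  simp only [mul_assoc]

/-- Moving x_k to the left means two crossings, and the contraction slides through both. -/
theorem trace_mul (h : IsBraidPair Q Q' C p z)
    (hγ : ∀ i j, γ i * x j = act Q (fun k l => x k * γ l) i j) (k : Fin N) :
    tr C (fun i j => γ i * γ j) * x k = x k * tr C (fun i j => γ i * γ j) := by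
  have e := congrFun (h.tr_slide' (act₁₂ Q (fun a b c => x a * (γ b * γ c)))) k
  rw [h.act₁₂_act₁₂'] at e
  rw [tr_mul, mul_tr]
  simp only [frame_frame_mul hγ]
  exact e

variable (C p z x γ η) in
/-- The two-forms `u_l = p γ_l η + η γ_l + c x_l t` fixed by the braiding. -/
def fixedForm (l : Fin N) : T :=
  p • (γ l * η) + η * γ l + cC p z • (x l * tr C (fun i j => γ i * γ j))

theorem tr_coord_eta_frame (h : IsBraidPair Q Q' C p z) (hg : IsGeneric p z)
    (hx : IsSphere Q C p z x) (hγ : ∀ i j, γ i * x j = act Q (fun k l => x k * γ l) i j)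
    (hη : η = gC p z • tr C (fun k l => x k * γ l)) :
    tr C (fun k l => x k * (η * γ l)) = (p⁻¹ * (gC p z)⁻¹) • (η * η)
      - (p⁻¹ * betaC p z) • tr C (fun i j => γ i * γ j) := by
  have e : ∀ k l, x k * (η * γ l) = p⁻¹ • (η * (x k * γ l)) - (p⁻¹ * betaC p z) • (γ k * γ l) := by
    intro k l
    rw [← mul_assoc, ← mul_assoc, eta_mul_frame h hg hx hγ hη]
    simp only [add_mul, smul_mul_assoc]
    match_scalars
    · have := hg.p_ne
      field_simp
    · ring
  simp only [e, tr_sub, tr_smul, ← mul_tr, tr_mul_eq hg hη, mul_smul_comm, smul_smul]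

/-- `C^{kl} x_k u_l` in terms of `η²` and `t`. -/
theorem tr_coord_fixedForm (h : IsBraidPair Q Q' C p z) (hg : IsGeneric p z)
    (hx : IsSphere Q C p z x) (hγ : ∀ i j, γ i * x j = act Q (fun k l => x k * γ l) i j)
    (hη : η = gC p z • tr C (fun k l => x k * γ l)) :
    tr C (fun k l => x k * fixedForm C p z x γ η l) = ((p + p⁻¹) * (gC p z)⁻¹) • (η * η)
      + (cC p z - p⁻¹ * betaC p z) • tr C (fun i j => γ i * γ j) := by
  simp only [fixedForm, mul_add, mul_smul_comm, tr_add, tr_smul,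
    tr_coord_eta_frame h hg hx hγ hη]
  simp only [← mul_assoc, ← tr_mul, tr_mul_eq hg hη, hx.norm, one_mul, smul_mul_assoc]
  module

/-- In the tensor algebra this shows that the sub-bimodule generated by C^{kl} x_k u_l, hence the
one generated by [II], already contains every u_j: the coefficient on the right is nonzero for
generic parameters. -/
theorem fixedTrace_mul (h : IsBraidPair Q Q' C p z) (hg : IsGeneric p z)
    (hx : IsSphere Q C p z x) (hγ : ∀ i j, γ i * x j = act Q (fun k l => x k * γ l) i j)
    (hη : η = gC p z • tr C (fun k l => x k * γ l)) (j : Fin N) :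
    tr C (fun k l => x k * fixedForm C p z x γ η l) * x j
      - p ^ 2 • (x j * tr C (fun k l => x k * fixedForm C p z x γ η l)) =
    ((p + p⁻¹) * (gC p z)⁻¹ * betaC p z) • fixedForm C p z x γ η j := by
  rw [tr_coord_fixedForm h hg hx hγ hη, fixedForm]
  simp only [add_mul, smul_mul_assoc, mul_add, mul_smul_comm, trace_mul h hγ, mul_assoc,
    eta_mul_frame h hg hx hγ hη]
  simp only [← mul_assoc, eta_mul_frame h hg hx hγ hη, add_mul, smul_mul_assoc]
  obtain ⟨h1, h2, h3, h4, h5, h6, h7, h8, h9⟩ := hg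
  simp only [betaC, gC, cC]
  match_scalars <;> field_simp <;> ring

/-- The commutator of `η²` with coordinates. -/
theorem eta_sq_commutator (h : IsBraidPair Q Q' C p z) (hg : IsGeneric p z)
    (hx : IsSphere Q C p z x) (hγ : ∀ i j, γ i * x j = act Q (fun k l => x k * γ l) i j)
    (hη : η = gC p z • tr C (fun k l => x k * γ l)) (j : Fin N) :
    ((p + p⁻¹) * (gC p z)⁻¹) • (η * η * x j - x j * (η * η)) =
      (p ^ 2 - 1) • (x j * tr C (fun k l => x k * fixedForm C p z x γ η l))
      + ((p + p⁻¹) * (gC p z)⁻¹ * betaC p z) • fixedForm C p z x γ η j := by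
  rw [tr_coord_fixedForm h hg hx hγ hη, fixedForm]
  simp only [mul_add, mul_smul_comm, mul_assoc, eta_mul_frame h hg hx hγ hη]
  simp only [← mul_assoc, eta_mul_frame h hg hx hγ hη, add_mul, smul_mul_assoc]
  obtain ⟨h1, h2, h3, h4, h5, h6, h7, h8, h9⟩ := hg
  simp only [betaC, gC, cC]
  match_scalars <;> field_simp <;> ring

variable (C p z x γ η) in
/-- The form `C^{mn} dx_m dx_n + 2 b⁻¹ C^{kl} x_k η dx_l` with `dx_i = γ_i - α x_i η`. -/
def metricForm : T :=
  tr C (fun m n => (γ m - alphaC p z • (x m * η)) * (γ n - alphaC p z • (x n * η)))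
    + (2 / betaC p z) • tr C (fun k l => x k * (η * (γ l - alphaC p z • (x l * η))))

theorem coord_eta_form (h : IsBraidPair Q Q' C p z) (hg : IsGeneric p z)
    (hx : IsSphere Q C p z x) (hγ : ∀ i j, γ i * x j = act Q (fun k l => x k * γ l) i j)
    (hη : η = gC p z • tr C (fun k l => x k * γ l)) (k l : Fin N) :
    x k * (η * (γ l - alphaC p z • (x l * η))) = x k * η * γ l
      - (alphaC p z * p) • (x k * x l * (η * η))
      - (alphaC p z * betaC p z) • (x k * γ l * η) := by
  rw [mul_sub, mul_smul_comm, ← mul_assoc η, eta_mul_frame h hg hx hγ hη]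
  simp only [mul_sub, mul_add, add_mul, mul_smul_comm, smul_mul_assoc, mul_assoc]
  module

theorem form_mul_form (hγ : ∀ i j, γ i * x j = act Q (fun k l => x k * γ l) i j) (m n : Fin N) :
    (γ m - alphaC p z • (x m * η)) * (γ n - alphaC p z • (x n * η)) =
      γ m * γ n - alphaC p z • (act Q (fun k l => x k * γ l) m n * η)
      - alphaC p z • (x m * (η * (γ n - alphaC p z • (x n * η)))) := by
  rw [← hγ]
  simp only [sub_mul, mul_sub, smul_mul_assoc, mul_smul_comm, mul_assoc]
  module

theorem tr_coord_eta_form (h : IsBraidPair Q Q' C p z) (hg : IsGeneric p z)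
    (hx : IsSphere Q C p z x) (hγ : ∀ i j, γ i * x j = act Q (fun k l => x k * γ l) i j)
    (hη : η = gC p z • tr C (fun k l => x k * γ l)) :
    tr C (fun k l => x k * (η * (γ l - alphaC p z • (x l * η)))) =
      (p⁻¹ * (gC p z)⁻¹ - alphaC p z * (p + betaC p z * (gC p z)⁻¹)) • (η * η)
      - (p⁻¹ * betaC p z) • tr C (fun i j => γ i * γ j) := by
  have e : ∀ k l, x k * (η * (γ l - alphaC p z • (x l * η))) = x k * η * γ l
      - (alphaC p z * p) • (x k * x l * (η * η))
      - (alphaC p z * betaC p z) • (x k * γ l * η) := by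
    intro k l
    exact coord_eta_form h hg hx hγ hη k l
  simp only [e, tr_sub, tr_smul, ← tr_mul, hx.norm, one_mul, tr_mul_eq hg hη, smul_mul_assoc]
  simp only [mul_assoc, tr_coord_eta_frame h hg hx hγ hη]
  module

/-- Both sides are combinations of η² and C^{ij} γ_i γ_j; the factor 2/β in [II] is the one for
which these combinations are proportional. -/
theorem metricForm_eq (h : IsBraidPair Q Q' C p z) (hg : IsGeneric p z)
    (hx : IsSphere Q C p z x) (hγ : ∀ i j, γ i * x j = act Q (fun k l => x k * γ l) i j)
    (hη : η = gC p z • tr C (fun k l => x k * γ l)) :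
    metricForm C p z x γ η = ((1 - p ^ 2 * z) / ((1 + p ^ 2) * betaC p z)) •
      tr C (fun k l => x k * fixedForm C p z x γ η l) := by
  have e : ∀ m n, (γ m - alphaC p z • (x m * η)) * (γ n - alphaC p z • (x n * η)) =
      γ m * γ n - alphaC p z • (act Q (fun k l => x k * γ l) m n * η)
      - alphaC p z • (x m * (η * (γ n - alphaC p z • (x n * η)))) := by
    intro m n
    exact form_mul_form hγ m n
  rw [metricForm, tr_coord_fixedForm h hg hx hγ hη]
  simp only [e, tr_sub, tr_smul, ← tr_mul, tr_coord_eta_form h hg hx hγ hη]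
  have e2 : tr C (fun a b => act Q (fun k l => x k * γ l) a b) = (p * z * (gC p z)⁻¹) • η := by
    have := h.tr_act (fun k l => x k * γ l)
    rw [tr_mul_eq hg hη, smul_smul] at this
    exact this
  rw [e2, smul_mul_assoc]
  obtain ⟨h1, h2, h3, h4, h5, h6, h7, h8, h9⟩ := hg
  simp only [alphaC, betaC, gC, cC]
  match_scalars <;> field_simp <;> ring

variable (Q C p z x γ η) in
/-- The two-forms `(p + Q)(γ γ) - e C t`. -/
def symForm (i j : Fin N) : T :=
  p • (γ i * γ j) + act Q (fun k l => γ k * γ l) i j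
    - (p * cC p z * kappaC p z / betaC p z) • C i j • tr C (fun i j => γ i * γ j)

/-- The second step in generating the fixed tensors: commuting u_j past x_i yields the two-index
forms. -/
theorem fixedForm_mul (h : IsBraidPair Q Q' C p z) (hg : IsGeneric p z)
    (hx : IsSphere Q C p z x) (hγ : ∀ i j, γ i * x j = act Q (fun k l => x k * γ l) i j)
    (hη : η = gC p z • tr C (fun k l => x k * γ l)) (i j : Fin N) :
    fixedForm C p z x γ η j * x i
      - p • act Q (fun k l => x k * fixedForm C p z x γ η l) j i =
    betaC p z • symForm Q C p z γ j i := by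
  have e1 : ∀ k l, x k * fixedForm C p z x γ η l = p • (x k * γ l * η) + x k * η * γ l
      + cC p z • (x k * x l * tr C (fun i j => γ i * γ j)) := by
    intro k l
    rw [fixedForm]
    simp only [mul_add, mul_smul_comm, mul_assoc]
  have e2 : ∀ k l, η * (x k * γ l) = p • (x k * η * γ l) + betaC p z • (γ k * γ l) := by
    intro k l
    rw [← mul_assoc, eta_mul_frame h hg hx hγ hη, add_mul, smul_mul_assoc, smul_mul_assoc]
  have hb := betaC_ne_zero hg
  simp only [e1, act_add, act_smul, ← act_mul, hx.comm, ← hγ]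
  rw [fixedForm, symForm]
  simp only [add_mul, smul_mul_assoc, mul_assoc, eta_mul_frame h hg hx hγ hη, hγ, mul_act, e2,
    act_add, act_smul, trace_mul h hγ, mul_add, mul_smul_comm, one_mul]
  simp only [← mul_assoc, hγ]
  have := hg.p_ne
  match_scalars <;> field_simp <;> ring

variable (Q C p z x γ η) in
/-- The quadratic forms of the universal calculus, with `dx_i = γ_i - α x_i η`. -/
def quadForm (i j : Fin N) : T :=
  act Q (fun k l => (γ k - alphaC p z • (x k * η)) * (γ l - alphaC p z • (x l * η))) i j
  + p • ((γ i - alphaC p z • (x i * η)) * (γ j - alphaC p z • (x j * η)))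
  - (p * ((1 - p) * (1 + z) / (1 - p * z))) • (x i * (η * (γ j - alphaC p z • (x j * η))))
  - ((1 - p) * (1 + z) / (1 - p * z)) •
      act Q (fun k l => x k * (η * (γ l - alphaC p z • (x l * η)))) i j
  - ((1 + p ^ 2) * (1 + z) ^ 2 / (1 - p * z) ^ 2) •
      (x i * x j * tr C (fun k l => x k * (η * (γ l - alphaC p z • (x l * η)))))
  + (z * ((1 + p) * (1 + p ^ 2) * (1 + z) / (1 - p * z) ^ 2)) •
      C i j • tr C (fun k l => x k * (η * (γ l - alphaC p z • (x l * η))))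

theorem act_act_skein (h : IsBraidPair Q Q' C p z) {V : Type*} [AddCommGroup V] [Module F V]
    (v : Fin N → Fin N → V) (i j : Fin N) : act Q (act Q v) i j =
      v i j - (p - p⁻¹) • act Q v i j + ((p - p⁻¹) * (p * z)) • C i j • tr C v := by
  have e := h.act_skein (act Q v) i j
  rw [h.act_act', h.tr_act] at e
  rw [← sub_eq_iff_eq_add.2 e]
  module

/-- Substituting dx = γ - αxη, the terms quadratic in the frame form `symForm`, and everything else
is a left combination of the u_l and of the form of [II]. -/
theorem quadForm_eq (h : IsBraidPair Q Q' C p z) (hg : IsGeneric p z)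
    (hx : IsSphere Q C p z x) (hγ : ∀ i j, γ i * x j = act Q (fun k l => x k * γ l) i j)
    (hη : η = gC p z • tr C (fun k l => x k * γ l)) (i j : Fin N) :
    quadForm Q C p z x γ η i j = symForm Q C p z γ i j
      - (alphaC p z / p) • (act Q (fun k l => x k * fixedForm C p z x γ η l) i j
        + p • (x i * fixedForm C p z x γ η j))
      + (-(p + p⁻¹) * alphaC p z * cC p z
        - (1 + p ^ 2) * (1 + z) ^ 2 / (1 - p * z) ^ 2 * betaC p z) •
        (x i * x j * metricForm C p z x γ η)
      + (-kappaC p z * alphaC p z * cC p z - p * (p * cC p z * kappaC p z / betaC p z)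
        + z * ((1 + p) * (1 + p ^ 2) * (1 + z) / (1 - p * z) ^ 2) * betaC p z) • C i j •
        metricForm C p z x γ η := by
  set t := tr C (fun i j => γ i * γ j) with ht
  have e1 : ∀ k l, x k * (η * (γ l - alphaC p z • (x l * η))) = x k * η * γ l
      - (alphaC p z * p) • (x k * x l * (η * η))
      - (alphaC p z * betaC p z) • (x k * γ l * η) := by
    intro k l
    exact coord_eta_form h hg hx hγ hη k l
  have e2 : ∀ m n, (γ m - alphaC p z • (x m * η)) * (γ n - alphaC p z • (x n * η)) =
      γ m * γ n - alphaC p z • (act Q (fun k l => x k * γ l) m n * η)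
      - alphaC p z • (x m * (η * (γ n - alphaC p z • (x n * η)))) := by
    intro m n
    exact form_mul_form hγ m n
  have e3 : ∀ k l, x k * fixedForm C p z x γ η l = p • (x k * γ l * η) + x k * η * γ l
      + cC p z • (x k * x l * t) := by
    intro k l
    rw [fixedForm]
    simp only [mul_add, mul_smul_comm, mul_assoc, ← ht]
  have e4 : act Q (fun k l => act Q (fun a b => x a * γ b) k l) i j =
      x i * γ j - (p - p⁻¹) • act Q (fun a b => x a * γ b) i j
      + ((p - p⁻¹) * (p * z)) • C i j • (gC p z)⁻¹ • η := by
    rw [← tr_mul_eq hg hη]; exact act_act_skein h _ i j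
  rw [quadForm, metricForm_eq h hg hx hγ hη, tr_coord_fixedForm h hg hx hγ hη,
    tr_coord_eta_form h hg hx hγ hη, symForm, ← ht]
  simp only [e2, e3]
  simp only [e1, act_add, act_sub, act_smul, ← act_mul, hx.comm, e4]
  simp only [add_mul, sub_mul, mul_sub, mul_add, smul_mul_assoc, mul_smul_comm, one_mul, mul_assoc]
  -- The long coefficients stay opaque while coefficients are compared, and are put back for the
  -- final field identities.
  generalize hM : (1 - p ^ 2 * z) / ((1 + p ^ 2) * betaC p z) = M
  generalize hA : (1 + p ^ 2) * (1 + z) ^ 2 / (1 - p * z) ^ 2 = A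
  generalize hB : z * ((1 + p) * (1 + p ^ 2) * (1 + z) / (1 - p * z) ^ 2) = B
  generalize hH : (1 - p) * (1 + z) / (1 - p * z) = H
  obtain ⟨h1, h2, h3, h4, h5, h6, h7, h8, h9⟩ := hg
  have h7' : 1 - z * p ≠ 0 := by rwa [mul_comm]
  have h8' : 1 - z * p ^ 2 ≠ 0 := by rwa [mul_comm]
  match_scalars <;> subst hM hA hB hH <;> simp only [alphaC, betaC, gC, cC, kappaC] <;>
    field_simp <;> ring

end FrameLevel

end RingLevel

/-! ### Contracting the two-forms with coordinates, and conjugating them. -/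

section RingLevel

variable {F : Type*} [Field F] {N : ℕ} {T : Type*} [Ring T] [Algebra F T]
variable {Q Q' : Fin N → Fin N → Fin N → Fin N → F} {C : Fin N → Fin N → F} {p z : F}
variable {x γ : Fin N → T} {η : T}

theorem tr_coord_act_frame_frame (h : IsBraidPair Q Q' C p z) (hg : IsGeneric p z)
    (hγ : ∀ i j, γ i * x j = act Q (fun k l => x k * γ l) i j)
    (hη : η = gC p z • tr C (fun k l => x k * γ l)) (j : Fin N) :
    tr C (fun k l => x k * act Q (fun a b => γ a * γ b) l j) =
      (gC p z)⁻¹ • (γ j * η) + (p - p⁻¹) • (x j * tr C (fun a b => γ a * γ b))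
        - ((p - p⁻¹) * (gC p z)⁻¹) • (η * γ j) := by
  have e1 := congrFun (h.tr_slide' fun a b c => x a * (γ b * γ c)) j
  have e2 : act₁₂ Q' (fun a b c => x a * (γ b * γ c)) j = fun k c =>
      γ j * (x k * γ c) + (p - p⁻¹) • (x j * (γ k * γ c))
        - ((p - p⁻¹) * (gC p z)⁻¹) • (C j k • (η * γ c)) := by
    funext k c
    have e3 : (fun a b => x a * (γ b * γ c)) = fun a b => x a * γ b * γ c :=
      funext₂ fun a b => (mul_assoc _ _ _).symm
    rw [act₁₂, e3, h.act_skein, ← act_mul, ← hγ, ← tr_mul, tr_mul_eq hg hη]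
    simp only [smul_mul_assoc, mul_assoc]
    module
  simp only [tr₁₂, tr₂₃, act₂₃, ← mul_act, e2] at e1
  rw [e1, tr_sub, tr_add, tr_smul, tr_smul, tr_metric_left h, ← mul_tr, ← mul_tr, tr_mul_eq hg hη,
    mul_smul_comm]

/-- The metric term in `symForm` has exactly the coefficient for which contraction with a coordinate
gives back a multiple of u_j. -/
theorem tr_coord_symForm (h : IsBraidPair Q Q' C p z) (hg : IsGeneric p z)
    (hγ : ∀ i j, γ i * x j = act Q (fun k l => x k * γ l) i j)
    (hη : η = gC p z • tr C (fun k l => x k * γ l)) (j : Fin N) :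
    tr C (fun k l => x k * symForm Q C p z γ l j) =
      (p⁻¹ * (gC p z)⁻¹) • fixedForm C p z x γ η j := by
  simp only [symForm, mul_add, mul_sub, mul_smul_comm, tr_add, tr_sub, tr_smul,
    tr_coord_act_frame_frame h hg hγ hη,
    tr_metric_right h fun k => x k * tr C (fun i j => γ i * γ j)]
  simp only [← mul_assoc, ← tr_mul, tr_mul_eq hg hη, smul_mul_assoc]
  rw [fixedForm]
  have h7' : 1 - z * p ≠ 0 := by rw [mul_comm]; exact hg.one_sub_pz
  have h8' : 1 - z * p ^ 2 ≠ 0 := by rw [mul_comm]; exact hg.one_sub_sq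
  obtain ⟨h1, h2, h3, h4, h5, h6, h7, h8, h9⟩ := hg
  simp only [betaC, gC, cC, kappaC]
  match_scalars <;> field_simp <;> ring

/-- Used to recover the u_j from [I] and [II] by left multiplication alone, which makes the kernel a
left span of [I] and [II]; only the existence of c matters. -/
theorem tr_coord_quadForm (h : IsBraidPair Q Q' C p z) (hg : IsGeneric p z)
    (hx : IsSphere Q C p z x) (hγ : ∀ i j, γ i * x j = act Q (fun k l => x k * γ l) i j)
    (hη : η = gC p z • tr C (fun k l => x k * γ l)) : ∃ c : F, ∀ j,
    tr C (fun k l => x k * quadForm Q C p z x γ η l j) =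
      fixedForm C p z x γ η j + c • (x j * metricForm C p z x γ η) := by
  have hM : (1 - p ^ 2 * z) / ((1 + p ^ 2) * betaC p z) ≠ 0 :=
    div_ne_zero hg.one_sub_sq (mul_ne_zero hg.one_add_sq (betaC_ne_zero hg))
  have hs : tr C (fun k l => x k * fixedForm C p z x γ η l) =
      ((1 - p ^ 2 * z) / ((1 + p ^ 2) * betaC p z))⁻¹ • metricForm C p z x γ η := by
    rw [metricForm_eq h hg hx hγ hη, inv_smul_smul₀ hM]
  generalize ((1 - p ^ 2 * z) / ((1 + p ^ 2) * betaC p z))⁻¹ = M at hs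
  refine ⟨-(alphaC p z / p) * (p * M) + (-(p + p⁻¹) * alphaC p z * cC p z
        - (1 + p ^ 2) * (1 + z) ^ 2 / (1 - p * z) ^ 2 * betaC p z)
      + (-kappaC p z * alphaC p z * cC p z - p * (p * cC p z * kappaC p z / betaC p z)
        + z * ((1 + p) * (1 + p ^ 2) * (1 + z) / (1 - p * z) ^ 2) * betaC p z), fun j => ?_⟩
  simp only [quadForm_eq h hg hx hγ hη]
  generalize (-(p + p⁻¹) * alphaC p z * cC p z
        - (1 + p ^ 2) * (1 + z) ^ 2 / (1 - p * z) ^ 2 * betaC p z) = f₁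
  generalize (-kappaC p z * alphaC p z * cC p z - p * (p * cC p z * kappaC p z / betaC p z)
        + z * ((1 + p) * (1 + p ^ 2) * (1 + z) / (1 - p * z) ^ 2) * betaC p z) = f₂
  simp only [mul_add, mul_sub, mul_smul_comm, tr_add, tr_sub, tr_smul,
    tr_coord_symForm h hg hγ hη, tr_mul_act h hx,
    tr_metric_right h fun k => x k * metricForm C p z x γ η]
  simp only [← mul_assoc, ← tr_mul, hx.norm, one_mul, hs]
  obtain ⟨h1, h2, h3, h4, h5, h6, h7, h8, h9⟩ := hg
  simp only [mul_smul_comm]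
  match_scalars
  · simp only [alphaC, gC, kappaC]
    field_simp
    ring
  · field_simp

/-- The commutator of η² with x_l consists of x_l times C^{ab} x_a u_b and of u_l; contracted with
x_k both become multiples of C^{ab} x_a u_b, hence of the form of [II]. -/
theorem conj_eta_sq (h : IsBraidPair Q Q' C p z) (hg : IsGeneric p z)
    (hx : IsSphere Q C p z x) (hγ : ∀ i j, γ i * x j = act Q (fun k l => x k * γ l) i j)
    (hη : η = gC p z • tr C (fun k l => x k * γ l)) :
    tr C (fun k l => x k * (η * η) * x l) =
      η * η + (betaC p z) ^ 2 • metricForm C p z x γ η := by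
  have hs₁ : (p + p⁻¹) * (gC p z)⁻¹ ≠ 0 := by
    refine mul_ne_zero ?_ (inv_ne_zero (gC_ne_zero hg))
    have := hg.p_ne
    have h5 := hg.one_add_sq
    field_simp
    exact div_ne_zero (by rwa [add_comm]) this
  have e : ∀ k l, x k * (η * η) * x l = x k * x l * (η * η) + ((p + p⁻¹) * (gC p z)⁻¹)⁻¹ •
      ((p ^ 2 - 1) • (x k * x l * tr C (fun k l => x k * fixedForm C p z x γ η l))
      + ((p + p⁻¹) * (gC p z)⁻¹ * betaC p z) • (x k * fixedForm C p z x γ η l)) := by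
    intro k l
    have e1 := eta_sq_commutator h hg hx hγ hη l
    have e2 := congrArg (fun y => ((p + p⁻¹) * (gC p z)⁻¹)⁻¹ • (x k * y)) e1
    simp only [mul_smul_comm, inv_smul_smul₀ hs₁, mul_sub, mul_add] at e2
    simp only [mul_assoc] at e2 ⊢
    rw [← e2]
    abel
  simp only [e, tr_add, tr_smul, ← tr_mul, hx.norm, one_mul]
  rw [metricForm_eq h hg hx hγ hη]
  generalize tr C (fun k l => x k * fixedForm C p z x γ η l) = s
  have h7' : 1 - z * p ≠ 0 := by rw [mul_comm]; exact hg.one_sub_pz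
  have h5' : p ^ 2 + 1 ≠ 0 := by rw [add_comm]; exact hg.one_add_sq
  obtain ⟨h1, h2, h3, h4, h5, h6, h7, h8, h9⟩ := hg
  generalize hM : (1 - p ^ 2 * z) / ((1 + p ^ 2) * betaC p z) = M
  match_scalars <;> subst hM <;> simp only [betaC, gC] <;> field_simp
  ring

/-- Conjugation of `[II]` with the coordinates. -/
theorem conj_metricForm (h : IsBraidPair Q Q' C p z) (hg : IsGeneric p z)
    (hx : IsSphere Q C p z x) (hγ : ∀ i j, γ i * x j = act Q (fun k l => x k * γ l) i j)
    (hη : η = gC p z • tr C (fun k l => x k * γ l)) :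
    tr C (fun k l => x k * metricForm C p z x γ η * x l) =
      (1 + betaC p z * ((1 + p) * (1 - p ^ 2 * z) / (p * (1 - p * z)))) •
        metricForm C p z x γ η := by
  have e := conj_eta_sq h hg hx hγ hη
  have e1 := metricForm_eq h hg hx hγ hη
  have e2 : betaC p z * ((1 + p) * (1 - p ^ 2 * z) / (p * (1 - p * z))) =
      betaC p z ^ 2 * ((1 - p ^ 2 * z) / ((1 + p ^ 2) * betaC p z)
        * ((p + p⁻¹) * (gC p z)⁻¹)) := by
    have hb := betaC_ne_zero hg
    have h7' : 1 - z * p ≠ 0 := by rw [mul_comm]; exact hg.one_sub_pz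
    have h5' : p ^ 2 + 1 ≠ 0 := by rw [add_comm]; exact hg.one_add_sq
    obtain ⟨h1, h2, h3, h4, h5, h6, h7, h8, h9⟩ := hg
    simp only [gC]
    field_simp
    ring
  rw [tr_coord_fixedForm h hg hx hγ hη] at e1
  rw [e2]
  generalize (1 - p ^ 2 * z) / ((1 + p ^ 2) * betaC p z) = M at e1 ⊢
  generalize (p + p⁻¹) * (gC p z)⁻¹ = S at e1 ⊢
  generalize cC p z - p⁻¹ * betaC p z = D at e1
  generalize metricForm C p z x γ η = y at e e1 ⊢
  have e3 : tr C (fun k l => x k * y * x l) = M • (S • tr C (fun k l => x k * (η * η) * x l) +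
      D • tr C fun i j => γ i * γ j) := by
    rw [e1]
    simp only [mul_add, add_mul, mul_smul_comm, smul_mul_assoc, tr_add, tr_smul, smul_add]
    simp only [mul_assoc, trace_mul h hγ]
    simp only [← mul_assoc, ← tr_mul, hx.norm, one_mul]
  rw [e3, e, add_smul, one_smul]
  nth_rewrite 2 [e1]
  module

/-- In a differential algebra, `[II]` vanishes: the two ways of conjugating it disagree. -/
theorem metricForm_eq_zero (h : IsBraidPair Q Q' C p z) (hg : IsGeneric p z)
    (hx : IsSphere Q C p z x) (hγ : ∀ i j, γ i * x j = act Q (fun k l => x k * γ l) i j)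
    (hη : η = gC p z • tr C (fun k l => x k * γ l))
    (hZ : tr C (fun k l => x k * metricForm C p z x γ η * x l) =
      (1 + betaC p z) • metricForm C p z x γ η) : metricForm C p z x γ η = 0 := by
  rw [conj_metricForm h hg hx hγ hη, ← sub_eq_zero, ← sub_smul] at hZ
  refine (smul_eq_zero.1 hZ).resolve_left ?_
  -- The gap between the two eigenvalues, since (1 + p)(1 - p²z) - p(1 - pz) = 1 - p³z. This is
  -- where the condition `one_sub_cube` is needed.
  have e : 1 + betaC p z * ((1 + p) * (1 - p ^ 2 * z) / (p * (1 - p * z))) - (1 + betaC p z) =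
      betaC p z * ((1 - p ^ 3 * z) / (p * (1 - p * z))) := by
    have h7' : 1 - z * p ≠ 0 := by rw [mul_comm]; exact hg.one_sub_pz
    obtain ⟨h1, h2, h3, h4, h5, h6, h7, h8, h9⟩ := hg
    field_simp
    ring
  rw [e]
  exact mul_ne_zero (betaC_ne_zero hg)
    (div_ne_zero hg.one_sub_cube (mul_ne_zero hg.p_ne hg.one_sub_pz))

end RingLevel

/-! ### The parameters p = q, z = q^(N-2) and the coefficients of the statement. -/

section Parameters

variable (𝕜 : Type u) [RCLike 𝕜] {N : ℕ} {q : ℝ}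

theorem isGeneric (hq : 0 < q) (hq1 : q ≠ 1) (hN : 3 ≤ N) :
    IsGeneric (q : 𝕜) ((q : 𝕜) ^ (N - 2)) := by
  have hp : ∀ n : ℕ, n ≠ 0 → 1 - (q : 𝕜) ^ n ≠ 0 := by
    intro n hn h
    have h1 : (1 : ℝ) - q ^ n = 0 := by exact_mod_cast h
    exact hq1 ((pow_eq_one_iff_of_nonneg hq.le hn).1 (by linarith))
  have hq' : (q : 𝕜) ≠ 0 := by exact_mod_cast hq.ne'
  have hm : ∀ k n : ℕ, n ≠ 0 → 1 - (q : 𝕜) ^ k * (q : 𝕜) ^ n ≠ 0 := by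
    intro k n hn
    rw [← pow_add]
    exact hp _ (by omega)
  have h3 : N - 2 ≠ 0 := by omega
  refine ⟨hq', pow_ne_zero _ hq', ?_, ?_, ?_, ?_, ?_, hm 2 _ h3, hm 3 _ h3⟩
  · simpa using hp 1 one_ne_zero
  · have : (1 : ℝ) + q ≠ 0 := by positivity
    exact_mod_cast this
  · have : (1 : ℝ) + q ^ 2 ≠ 0 := by positivity
    exact_mod_cast this
  · have : (1 : ℝ) + q ^ (N - 2) ≠ 0 := by positivity
    exact_mod_cast this
  · simpa using hm 1 _ h3

theorem kappaC_q (hq : 0 < q) (hq1 : q ≠ 1) (hN : 3 ≤ N) :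
    (((q ^ (N - 1) - q ^ (N - 3)) / (1 + q ^ (N - 2)) : ℝ) : 𝕜) =
      kappaC (q : 𝕜) ((q : 𝕜) ^ (N - 2)) := by
  have hg := isGeneric 𝕜 hq hq1 hN
  obtain ⟨n, rfl⟩ := Nat.exists_eq_add_of_le' hN
  have h1 := hg.p_ne
  have h6 := hg.one_add_z
  rw [kappaC]
  simp only [Nat.add_sub_cancel, show n + 3 - 1 = n + 2 by omega, show n + 3 - 2 = n + 1 by omega]
    at h6 ⊢
  push_cast
  field_simp
  ring

theorem metric_coeff_q (hN : 3 ≤ N) :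
    (((q ^ N - q ^ (N - 2)) / (1 - q ^ (N - 1)) : ℝ) : 𝕜) =
      ((q : 𝕜) ^ 2 - 1) * (q : 𝕜) ^ (N - 2) / (1 - q * (q : 𝕜) ^ (N - 2)) := by
  obtain ⟨n, rfl⟩ := Nat.exists_eq_add_of_le' hN
  simp only [show n + 3 - 1 = n + 2 by omega, show n + 3 - 2 = n + 1 by omega]
  push_cast
  congr 1 <;> ring

theorem cubic_coeff_q (hN : 3 ≤ N) :
    (((1 - q) * (1 + q ^ (N - 2)) / (1 - q ^ (N - 1)) : ℝ) : 𝕜) =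
      (1 - (q : 𝕜)) * (1 + (q : 𝕜) ^ (N - 2)) / (1 - q * (q : 𝕜) ^ (N - 2)) := by
  obtain ⟨n, rfl⟩ := Nat.exists_eq_add_of_le' hN
  simp only [show n + 3 - 1 = n + 2 by omega, show n + 3 - 2 = n + 1 by omega]
  push_cast
  congr 1
  ring

theorem alphaC_minus (hN : 3 ≤ N) :
    ((q * ((1 + q ^ (N - 2)) / (1 - q ^ (N - 1))) : ℝ) : 𝕜) =
      alphaC (q : 𝕜) ((q : 𝕜) ^ (N - 2)) := by
  obtain ⟨n, rfl⟩ := Nat.exists_eq_add_of_le' hN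
  rw [alphaC]
  simp only [show n + 3 - 1 = n + 2 by omega, show n + 3 - 2 = n + 1 by omega]
  push_cast
  rw [mul_div_assoc]
  congr 3
  ring

/-- The coefficient of γ⁺ is that of γ⁻ with p and z inverted. -/
theorem alphaC_plus (hq : 0 < q) (hq1 : q ≠ 1) (hN : 3 ≤ N) :
    ((-((1 + q ^ (N - 2)) / (1 - q ^ (N - 1))) : ℝ) : 𝕜) =
      alphaC (q : 𝕜)⁻¹ ((q : 𝕜) ^ (N - 2))⁻¹ := by
  have hg := isGeneric 𝕜 hq hq1 hN
  have h1 := hg.p_ne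
  have h2 := hg.z_ne
  have h7 := hg.one_sub_pz
  have h7' : 1 - (q : 𝕜)⁻¹ * ((q : 𝕜) ^ (N - 2))⁻¹ =
      - (1 - q * (q : 𝕜) ^ (N - 2)) / (q * (q : 𝕜) ^ (N - 2)) := by
    field_simp; ring
  have e : ((-((1 + q ^ (N - 2)) / (1 - q ^ (N - 1))) : ℝ) : 𝕜) =
      -((1 + (q : 𝕜) ^ (N - 2)) / (1 - q * (q : 𝕜) ^ (N - 2))) := by
    have e1 : q ^ (N - 1) = q * q ^ (N - 2) := by rw [← pow_succ']; congr 1; omega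
    rw [e1]
    push_cast
    rfl
  rw [alphaC, h7', e]
  field_simp
  ring

end Parameters

/-! ### The two frames as instances of one set of parameters. -/

section Frames

variable (𝕜 : Type u) [RCLike 𝕜] {N : ℕ} (q : ℝ)

/-- A choice of braid matrix and parameters for which the defining relations of the sphere and of
its calculus take the standard form. -/
structure IsParam (Q Q' : Fin N → Fin N → Fin N → Fin N → 𝕜) (p z : 𝕜) : Prop where
  braid : IsBraidPair Q Q' (metricS 𝕜 q) p z
  generic : IsGeneric p z
  beta_eq : betaC p z = betaC (q : 𝕜) ((q : 𝕜) ^ (N - 2))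
  sphere_iff : ∀ (T : Type u) [Ring T] [Algebra 𝕜 T] (x : Fin N → T),
    IsSphere Q (metricS 𝕜 q) p z x ↔ (∀ i j, act (RinvS 𝕜 q) (fun k l => x k * x l) i j =
      (q : 𝕜)⁻¹ • (x i * x j) +
      (((q ^ (N - 1) - q ^ (N - 3)) / (1 + q ^ (N - 2)) : ℝ) : 𝕜) • metricS 𝕜 q i j • (1 : T)) ∧
      tr (metricS 𝕜 q) (fun k l => x k * x l) = 1
  forms_iff : ∀ (T : Type u) [Ring T] [Algebra 𝕜 T] (x dx : Fin N → T),
    IsForms Q (metricS 𝕜 q) p z x dx ↔ ∀ i j, dx i * x j =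
      act (RinvS 𝕜 q) (fun k l => x k * dx l) i j + ((q : 𝕜) - 1) • (x i * dx j)
      + (((q ^ N - q ^ (N - 2)) / (1 - q ^ (N - 1)) : ℝ) : 𝕜) • metricS 𝕜 q i j •
        tr (metricS 𝕜 q) (fun k l => x k * dx l)
      + (((1 - q) * (1 + q ^ (N - 2)) / (1 - q ^ (N - 1)) : ℝ) : 𝕜) •
        (x i * x j * tr (metricS 𝕜 q) (fun k l => x k * dx l))

theorem isParam_minus {q : ℝ} (hq : 0 < q) (hq1 : q ≠ 1) (hN : 3 ≤ N) :
    IsParam 𝕜 q (RinvS 𝕜 q) (RmatS 𝕜 q : Fin N → Fin N → Fin N → Fin N → 𝕜)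
      (q : 𝕜) ((q : 𝕜) ^ (N - 2)) where
  braid := isBraidPair hq (by omega)
  generic := isGeneric 𝕜 hq hq1 hN
  beta_eq := rfl
  sphere_iff T _ _ x := by
    rw [kappaC_q 𝕜 hq hq1 hN]
    exact ⟨fun h => ⟨h.comm, h.norm⟩, fun h => ⟨h.1, h.2⟩⟩
  forms_iff T _ _ x dx := by
    rw [metric_coeff_q 𝕜 hN, cubic_coeff_q 𝕜 hN]
    rfl

/-- Starting from `isParam_minus`, which belongs to γ⁻, this gives the parameters belonging to γ⁺.
-/
theorem IsParam.swap {q : ℝ} {Q Q' : Fin N → Fin N → Fin N → Fin N → 𝕜} {p z : 𝕜}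
    (h : IsParam 𝕜 q Q Q' p z) : IsParam 𝕜 q Q' Q p⁻¹ z⁻¹ where
  braid := h.braid.swap
  generic := h.generic.inv
  beta_eq := by rw [betaC_inv h.generic, h.beta_eq]
  sphere_iff T _ _ x := by
    rw [← h.sphere_iff]
    refine ⟨fun hx => ?_, fun hx => hx.swap h.braid h.generic⟩
    have := hx.swap h.braid.swap h.generic.inv
    rwa [inv_inv, inv_inv] at this
  forms_iff T _ _ x dx := by
    rw [← h.forms_iff]
    refine ⟨fun hx => ?_, fun hx => hx.swap h.braid h.generic⟩
    have := hx.swap h.braid.swap h.generic.inv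
    rwa [inv_inv, inv_inv] at this

variable {𝕜 q}
variable {Q Q' : Fin N → Fin N → Fin N → Fin N → 𝕜} {p z : 𝕜}

variable (q p z) in
/-- The frame of one-forms. -/
def gam (i : Fin N) : OneForms 𝕜 N q :=
  dx 𝕜 q i + alphaC p z • coord 𝕜 q i • eta 𝕜 q

theorem gammaMinus_eq (hN : 3 ≤ N) :
    (gammaMinus 𝕜 q : Fin N → OneForms 𝕜 N q) = gam q (q : 𝕜) ((q : 𝕜) ^ (N - 2)) := by
  funext i
  rw [gammaMinus, alphaC_minus 𝕜 hN, gam]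

theorem gammaPlus_eq (hq : 0 < q) (hq1 : q ≠ 1) (hN : 3 ≤ N) :
    (gammaPlus 𝕜 q : Fin N → OneForms 𝕜 N q) = gam q (q : 𝕜)⁻¹ ((q : 𝕜) ^ (N - 2))⁻¹ := by
  funext i
  rw [gammaPlus, alphaC_plus 𝕜 hq hq1 hN, gam]

section Rep

variable {T : Type u} [Ring T] [Algebra 𝕜 T] (f : Sphere 𝕜 N q →ₐ[𝕜] T)
  (g : OneForms 𝕜 N q →ₗ[𝕜] T)

theorem IsParam.isSphere_coord (h : IsParam 𝕜 q Q Q' p z) :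
    IsSphere Q (metricS 𝕜 q) p z (coord 𝕜 q : Fin N → Sphere 𝕜 N q) :=
  (h.sphere_iff _ _).2 ⟨coord_comm, coord_norm⟩

theorem IsSphere.map {Q : Fin N → Fin N → Fin N → Fin N → 𝕜} {C : Fin N → Fin N → 𝕜}
    {T T' : Type u} [Ring T] [Algebra 𝕜 T] [Ring T']
    [Algebra 𝕜 T'] {x : Fin N → T} (hx : IsSphere Q C p z x) (f : T →ₐ[𝕜] T') :
    IsSphere Q C p z (fun i => f (x i)) where
  comm i j := by
    have := congrArg f (hx.comm i j)
    rw [← AlgHom.toLinearMap_apply, map_act] at this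
    simpa using this
  norm := by
    have := congrArg f hx.norm
    rw [← AlgHom.toLinearMap_apply, map_tr] at this
    simpa using this

theorem eta_eq_tr : eta 𝕜 q =
    tr (metricS 𝕜 q) (fun k l : Fin N => coord 𝕜 q k • dx 𝕜 q l) := rfl

variable {f g}

theorem map_eta (hl : ∀ a m, g (a • m) = f a * g m) : g (eta 𝕜 q) =
    tr (metricS 𝕜 q) (fun k l => f (coord 𝕜 q k) * g (dx 𝕜 q l)) := by
  rw [eta_eq_tr, map_tr]
  simp only [hl]

theorem map_gam (hl : ∀ a m, g (a • m) = f a * g m) (i : Fin N) : g (gam q p z i) =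
    frame (metricS 𝕜 q) p z (fun i => f (coord 𝕜 q i)) (fun i => g (dx 𝕜 q i)) i := by
  rw [gam, map_add, map_smul, hl, map_eta hl]
  rfl

theorem IsParam.isForms (hl : ∀ a m, g (a • m) = f a * g m)
    (hr : ∀ a m, g (op a • m) = g m * f a) (h : IsParam 𝕜 q Q Q' p z) :
    IsForms Q (metricS 𝕜 q) p z (fun i => f (coord 𝕜 q i)) (fun i => g (dx 𝕜 q i)) := by
  refine (h.forms_iff T _ _).2 fun i j => ?_
  rw [← hr, dx_mul_coord, map_add, map_add, map_add, map_act]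
  simp only [map_smul, hl, map_eta hl, map_mul]

theorem IsParam.frame_rel (hl : ∀ a m, g (a • m) = f a * g m)
    (hr : ∀ a m, g (op a • m) = g m * f a) (h : IsParam 𝕜 q Q Q' p z) (i j : Fin N) :
    g (gam q p z i) * f (coord 𝕜 q j) =
      act Q (fun k l => f (coord 𝕜 q k) * g (gam q p z l)) i j := by
  simp only [map_gam hl]
  exact frame_mul h.braid h.generic (h.isSphere_coord.map f) (h.isForms hl hr) i j

theorem IsParam.eta_rel (hl : ∀ a m, g (a • m) = f a * g m) (h : IsParam 𝕜 q Q Q' p z) : g (eta 𝕜 q) =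
    gC p z • tr (metricS 𝕜 q) (fun k l => f (coord 𝕜 q k) * g (gam q p z l)) := by
  simp only [map_gam hl]
  rw [tr_mul_frame h.generic (h.isSphere_coord.map f), map_eta hl]

end Rep

end Frames

/-! ### One-forms are presented by the frame relations. -/

section FrameLift

variable {𝕜 : Type u} [RCLike 𝕜] {N : ℕ} {q : ℝ}
variable {Q Q' : Fin N → Fin N → Fin N → Fin N → 𝕜} {p z : 𝕜}

/-- A bimodule map on one-forms is determined by the image of the frame, which can be any family
satisfying the commutation rules of the frame. -/
theorem IsParam.exists_frame_lift (h : IsParam 𝕜 q Q Q' p z) {B : Type u} [Ring B] [Algebra 𝕜 B]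
    (f : Sphere 𝕜 N q →ₐ[𝕜] B) (γ : Fin N → B)
    (hγ : ∀ i j, γ i * f (coord 𝕜 q j) = act Q (fun k l => f (coord 𝕜 q k) * γ l) i j) :
    ∃ g : OneForms 𝕜 N q →ₗ[𝕜] B, (∀ a m, g (a • m) = f a * g m) ∧
      (∀ a m, g (op a • m) = g m * f a) ∧ (∀ i, g (gam q p z i) = γ i) := by
  set η := gC p z • tr (metricS 𝕜 q) (fun k l => f (coord 𝕜 q k) * γ l) with hη
  have hb := betaC_ne_zero h.generic
  have hx := h.isSphere_coord.map f
  -- An inner derivation satisfies the Leibniz rule automatically, so only its values on coordinates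
  -- need checking against the bimodule relations.
  let D : Sphere 𝕜 N q →ₗ[𝕜] B :=
    (betaC p z)⁻¹ • ((LinearMap.mulLeft 𝕜 η - LinearMap.mulRight 𝕜 η) ∘ₗ f.toLinearMap)
  have hD : ∀ a, D a = (betaC p z)⁻¹ • (η * f a - f a * η) := fun a => rfl
  have hDx : ∀ i, D (coord 𝕜 q i) = γ i - alphaC p z • (f (coord 𝕜 q i) * η) := fun i => by
    rw [hD, eta_commutator h.braid h.generic hx hγ hη, inv_smul_smul₀ hb]
  obtain ⟨g, hl, hr, hg⟩ := OneForms.exists_lift f D (fun a b => by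
      simp only [hD, map_mul, smul_mul_assoc, mul_smul_comm, ← smul_add, mul_sub, sub_mul,
        mul_assoc]
      congr 1
      abel) (by
      simp only [hDx]
      exact (h.forms_iff _ _ _).1 (isForms_of_frame h.braid h.generic hx hγ hη))
  refine ⟨g, hl, hr, fun i => ?_⟩
  rw [map_gam hl, frame]
  simp only [dx, hg, hDx]
  rw [tr_mul_form h.generic hx hη]
  abel

end FrameLift

/-! ### The frame is a left basis of the one-forms. -/

section Model

variable {𝕜 : Type u} [RCLike 𝕜] {N : ℕ} {q : ℝ}
variable {Q Q' : Fin N → Fin N → Fin N → Fin N → 𝕜} {p z : 𝕜}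

variable (q Q) in
/-- The matrix of right multiplication by a coordinate in the frame. -/
def rightMat (j : Fin N) : Matrix (Fin N) (Fin N) (Sphere 𝕜 N q) :=
  fun s t => ∑ k, Q k t s j • coord 𝕜 q k

theorem rightMat_apply (s t j : Fin N) : rightMat q Q j s t =
    act Q (fun k l => (if l = t then (1 : 𝕜) else 0) • coord 𝕜 q k) s j := by
  simp only [act, rightMat, ite_smul, one_smul, zero_smul, smul_ite, smul_zero,
    Finset.sum_ite_eq', Finset.mem_univ, if_true]

theorem rightMat_mul_apply (a b s t : Fin N) : (rightMat q Q a * rightMat q Q b) s t =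
    act₁₂ Q (act₂₃ Q fun k m c => (if c = t then (1 : 𝕜) else 0) •
      (coord 𝕜 q k * coord 𝕜 q m)) s a b := by
  have e1 : ∀ k l, act₂₃ Q (fun k m c => (if c = t then (1 : 𝕜) else 0) •
      (coord 𝕜 q k * coord 𝕜 q m)) k l b = coord 𝕜 q k * rightMat q Q b l t := by
    intro k l
    rw [rightMat_apply, act₂₃, mul_act]
    simp only [mul_smul_comm]
  simp only [act₁₂, e1, act]
  rw [Matrix.mul_apply, Finset.sum_comm]
  refine Finset.sum_congr rfl fun l _ => ?_
  conv_lhs => rw [rightMat, Finset.sum_mul]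
  simp only [smul_mul_assoc]

/-- The entries of a product of two such matrices are Q₁₂Q₂₃ applied to products of coordinates.
Yang–Baxter moves Q across to those products, where the sphere relation applies; the metric term
returns to the right place by `cup_slide`. The norm relation is `tr_slide`. -/
theorem IsParam.isSphere_rightMat (h : IsParam 𝕜 q Q Q' p z) :
    IsSphere Q (metricS 𝕜 q) p z (rightMat q Q) where
  comm i j := by
    refine Matrix.ext fun s t => ?_
    set w : Fin N → Fin N → Fin N → Sphere 𝕜 N q := fun k m c =>
      (if c = t then (1 : 𝕜) else 0) • (coord 𝕜 q k * coord 𝕜 q m) with hw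
    have e1 := map_act Q (Matrix.entryLinearMap 𝕜 (Sphere 𝕜 N q) s t)
      (fun k l => rightMat q Q k * rightMat q Q l) i j
    simp only [Matrix.entryLinearMap_apply, rightMat_mul_apply] at e1
    have e2 : act₁₂ Q w = fun a b c => p⁻¹ • w a b c + kappaC p z •
        (metricS 𝕜 q a b • (if c = t then (1 : 𝕜) else 0) • (1 : Sphere 𝕜 N q)) := by
      funext a b c
      rw [hw, act₁₂, act_smul, h.isSphere_coord.comm]
      module
    have e3 : act₁₂ Q (act₂₃ Q fun a b c => p⁻¹ • w a b c + kappaC p z •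
        (metricS 𝕜 q a b • (if c = t then (1 : 𝕜) else 0) • (1 : Sphere 𝕜 N q))) =
        fun a b c => p⁻¹ • act₁₂ Q (act₂₃ Q w) a b c + kappaC p z •
        (metricS 𝕜 q b c • (if a = t then (1 : 𝕜) else 0) • (1 : Sphere 𝕜 N q)) := by
      have e4 : (act₂₃ Q fun a b c => p⁻¹ • w a b c + kappaC p z •
          (metricS 𝕜 q a b • (if c = t then (1 : 𝕜) else 0) • (1 : Sphere 𝕜 N q))) =
          fun a b c => p⁻¹ • act₂₃ Q w a b c + kappaC p z • act₁₂ Q' (fun i j k =>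
            metricS 𝕜 q j k • (if i = t then (1 : 𝕜) else 0) • (1 : Sphere 𝕜 N q)) a b c := by
        rw [← h.braid.cup_slide fun c => (if c = t then (1 : 𝕜) else 0) • (1 : Sphere 𝕜 N q)]
        funext a b c
        simp only [act₂₃, act_add, act_smul]
      rw [e4]
      have e5 := h.braid.act₁₂_act₁₂ (fun i j k =>
            metricS 𝕜 q j k • (if i = t then (1 : 𝕜) else 0) • (1 : Sphere 𝕜 N q))
      funext a b c
      have e6 := congrFun₃ e5 a b c
      simp only [act₁₂, act_add, act_smul] at e6 ⊢
      rw [e6]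
    have e7 := congrFun₃ (h.braid.yang_baxter w) s i j
    rw [e2, e3] at e7
    refine e1.trans (e7.symm.trans ?_)
    simp only [Matrix.add_apply, Matrix.smul_apply, rightMat_mul_apply, Matrix.one_apply, ← hw]
    split_ifs <;> simp
  norm := by
    refine Matrix.ext fun s t => ?_
    have e1 := map_tr (metricS 𝕜 q) (Matrix.entryLinearMap 𝕜 (Sphere 𝕜 N q) s t)
      (fun k l => rightMat q Q k * rightMat q Q l)
    simp only [Matrix.entryLinearMap_apply, rightMat_mul_apply] at e1
    set w : Fin N → Fin N → Fin N → Sphere 𝕜 N q := fun k m c =>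
      (if c = t then (1 : 𝕜) else 0) • (coord 𝕜 q k * coord 𝕜 q m) with hw
    have e2 := congrFun (h.braid.tr_slide (act₂₃ Q w)) s
    rw [h.braid.act₂₃_act₂₃'] at e2
    refine e1.trans (e2.symm.trans ?_)
    simp only [hw, tr₁₂, tr_smul, h.isSphere_coord.norm, Matrix.one_apply]
    split_ifs <;> simp

/-- Right multiplication in the frame. -/
theorem IsParam.exists_rightRep (h : IsParam 𝕜 q Q Q' p z) :
    ∃ ρ : Sphere 𝕜 N q →ₐ[𝕜] Matrix (Fin N) (Fin N) (Sphere 𝕜 N q),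
      ∀ j, ρ (coord 𝕜 q j) = rightMat q Q j := by
  have := (h.sphere_iff _ _).1 h.isSphere_rightMat
  exact ⟨Sphere.lift _ this.1 this.2, Sphere.lift_coord _ this.1 this.2⟩

/-- The coordinate functionals of the frame. -/
theorem IsParam.exists_coordinates (h : IsParam 𝕜 q Q Q' p z) :
    ∃ c : Fin N → OneForms 𝕜 N q →ₗ[Sphere 𝕜 N q] Sphere 𝕜 N q,
      ∀ i j, c i (gam q p z j) = if i = j then 1 else 0 := by
  obtain ⟨ρ, hρ⟩ := h.exists_rightRep
  let X := Sphere 𝕜 N q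
  -- The bimodule X^N, with right action through ρ, is realised as the upper right block of a matrix
  -- algebra in which a acts as diag(a, ρ(a)). The universal property of one-forms, stated for
  -- algebras, then applies and sends γ_i to the i-th basis row.
  let f : X →ₐ[𝕜] Matrix (Unit ⊕ Fin N) (Unit ⊕ Fin N) X :=
    { toFun := fun a => Matrix.fromBlocks (Matrix.diagonal fun _ => a) 0 0 (ρ a)
      map_one' := by simp
      map_mul' := fun a b => by simp [Matrix.fromBlocks_multiply]
      map_zero' := by simp
      map_add' := fun a b => by
        rw [Matrix.fromBlocks_add, map_add, Matrix.diagonal_add, add_zero, add_zero]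
      commutes' := fun c => by
        rw [AlgHom.commutes, Matrix.algebraMap_eq_diagonal, Matrix.algebraMap_eq_diagonal]
        refine (Matrix.fromBlocks_diagonal _ _).trans (congrArg _ (funext fun i => ?_))
        rcases i with i | i <;> rfl }
  let row : (Fin N → X) →ₗ[X] Matrix (Unit ⊕ Fin N) (Unit ⊕ Fin N) X :=
    { toFun := fun v => Matrix.fromBlocks 0 (Matrix.of fun _ l => v l) 0 0
      map_add' := fun v w => by
        rw [Matrix.fromBlocks_add]; simp; rfl
      map_smul' := fun a v => by
        rw [RingHom.id_apply, Matrix.fromBlocks_smul]; simp; rfl }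
  have hrow : ∀ v, row v = Matrix.fromBlocks 0 (Matrix.of fun _ l => v l) 0 0 := fun v => rfl
  have hf : ∀ a, f a = Matrix.fromBlocks (Matrix.diagonal fun _ => a) 0 0 (ρ a) := fun a => rfl
  have hleft : ∀ a v, f a * row v = row (a • v) := fun a v => by
    rw [hf, hrow, hrow, Matrix.fromBlocks_multiply]
    congr 1 <;> ext <;> simp
  have hright : ∀ a v, row v * f a = row (Matrix.vecMul v (ρ a)) := fun a v => by
    rw [hf, hrow, hrow, Matrix.fromBlocks_multiply]
    congr 1 <;> ext <;> simp [Matrix.mul_apply, Matrix.vecMul, dotProduct]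
  obtain ⟨g, hl, hr, hg⟩ := h.exists_frame_lift f (fun i => row (Pi.single i 1)) (fun i j => by
    have e := map_act Q (row.restrictScalars 𝕜)
      (fun k l => coord 𝕜 q k • (Pi.single l 1 : Fin N → X)) i j
    simp only [LinearMap.coe_restrictScalars] at e
    simp only [hleft, hright, hρ, ← e]
    congr 1
    funext t
    have e2 := map_act Q (LinearMap.proj (R := 𝕜) (φ := fun _ : Fin N => X) t)
      (fun k l => coord 𝕜 q k • (Pi.single l 1 : Fin N → X)) i j
    simp only [LinearMap.proj_apply] at e2
    rw [e2, Matrix.single_one_vecMul]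
    refine (rightMat_apply i t j).trans ?_
    congr 1
    funext k l
    simp [Pi.single_apply, eq_comm])
  refine ⟨fun i => ⟨⟨fun m => g m (Sum.inl ()) (Sum.inr i), fun m n => ?_⟩, fun a m => ?_⟩,
    fun i j => ?_⟩
  · rw [map_add]; rfl
  · change g (a • m) (Sum.inl ()) (Sum.inr i) = _
    rw [hl, hf, Matrix.mul_apply, Fintype.sum_sum_type]
    simp
  · change g (gam q p z j) (Sum.inl ()) (Sum.inr i) = _
    rw [hg, hrow]
    simp [Pi.single_apply]

end Model

/-! ### A left basis of a bimodule yields one of its tensor square. -/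

section LeftFrame

variable {𝕜 : Type u} [Field 𝕜] {A : Type u} [Ring A] [Algebra 𝕜 A]
variable {M : Type u} [AddCommGroup M] [Module 𝕜 M] [Module A M] [Module Aᵐᵒᵖ M]
  [SMulCommClass A Aᵐᵒᵖ M] [IsScalarTower 𝕜 A M] [IsScalarTower 𝕜 Aᵐᵒᵖ M]

theorem BTensorAlgebra.ι₁_injective : Function.Injective (BTensorAlgebra.ι₁ 𝕜 A M) := by
  refine (injective_iff_map_eq_zero _).2 fun m hm => ?_
  have := truncRep_ι₁ LinearMap.id m ((1 : A), (0 : M), (0 : BTensor 𝕜 A M))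
  rw [hm, map_zero] at this
  simpa using (congrArg (fun x => x.2.1) this).symm

variable (𝕜) in
/-- The functional `m ⊗ n ↦ c (m · c' n)` as a linear map over the ground field. -/
def BTensor.coordinateAux (c c' : M →ₗ[A] A) : BTensor 𝕜 A M →ₗ[𝕜] A :=
  (balancedRel 𝕜 A M).liftQ (TensorProduct.lift
    (LinearMap.mk₂ 𝕜 (fun m n => c (op (c' n) • m))
      (fun m m' n => by rw [smul_add, map_add])
      (fun r m n => by 
        have e : op (c' n) • r • m = r • op (c' n) • m := by
          rw [← algebraMap_smul A r m, ← smul_comm, algebraMap_smul]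
        rw [e, c.map_smul_of_tower])
      (fun m n n' => by rw [map_add, op_add, add_smul, map_add])
      (fun r m n => by
        rw [c'.map_smul_of_tower, op_smul, smul_assoc, c.map_smul_of_tower]))) (by
      rw [balancedRel, Submodule.span_le]
      rintro _ ⟨m, n, a, rfl⟩
      simp [mul_smul])

theorem BTensor.coordinateAux_btmul (c c' : M →ₗ[A] A) (m n : M) :
    BTensor.coordinateAux 𝕜 c c' (btmul 𝕜 A m n) = c (op (c' n) • m) :=
  (Submodule.liftQ_apply ..).trans (by simp)

variable (𝕜) in
/-- The left linear functional `m ⊗ n ↦ c (m · c' n)`. -/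
def BTensor.coordinate (c c' : M →ₗ[A] A) : BTensor 𝕜 A M →ₗ[A] A where
  toFun := BTensor.coordinateAux 𝕜 c c'
  map_add' := map_add _
  map_smul' a t := by
    induction t using BTensor.induction with
    | h0 => rw [smul_zero, map_zero, smul_zero]
    | ht m n =>
      rw [smul_btmul, coordinateAux_btmul, coordinateAux_btmul, ← smul_comm a, map_smul]
      rfl
    | ha s t hs ht => rw [smul_add, map_add, map_add, smul_add, hs, ht]

theorem BTensor.coordinate_btmul (c c' : M →ₗ[A] A) (m n : M) :
    BTensor.coordinate 𝕜 c c' (btmul 𝕜 A m n) = c (op (c' n) • m) :=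
  coordinateAux_btmul c c' m n

variable {ι : Type*} [Fintype ι] [DecidableEq ι] {γ : ι → M} {c : ι → M →ₗ[A] A}

theorem sum_coordinate_smul (hc : ∀ i j, c i (γ j) = if i = j then 1 else 0)
    (hγ : Submodule.span A (Set.range γ) = ⊤) (m : M) : ∑ i, c i m • γ i = m := by
  have h : m ∈ Submodule.span A (Set.range γ) := hγ ▸ Submodule.mem_top
  induction h using Submodule.span_induction with
  | mem x hx => obtain ⟨j, rfl⟩ := hx; simp [hc]
  | zero => simp
  | add x y _ _ hx hy => simp only [map_add, add_smul, Finset.sum_add_distrib, hx, hy]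
  | smul a x _ hx => simp only [map_smul, smul_eq_mul, mul_smul, ← Finset.smul_sum, hx]

theorem BTensor.sum_coordinate_smul (hc : ∀ i j, c i (γ j) = if i = j then 1 else 0)
    (hγ : Submodule.span A (Set.range γ) = ⊤) (t : BTensor 𝕜 A M) :
    ∑ i, ∑ j, BTensor.coordinate 𝕜 (c i) (c j) t • btmul 𝕜 A (γ i) (γ j) = t := by
  induction t using BTensor.induction with
  | h0 => simp
  | ht m n =>
    simp only [coordinate_btmul, smul_btmul]
    rw [Finset.sum_comm]
    have e1 : ∀ j, ∑ i, btmul 𝕜 A (c i (op (c j n) • m) • γ i) (γ j) =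
        btmul 𝕜 A m (c j n • γ j) := by
      intro j
      rw [← btmul_balanced]
      conv_rhs => rw [← QSphere.sum_coordinate_smul hc hγ (op (c j n) • m)]
      simp only [btmul, TensorProduct.sum_tmul, map_sum]
    simp only [e1]
    conv_rhs => rw [← QSphere.sum_coordinate_smul hc hγ n]
    simp only [btmul, TensorProduct.tmul_sum, map_sum]
  | ha s t hs ht =>
    simp only [map_add, add_smul, Finset.sum_add_distrib, hs, ht]

theorem BTensor.coordinate_frame (hc : ∀ i j, c i (γ j) = if i = j then 1 else 0) (i j k l : ι) :
    BTensor.coordinate 𝕜 (c i) (c j) (btmul 𝕜 A (γ k) (γ l)) =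
      if i = k ∧ j = l then 1 else 0 := by
  rw [coordinate_btmul, hc]
  by_cases h : j = l
  · simp [h, hc]
  · simp [h]

theorem BTensor.frame_ext (hγ : Submodule.span A (Set.range γ) = ⊤)
    (hc : ∀ i j, c i (γ j) = if i = j then 1 else 0)
    {V : Type*} [AddCommGroup V] [Module A V] {f g : BTensor 𝕜 A M →ₗ[A] V}
    (h : ∀ i j, f (btmul 𝕜 A (γ i) (γ j)) = g (btmul 𝕜 A (γ i) (γ j))) : f = g := by
  ext t
  rw [← BTensor.sum_coordinate_smul hc hγ t]
  simp only [map_sum, map_smul, h]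

theorem BTensor.exists_frame_map (hc : ∀ i j, c i (γ j) = if i = j then 1 else 0)
    {V : Type*} [AddCommGroup V] [Module A V] (w : ι → ι → V) :
    ∃ f : BTensor 𝕜 A M →ₗ[A] V, ∀ i j, f (btmul 𝕜 A (γ i) (γ j)) = w i j := by
  refine ⟨∑ i, ∑ j, (BTensor.coordinate 𝕜 (c i) (c j)).smulRight (w i j), fun k l => ?_⟩
  simp only [LinearMap.sum_apply, LinearMap.smulRight_apply, coordinate_frame hc, ite_and,
    ite_smul, one_smul, zero_smul, Finset.sum_ite_irrel, Finset.sum_const_zero,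
    Finset.sum_ite_eq', Finset.mem_univ, if_true]

end LeftFrame

/-! ### Existence and uniqueness of the braiding. -/

section Braiding

variable {𝕜 : Type u} [RCLike 𝕜] {N : ℕ} {q : ℝ}
variable {Q Q' : Fin N → Fin N → Fin N → Fin N → 𝕜} {p z : 𝕜}

theorem IsParam.eta_eq (h : IsParam 𝕜 q Q Q' p z) : eta 𝕜 q =
    gC p z • tr (metricS 𝕜 q) (fun k l : Fin N => coord 𝕜 q k • gam q p z l) := by
  apply BTensorAlgebra.ι₁_injective (𝕜 := 𝕜) (A := Sphere 𝕜 N q)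
  rw [h.eta_rel (BTensorAlgebra.ι₁_left 𝕜 _ _), map_smul, map_tr]
  simp only [BTensorAlgebra.ι₁_left]

theorem IsParam.span_gam (h : IsParam 𝕜 q Q Q' p z) :
    Submodule.span (Sphere 𝕜 N q) (Set.range (gam q p z : Fin N → OneForms 𝕜 N q)) = ⊤ := by
  have hk : ∀ (S : Submodule (Sphere 𝕜 N q) (OneForms 𝕜 N q)) (c : 𝕜) {m}, m ∈ S → c • m ∈ S :=
    fun S c m hm => by rw [← algebraMap_smul (Sphere 𝕜 N q)]; exact S.smul_mem _ hm
  have hγ : ∀ i, gam q p z i ∈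
      Submodule.span (Sphere 𝕜 N q) (Set.range (gam q p z : Fin N → OneForms 𝕜 N q)) :=
    fun i => Submodule.subset_span ⟨i, rfl⟩
  rw [← top_le_iff, ← span_dx, Submodule.span_le]
  rintro _ ⟨i, rfl⟩
  have e : dx 𝕜 q i = gam q p z i - alphaC p z • coord 𝕜 q i • eta 𝕜 q := by
    rw [gam, add_sub_cancel_right]
  rw [e, SetLike.mem_coe, h.eta_eq]
  exact sub_mem (hγ i) (hk _ _ (Submodule.smul_mem _ _ (hk _ _ (sum_mem fun k _ =>
    sum_mem fun l _ => hk _ _ (Submodule.smul_mem _ _ (hγ l))))))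

theorem IsParam.op_smul_gam_gam (h : IsParam 𝕜 q Q Q' p z) (i j k : Fin N) :
    op (coord 𝕜 q k) • tens (gam q p z i) (gam q p z j) = act₂₃ Q (act₁₂ Q
      (fun a b c => coord 𝕜 q a • tens (gam q p z b) (gam q p z c))) i j k := by
  apply BTensorAlgebra.ι₂_injective (𝕜 := 𝕜) (A := Sphere 𝕜 N q)
  rw [map_act₂₃]
  simp only [map_act₁₂]
  rw [BTensorAlgebra.ι₂, wedge₂_op_smul, wedge₂_btmul]
  simp only [wedge₂_smul, wedge₂_btmul]
  exact frame_frame_mul (h.frame_rel (BTensorAlgebra.ι₁_left 𝕜 _ _)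
    (BTensorAlgebra.ι₁_right 𝕜 _ _)) i j k

/-- A left linear map on two-tensors is right linear if it is so on the frame for coordinates. -/
theorem IsParam.right_linear (h : IsParam 𝕜 q Q Q' p z)
    {σ : TwoTensors 𝕜 N q →ₗ[Sphere 𝕜 N q] TwoTensors 𝕜 N q}
    (hσ : ∀ i j k : Fin N, σ (op (coord 𝕜 q k) • tens (gam q p z i) (gam q p z j)) =
      op (coord 𝕜 q k) • σ (tens (gam q p z i) (gam q p z j)))
    (a : Sphere 𝕜 N q) (t : TwoTensors 𝕜 N q) : σ (op a • t) = op a • σ t := by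
  obtain ⟨c, hc⟩ := h.exists_coordinates
  induction a using Sphere.induction generalizing t with
  | h1 r =>
    have e : op (algebraMap 𝕜 (Sphere 𝕜 N q) r) = algebraMap 𝕜 (Sphere 𝕜 N q)ᵐᵒᵖ r := rfl
    rw [e, algebraMap_smul, algebraMap_smul, LinearMap.map_smul_of_tower]
  | hx k =>
    have e := BTensor.sum_coordinate_smul (𝕜 := 𝕜) hc h.span_gam t
    rw [← e]
    simp only [Finset.smul_sum, map_sum, ← smul_comm _ (op (coord 𝕜 q k)), map_smul, hσ]
  | ha a b ha hb => rw [op_add, add_smul, map_add, ha, hb, add_smul]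
  | hm a b ha hb => rw [op_mul, mul_smul, mul_smul, hb, ha]

/-- A left linear map is free on the frame tensors, so only right linearity is at stake, and this is
Yang–Baxter. Both Q and Q' are allowed, because R⁻ is Q for γ⁻ and Q' for γ⁺. -/
theorem IsParam.existsUnique_braiding (h : IsParam 𝕜 q Q Q' p z)
    {P : Fin N → Fin N → Fin N → Fin N → 𝕜} (hP : P = Q ∨ P = Q') (r : 𝕜) :
    ∃! σ : TwoTensors 𝕜 N q →ₗ[Sphere 𝕜 N q] TwoTensors 𝕜 N q,
      (∀ (a : Sphere 𝕜 N q) (t : TwoTensors 𝕜 N q), σ (op a • t) = op a • σ t) ∧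
      ∀ i j, σ (tens (gam q p z i) (gam q p z j)) =
        r • act P (fun k l => tens (gam q p z k) (gam q p z l)) i j := by
  obtain ⟨c, hc⟩ := h.exists_coordinates
  obtain ⟨σ, hσ⟩ := BTensor.exists_frame_map (𝕜 := 𝕜) hc
    (fun i j => r • act P (fun k l => tens (gam q p z k) (gam q p z l)) i j)
  refine ⟨σ, ⟨h.right_linear fun i j k => ?_, hσ⟩, fun τ hτ => BTensor.frame_ext h.span_gam hc
    fun i j => (hτ.2 i j).trans (hσ i j).symm⟩
  set w : Fin N → Fin N → Fin N → TwoTensors 𝕜 N q :=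
    fun a b c => coord 𝕜 q a • tens (gam q p z b) (gam q p z c) with hw
  -- For P = Q' this is the mixed form of Yang–Baxter, got by cancelling Q against Q'.
  have ybe : act₁₂ P (act₂₃ Q (act₁₂ Q w)) = act₂₃ Q (act₁₂ Q (act₂₃ P w)) := by
    rcases hP with rfl | rfl
    · exact h.braid.yang_baxter w
    · have e := h.braid.yang_baxter (act₂₃ P w)
      rw [h.braid.act₂₃_act₂₃] at e
      rw [← e, h.braid.act₁₂_act₁₂']
  have e1 : σ (op (coord 𝕜 q k) • tens (gam q p z i) (gam q p z j)) =
      r • act₂₃ Q (act₁₂ Q (act₂₃ P w)) i j k := by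
    let σ' : TwoTensors 𝕜 N q →ₗ[𝕜] TwoTensors 𝕜 N q := σ.restrictScalars 𝕜
    have e2 : ∀ a b c, σ' (w a b c) = r • act₂₃ P w a b c := fun a b c => by
      change σ (coord 𝕜 q a • _) = _
      rw [map_smul, hσ, act₂₃, hw]
      have := map_act P (Algebra.lsmul 𝕜 𝕜 (TwoTensors 𝕜 N q) (coord 𝕜 q a))
        (fun k l => tens (gam q p z k) (gam q p z l)) b c
      simp only [Algebra.lsmul_coe] at this
      rw [← this, smul_comm]
    rw [h.op_smul_gam_gam]
    refine (map_act₂₃ Q σ' _ i j k).trans ?_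
    simp only [map_act₁₂ Q σ', ← hw, e2]
    simp only [act₁₂, act₂₃, act_smul]
    rfl
  have e3 : op (coord 𝕜 q k) • σ (tens (gam q p z i) (gam q p z j)) =
      r • act₁₂ P (act₂₃ Q (act₁₂ Q w)) i j k := by
    have := map_act P (Algebra.lsmul 𝕜 𝕜 (TwoTensors 𝕜 N q) (op (coord 𝕜 q k)))
        (fun k l => tens (gam q p z k) (gam q p z l)) i j
    simp only [Algebra.lsmul_coe, h.op_smul_gam_gam] at this
    rw [hσ, smul_comm, this, act₁₂]
  rw [e1, e3, ybe]

end Braiding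

/-! ### The tensors of the statement and their images in algebras. -/

section Tensors

variable {𝕜 : Type u} [RCLike 𝕜] {N : ℕ} {q : ℝ}
variable {Q Q' : Fin N → Fin N → Fin N → Fin N → 𝕜} {p z : 𝕜}

theorem two_div_betaC (hN : 3 ≤ N) :
    ((2 * q * ((1 + q ^ (N - 2)) / ((1 - q) * (1 - q ^ (N - 1)))) : ℝ) : 𝕜) =
      2 / betaC (q : 𝕜) ((q : 𝕜) ^ (N - 2)) := by
  have e1 : q ^ (N - 1) = q * q ^ (N - 2) := by rw [← pow_succ']; congr 1; omega
  rw [e1, betaC, div_div_eq_mul_div, mul_div_assoc, mul_assoc]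
  push_cast
  ring

variable (N q p z) in
/-- The two-tensor `C^{ij} γ_i ⊗ γ_j`. -/
def traceT : TwoTensors 𝕜 N q :=
  tr (metricS 𝕜 q) (fun i j => tens (gam q p z i) (gam q p z j))

variable (q p z) in
/-- The two-tensors fixed by the braiding with one free index. -/
def fixedT (l : Fin N) : TwoTensors 𝕜 N q :=
  p • tens (gam q p z l) (eta 𝕜 q) + tens (eta 𝕜 q) (gam q p z l)
    + cC p z • coord 𝕜 q l • traceT N q p z

variable (q Q p z) in
/-- The two-tensors fixed by the braiding with two free indices. -/
def symT (i j : Fin N) : TwoTensors 𝕜 N q :=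
  p • tens (gam q p z i) (gam q p z j)
    + act Q (fun k l => tens (gam q p z k) (gam q p z l)) i j
    - (p * cC p z * kappaC p z / betaC p z) • metricS 𝕜 q i j • traceT N q p z

section Rep

variable {T : Type u} [Ring T] [Algebra 𝕜 T] {f : Sphere 𝕜 N q →ₐ[𝕜] T}
  {g : OneForms 𝕜 N q →ₗ[𝕜] T} (hl : ∀ a m, g (a • m) = f a * g m)
  (hr : ∀ a m, g (op a • m) = g m * f a)

theorem wedge₂_traceT : wedge₂ f g hl hr (traceT N q p z) =
    tr (metricS 𝕜 q) (fun i j => g (gam q p z i) * g (gam q p z j)) := by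
  rw [traceT, map_tr]
  simp only [wedge₂_btmul]

theorem wedge₂_fixedT (l : Fin N) : wedge₂ f g hl hr (fixedT q p z l) =
    fixedForm (metricS 𝕜 q) p z (fun i => f (coord 𝕜 q i)) (fun i => g (gam q p z i))
      (g (eta 𝕜 q)) l := by
  rw [fixedT, map_add, map_add, map_smul, map_smul, wedge₂_smul, wedge₂_traceT, wedge₂_btmul,
    wedge₂_btmul]
  rfl

theorem wedge₂_symT (i j : Fin N) : wedge₂ f g hl hr (symT q Q p z i j) =
    symForm Q (metricS 𝕜 q) p z (fun i => g (gam q p z i)) i j := by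
  rw [symT, map_sub, map_add, map_smul, map_smul, map_smul, map_act, wedge₂_traceT, wedge₂_btmul]
  simp only [wedge₂_btmul]
  rfl

theorem map_dx (hl : ∀ a m, g (a • m) = f a * g m) (i : Fin N) : g (dx 𝕜 q i) =
    g (gam q p z i) - alphaC p z • (f (coord 𝕜 q i) * g (eta 𝕜 q)) := by
  rw [gam, map_add, map_smul, hl, add_sub_cancel_right]

/-- Valid for both frames: the coefficient in [II] depends on the parameters only through β. For
[I], in contrast, only the parameters of γ⁻ are used. -/
theorem IsParam.wedge₂_tensorII (h : IsParam 𝕜 q Q Q' p z) (hN : 3 ≤ N) :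
    wedge₂ f g hl hr (tensorII 𝕜 N q) =
      metricForm (metricS 𝕜 q) p z (fun i => f (coord 𝕜 q i)) (fun i => g (gam q p z i))
        (g (eta 𝕜 q)) := by
  have e : tensorII 𝕜 N q = tr (metricS 𝕜 q) (fun m n => tens (dx 𝕜 q m) (dx 𝕜 q n)) +
      (2 / betaC p z) • tr (metricS 𝕜 q)
        (fun k l => coord 𝕜 q k • tens (eta 𝕜 q) (dx 𝕜 q l)) := by
    rw [h.beta_eq, ← two_div_betaC hN]
    rfl
  rw [e, metricForm, map_add, map_smul, map_tr, map_tr]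
  simp only [wedge₂_smul, wedge₂_btmul, map_dx (p := p) (z := z) hl]

theorem wedge₂_tensorI (hN : 3 ≤ N) (i j : Fin N) :
    wedge₂ f g hl hr (tensorI 𝕜 q i j) =
      quadForm (RinvS 𝕜 q) (metricS 𝕜 q) (q : 𝕜) ((q : 𝕜) ^ (N - 2))
        (fun i => f (coord 𝕜 q i)) (fun i => g (gam q (q : 𝕜) ((q : 𝕜) ^ (N - 2)) i))
        (g (eta 𝕜 q)) i j := by
  have e2 : (((1 + q ^ 2) * (1 + q ^ (N - 2)) ^ 2 / (1 - q ^ (N - 1)) ^ 2 : ℝ) : 𝕜) =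
      (1 + (q : 𝕜) ^ 2) * (1 + (q : 𝕜) ^ (N - 2)) ^ 2 / (1 - q * (q : 𝕜) ^ (N - 2)) ^ 2 := by
    have e1 : q ^ (N - 1) = q * q ^ (N - 2) := by rw [← pow_succ']; congr 1; omega
    rw [e1]; push_cast; rfl
  have e3 : ((q ^ (N - 2) * ((1 + q) * (1 + q ^ 2) * (1 + q ^ (N - 2)) /
      (1 - q ^ (N - 1)) ^ 2) : ℝ) : 𝕜) = (q : 𝕜) ^ (N - 2) * ((1 + (q : 𝕜)) * (1 + (q : 𝕜) ^ 2) *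
      (1 + (q : 𝕜) ^ (N - 2)) / (1 - q * (q : 𝕜) ^ (N - 2)) ^ 2) := by
    have e1 : q ^ (N - 1) = q * q ^ (N - 2) := by rw [← pow_succ']; congr 1; omega
    rw [e1]; push_cast; rfl
  have e4 : ∑ k, ∑ l, (Kmat q k l i j : 𝕜) • coord 𝕜 q k • tens (eta 𝕜 q) (dx 𝕜 q l) =
      metricS 𝕜 q i j • tr (metricS 𝕜 q)
        (fun k l => coord 𝕜 q k • tens (eta 𝕜 q) (dx 𝕜 q l)) := by
    simp only [tr, Finset.smul_sum, smul_smul, Kmat, metricS]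
    push_cast
    simp only [mul_comm]
  have e5 := cubic_coeff_q (q := q) 𝕜 hN
  have e : tensorI 𝕜 q i j = act (RinvS 𝕜 q) (fun k l => tens (dx 𝕜 q k) (dx 𝕜 q l)) i j
    + (q : 𝕜) • tens (dx 𝕜 q i) (dx 𝕜 q j)
    - ((q : 𝕜) * ((1 - (q : 𝕜)) * (1 + (q : 𝕜) ^ (N - 2)) / (1 - q * (q : 𝕜) ^ (N - 2)))) •
      coord 𝕜 q i • tens (eta 𝕜 q) (dx 𝕜 q j)
    - ((1 - (q : 𝕜)) * (1 + (q : 𝕜) ^ (N - 2)) / (1 - q * (q : 𝕜) ^ (N - 2))) •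
      act (RinvS 𝕜 q) (fun k l => coord 𝕜 q k • tens (eta 𝕜 q) (dx 𝕜 q l)) i j
    - ((1 + (q : 𝕜) ^ 2) * (1 + (q : 𝕜) ^ (N - 2)) ^ 2 / (1 - q * (q : 𝕜) ^ (N - 2)) ^ 2) •
      (coord 𝕜 q i * coord 𝕜 q j) • tr (metricS 𝕜 q)
        (fun k l => coord 𝕜 q k • tens (eta 𝕜 q) (dx 𝕜 q l))
    + ((q : 𝕜) ^ (N - 2) * ((1 + (q : 𝕜)) * (1 + (q : 𝕜) ^ 2) *
      (1 + (q : 𝕜) ^ (N - 2)) / (1 - q * (q : 𝕜) ^ (N - 2)) ^ 2)) • metricS 𝕜 q i j •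
        tr (metricS 𝕜 q) (fun k l => coord 𝕜 q k • tens (eta 𝕜 q) (dx 𝕜 q l)) := by
    rw [tensorI, e2, e3, e4, RCLike.ofReal_mul, e5]
    rfl
  rw [e, quadForm]
  simp only [map_add, map_sub, map_smul, map_act, map_tr, wedge₂_smul, wedge₂_btmul,
    map_mul, map_dx (p := (q : 𝕜)) (z := (q : 𝕜) ^ (N - 2)) hl]

end Rep

end Tensors

/-- Keeps only the shape of `quadForm_eq`; the values of the coefficients are irrelevant for
membership arguments. -/
theorem exists_quadForm_eq {F : Type*} [Field F] {N : ℕ} {T : Type*} [Ring T] [Algebra F T]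
    {Q Q' : Fin N → Fin N → Fin N → Fin N → F} {C : Fin N → Fin N → F} {p z : F}
    {x γ : Fin N → T} {η : T} (h : IsBraidPair Q Q' C p z) (hg : IsGeneric p z)
    (hx : IsSphere Q C p z x) (hγ : ∀ i j, γ i * x j = act Q (fun k l => x k * γ l) i j)
    (hη : η = gC p z • tr C (fun k l => x k * γ l)) : ∃ a b c : F, ∀ i j,
    quadForm Q C p z x γ η i j = symForm Q C p z γ i j
      - a • (act Q (fun k l => x k * fixedForm C p z x γ η l) i j
        + p • (x i * fixedForm C p z x γ η j))
      + b • (x i * x j * metricForm C p z x γ η) + c • C i j • metricForm C p z x γ η :=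
  ⟨_, _, _, quadForm_eq h hg hx hγ hη⟩

/-! ### Fixed points of the normalised braiding. -/

section Kernel

variable {𝕜 : Type u} [RCLike 𝕜] {N : ℕ} {q : ℝ}
variable {Q Q' : Fin N → Fin N → Fin N → Fin N → 𝕜} {p z : 𝕜}

theorem ι₁_frame_rel (h : IsParam 𝕜 q Q Q' p z) (i j : Fin N) :
    BTensorAlgebra.ι₁ 𝕜 (Sphere 𝕜 N q) (OneForms 𝕜 N q) (gam q p z i) *
      BTensorAlgebra.ι₀ 𝕜 (Sphere 𝕜 N q) (OneForms 𝕜 N q) (coord 𝕜 q j) =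
    act Q (fun k l => BTensorAlgebra.ι₀ 𝕜 (Sphere 𝕜 N q) (OneForms 𝕜 N q) (coord 𝕜 q k) *
      BTensorAlgebra.ι₁ 𝕜 (Sphere 𝕜 N q) (OneForms 𝕜 N q) (gam q p z l)) i j :=
  h.frame_rel (BTensorAlgebra.ι₁_left 𝕜 _ _) (BTensorAlgebra.ι₁_right 𝕜 _ _) i j

theorem IsParam.tensorII_eq (h : IsParam 𝕜 q Q Q' p z) (hN : 3 ≤ N) :
    tensorII 𝕜 N q = ((1 - p ^ 2 * z) / ((1 + p ^ 2) * betaC p z)) •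
      tr (metricS 𝕜 q) (fun k l => coord 𝕜 q k • fixedT q p z l) := by
  apply BTensorAlgebra.ι₂_injective (𝕜 := 𝕜) (A := Sphere 𝕜 N q)
  rw [map_smul, map_tr, BTensorAlgebra.ι₂, h.wedge₂_tensorII _ _ hN]
  simp only [wedge₂_smul, wedge₂_fixedT]
  exact metricForm_eq h.braid h.generic (h.isSphere_coord.map _) (ι₁_frame_rel h)
    (h.eta_rel (BTensorAlgebra.ι₁_left 𝕜 _ _))

theorem IsParam.fixedTrace_op_smul (h : IsParam 𝕜 q Q Q' p z) (j : Fin N) :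
    op (coord 𝕜 q j) • tr (metricS 𝕜 q) (fun k l => coord 𝕜 q k • fixedT q p z l)
      - p ^ 2 • coord 𝕜 q j • tr (metricS 𝕜 q) (fun k l => coord 𝕜 q k • fixedT q p z l) =
    ((p + p⁻¹) * (gC p z)⁻¹ * betaC p z) • fixedT q p z j := by
  apply BTensorAlgebra.ι₂_injective (𝕜 := 𝕜) (A := Sphere 𝕜 N q)
  rw [map_sub, BTensorAlgebra.ι₂, wedge₂_op_smul, map_smul _ (p ^ 2), wedge₂_smul, map_smul,
    map_tr]
  simp only [wedge₂_smul, wedge₂_fixedT]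
  exact fixedTrace_mul h.braid h.generic (h.isSphere_coord.map _) (ι₁_frame_rel h)
    (h.eta_rel (BTensorAlgebra.ι₁_left 𝕜 _ _)) j

theorem IsParam.fixedT_op_smul (h : IsParam 𝕜 q Q Q' p z) (i j : Fin N) :
    op (coord 𝕜 q i) • fixedT q p z j
      - p • act Q (fun k l => coord 𝕜 q k • fixedT q p z l) j i =
    betaC p z • symT q Q p z j i := by
  apply BTensorAlgebra.ι₂_injective (𝕜 := 𝕜) (A := Sphere 𝕜 N q)
  rw [map_sub, BTensorAlgebra.ι₂, wedge₂_op_smul, map_smul, map_smul, map_act]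
  simp only [wedge₂_smul, wedge₂_fixedT, wedge₂_symT]
  exact fixedForm_mul h.braid h.generic (h.isSphere_coord.map _) (ι₁_frame_rel h)
    (h.eta_rel (BTensorAlgebra.ι₁_left 𝕜 _ _)) i j

theorem exists_tensorI_eq (hq : 0 < q) (hq1 : q ≠ 1) (hN : 3 ≤ N) :
    ∃ a b c : 𝕜, ∀ i j : Fin N, tensorI 𝕜 q i j =
      symT q (RinvS 𝕜 q) (q : 𝕜) ((q : 𝕜) ^ (N - 2)) i j
      - a • (act (RinvS 𝕜 q) (fun k l => coord 𝕜 q k •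
          fixedT q (q : 𝕜) ((q : 𝕜) ^ (N - 2)) l) i j
        + (q : 𝕜) • coord 𝕜 q i • fixedT q (q : 𝕜) ((q : 𝕜) ^ (N - 2)) j)
      + b • (coord 𝕜 q i * coord 𝕜 q j) • tensorII 𝕜 N q
      + c • metricS 𝕜 q i j • tensorII 𝕜 N q := by
  have h := isParam_minus 𝕜 hq hq1 hN
  obtain ⟨a, b, c, hc⟩ := exists_quadForm_eq h.braid h.generic (h.isSphere_coord.map
    (BTensorAlgebra.ι₀ 𝕜 (Sphere 𝕜 N q) (OneForms 𝕜 N q))) (ι₁_frame_rel h)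
    (h.eta_rel (BTensorAlgebra.ι₁_left 𝕜 _ _))
  refine ⟨a, b, c, fun i j => ?_⟩
  apply BTensorAlgebra.ι₂_injective (𝕜 := 𝕜) (A := Sphere 𝕜 N q)
  rw [BTensorAlgebra.ι₂, wedge₂_tensorI _ _ hN, hc]
  simp only [map_add, map_sub, map_smul, map_act, wedge₂_smul, wedge₂_fixedT, wedge₂_symT,
    h.wedge₂_tensorII _ _ hN, map_mul]

theorem exists_tr_tensorI (hq : 0 < q) (hq1 : q ≠ 1) (hN : 3 ≤ N) : ∃ c : 𝕜, ∀ j : Fin N,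
    tr (metricS 𝕜 q) (fun k l => coord 𝕜 q k • tensorI 𝕜 q l j) =
      fixedT q (q : 𝕜) ((q : 𝕜) ^ (N - 2)) j + c • coord 𝕜 q j • tensorII 𝕜 N q := by
  have h := isParam_minus 𝕜 hq hq1 hN
  obtain ⟨c, hc⟩ := tr_coord_quadForm h.braid h.generic (h.isSphere_coord.map
    (BTensorAlgebra.ι₀ 𝕜 (Sphere 𝕜 N q) (OneForms 𝕜 N q))) (ι₁_frame_rel h)
    (h.eta_rel (BTensorAlgebra.ι₁_left 𝕜 _ _))
  refine ⟨c, fun j => ?_⟩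
  apply BTensorAlgebra.ι₂_injective (𝕜 := 𝕜) (A := Sphere 𝕜 N q)
  rw [BTensorAlgebra.ι₂, map_tr]
  simp only [map_add, map_smul, wedge₂_smul, wedge₂_fixedT, wedge₂_tensorI _ _ hN,
    h.wedge₂_tensorII _ _ hN]
  exact hc j

theorem IsParam.tens_gam_eta (h : IsParam 𝕜 q Q Q' p z) (i : Fin N) :
    tens (gam q p z i) (eta 𝕜 q) = gC p z • tr₂₃ (metricS 𝕜 q) (act₁₂ Q
      (fun a b c => coord 𝕜 q a • tens (gam q p z b) (gam q p z c))) i := by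
  apply BTensorAlgebra.ι₂_injective (𝕜 := 𝕜) (A := Sphere 𝕜 N q)
  rw [map_smul, tr₂₃, map_tr]
  simp only [map_act₁₂]
  rw [BTensorAlgebra.ι₂, wedge₂_btmul]
  simp only [wedge₂_smul, wedge₂_btmul]
  exact frame_eta (ι₁_frame_rel h) (h.eta_rel (BTensorAlgebra.ι₁_left 𝕜 _ _)) i

theorem IsParam.tens_eta_gam (h : IsParam 𝕜 q Q Q' p z) (i : Fin N) :
    tens (eta 𝕜 q) (gam q p z i) = gC p z • tr₁₂ (metricS 𝕜 q)
      (fun a b c => coord 𝕜 q a • tens (gam q p z b) (gam q p z c)) i := by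
  apply BTensorAlgebra.ι₂_injective (𝕜 := 𝕜) (A := Sphere 𝕜 N q)
  rw [map_smul, tr₁₂, map_tr, BTensorAlgebra.ι₂, wedge₂_btmul]
  simp only [wedge₂_smul, wedge₂_btmul]
  exact eta_frame (h.eta_rel (BTensorAlgebra.ι₁_left 𝕜 _ _)) i

theorem IsParam.tr_coord_act_tens (h : IsParam 𝕜 q Q Q' p z) (j : Fin N) :
    tr (metricS 𝕜 q) (fun k l => coord 𝕜 q k •
      act Q (fun a b => tens (gam q p z a) (gam q p z b)) l j) =
      (gC p z)⁻¹ • tens (gam q p z j) (eta 𝕜 q)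
        + (p - p⁻¹) • coord 𝕜 q j • traceT N q p z
        - ((p - p⁻¹) * (gC p z)⁻¹) • tens (eta 𝕜 q) (gam q p z j) := by
  apply BTensorAlgebra.ι₂_injective (𝕜 := 𝕜) (A := Sphere 𝕜 N q)
  rw [BTensorAlgebra.ι₂, map_tr]
  simp only [map_add, map_sub, map_smul, wedge₂_smul, map_act, wedge₂_btmul, wedge₂_traceT]
  exact tr_coord_act_frame_frame h.braid h.generic (ι₁_frame_rel h)
    (h.eta_rel (BTensorAlgebra.ι₁_left 𝕜 _ _)) j

/-- The braiding normalised to have non-trivial fixed points. -/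
structure IsTwist (q : ℝ) (Q : Fin N → Fin N → Fin N → Fin N → 𝕜) (p z : 𝕜)
    (τ : TwoTensors 𝕜 N q →ₗ[Sphere 𝕜 N q] TwoTensors 𝕜 N q) : Prop where
  right_linear : ∀ (a : Sphere 𝕜 N q) (t : TwoTensors 𝕜 N q), τ (op a • t) = op a • τ t
  apply_gam : ∀ i j, τ (tens (gam q p z i) (gam q p z j)) =
    p • act Q (fun k l => tens (gam q p z k) (gam q p z l)) i j

section Twist

variable {τ : TwoTensors 𝕜 N q →ₗ[Sphere 𝕜 N q] TwoTensors 𝕜 N q}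

theorem IsTwist.apply_coord_smul (hτ : IsTwist q Q p z τ) (a b c : Fin N) :
    τ (coord 𝕜 q a • tens (gam q p z b) (gam q p z c)) =
      p • act₂₃ Q (fun a b c => coord 𝕜 q a • tens (gam q p z b) (gam q p z c)) a b c := by
  have := map_act Q (Algebra.lsmul 𝕜 𝕜 (TwoTensors 𝕜 N q) (coord 𝕜 q a))
    (fun k l => tens (gam q p z k) (gam q p z l)) b c
  simp only [Algebra.lsmul_coe] at this
  rw [map_smul, hτ.apply_gam, act₂₃, ← this, smul_comm]

theorem map_tr_left {V W : Type*} [AddCommGroup V] [Module 𝕜 V] [Module (Sphere 𝕜 N q) V]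
    [IsScalarTower 𝕜 (Sphere 𝕜 N q) V]
    [AddCommGroup W] [Module 𝕜 W] [Module (Sphere 𝕜 N q) W] [IsScalarTower 𝕜 (Sphere 𝕜 N q) W]
    (f : V →ₗ[Sphere 𝕜 N q] W) (C : Fin N → Fin N → 𝕜) (v : Fin N → Fin N → V) :
    f (tr C v) = tr C (fun a b => f (v a b)) := map_tr C (f.restrictScalars 𝕜) v

theorem map_act_left {V W : Type*} [AddCommGroup V] [Module 𝕜 V] [Module (Sphere 𝕜 N q) V]
    [IsScalarTower 𝕜 (Sphere 𝕜 N q) V]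
    [AddCommGroup W] [Module 𝕜 W] [Module (Sphere 𝕜 N q) W] [IsScalarTower 𝕜 (Sphere 𝕜 N q) W]
    (f : V →ₗ[Sphere 𝕜 N q] W) (P : Fin N → Fin N → Fin N → Fin N → 𝕜)
    (v : Fin N → Fin N → V) (i j : Fin N) :
    f (act P v i j) = act P (fun a b => f (v a b)) i j := map_act P (f.restrictScalars 𝕜) v i j

/-- The tensor γ_i ⊗ η carries a contraction over two crossings; applying Q to it undoes one of them
by the sliding rule, which is η ⊗ γ_i. -/
theorem IsTwist.apply_gam_eta (h : IsParam 𝕜 q Q Q' p z) (hτ : IsTwist q Q p z τ) (i : Fin N) :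
    τ (tens (gam q p z i) (eta 𝕜 q)) = p • tens (eta 𝕜 q) (gam q p z i) := by
  rw [h.tens_gam_eta, h.tens_eta_gam, τ.map_smul_of_tower, tr₂₃, map_tr_left]
  simp only [act₁₂, map_act_left, hτ.apply_coord_smul, act_smul, tr_smul]
  rw [smul_comm]
  congr 2
  set w : Fin N → Fin N → Fin N → TwoTensors 𝕜 N q :=
    fun a b c => coord 𝕜 q a • tens (gam q p z b) (gam q p z c)
  have e := congrFun (h.braid.tr_slide (act₂₃ Q w)) i
  rw [h.braid.act₂₃_act₂₃'] at e
  exact e.symm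

theorem IsTwist.apply_eta_gam (h : IsParam 𝕜 q Q Q' p z) (hτ : IsTwist q Q p z τ) (i : Fin N) :
    τ (tens (eta 𝕜 q) (gam q p z i)) = p • (tens (gam q p z i) (eta 𝕜 q)
      + ((p - p⁻¹) * gC p z) • coord 𝕜 q i • traceT N q p z
      - (p - p⁻¹) • tens (eta 𝕜 q) (gam q p z i)) := by
  rw [h.tens_eta_gam, τ.map_smul_of_tower, tr₁₂, map_tr_left]
  simp only [map_smul, hτ.apply_gam, smul_comm _ p, tr_smul, h.tr_coord_act_tens]
  have e := h.tens_eta_gam i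
  rw [tr₁₂] at e
  rw [← e]
  have := gC_ne_zero h.generic
  generalize coord 𝕜 q i • traceT N q p z = y
  match_scalars <;> field_simp

/-- The trace is an eigenvector with eigenvalue p²z ≠ 1, hence not fixed; the fixed tensors need
corrections by it. -/
theorem IsTwist.apply_traceT (h : IsParam 𝕜 q Q Q' p z) (hτ : IsTwist q Q p z τ) :
    τ (traceT N q p z) = (p ^ 2 * z) • traceT N q p z := by
  rw [traceT, map_tr_left]
  simp only [hτ.apply_gam, tr_smul]
  have e := h.braid.tr_act fun i j => tens (gam q p z i) (gam q p z j)
  refine (congrArg (p • ·) e).trans ?_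
  rw [← mul_smul]
  congr 1
  ring

/-- The constant c is the solution of (p² - 1)g + c p²z = c, which compares the coefficients of x_l
t. -/
theorem IsTwist.apply_fixedT (h : IsParam 𝕜 q Q Q' p z) (hτ : IsTwist q Q p z τ) (l : Fin N) :
    τ (fixedT q p z l) = fixedT q p z l := by
  have h8' : 1 - z * p ^ 2 ≠ 0 := by rw [mul_comm]; exact h.generic.one_sub_sq
  obtain ⟨h1, h2, h3, h4, h5, h6, h7, h8, h9⟩ := h.generic
  rw [fixedT, map_add, map_add, τ.map_smul_of_tower, τ.map_smul_of_tower, map_smul,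
    hτ.apply_gam_eta h, hτ.apply_eta_gam h, hτ.apply_traceT h, ← smul_comm (p ^ 2 * z)]
  simp only [cC]
  generalize coord 𝕜 q l • traceT N q p z = y
  match_scalars <;> field_simp <;> ring

theorem IsTwist.apply_tensorII (h : IsParam 𝕜 q Q Q' p z) (hN : 3 ≤ N)
    (hτ : IsTwist q Q p z τ) : τ (tensorII 𝕜 N q) = tensorII 𝕜 N q := by
  rw [h.tensorII_eq hN, τ.map_smul_of_tower, map_tr_left]
  simp only [map_smul, hτ.apply_fixedT h]

variable (K : Submodule (Sphere 𝕜 N q) (TwoTensors 𝕜 N q))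

theorem smul_mem_of_scalar (c : 𝕜) {t : TwoTensors 𝕜 N q} (ht : t ∈ K) : c • t ∈ K := by
  rw [← algebraMap_smul (Sphere 𝕜 N q)]
  exact K.smul_mem _ ht

theorem tr_mem {C : Fin N → Fin N → 𝕜} {v : Fin N → Fin N → TwoTensors 𝕜 N q}
    (hv : ∀ i j, v i j ∈ K) : tr C v ∈ K :=
  sum_mem fun _ _ => sum_mem fun _ _ => smul_mem_of_scalar K _ (hv _ _)

theorem act_mem {P : Fin N → Fin N → Fin N → Fin N → 𝕜} {v : Fin N → Fin N → TwoTensors 𝕜 N q}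
    (hv : ∀ i j, v i j ∈ K) (i j : Fin N) : act P v i j ∈ K :=
  sum_mem fun _ _ => sum_mem fun _ _ => smul_mem_of_scalar K _ (hv _ _)

variable {K}

theorem IsParam.fixedT_mem (h : IsParam 𝕜 q Q Q' p z) (hN : 3 ≤ N)
    (hK : ∀ (a : Sphere 𝕜 N q), ∀ t ∈ K, op a • t ∈ K) (hII : tensorII 𝕜 N q ∈ K) (j : Fin N) :
    fixedT q p z j ∈ K := by
  have hM : (1 - p ^ 2 * z) / ((1 + p ^ 2) * betaC p z) ≠ 0 :=
    div_ne_zero h.generic.one_sub_sq (mul_ne_zero h.generic.one_add_sq (betaC_ne_zero h.generic))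
  have hs : tr (metricS 𝕜 q) (fun k l => coord 𝕜 q k • fixedT q p z l) ∈ K := by
    have := smul_mem_of_scalar K ((1 - p ^ 2 * z) / ((1 + p ^ 2) * betaC p z))⁻¹ hII
    rwa [h.tensorII_eq hN, inv_smul_smul₀ hM] at this
  have hc : (p + p⁻¹) * (gC p z)⁻¹ * betaC p z ≠ 0 := by
    refine mul_ne_zero (mul_ne_zero ?_ (inv_ne_zero (gC_ne_zero h.generic)))
      (betaC_ne_zero h.generic)
    have h1 := h.generic.p_ne
    have e : p + p⁻¹ = (1 + p ^ 2) / p := by field_simp; ring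
    rw [e]
    exact div_ne_zero h.generic.one_add_sq h1
  have := smul_mem_of_scalar K ((p + p⁻¹) * (gC p z)⁻¹ * betaC p z)⁻¹
    (sub_mem (hK (coord 𝕜 q j) _ hs) (smul_mem_of_scalar K (p ^ 2) (K.smul_mem (coord 𝕜 q j) hs)))
  rwa [h.fixedTrace_op_smul, inv_smul_smul₀ hc] at this

theorem IsParam.symT_mem (h : IsParam 𝕜 q Q Q' p z) (hN : 3 ≤ N)
    (hK : ∀ (a : Sphere 𝕜 N q), ∀ t ∈ K, op a • t ∈ K) (hII : tensorII 𝕜 N q ∈ K) (i j : Fin N) :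
    symT q Q p z i j ∈ K := by
  have hu := h.fixedT_mem hN hK hII
  have := smul_mem_of_scalar K (betaC p z)⁻¹ (sub_mem (hK (coord 𝕜 q j) _ (hu i))
    (smul_mem_of_scalar K p (act_mem K (P := Q) (fun k l => K.smul_mem (coord 𝕜 q k) (hu l)) i j)))
  rwa [h.fixedT_op_smul, inv_smul_smul₀ (betaC_ne_zero h.generic)] at this

theorem tensorI_mem (hq : 0 < q) (hq1 : q ≠ 1) (hN : 3 ≤ N)
    (hK : ∀ (a : Sphere 𝕜 N q), ∀ t ∈ K, op a • t ∈ K) (hII : tensorII 𝕜 N q ∈ K) (i j : Fin N) :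
    tensorI 𝕜 q i j ∈ K := by
  have h := isParam_minus 𝕜 hq hq1 hN
  obtain ⟨a, b, c, e⟩ := exists_tensorI_eq (𝕜 := 𝕜) hq hq1 hN
  have hu := h.fixedT_mem hN hK hII
  rw [e]
  exact add_mem (add_mem (sub_mem (h.symT_mem hN hK hII i j) (smul_mem_of_scalar K _ (add_mem
    (act_mem K (fun k l => K.smul_mem (coord 𝕜 q k) (hu l)) i j)
    (smul_mem_of_scalar K _ (K.smul_mem _ (hu j))))))
    (smul_mem_of_scalar K _ (K.smul_mem _ hII))) (smul_mem_of_scalar K _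
    (smul_mem_of_scalar K _ hII))

/-- The coordinates f of a fixed tensor satisfy f = pQf by the symmetry of Q. Contracting with the
metric gives (1 - p²z) tr f = 0, so the trace correction drops out and Σ f_ij times the spanning
tensors equals (p + p⁻¹)t. -/
theorem IsTwist.mem_span_symT (h : IsParam 𝕜 q Q Q' p z) (hτ : IsTwist q Q p z τ)
    {t : TwoTensors 𝕜 N q} (ht : τ t = t) : t ∈ Submodule.span (Sphere 𝕜 N q)
      (Set.range fun i : Fin N × Fin N => symT q Q p z i.1 i.2) := by
  obtain ⟨c, hc⟩ := h.exists_coordinates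
  set f : Fin N → Fin N → Sphere 𝕜 N q := fun i j => BTensor.coordinate 𝕜 (c i) (c j) t with hf
  have e1 : ∑ i, ∑ j, f i j • tens (gam q p z i) (gam q p z j) = t :=
    BTensor.sum_coordinate_smul hc h.span_gam t
  have e2 : ∑ i, ∑ j, f i j • act Q (fun k l => tens (gam q p z k) (gam q p z l)) i j = p⁻¹ • t := by
    conv_rhs => rw [← ht, ← e1]
    simp only [map_sum, map_smul, hτ.apply_gam, ← smul_comm p]
    simp only [← Finset.smul_sum]
    rw [inv_smul_smul₀ h.generic.p_ne]
  have e3 : ∀ k l, f k l = p • act Q f k l := by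
    intro k l
    have e4 := congrArg (BTensor.coordinate 𝕜 (c k) (c l)) e2
    rw [LinearMap.map_smul_of_tower] at e4
    simp only [map_sum, map_smul, map_act_left, BTensor.coordinate_frame hc] at e4
    have e5 : ∀ i j, act Q (fun a b => if k = a ∧ l = b then (1 : Sphere 𝕜 N q) else 0) i j =
        Q k l i j • 1 := by
      intro i j
      have := act_smul_const Q (fun a b => if k = a ∧ l = b then (1 : 𝕜) else 0)
        (1 : Sphere 𝕜 N q) i j
      simp only [ite_smul, one_smul, zero_smul] at this
      rw [this]
      congr 1
      simp [act, ite_and]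
    simp only [e5, smul_eq_mul, mul_smul_comm, mul_one, h.braid.symm k l] at e4
    rw [← inv_smul_eq_iff₀ h.generic.p_ne]
    exact e4.symm
  have e6 : tr (metricS 𝕜 q) f = 0 := by
    have e7 : tr (metricS 𝕜 q) f = (p ^ 2 * z) • tr (metricS 𝕜 q) f := by
      conv_lhs => rw [show f = fun k l => p • act Q f k l from funext₂ e3, tr_smul]
      rw [h.braid.tr_act, smul_smul]
      congr 1
      ring
    have e8 : (1 - p ^ 2 * z) • tr (metricS 𝕜 q) f = 0 := by
      rw [sub_smul, one_smul, ← e7, sub_self]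
    exact (smul_eq_zero.1 e8).resolve_left h.generic.one_sub_sq
  have e9 : ∑ i, ∑ j, f i j • symT q Q p z i j = (p + p⁻¹) • t := by
    have e10 : ∑ i, ∑ j, f i j • metricS 𝕜 q i j • traceT N q p z =
        tr (metricS 𝕜 q) f • traceT N q p z := by
      simp only [tr, Finset.sum_smul, smul_assoc]
      simp only [smul_comm (f _ _)]
    simp only [symT, smul_sub, smul_add, Finset.sum_sub_distrib, Finset.sum_add_distrib, e2,
      ← smul_comm p, ← smul_comm (p * cC p z * kappaC p z / betaC p z), ← Finset.smul_sum, e10, e6,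
      e1, zero_smul, smul_zero, sub_zero]
    rw [add_smul]
  have h0 : p + p⁻¹ ≠ 0 := by
    have h1 := h.generic.p_ne
    have e : p + p⁻¹ = (1 + p ^ 2) / p := by field_simp; ring
    rw [e]
    exact div_ne_zero h.generic.one_add_sq h1
  rw [← inv_smul_smul₀ h0 t, ← e9]
  exact smul_mem_of_scalar _ _ (sum_mem fun i _ => sum_mem fun j _ =>
    Submodule.smul_mem _ _ (Submodule.subset_span ⟨(i, j), rfl⟩))

/-- Fixed points of the braiding lie in every sub-bimodule containing `[II]`. -/
theorem IsTwist.mem_of_fixed (h : IsParam 𝕜 q Q Q' p z) (hN : 3 ≤ N) (hτ : IsTwist q Q p z τ)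
    (hK : ∀ (a : Sphere 𝕜 N q), ∀ t ∈ K, op a • t ∈ K) (hII : tensorII 𝕜 N q ∈ K)
    {t : TwoTensors 𝕜 N q} (ht : τ t = t) : t ∈ K := by
  refine Submodule.span_le.2 ?_ (hτ.mem_span_symT h ht)
  rintro _ ⟨i, rfl⟩
  exact h.symT_mem hN hK hII i.1 i.2

/-- The fixed points are a sub-bimodule containing [II], hence they contain every [I]. -/
theorem IsTwist.fixed_tensorI (h : IsParam 𝕜 q Q Q' p z) (hq : 0 < q) (hq1 : q ≠ 1) (hN : 3 ≤ N)
    (hτ : IsTwist q Q p z τ) (i j : Fin N) : τ (tensorI 𝕜 q i j) = tensorI 𝕜 q i j :=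
  tensorI_mem (K := LinearMap.eqLocus τ LinearMap.id) hq hq1 hN
    (fun a t ht => (hτ.right_linear a t).trans (congrArg _ ht)) (hτ.apply_tensorII h hN) i j

/-- The fixed points of the braiding are spanned by `[I]` and `[II]`. -/
theorem IsTwist.fixed_iff (hq : 0 < q) (hq1 : q ≠ 1) (hN : 3 ≤ N)
    (hτ : IsTwist q (RinvS 𝕜 q) (q : 𝕜) ((q : 𝕜) ^ (N - 2)) τ) (t : TwoTensors 𝕜 N q) :
    τ t = t ↔ t ∈ Submodule.span (Sphere 𝕜 N q)
      (Set.range (fun p : Fin N × Fin N => tensorI 𝕜 q p.1 p.2) ∪ {tensorII 𝕜 N q}) := by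
  have h := isParam_minus 𝕜 hq hq1 hN
  set W := Submodule.span (Sphere 𝕜 N q)
      (Set.range (fun p : Fin N × Fin N => tensorI 𝕜 q p.1 p.2) ∪ {tensorII 𝕜 N q}) with hW
  have hI : ∀ i j, tensorI 𝕜 q i j ∈ W := fun i j => Submodule.subset_span (Or.inl ⟨(i, j), rfl⟩)
  have hII : tensorII 𝕜 N q ∈ W := Submodule.subset_span (Or.inr rfl)
  constructor
  · intro ht
    refine Submodule.span_le.2 ?_ (hτ.mem_span_symT h ht)
    rintro _ ⟨⟨i, j⟩, rfl⟩
    obtain ⟨d, hd⟩ := exists_tr_tensorI (𝕜 := 𝕜) hq hq1 hN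
    have hu : ∀ j, fixedT q (q : 𝕜) ((q : 𝕜) ^ (N - 2)) j ∈ W := fun j => by
      rw [eq_sub_of_add_eq (hd j).symm]
      exact sub_mem (tr_mem W fun k l => W.smul_mem _ (hI l j))
        (smul_mem_of_scalar W _ (W.smul_mem _ hII))
    obtain ⟨a, b, c, e⟩ := exists_tensorI_eq (𝕜 := 𝕜) hq hq1 hN
    have e1 := e i j
    rw [← sub_eq_iff_eq_add, ← sub_eq_iff_eq_add, eq_sub_iff_add_eq] at e1
    change symT _ _ _ _ i j ∈ W
    rw [← e1]
    exact add_mem (sub_mem (sub_mem (hI i j) (smul_mem_of_scalar W _ (smul_mem_of_scalar W _ hII)))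
      (smul_mem_of_scalar W _ (W.smul_mem _ hII))) (smul_mem_of_scalar W _ (add_mem
      (act_mem W (fun k l => W.smul_mem (coord 𝕜 q k) (hu l)) i j)
      (smul_mem_of_scalar W _ (W.smul_mem _ (hu j)))))
  · intro ht
    have hle : W ≤ LinearMap.eqLocus τ LinearMap.id := Submodule.span_le.2 ?_
    · exact hle ht
    rintro _ (⟨⟨i, j⟩, rfl⟩ | rfl)
    · exact hτ.fixed_tensorI h hq hq1 hN i j
    · exact hτ.apply_tensorII h hN

end Twist

end Kernel

/-! ### The sphere is nontrivial, and [II] ≠ 0. -/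

section Character

variable {𝕜 : Type u} [RCLike 𝕜] {N : ℕ} {q : ℝ}

/-- The values of a character of the sphere supported on the first and last coordinates. -/
def charVal (a : Fin N) (w : 𝕜) (i : Fin N) : 𝕜 := if i = a then 1 else if i = a.rev then w else 0

/-- A character that is nonzero on x_1 and x_N only: the value 1 on x_1 is a choice, and the value w
on x_N is then forced by the norm relation. -/
theorem charVal_isSphere (hq : 0 < q) (hq1 : q ≠ 1) (hN : 3 ≤ N) {a : Fin N} (ha : (a : ℕ) = 0)
    {w : 𝕜} (hw : w * ((1 + (q : 𝕜) ^ (N - 2)) * weight 𝕜 q a) = 1) :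
    IsSphere (RmatS 𝕜 q) (metricS 𝕜 q) (q : 𝕜)⁻¹ ((q : 𝕜) ^ (N - 2))⁻¹ (charVal a w) := by
  have hg := isGeneric 𝕜 hq hq1 hN
  obtain ⟨h1, h2, h3, h4, h5, h6, h7, h8, h9⟩ := hg
  have hc := weight_isMetricWeight 𝕜 (N := N) hq
  have hrev : ((a.rev : Fin N) : ℕ) = N - 1 := by rw [Fin.val_rev]; omega
  have hab : a ≠ a.rev := fun h => by rw [← h, ha] at hrev; omega
  have hrr : a.rev.rev = a := Fin.rev_rev a
  have hcc : weight 𝕜 q a * weight 𝕜 q a.rev = 1 := hc.mul_rev a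
  -- From c_1² = q^(2-N) and c_1 c_N = 1.
  have hcs : weight 𝕜 q a.rev = (q : 𝕜) ^ (N - 2) * weight 𝕜 q a := by
    have e := hc.sq_of_lt a (by omega)
    have e2 : weight 𝕜 q a ^ 2 * (q : 𝕜) ^ (N - 2) = 1 := by
      rw [e, ha, ← zpow_natCast, ← zpow_add₀ h1]
      have : 2 * ((0 : ℕ) : ℤ) + 2 - N + ((N - 2 : ℕ) : ℤ) = 0 := by omega
      rw [this, zpow_zero]
    have hne : weight 𝕜 q a ≠ 0 := left_ne_zero_of_mul_eq_one hcc
    apply mul_left_cancel₀ hne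
    rw [hcc, ← e2]
    ring
  have hya : charVal a w a = 1 := if_pos rfl
  have hyb : charVal a w a.rev = w := by rw [charVal, if_neg hab.symm, if_pos rfl]
  have hy0 : ∀ i, i ≠ a → i ≠ a.rev → charVal a w i = 0 := fun i hi hi' => by
    rw [charVal, if_neg hi, if_neg hi']
  generalize (q : 𝕜) ^ (N - 2) = z at *
  have hcap : ∀ i : Fin N, capFrom (weight 𝕜 q) (i + 1)
      (fun k l => charVal a w k * charVal a w l) = if i = a.rev then 0 else weight 𝕜 q a * w := by
    intro i
    rw [capFrom, Finset.sum_eq_single a.rev]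
    · rw [hrr, hya, hyb, one_mul]
      split_ifs with h h' h'
      · rw [h', hrev] at h; omega
      · rfl
      · rfl
      · exact absurd (Fin.ext (by omega)) h'
    · intro l _ hl
      split_ifs with h
      · rw [hy0 l (fun e => by rw [e, ha] at h; omega) hl, mul_zero, mul_zero]
      · rfl
    · simp
  have h6' : 1 + z⁻¹ = (1 + z) / z := by field_simp; ring
  have hk : kappaC (q : 𝕜)⁻¹ z⁻¹ = -(((q : 𝕜) - (q : 𝕜)⁻¹) * (w * weight 𝕜 q a)) := by
    have e : w * weight 𝕜 q a = 1 / (1 + z) := by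
      rw [eq_div_iff h6]; linear_combination hw
    rw [kappaC, h6', e]
    field_simp
    ring
  constructor
  · intro i j
    rw [act_RmatS hq, braid, hcap, hk, inv_inv, metricS_apply, swapWeight]
    have hirr : i = j.rev ↔ j = i.rev := by
      rw [eq_rev_iff, eq_rev_iff]; omega
    simp only [hirr, smul_eq_mul, mul_one]
    by_cases hj : j = i.rev
    · subst hj
      simp only [if_true]
      by_cases hia : i = a
      · subst hia
        have hlt : i < i.rev := by rw [Fin.lt_def]; omega
        rw [if_neg hab, if_pos hlt, if_neg hab, hya, hyb]
        ring
      · by_cases hib : i = a.rev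
        · subst hib
          have hlt : ¬ a.rev < a := by rw [Fin.lt_def]; omega
          rw [hrr, if_neg hab.symm, if_neg hlt, if_pos rfl, hya, hyb, hcs]
          have e : w * (z * weight 𝕜 q a * weight 𝕜 q a) = w := by
            rw [← hcs, mul_comm (weight 𝕜 q a.rev), hcc, mul_one]
          linear_combination ((q : 𝕜) - (q : 𝕜)⁻¹) * e
        · rw [if_neg hib, hy0 i hia hib, zero_mul, mul_zero]
          split_ifs <;> ring
    · simp only [hj, if_false, mul_zero, sub_zero, add_zero, mul_one]
      by_cases hia : i = a
      · subst hia
        by_cases hja : j = i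
        · subst hja; simp
        · simp [hy0 j hja hj]
      · by_cases hib : i = a.rev
        · subst hib
          rw [hrr] at hj
          by_cases hjb : j = a.rev
          · subst hjb; simp
          · simp [hy0 j hj hjb]
        · simp [hy0 i hia hib]
  · rw [tr_metricS, capFrom]
    simp only [Nat.zero_le, if_true]
    rw [Finset.sum_eq_add a a.rev hab]
    · rw [hrr, hya, hyb, hcs]
      linear_combination hw
    · intro i _ hi
      rw [hy0 i hi.1 hi.2, mul_zero, mul_zero]
    · simp
    · simp

/-- The sphere is not trivial: some square of a coordinate does not vanish. -/
theorem coord_sq_ne_zero (hq : 0 < q) (hq1 : q ≠ 1) (hN : 3 ≤ N) {a : Fin N} (ha : (a : ℕ) = 0) :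
    coord 𝕜 q a * coord 𝕜 q a ≠ 0 := by
  have hc := weight_isMetricWeight 𝕜 (N := N) hq
  have hne : (1 + (q : 𝕜) ^ (N - 2)) * weight 𝕜 q a ≠ 0 :=
    mul_ne_zero (isGeneric 𝕜 hq hq1 hN).one_add_z (left_ne_zero_of_mul_eq_one (hc.mul_rev a))
  have h := (((isParam_minus 𝕜 hq hq1 hN).swap).sphere_iff 𝕜 _).1
    (charVal_isSphere hq hq1 hN ha (inv_mul_cancel₀ hne))
  intro h0
  have e := congrArg (Sphere.lift _ h.1 h.2) h0
  rw [map_mul, Sphere.lift_coord, map_zero, charVal, if_pos rfl, one_mul] at e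
  exact one_ne_zero e

variable {Q Q' : Fin N → Fin N → Fin N → Fin N → 𝕜} {p z : 𝕜}

theorem IsParam.tens_eta_eta (h : IsParam 𝕜 q Q Q' p z) :
    tens (eta 𝕜 q) (eta 𝕜 q) = (p * gC p z) • tr (metricS 𝕜 q)
      (fun k l => coord 𝕜 q k • tens (eta 𝕜 q) (gam q p z l))
      + (gC p z * betaC p z) • traceT N q p z := by
  apply BTensorAlgebra.ι₂_injective (𝕜 := 𝕜) (A := Sphere 𝕜 N q)
  rw [map_add, map_smul, map_smul, map_tr, BTensorAlgebra.ι₂, wedge₂_btmul]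
  simp only [wedge₂_smul, wedge₂_btmul, wedge₂_traceT]
  have hx := h.isSphere_coord.map (BTensorAlgebra.ι₀ 𝕜 (Sphere 𝕜 N q) (OneForms 𝕜 N q))
  have hη := h.eta_rel (BTensorAlgebra.ι₁_left 𝕜 (Sphere 𝕜 N q) (OneForms 𝕜 N q))
  have e := tr_coord_eta_frame h.braid h.generic hx (ι₁_frame_rel h) hη
  rw [e]
  have h1 := h.generic.p_ne
  have hg := gC_ne_zero h.generic
  match_scalars <;> field_simp
  ring

/-- The tensor `[II]` does not vanish. -/
theorem tensorII_ne_zero (hq : 0 < q) (hq1 : q ≠ 1) (hN : 3 ≤ N) : tensorII 𝕜 N q ≠ 0 := by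
  have h := isParam_minus 𝕜 hq hq1 hN
  obtain ⟨c, hc⟩ := h.exists_coordinates
  let a : Fin N := ⟨0, by omega⟩
  have hab : a.rev ≠ a := fun e => by
    have := congrArg Fin.val e
    rw [Fin.val_rev] at this
    change N - (0 + 1) = 0 at this
    omega
  intro h0
  set p : 𝕜 := (q : 𝕜)
  set z : 𝕜 := (q : 𝕜) ^ (N - 2)
  have hC : metricS 𝕜 q a.rev a.rev = 0 := by
    rw [metricS_apply, if_neg]
    rw [Fin.rev_rev]; exact hab
  have hCx : ∀ k : Fin N, metricS 𝕜 q k a.rev = if k = a then weight 𝕜 q a else 0 := fun k => by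
    rw [metricS_apply, Fin.rev_rev]
    split_ifs with hk
    · rw [hk]
    · rfl
  -- The coefficient of γ_N ⊗ γ_N. As C_{NN} = 0 it kills the trace, while on η ⊗ η it is a nonzero
  -- multiple of x_1², which the character shows to be nonzero.
  let π : TwoTensors 𝕜 N q →ₗ[Sphere 𝕜 N q] Sphere 𝕜 N q :=
    BTensor.coordinate 𝕜 (c a.rev) (c a.rev)
  have hπ : ∀ i j, π (tens (gam q p z i) (gam q p z j)) =
      if j = a.rev then if i = a.rev then 1 else 0 else 0 := fun i j => by
    change BTensor.coordinate 𝕜 (c a.rev) (c a.rev) _ = _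
    rw [BTensor.coordinate_frame hc, ← ite_and]
    simp only [eq_comm (a := a.rev), and_comm]
  have hsum : ∀ y : Fin N → Sphere 𝕜 N q, tr (metricS 𝕜 q)
      (fun k l => if l = a.rev then y k else 0) = weight 𝕜 q a • y a := fun y => by
    simp only [tr, smul_ite, smul_zero, Finset.sum_ite_eq', Finset.mem_univ, if_true, hCx,
      ite_smul, zero_smul]
  have hπt : π (traceT N q p z) = 0 := by
    rw [traceT, map_tr_left]
    simp only [hπ]
    rw [hsum fun k => if k = a.rev then 1 else 0, if_neg hab.symm, smul_zero]
  have hπη : ∀ l, π (tens (eta 𝕜 q) (gam q p z l)) =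
      if l = a.rev then gC p z • weight 𝕜 q a • coord 𝕜 q a else 0 := fun l => by
    rw [h.tens_eta_gam, π.map_smul_of_tower, tr₁₂, map_tr_left]
    simp only [map_smul, hπ, smul_eq_mul]
    split_ifs
    · simp only [mul_ite, mul_one, mul_zero, hsum]
    · simp only [mul_zero, tr, smul_zero, Finset.sum_const_zero]
  have hπηη : π (tens (eta 𝕜 q) (eta 𝕜 q)) =
      (p * gC p z * (gC p z * weight 𝕜 q a ^ 2)) • (coord 𝕜 q a * coord 𝕜 q a) := by
    rw [h.tens_eta_eta, map_add, π.map_smul_of_tower, π.map_smul_of_tower, hπt, map_tr_left]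
    simp only [map_smul, hπη, smul_eq_mul, mul_ite, mul_zero, hsum, mul_smul_comm]
    module
  have e2 : tensorII 𝕜 N q = ((1 - p ^ 2 * z) / ((1 + p ^ 2) * betaC p z)) •
      (((p + p⁻¹) * (gC p z)⁻¹) • tens (eta 𝕜 q) (eta 𝕜 q)
      + (cC p z - p⁻¹ * betaC p z) • traceT N q p z) := by
    rw [h.tensorII_eq hN]
    congr 1
    apply BTensorAlgebra.ι₂_injective (𝕜 := 𝕜) (A := Sphere 𝕜 N q)
    rw [map_add, map_smul, map_smul, map_tr, BTensorAlgebra.ι₂, wedge₂_btmul]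
    simp only [wedge₂_smul, wedge₂_fixedT, wedge₂_traceT]
    exact tr_coord_fixedForm h.braid h.generic (h.isSphere_coord.map _) (ι₁_frame_rel h)
      (h.eta_rel (BTensorAlgebra.ι₁_left 𝕜 _ _))
  have e3 := congrArg π e2
  rw [h0, map_zero, π.map_smul_of_tower, map_add, π.map_smul_of_tower, π.map_smul_of_tower, hπt,
    hπηη, smul_zero, add_zero, smul_smul, smul_smul] at e3
  refine coord_sq_ne_zero (𝕜 := 𝕜) hq hq1 hN (a := a) rfl
    ((smul_eq_zero.1 e3.symm).resolve_left ?_)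
  have hg := h.generic
  have hwt : weight 𝕜 q a ≠ 0 :=
    left_ne_zero_of_mul_eq_one ((weight_isMetricWeight 𝕜 (N := N) hq).mul_rev a)
  have h10 : p + p⁻¹ ≠ 0 := by
    have h1 := hg.p_ne
    have e : p + p⁻¹ = (1 + p ^ 2) / p := by field_simp; ring
    rw [e]
    exact div_ne_zero hg.one_add_sq h1
  exact mul_ne_zero (mul_ne_zero (div_ne_zero hg.one_sub_sq (mul_ne_zero hg.one_add_sq
    (betaC_ne_zero hg))) (mul_ne_zero h10 (inv_ne_zero (gC_ne_zero hg))))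
    (mul_ne_zero (mul_ne_zero hg.p_ne (gC_ne_zero hg)) (mul_ne_zero (gC_ne_zero hg)
    (pow_ne_zero _ hwt)))

end Character

/-! ### The behaviour of [II] forced by a differential. -/

section DifferentialAlgebra

/-- Conjugation of the metric form in a differential algebra. -/
theorem conj_metricForm_of_differential {F : Type*} [Field F] {N : ℕ} {T : Type*} [Ring T]
    [Algebra F T] {Q Q' : Fin N → Fin N → Fin N → Fin N → F} {C : Fin N → Fin N → F} {p z : F}
    {x γ : Fin N → T} {η : T} (h : IsBraidPair Q Q' C p z) (hg : IsGeneric p z)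
    (hx : IsSphere Q C p z x) (hγ : ∀ i j, γ i * x j = act Q (fun k l => x k * γ l) i j)
    (hη : η = gC p z • tr C (fun k l => x k * γ l)) {y : Fin N → T}
    (hy : ∀ i, y i = γ i - alphaC p z • (x i * η))
    (hd : ∀ j, tr C (fun k l => y k * y l) * x j =
      x j * tr C (fun k l => y k * y l) + η * y j + y j * η) :
    tr C (fun k l => x k * metricForm C p z x γ η * x l) =
      (1 + betaC p z) • metricForm C p z x γ η := by
  have hb := betaC_ne_zero hg
  have h0 : tr C (fun k l => x k * y l) = η := by
    simp only [hy]; exact tr_mul_form hg hx hη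
  have h1 : ∀ j, η * x j = x j * η + betaC p z • y j := fun j => by
    rw [hy, ← eta_commutator h hg hx hγ hη, add_sub_cancel]
  set τ := tr C (fun k l => y k * y l) with hτ
  have e1 : tr C (fun k l => x k * (η * y l)) = η * η - betaC p z • τ := by
    have e : ∀ k l, x k * (η * y l) = η * (x k * y l) - betaC p z • (y k * y l) := fun k l => by
      rw [← mul_assoc, ← mul_assoc, h1, add_mul, smul_mul_assoc, add_sub_cancel_right]
    simp only [e, tr_sub, tr_smul, ← mul_tr, h0, ← hτ]
  -- The contraction of xη dx is η² - βτ, so the coefficient 2/β turns +τ into -τ. In a calculus τ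
  -- is dη, and the hypothesis `hd` describes its commutator with coordinates.
  have hm : metricForm C p z x γ η = (2 / betaC p z) • (η * η) - τ := by
    rw [metricForm]
    simp only [← hy, e1, ← hτ]
    match_scalars <;> field_simp <;> ring
  have e2 : ∀ j, η * η * x j = x j * (η * η) + betaC p z • (η * y j + y j * η) := fun j => by
    rw [mul_assoc, h1, mul_add, mul_smul_comm, ← mul_assoc, h1, add_mul, smul_mul_assoc, mul_assoc]
    module
  have e3 : ∀ k l, x k * metricForm C p z x γ η * x l =
      x k * x l * metricForm C p z x γ η + (x k * (η * y l) + x k * y l * η) := fun k l => by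
    have : metricForm C p z x γ η * x l = x l * metricForm C p z x γ η + (η * y l + y l * η) := by
      rw [hm, sub_mul, smul_mul_assoc, e2, hd, mul_sub, mul_smul_comm]
      match_scalars <;> field_simp <;> ring
    rw [mul_assoc, this, mul_add, mul_add]
    simp only [mul_assoc]
  simp only [e3, tr_add, ← tr_mul, hx.norm, h0, e1, one_mul]
  rw [hm]
  match_scalars <;> field_simp <;> ring

end DifferentialAlgebra

/-! ### [II] vanishes in every calculus; construction of the universal calculus. -/

section Calculi

variable {𝕜 : Type u} [RCLike 𝕜] {N : ℕ} {q : ℝ}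
variable {Q Q' : Fin N → Fin N → Fin N → Fin N → 𝕜} {p z : 𝕜}

variable (𝕜 N q) in
/-- The one-form whose commutators are the differentials. -/
def innerForm : OneForms 𝕜 N q := (betaC (q : 𝕜) ((q : 𝕜) ^ (N - 2)))⁻¹ • eta 𝕜 q

/-- Both sides are derivations, so the commutator of η with coordinates decides. -/
theorem diff_eq_commutator (hq : 0 < q) (hq1 : q ≠ 1) (hN : 3 ≤ N) (a : Sphere 𝕜 N q) :
    diff 𝕜 q a = op a • innerForm 𝕜 N q - a • innerForm 𝕜 N q := by
  have h := isParam_minus 𝕜 hq hq1 hN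
  induction a using Sphere.induction with
  | h1 c =>
    have e : op (algebraMap 𝕜 (Sphere 𝕜 N q) c) = algebraMap 𝕜 (Sphere 𝕜 N q)ᵐᵒᵖ c := rfl
    rw [diff_algebraMap, e, algebraMap_smul, algebraMap_smul, sub_self]
  | hx i =>
    apply BTensorAlgebra.ι₁_injective (𝕜 := 𝕜) (A := Sphere 𝕜 N q)
    have e := eta_commutator h.braid h.generic (h.isSphere_coord.map
      (BTensorAlgebra.ι₀ 𝕜 (Sphere 𝕜 N q) (OneForms 𝕜 N q))) (ι₁_frame_rel h)
      (h.eta_rel (BTensorAlgebra.ι₁_left 𝕜 _ _)) i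
    rw [map_sub, BTensorAlgebra.ι₁_right, BTensorAlgebra.ι₁_left, innerForm, map_smul,
      smul_mul_assoc, mul_smul_comm, ← smul_sub, e, inv_smul_smul₀ (betaC_ne_zero h.generic),
      ← map_dx (BTensorAlgebra.ι₁_left 𝕜 _ _)]
  | ha a b ha hb => rw [map_add, ha, hb, op_add, add_smul, add_smul]; abel
  | hm a b ha hb =>
    rw [diff_mul, ha, hb, smul_sub, smul_sub, op_mul, mul_smul, mul_smul,
      smul_comm a (op b)]
    abel

/-- In every higher order calculus, `[II]` vanishes. -/
theorem HigherCalculus.wedge_tensorII (hq : 0 < q) (hq1 : q ≠ 1) (hN : 3 ≤ N) {L : Type u}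
    [Ring L] [Algebra 𝕜 L]
    (S : HigherCalculus (diff 𝕜 q : Sphere 𝕜 N q →ₗ[𝕜] OneForms 𝕜 N q) L) :
    S.wedge (tensorII 𝕜 N q) = 0 := by
  have h := isParam_minus 𝕜 hq hq1 hN
  have hx := h.isSphere_coord.map S.i₀
  have hγ := h.frame_rel S.i₁_left S.i₁_right
  have hη := h.eta_rel S.i₁_left
  have hy := map_dx (p := (q : 𝕜)) (z := (q : 𝕜) ^ (N - 2)) S.i₁_left
  rw [HigherCalculus.wedge, h.wedge₂_tensorII _ _ hN]
  refine metricForm_eq_zero h.braid h.generic hx hγ hη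
    (conj_metricForm_of_differential h.braid h.generic hx hγ hη hy fun j => ?_)
  have d0 : ∀ a y, S.d (S.i₀ a * y) = S.i₁ (diff 𝕜 q a) * y + S.i₀ a * S.d y := fun a y => by
    have := S.leibniz 0 (S.i₀ a) (S.range_i₀ ▸ ⟨a, rfl⟩) y
    rwa [S.d_extends, pow_zero, one_smul] at this
  have d1 : ∀ m y, S.d (S.i₁ m * y) = S.d (S.i₁ m) * y - S.i₁ m * S.d y := fun m y => by
    have := S.leibniz 1 (S.i₁ m) (S.range_i₁ ▸ ⟨m, rfl⟩) y
    rwa [pow_one, neg_smul, one_smul, ← sub_eq_add_neg] at this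
  have d2 : ∀ a, S.d (S.i₁ (diff 𝕜 q a)) = 0 := fun a => by rw [← S.d_extends, S.d_d]
  have dη : S.d (S.i₁ (eta 𝕜 q)) = tr (metricS 𝕜 q)
      (fun k l => S.i₁ (dx 𝕜 q k) * S.i₁ (dx 𝕜 q l)) := by
    rw [map_eta S.i₁_left, map_tr]
    simp only [d0, d2, mul_zero, add_zero]
  -- Differentiating [η, x_j] = β dx_j makes the right side vanish, and the left side is the
  -- required commutation rule of dη with x_j.
  have e := congrArg S.d (eta_commutator h.braid h.generic hx hγ hη j)
  rw [← hy, map_smul, d2, smul_zero, map_sub, d0, d1, S.d_extends, dη] at e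
  rw [← sub_eq_zero, ← e]
  abel

variable {T : Type u} [Ring T] [Algebra 𝕜 T]

/-- The kernel of the product of one-forms. -/
def wedgeKer (f : Sphere 𝕜 N q →ₐ[𝕜] T) (g : OneForms 𝕜 N q →ₗ[𝕜] T)
    (hl : ∀ a m, g (a • m) = f a * g m) (hr : ∀ a m, g (op a • m) = g m * f a) :
    Submodule (Sphere 𝕜 N q) (TwoTensors 𝕜 N q) where
  carrier := {t | wedge₂ f g hl hr t = 0}
  zero_mem' := map_zero _
  add_mem' {s t} hs ht := by
    rw [Set.mem_ofPred_eq] at *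
    rw [map_add, hs, ht, add_zero]
  smul_mem' a t ht := by
    rw [Set.mem_ofPred_eq] at *
    rw [wedge₂_smul, ht, mul_zero]

/-- The kernel of `id - σ` is the smallest sub-bimodule containing `[II]`. -/
structure IsUniversalBraiding (σ : TwoTensors 𝕜 N q →ₗ[Sphere 𝕜 N q] TwoTensors 𝕜 N q) :
    Prop where
  right_linear : ∀ (a : Sphere 𝕜 N q) (t : TwoTensors 𝕜 N q), σ (op a • t) = op a • σ t
  tensorII : idSub σ (tensorII 𝕜 N q) = 0
  minimal : ∀ K : Submodule (Sphere 𝕜 N q) (TwoTensors 𝕜 N q),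
    (∀ (a : Sphere 𝕜 N q), ∀ t ∈ K, op a • t ∈ K) → QSphere.tensorII 𝕜 N q ∈ K →
    ∀ t, idSub σ t = 0 → t ∈ K

variable {σ : TwoTensors 𝕜 N q →ₗ[Sphere 𝕜 N q] TwoTensors 𝕜 N q}

theorem IsUniversalBraiding.wedge₂_eq_zero (hσ : IsUniversalBraiding σ)
    {f : Sphere 𝕜 N q →ₐ[𝕜] T} {g : OneForms 𝕜 N q →ₗ[𝕜] T}
    (hl : ∀ a m, g (a • m) = f a * g m) (hr : ∀ a m, g (op a • m) = g m * f a)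
    (hII : wedge₂ f g hl hr (QSphere.tensorII 𝕜 N q) = 0) {t : TwoTensors 𝕜 N q}
    (ht : idSub σ t = 0) : wedge₂ f g hl hr t = 0 := by
  refine hσ.minimal (wedgeKer f g hl hr) (fun a t ht => ?_) hII t ht
  change wedge₂ f g hl hr _ = 0
  rw [wedge₂_op_smul, show wedge₂ f g hl hr t = 0 from ht, zero_mul]

theorem IsUniversalBraiding.idSub_mem (hσ : IsUniversalBraiding σ) (a : Sphere 𝕜 N q) :
    ∀ t ∈ LinearMap.ker (idSub σ), op a • t ∈ LinearMap.ker (idSub σ) := fun t ht => by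
  rw [LinearMap.mem_ker, LinearMap.sub_apply, LinearMap.id_apply, sub_eq_zero] at *
  rw [hσ.right_linear, ← ht]

/-- The commutator of η² with x_j is a combination of the u_l with coefficients in X, and these are
zero in the quotient. -/
theorem IsUniversalBraiding.eta_sq_commute (hσ : IsUniversalBraiding σ) (hq : 0 < q)
    (hq1 : q ≠ 1) (hN : 3 ≤ N) (a : Sphere 𝕜 N q) :
    ExteriorAlg.ι₀ σ a ∈ Subalgebra.centralizer 𝕜
      {ExteriorAlg.ι₁ σ (innerForm 𝕜 N q) * ExteriorAlg.ι₁ σ (innerForm 𝕜 N q)} := by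
  have h := isParam_minus 𝕜 hq hq1 hN
  induction a using Sphere.induction with
  | h1 c => rw [AlgHom.commutes]; exact Subalgebra.algebraMap_mem _ c
  | hx j =>
    have hu : ∀ l, fixedForm (metricS 𝕜 q) (q : 𝕜) ((q : 𝕜) ^ (N - 2))
        (fun i => ExteriorAlg.ι₀ σ (coord 𝕜 q i))
        (fun i => ExteriorAlg.ι₁ σ (gam q (q : 𝕜) ((q : 𝕜) ^ (N - 2)) i))
        (ExteriorAlg.ι₁ σ (eta 𝕜 q)) l = 0 := fun l => by
      rw [← wedge₂_fixedT ExteriorAlg.ι₁_left ExteriorAlg.ι₁_right]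
      exact ExteriorAlg.wedge₂_eq_zero (h.fixedT_mem (K := LinearMap.ker (idSub σ)) hN
        hσ.idSub_mem hσ.tensorII l)
    have e := eta_sq_commutator h.braid h.generic (h.isSphere_coord.map (ExteriorAlg.ι₀ σ))
      (h.frame_rel ExteriorAlg.ι₁_left ExteriorAlg.ι₁_right) (h.eta_rel ExteriorAlg.ι₁_left) j
    have hs : ((q : 𝕜) + (q : 𝕜)⁻¹) * (gC (q : 𝕜) ((q : 𝕜) ^ (N - 2)))⁻¹ ≠ 0 := by
      have e1 : (q : 𝕜) + (q : 𝕜)⁻¹ = (1 + (q : 𝕜) ^ 2) / q := by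
        have := h.generic.p_ne; field_simp; ring
      rw [e1]
      exact mul_ne_zero (div_ne_zero h.generic.one_add_sq h.generic.p_ne)
        (inv_ne_zero (gC_ne_zero h.generic))
    simp only [hu, mul_zero, smul_zero, add_zero] at e
    have e0 : tr (metricS 𝕜 q : Fin N → Fin N → 𝕜) (fun _ _ => (0 : ExteriorAlg σ)) = 0 := by
      simp [tr]
    rw [e0, mul_zero, smul_zero, smul_eq_zero, or_iff_right hs, sub_eq_zero] at e
    rw [Subalgebra.mem_centralizer_iff]
    rintro _ rfl
    simp only [innerForm, map_smul, smul_mul_assoc, mul_smul_comm, e]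
  | ha a b ha hb => rw [map_add]; exact add_mem ha hb
  | hm a b ha hb => rw [map_mul]; exact mul_mem ha hb

/-- The centraliser of w² contains X and w, hence also the commutators dx_i, and together they
generate the algebra. This is the condition for the square of the inner differential to vanish. -/
theorem IsUniversalBraiding.sq_central (hσ : IsUniversalBraiding σ) (hq : 0 < q)
    (hq1 : q ≠ 1) (hN : 3 ≤ N) (y : ExteriorAlg σ) :
    ExteriorAlg.ι₁ σ (innerForm 𝕜 N q) * ExteriorAlg.ι₁ σ (innerForm 𝕜 N q) * y =
      y * (ExteriorAlg.ι₁ σ (innerForm 𝕜 N q) * ExteriorAlg.ι₁ σ (innerForm 𝕜 N q)) := by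
  set w := ExteriorAlg.ι₁ σ (innerForm 𝕜 N q) with hw
  set Z := Subalgebra.centralizer 𝕜 {w * w} with hZ
  have h₀ : ∀ a, ExteriorAlg.ι₀ σ a ∈ Z := hσ.eta_sq_commute hq hq1 hN
  have hwZ : w ∈ Z := by
    rw [hZ, Subalgebra.mem_centralizer_iff]
    rintro _ rfl
    exact mul_assoc w w w
  have h₁ : ∀ m, ExteriorAlg.ι₁ σ m ∈ Z := fun m => by
    have hm : m ∈ Submodule.span (Sphere 𝕜 N q)
        (Set.range (dx 𝕜 q : Fin N → OneForms 𝕜 N q)) := by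
      rw [span_dx]; exact Submodule.mem_top
    induction hm using Submodule.span_induction with
    | mem x hx =>
      obtain ⟨i, rfl⟩ := hx
      rw [dx, diff_eq_commutator hq hq1 hN, map_sub, ExteriorAlg.ι₁_left, ExteriorAlg.ι₁_right]
      exact sub_mem (mul_mem hwZ (h₀ _)) (mul_mem (h₀ _) hwZ)
    | zero => rw [map_zero]; exact zero_mem _
    | add x y _ _ hx hy => rw [map_add]; exact add_mem hx hy
    | smul a x _ hx => rw [ExteriorAlg.ι₁_left]; exact mul_mem (h₀ _) hx
  have htop : Subalgebra.toSubmodule Z = ⊤ := ExteriorAlg.eq_top_of_mul_mem (one_mem Z)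
    (fun a _ hy => Z.mul_mem (h₀ a) hy) (fun m _ hy => Z.mul_mem (h₁ m) hy)
  have hy : y ∈ Z := (htop ▸ Submodule.mem_top : y ∈ Subalgebra.toSubmodule Z)
  exact (Subalgebra.mem_centralizer_iff 𝕜).1 hy _ rfl

/-- The inner calculus on the antisymmetrised algebra. -/
def IsUniversalBraiding.calculus (hσ : IsUniversalBraiding σ) (hq : 0 < q) (hq1 : q ≠ 1)
    (hN : 3 ≤ N) : HigherCalculus (diff 𝕜 q : Sphere 𝕜 N q →ₗ[𝕜] OneForms 𝕜 N q)
      (ExteriorAlg σ) :=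
  ExteriorAlg.calculus σ hσ.right_linear (innerForm 𝕜 N q) (diff_eq_commutator hq hq1 hN)
    (hσ.sq_central hq hq1 hN)

theorem IsUniversalBraiding.calculus_isUniversal (hσ : IsUniversalBraiding σ) (hq : 0 < q)
    (hq1 : q ≠ 1) (hN : 3 ≤ N) : (hσ.calculus hq hq1 hN).IsUniversal := by
  refine ExteriorAlg.calculus_isUniversal _ _ _ _ ?_ fun L _ _ S t ht =>
    hσ.wedge₂_eq_zero S.i₁_left S.i₁_right (S.wedge_tensorII hq hq1 hN) ht
  refine top_le_iff.1 (span_dx.symm.trans_le (Submodule.span_mono ?_))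
  rintro _ ⟨i, rfl⟩
  exact ⟨_, rfl⟩

theorem IsUniversalBraiding.calculus_wedge_eq_zero_iff (hσ : IsUniversalBraiding σ) (hq : 0 < q)
    (hq1 : q ≠ 1) (hN : 3 ≤ N) (t : TwoTensors 𝕜 N q) :
    (hσ.calculus hq hq1 hN).wedge t = 0 ↔ idSub σ t = 0 :=
  ExteriorAlg.calculus_wedge_eq_zero_iff ..

end Calculi

/-! ### Which normalisations of the braiding give a calculus. -/

section Classification

variable {𝕜 : Type u} [RCLike 𝕜] {N : ℕ} {q : ℝ}
variable {Q Q' : Fin N → Fin N → Fin N → Fin N → 𝕜} {p z : 𝕜}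
variable {σ τ : TwoTensors 𝕜 N q →ₗ[Sphere 𝕜 N q] TwoTensors 𝕜 N q}

theorem IsParam.exists_isTwist (h : IsParam 𝕜 q Q Q' p z) : ∃ τ, IsTwist q Q p z τ :=
  let ⟨τ, hτ, _⟩ := h.existsUnique_braiding (.inl rfl) p
  ⟨τ, hτ.1, hτ.2⟩

theorem IsTwist.isUniversalBraiding (h : IsParam 𝕜 q Q Q' p z) (hN : 3 ≤ N)
    (hτ : IsTwist q Q p z τ) (hr : ∀ (a : Sphere 𝕜 N q) (t : TwoTensors 𝕜 N q),
      σ (op a • t) = op a • σ t) (hf : ∀ t, σ t = t ↔ τ t = t) : IsUniversalBraiding σ := by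
  have hs : ∀ t, idSub σ t = 0 ↔ τ t = t := fun t => by
    rw [← hf, LinearMap.sub_apply, LinearMap.id_apply, sub_eq_zero, eq_comm]
  exact ⟨hr, (hs _).2 (hτ.apply_tensorII h hN), fun K hK hII t ht =>
    hτ.mem_of_fixed h hN hK hII ((hs t).1 ht)⟩

/-- For γ⁻ the braiding is (α/q)τ. For γ⁺ the parameters are exchanged, so τ is q⁻¹R there while the
braiding is αR⁻; the two are inverse up to α/q. The second alternative avoids dividing by α, which
may be zero. -/
theorem IsBraiding.exists_twist (hq : 0 < q) (hq1 : q ≠ 1) (hN : 3 ≤ N)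
    {γ : Fin N → OneForms 𝕜 N q} (hγ : γ = gammaPlus 𝕜 q ∨ γ = gammaMinus 𝕜 q) {α : ℝ}
    (hσ : IsBraiding α γ σ) : ∃ Q Q' p z τ, IsParam 𝕜 q Q Q' p z ∧ IsTwist q Q p z τ ∧
      ((∀ t, σ t = ((α / q : ℝ) : 𝕜) • τ t) ∨
        ∀ t, σ (τ t) = ((α / q : ℝ) : 𝕜) • t ∧ τ (σ t) = ((α / q : ℝ) : 𝕜) • t) := by
  have h := isParam_minus 𝕜 hq hq1 hN
  have hq' := h.generic.p_ne
  rcases hγ with rfl | rfl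
  · have h' := h.swap
    obtain ⟨τ, hτ⟩ := h'.exists_isTwist
    refine ⟨_, _, _, _, τ, h', hτ, .inr fun t => ?_⟩
    obtain ⟨c, hc⟩ := h'.exists_coordinates
    set g : Fin N → OneForms 𝕜 N q := gam q (q : 𝕜)⁻¹ ((q : 𝕜) ^ (N - 2))⁻¹ with hg
    have e1 : ∀ i j, σ (tens (g i) (g j)) =
        (α : 𝕜) • act (RinvS 𝕜 q) (fun k l => tens (g k) (g l)) i j := by
      rw [hg, ← gammaPlus_eq hq hq1 hN]
      exact hσ.apply_gamma
    have e2 : ∀ i j, τ (tens (g i) (g j)) =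
        (q : 𝕜)⁻¹ • act (RmatS 𝕜 q) (fun k l => tens (g k) (g l)) i j := hτ.apply_gam
    have e3 : σ ∘ₗ τ = ((α / q : ℝ) : 𝕜) • LinearMap.id := by
      refine BTensor.frame_ext h'.span_gam hc fun i j => ?_
      rw [LinearMap.comp_apply, ← hg, e2, σ.map_smul_of_tower, map_act_left]
      simp only [e1, act_smul]
      refine (congrArg (fun v => (q : 𝕜)⁻¹ • (α : 𝕜) • v) (congrFun₂ (h'.braid.act_act
        fun k l => tens (g k) (g l)) i j)).trans ?_
      rw [smul_smul, LinearMap.smul_apply, LinearMap.id_apply, RCLike.ofReal_div, div_eq_inv_mul]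
    have e4 : τ ∘ₗ σ = ((α / q : ℝ) : 𝕜) • LinearMap.id := by
      refine BTensor.frame_ext h'.span_gam hc fun i j => ?_
      rw [LinearMap.comp_apply, ← hg, e1, τ.map_smul_of_tower, map_act_left]
      simp only [e2, act_smul]
      refine (congrArg (fun v => (α : 𝕜) • (q : 𝕜)⁻¹ • v) (congrFun₂ (h'.braid.act_act'
        fun k l => tens (g k) (g l)) i j)).trans ?_
      rw [smul_smul, LinearMap.smul_apply, LinearMap.id_apply, RCLike.ofReal_div, div_eq_mul_inv]
    exact ⟨DFunLike.congr_fun e3 t, DFunLike.congr_fun e4 t⟩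
  · obtain ⟨τ, hτ⟩ := h.exists_isTwist
    refine ⟨_, _, _, _, τ, h, hτ, .inl fun t => ?_⟩
    obtain ⟨c, hc⟩ := h.exists_coordinates
    have e : σ = ((α / q : ℝ) : 𝕜) • τ := by
      refine BTensor.frame_ext h.span_gam hc fun i j => ?_
      rw [LinearMap.smul_apply, hτ.apply_gam, smul_smul]
      push_cast
      rw [div_mul_cancel₀ _ hq', ← gammaMinus_eq hN]
      exact hσ.apply_gamma i j
    exact DFunLike.congr_fun e t

/-- In either alternative of `exists_twist` the eigenvalue is α/q, because [II] is fixed by τ and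
therefore also by its inverse. -/
theorem IsBraiding.apply_tensorII (hq : 0 < q) (hq1 : q ≠ 1) (hN : 3 ≤ N)
    {γ : Fin N → OneForms 𝕜 N q} (hγ : γ = gammaPlus 𝕜 q ∨ γ = gammaMinus 𝕜 q) {α : ℝ}
    (hσ : IsBraiding α γ σ) : σ (tensorII 𝕜 N q) = ((α / q : ℝ) : 𝕜) • tensorII 𝕜 N q := by
  obtain ⟨Q, Q', p, z, τ, h, hτ, e | e⟩ := hσ.exists_twist hq hq1 hN hγ
  · rw [e, hτ.apply_tensorII h hN]
  · rw [← (e _).1, hτ.apply_tensorII h hN]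

theorem IsBraiding.eq_of_fixed_tensorII (hq : 0 < q) (hq1 : q ≠ 1) (hN : 3 ≤ N)
    {γ : Fin N → OneForms 𝕜 N q} (hγ : γ = gammaPlus 𝕜 q ∨ γ = gammaMinus 𝕜 q) {α : ℝ}
    (hσ : IsBraiding α γ σ) (hII : idSub σ (tensorII 𝕜 N q) = 0) : α = q := by
  rw [LinearMap.sub_apply, LinearMap.id_apply, hσ.apply_tensorII hq hq1 hN hγ, sub_eq_zero] at hII
  have e : (1 - ((α / q : ℝ) : 𝕜)) • tensorII 𝕜 N q = 0 := by
    rw [sub_smul, one_smul, ← hII, sub_self]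
  have e1 := (smul_eq_zero.1 e).resolve_right (tensorII_ne_zero hq hq1 hN)
  have e2 : (1 : ℝ) - α / q = 0 := by exact_mod_cast e1
  have e3 : α / q = 1 := by linarith
  exact (div_eq_one_iff_eq hq.ne').1 e3

/-- For α = q the braiding is τ or τ⁻¹, and these have the same fixed points. -/
theorem IsBraiding.isUniversalBraiding (hq : 0 < q) (hq1 : q ≠ 1) (hN : 3 ≤ N)
    {γ : Fin N → OneForms 𝕜 N q} (hγ : γ = gammaPlus 𝕜 q ∨ γ = gammaMinus 𝕜 q)
    (hσ : IsBraiding q γ σ) : IsUniversalBraiding σ := by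
  obtain ⟨Q, Q', p, z, τ, h, hτ, e⟩ := hσ.exists_twist hq hq1 hN hγ
  refine hτ.isUniversalBraiding h hN hσ.right_linear fun t => ?_
  rw [div_self hq.ne'] at e
  simp only [RCLike.ofReal_one, one_smul] at e
  rcases e with e | e
  · rw [e]
  · exact ⟨fun ht => by simpa only [ht] using (e t).2,
      fun ht => by simpa only [ht] using (e t).1⟩

theorem existsUnique_isBraiding (hq : 0 < q) (hq1 : q ≠ 1) (hN : 3 ≤ N)
    {γ : Fin N → OneForms 𝕜 N q} (hγ : γ = gammaPlus 𝕜 q ∨ γ = gammaMinus 𝕜 q) (α : ℝ) :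
    ∃! σ : TwoTensors 𝕜 N q →ₗ[Sphere 𝕜 N q] TwoTensors 𝕜 N q, IsBraiding α γ σ := by
  have h := isParam_minus 𝕜 hq hq1 hN
  have key : ∃! σ : TwoTensors 𝕜 N q →ₗ[Sphere 𝕜 N q] TwoTensors 𝕜 N q,
      (∀ (a : Sphere 𝕜 N q) (t : TwoTensors 𝕜 N q), σ (op a • t) = op a • σ t) ∧
      ∀ i j, σ (tens (γ i) (γ j)) =
        (α : 𝕜) • act (RinvS 𝕜 q) (fun k l => tens (γ k) (γ l)) i j := by
    rcases hγ with rfl | rfl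
    · rw [gammaPlus_eq hq hq1 hN]
      exact h.swap.existsUnique_braiding (.inr rfl) _
    · rw [gammaMinus_eq hN]
      exact h.existsUnique_braiding (.inl rfl) _
  obtain ⟨σ, hσ, hu⟩ := key
  exact ⟨σ, ⟨hσ.1, hσ.2⟩, fun τ hτ => hu τ ⟨hτ.right_linear, hτ.apply_gamma⟩⟩

end Classification

/-! ### The transformation of arrays by O_q(N), and its compatibility with R⁻ and the metric. -/

section Coaction

variable {𝕜 : Type u} [RCLike 𝕜] {N : ℕ} {q : ℝ} {E : Type u} [Ring E] [Algebra 𝕜 E]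

variable (𝕜 q) in
/-- The transformation `v_k ↦ v_i ⊗ u^i_k` of a vector by the quantum group. -/
def coact (v : Fin N → E) (k : Fin N) : E ⊗[𝕜] Oq 𝕜 N q := ∑ i, v i ⊗ₜ[𝕜] uu 𝕜 q i k

variable (𝕜 q) in
/-- The transformation `w_{kl} ↦ w_{ij} ⊗ u^i_k u^j_l` of a two-index array. -/
def coact₂ (w : Fin N → Fin N → E) (k l : Fin N) : E ⊗[𝕜] Oq 𝕜 N q :=
  ∑ i, ∑ j, w i j ⊗ₜ[𝕜] (uu 𝕜 q i k * uu 𝕜 q j l)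

theorem coact_mul_coact (v w : Fin N → E) (k l : Fin N) :
    coact 𝕜 q v k * coact 𝕜 q w l = coact₂ 𝕜 q (fun i j => v i * w j) k l := by
  simp only [coact, coact₂, Finset.sum_mul_sum, Algebra.TensorProduct.tmul_mul_tmul]

theorem coact_sub (v w : Fin N → E) (k : Fin N) :
    coact 𝕜 q (fun i => v i - w i) k = coact 𝕜 q v k - coact 𝕜 q w k := by
  simp only [coact, TensorProduct.sub_tmul, Finset.sum_sub_distrib]

theorem coact_smul (c : 𝕜) (v : Fin N → E) (k : Fin N) :
    coact 𝕜 q (fun i => c • v i) k = c • coact 𝕜 q v k := by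
  simp only [coact, Finset.smul_sum, TensorProduct.smul_tmul']

theorem coact_mul_tmul_one (v : Fin N → E) (y : E) (k : Fin N) :
    coact 𝕜 q v k * y ⊗ₜ[𝕜] 1 = coact 𝕜 q (fun i => v i * y) k := by
  simp only [coact, Finset.sum_mul, Algebra.TensorProduct.tmul_mul_tmul, mul_one]

theorem tmul_one_mul_coact (v : Fin N → E) (y : E) (k : Fin N) :
    y ⊗ₜ[𝕜] 1 * coact 𝕜 q v k = coact 𝕜 q (fun i => y * v i) k := by
  simp only [coact, Finset.mul_sum, Algebra.TensorProduct.tmul_mul_tmul, one_mul]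

theorem coact₂_add (v w : Fin N → Fin N → E) (k l : Fin N) :
    coact₂ 𝕜 q (fun i j => v i j + w i j) k l = coact₂ 𝕜 q v k l + coact₂ 𝕜 q w k l := by
  simp only [coact₂, TensorProduct.add_tmul, Finset.sum_add_distrib]

theorem coact₂_sub (v w : Fin N → Fin N → E) (k l : Fin N) :
    coact₂ 𝕜 q (fun i j => v i j - w i j) k l = coact₂ 𝕜 q v k l - coact₂ 𝕜 q w k l := by
  simp only [coact₂, TensorProduct.sub_tmul, Finset.sum_sub_distrib]

theorem coact₂_smul (c : 𝕜) (w : Fin N → Fin N → E) (k l : Fin N) :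
    coact₂ 𝕜 q (fun i j => c • w i j) k l = c • coact₂ 𝕜 q w k l := by
  simp only [coact₂, Finset.smul_sum, TensorProduct.smul_tmul']

theorem coact₂_metric (y : E) (k l : Fin N) :
    coact₂ 𝕜 q (fun i j => metricS 𝕜 q i j • y) k l = metricS 𝕜 q k l • y ⊗ₜ[𝕜] 1 := by
  have e : ∀ i j, (metricS 𝕜 q i j • y) ⊗ₜ[𝕜] (uu 𝕜 q i k * uu 𝕜 q j l) =
      y ⊗ₜ[𝕜] ((metric q i j : 𝕜) • (uu 𝕜 q i k * uu 𝕜 q j l)) := fun i j =>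
    TensorProduct.smul_tmul _ _ _
  simp only [coact₂, e, ← TensorProduct.tmul_sum, uu_lower]
  rw [Algebra.algebraMap_eq_smul_one, TensorProduct.tmul_smul]
  rfl

theorem tr_coact₂ (w : Fin N → Fin N → E) :
    tr (metricS 𝕜 q) (coact₂ 𝕜 q w) = tr (metricS 𝕜 q) w ⊗ₜ[𝕜] 1 := by
  have e : tr (metricS 𝕜 q) (coact₂ 𝕜 q w) = ∑ i, ∑ j, w i j ⊗ₜ[𝕜]
      ∑ k, ∑ l, (metric q k l : 𝕜) • (uu 𝕜 q i k * uu 𝕜 q j l) := by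
    simp only [tr, coact₂, Finset.smul_sum, TensorProduct.tmul_sum]
    rw [sum4_swap]
    simp only [TensorProduct.tmul_smul]
    rfl
  rw [e]
  simp only [uu_upper, tr, TensorProduct.sum_tmul]
  refine Finset.sum_congr rfl fun i _ => Finset.sum_congr rfl fun j _ => ?_
  rw [Algebra.algebraMap_eq_smul_one, TensorProduct.tmul_smul, TensorProduct.smul_tmul']
  rfl

theorem act_RmatS_coact₂ (w : Fin N → Fin N → E) (i j : Fin N) :
    act (RmatS 𝕜 q) (coact₂ 𝕜 q w) i j = coact₂ 𝕜 q (act (RmatS 𝕜 q) w) i j := by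
  have e1 : act (RmatS 𝕜 q) (coact₂ 𝕜 q w) i j = ∑ s, ∑ t, w s t ⊗ₜ[𝕜]
      ∑ k, ∑ l, (Rmat q k l i j : 𝕜) • (uu 𝕜 q s k * uu 𝕜 q t l) := by
    simp only [act, coact₂, Finset.smul_sum, TensorProduct.tmul_sum]
    rw [sum4_swap]
    simp only [TensorProduct.tmul_smul]
    rfl
  have e2 : coact₂ 𝕜 q (act (RmatS 𝕜 q) w) i j = ∑ s, ∑ t, w s t ⊗ₜ[𝕜]
      ∑ k, ∑ l, (Rmat q s t k l : 𝕜) • (uu 𝕜 q k i * uu 𝕜 q l j) := by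
    simp only [act, coact₂, TensorProduct.sum_tmul, TensorProduct.tmul_sum]
    rw [sum4_swap]
    simp only [TensorProduct.tmul_smul, ← TensorProduct.smul_tmul']
    rfl
  rw [e1, e2]
  simp only [uu_ruu]

/-- The defining relations of O_q(N) give the statement for R and for the metric; the skein relation
transfers it to R⁻. -/
theorem act_RinvS_coact₂ (hq : 0 < q) (hq1 : q ≠ 1) (hN : 3 ≤ N) (w : Fin N → Fin N → E)
    (i j : Fin N) :
    act (RinvS 𝕜 q) (coact₂ 𝕜 q w) i j = coact₂ 𝕜 q (act (RinvS 𝕜 q) w) i j := by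
  have h := (isParam_minus 𝕜 hq hq1 hN).swap.braid
  have e : act (RinvS 𝕜 q) w = fun i j => act (RmatS 𝕜 q) w i j +
      ((q : 𝕜)⁻¹ - (q : 𝕜)⁻¹⁻¹) • (w i j - metricS 𝕜 q i j • tr (metricS 𝕜 q) w) :=
    funext₂ fun i j => h.act_skein w i j
  rw [h.act_skein, act_RmatS_coact₂, tr_coact₂, e, coact₂_add, coact₂_smul, coact₂_sub,
    coact₂_metric]

theorem IsSphere.coact (hq : 0 < q) (hq1 : q ≠ 1) (hN : 3 ≤ N) {p z : 𝕜} {x : Fin N → E}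
    (hx : IsSphere (RinvS 𝕜 q) (metricS 𝕜 q) p z x) :
    IsSphere (RinvS 𝕜 q) (metricS 𝕜 q) p z (QSphere.coact 𝕜 q x) where
  comm i j := by
    simp only [coact_mul_coact]
    refine (act_RinvS_coact₂ hq hq1 hN _ i j).trans ?_
    have e : act (RinvS 𝕜 q) (fun k l => x k * x l) = fun i j => p⁻¹ • (x i * x j) +
        kappaC p z • metricS 𝕜 q i j • (1 : E) := funext₂ hx.comm
    rw [e, coact₂_add, coact₂_smul, coact₂_smul, coact₂_metric, Algebra.TensorProduct.one_def]
  norm := by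
    simp only [coact_mul_coact]
    refine (tr_coact₂ _).trans ?_
    rw [hx.norm, Algebra.TensorProduct.one_def]

/-- The form of [II] is a full contraction of coordinate and frame vectors with the coinvariant η,
hence itself coinvariant. -/
theorem metricForm_coact {p z : 𝕜} (x γ : Fin N → E) (η : E) :
    metricForm (metricS 𝕜 q) p z (coact 𝕜 q x) (coact 𝕜 q γ) (η ⊗ₜ[𝕜] 1) =
      metricForm (metricS 𝕜 q) p z x γ η ⊗ₜ[𝕜] 1 := by
  have e : ∀ i, coact 𝕜 q γ i - alphaC p z • (coact 𝕜 q x i * η ⊗ₜ[𝕜] 1) =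
      coact 𝕜 q (fun i => γ i - alphaC p z • (x i * η)) i := fun i => by
    rw [coact_mul_tmul_one, coact_sub, coact_smul]
  rw [metricForm, metricForm]
  simp only [e, tmul_one_mul_coact, coact_mul_coact]
  refine (congrArg₂ (fun a b => a + (2 / betaC p z) • b) (tr_coact₂ _) (tr_coact₂ _)).trans ?_
  rw [TensorProduct.add_tmul, TensorProduct.smul_tmul']

/-- An algebra map applied to the coefficients of a transformed vector. -/
theorem map_coact {B : Type u} [Ring B] [Algebra 𝕜 B] (φ : E →ₐ[𝕜] B) (v : Fin N → E)
    (k : Fin N) : Algebra.TensorProduct.map φ (AlgHom.id 𝕜 (Oq 𝕜 N q)) (coact 𝕜 q v k) =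
      coact 𝕜 q (fun i => φ (v i)) k := by
  simp only [coact, map_sum, Algebra.TensorProduct.map_tmul, AlgHom.id_apply]

theorem comul_uu (i j : Fin N) :
    comul 𝕜 q (uu 𝕜 q i j) = ∑ k, uu 𝕜 q i k ⊗ₜ[𝕜] uu 𝕜 q k j :=
  (RingQuot.liftAlgHom_mkAlgHom_apply 𝕜 _ _ _).trans (FreeAlgebra.lift_ι_apply _ _)

theorem counit_uu (i j : Fin N) : counit 𝕜 q (uu 𝕜 q i j) = if i = j then (1 : 𝕜) else 0 :=
  (RingQuot.liftAlgHom_mkAlgHom_apply 𝕜 _ _ _).trans (FreeAlgebra.lift_ι_apply _ _)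

theorem coassoc_coact (v : Fin N → E) (k : Fin N) :
    Algebra.TensorProduct.assoc 𝕜 𝕜 𝕜 E (Oq 𝕜 N q) (Oq 𝕜 N q) (coact 𝕜 q (coact 𝕜 q v) k) =
      Algebra.TensorProduct.map (AlgHom.id 𝕜 E) (comul 𝕜 q) (coact 𝕜 q v k) := by
  simp only [coact, map_sum, Algebra.TensorProduct.map_tmul, AlgHom.id_apply, comul_uu,
    TensorProduct.sum_tmul, TensorProduct.tmul_sum, Algebra.TensorProduct.assoc_tmul]
  exact Finset.sum_comm

theorem counit_coact (v : Fin N → E) (k : Fin N) : Algebra.TensorProduct.rid 𝕜 𝕜 E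
    (Algebra.TensorProduct.map (AlgHom.id 𝕜 E) (counit 𝕜 q) (coact 𝕜 q v k)) = v k := by
  simp only [coact, map_sum, Algebra.TensorProduct.map_tmul, AlgHom.id_apply, counit_uu,
    Algebra.TensorProduct.rid_tmul]
  simp

end Coaction

/-! ### Covariance of the universal calculus. -/

section Covariance

variable {𝕜 : Type u} [RCLike 𝕜] {N : ℕ} {q : ℝ} {T : Type u} [Ring T] [Algebra 𝕜 T]
variable {σ : TwoTensors 𝕜 N q →ₗ[Sphere 𝕜 N q] TwoTensors 𝕜 N q}

/-- An algebra map on the antisymmetrised algebra is determined by coordinates and the frame. -/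
theorem IsParam.exteriorAlg_hom_ext {Q Q' : Fin N → Fin N → Fin N → Fin N → 𝕜} {p z : 𝕜}
    (h : IsParam 𝕜 q Q Q' p z) {φ ψ : ExteriorAlg σ →ₐ[𝕜] T}
    (h₀ : ∀ i, φ (ExteriorAlg.ι₀ σ (coord 𝕜 q i)) = ψ (ExteriorAlg.ι₀ σ (coord 𝕜 q i)))
    (h₁ : ∀ i, φ (ExteriorAlg.ι₁ σ (gam q p z i)) = ψ (ExteriorAlg.ι₁ σ (gam q p z i))) :
    φ = ψ := by
  have e : ∀ a, φ (ExteriorAlg.ι₀ σ a) = ψ (ExteriorAlg.ι₀ σ a) := fun a =>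
    DFunLike.congr_fun (Sphere.hom_ext (f := φ.comp (ExteriorAlg.ι₀ σ))
      (g := ψ.comp (ExteriorAlg.ι₀ σ)) h₀) a
  refine ExteriorAlg.hom_ext e fun m => ?_
  have hm : m ∈ Submodule.span (Sphere 𝕜 N q)
      (Set.range (gam q p z : Fin N → OneForms 𝕜 N q)) := by
    rw [h.span_gam]; exact Submodule.mem_top
  induction hm using Submodule.span_induction with
  | mem x hx => obtain ⟨i, rfl⟩ := hx; exact h₁ i
  | zero => simp only [map_zero]
  | add x y _ _ hx hy => simp only [map_add, hx, hy]
  | smul a x _ hx => simp only [ExteriorAlg.ι₁_left, map_mul, e, hx]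

theorem IsUniversalBraiding.isCovariant (hσ : IsUniversalBraiding σ) (hq : 0 < q)
    (hq1 : q ≠ 1) (hN : 3 ≤ N) : IsCovariant (hσ.calculus hq hq1 hN) := by
  have h := isParam_minus 𝕜 hq hq1 hN
  set x : Fin N → ExteriorAlg σ := fun i => ExteriorAlg.ι₀ σ (coord 𝕜 q i) with hx
  set γ : Fin N → ExteriorAlg σ := fun i =>
    ExteriorAlg.ι₁ σ (gam q (q : 𝕜) ((q : 𝕜) ^ (N - 2)) i) with hγ
  have hxs : IsSphere _ _ _ _ x := h.isSphere_coord.map (ExteriorAlg.ι₀ σ)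
  have hγx : ∀ i j, γ i * x j = act (RinvS 𝕜 q) (fun k l => x k * γ l) i j :=
    h.frame_rel ExteriorAlg.ι₁_left ExteriorAlg.ι₁_right
  have hη : ExteriorAlg.ι₁ σ (eta 𝕜 q) = gC (q : 𝕜) ((q : 𝕜) ^ (N - 2)) •
      tr (metricS 𝕜 q) (fun k l => x k * γ l) := h.eta_rel ExteriorAlg.ι₁_left
  obtain ⟨r1, r2⟩ := (h.sphere_iff _ _).1 (hxs.coact hq hq1 hN)
  let f := Sphere.lift _ r1 r2
  have hf : ∀ i, f (coord 𝕜 q i) = coact 𝕜 q x i := Sphere.lift_coord _ r1 r2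
  obtain ⟨g, hl, hr, hg⟩ := h.exists_frame_lift f (coact 𝕜 q γ) (fun i j => by
    simp only [hf, coact_mul_coact]
    refine Eq.trans ?_ (act_RinvS_coact₂ hq hq1 hN _ i j).symm
    exact congrArg (fun w => coact₂ 𝕜 q w i j) (funext₂ hγx))
  have hgη : g (eta 𝕜 q) = ExteriorAlg.ι₁ σ (eta 𝕜 q) ⊗ₜ[𝕜] 1 := by
    rw [h.eta_rel hl, hη, ← TensorProduct.smul_tmul']
    simp only [hf, hg, coact_mul_coact]
    exact congrArg _ (tr_coact₂ _)
  -- By minimality of the kernel this single relation suffices for the coaction to descend to the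
  -- quotient algebra.
  have hII : wedge₂ f g hl hr (QSphere.tensorII 𝕜 N q) = 0 := by
    rw [h.wedge₂_tensorII _ _ hN, hgη]
    simp only [hf, hg]
    refine (metricForm_coact x γ _).trans ?_
    have e := h.wedge₂_tensorII (ExteriorAlg.ι₁_left (σ := σ)) ExteriorAlg.ι₁_right hN
    rw [ExteriorAlg.wedge₂_eq_zero hσ.tensorII] at e
    rw [← e, TensorProduct.zero_tmul]
  let Φ : ExteriorAlg σ →ₐ[𝕜] ExteriorAlg σ ⊗[𝕜] Oq 𝕜 N q :=
    ExteriorAlg.lift f g hl hr fun t ht => hσ.wedge₂_eq_zero hl hr hII ht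
  have hΦ₀ : ∀ i, Φ (x i) = coact 𝕜 q x i := fun i => (ExteriorAlg.lift_ι₀ ..).trans (hf i)
  have hΦ₁ : ∀ i, Φ (γ i) = coact 𝕜 q γ i := fun i => (ExteriorAlg.lift_ι₁ ..).trans (hg i)
  have hΦη : Φ (ExteriorAlg.ι₁ σ (innerForm 𝕜 N q)) =
      ExteriorAlg.ι₁ σ (innerForm 𝕜 N q) ⊗ₜ[𝕜] 1 := by
    rw [innerForm, map_smul, map_smul, ← TensorProduct.smul_tmul', ← hgη]
    exact congrArg _ (ExteriorAlg.lift_ι₁ ..)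
  refine ⟨Φ, hΦ₀, fun y => ?_, fun y => ?_, fun y => ?_⟩
  · let P := Algebra.TensorProduct.map (ExteriorAlg.parity σ) (AlgHom.id 𝕜 (Oq 𝕜 N q))
    have e1 : Φ.comp (ExteriorAlg.parity σ) = P.comp Φ := by
      refine h.exteriorAlg_hom_ext (fun i => ?_) fun i => ?_
      · change Φ (ExteriorAlg.parity σ (x i)) = P (Φ (x i))
        have e : ∀ i, ExteriorAlg.parity σ (x i) = x i := fun i => ExteriorAlg.parity_ι₀ _
        rw [hΦ₀, map_coact, e, hΦ₀]
        simp only [e]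
      · change Φ (ExteriorAlg.parity σ (γ i)) = P (Φ (γ i))
        have e : ∀ i, ExteriorAlg.parity σ (γ i) = (-1 : 𝕜) • γ i := fun i => by
          rw [neg_smul, one_smul]; exact ExteriorAlg.parity_ι₁ _
        rw [hΦ₁, map_coact, e, map_smul, hΦ₁]
        simp only [e, coact_smul]
    -- On the tensor product d ⊗ id is the graded commutator with the inner form tensored with 1.
    -- Since that element is the image of the inner form and Φ respects parity, Φ commutes with d.
    have e2 : ∀ w : ExteriorAlg σ ⊗[𝕜] Oq 𝕜 N q,
        LinearMap.rTensor (Oq 𝕜 N q) (ExteriorAlg.innerD σ (innerForm 𝕜 N q)) w =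
          ExteriorAlg.ι₁ σ (innerForm 𝕜 N q) ⊗ₜ[𝕜] 1 * w -
            P w * ExteriorAlg.ι₁ σ (innerForm 𝕜 N q) ⊗ₜ[𝕜] 1 := by
      intro w
      induction w with
      | zero => simp
      | tmul a b =>
        simp only [P, LinearMap.rTensor_tmul, ExteriorAlg.innerD_apply,
          Algebra.TensorProduct.map_tmul, AlgHom.id_apply, Algebra.TensorProduct.tmul_mul_tmul,
          one_mul, mul_one, TensorProduct.sub_tmul]
      | add a b ha hb =>
        rw [map_add, ha, hb, map_add, mul_add, add_mul]
        abel
    change Φ (ExteriorAlg.innerD σ (innerForm 𝕜 N q) y) =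
      LinearMap.rTensor (Oq 𝕜 N q) (ExteriorAlg.innerD σ (innerForm 𝕜 N q)) (Φ y)
    rw [e2, ExteriorAlg.innerD_apply, map_sub, map_mul, map_mul, hΦη]
    exact congrArg (fun w => _ - w * _) (DFunLike.congr_fun e1 y)
  · have e : ((Algebra.TensorProduct.assoc 𝕜 𝕜 𝕜 (ExteriorAlg σ) (Oq 𝕜 N q) (Oq 𝕜 N q)).toAlgHom.comp
        (Algebra.TensorProduct.map Φ (AlgHom.id 𝕜 (Oq 𝕜 N q)))).comp Φ =
        (Algebra.TensorProduct.map (AlgHom.id 𝕜 (ExteriorAlg σ)) (comul 𝕜 q)).comp Φ := by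
      refine h.exteriorAlg_hom_ext (fun i => ?_) fun i => ?_
      · change Algebra.TensorProduct.assoc 𝕜 𝕜 𝕜 (ExteriorAlg σ) (Oq 𝕜 N q) (Oq 𝕜 N q)
          (Algebra.TensorProduct.map Φ (AlgHom.id 𝕜 (Oq 𝕜 N q)) (Φ (x i))) =
          Algebra.TensorProduct.map (AlgHom.id 𝕜 (ExteriorAlg σ)) (comul 𝕜 q) (Φ (x i))
        rw [hΦ₀, map_coact, ← coassoc_coact]
        simp only [hΦ₀]
      · change Algebra.TensorProduct.assoc 𝕜 𝕜 𝕜 (ExteriorAlg σ) (Oq 𝕜 N q) (Oq 𝕜 N q)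
          (Algebra.TensorProduct.map Φ (AlgHom.id 𝕜 (Oq 𝕜 N q)) (Φ (γ i))) =
          Algebra.TensorProduct.map (AlgHom.id 𝕜 (ExteriorAlg σ)) (comul 𝕜 q) (Φ (γ i))
        rw [hΦ₁, map_coact, ← coassoc_coact]
        simp only [hΦ₁]
    exact DFunLike.congr_fun e y
  · have e : ((Algebra.TensorProduct.rid 𝕜 𝕜 (ExteriorAlg σ)).toAlgHom.comp
        (Algebra.TensorProduct.map (AlgHom.id 𝕜 (ExteriorAlg σ)) (counit 𝕜 q))).comp Φ =
        AlgHom.id 𝕜 _ := by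
      refine h.exteriorAlg_hom_ext (fun i => ?_) fun i => ?_
      · change Algebra.TensorProduct.rid 𝕜 𝕜 (ExteriorAlg σ) (Algebra.TensorProduct.map
          (AlgHom.id 𝕜 (ExteriorAlg σ)) (counit 𝕜 q) (Φ (x i))) = x i
        rw [hΦ₀, counit_coact]
      · change Algebra.TensorProduct.rid 𝕜 𝕜 (ExteriorAlg σ) (Algebra.TensorProduct.map
          (AlgHom.id 𝕜 (ExteriorAlg σ)) (counit 𝕜 q) (Φ (γ i))) = γ i
        rw [hΦ₁, counit_coact]
    exact DFunLike.congr_fun e y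

end Covariance

end QSphere

end

theorem mainTheorem6 {𝕜 : Type u} [RCLike 𝕜] (N : ℕ) (hN : 3 ≤ N) (q : ℝ) (hq : 0 < q)
    (hq1 : q ≠ 1) :
    (∀ (γ : Fin N → QSphere.OneForms 𝕜 N q),
      (γ = QSphere.gammaPlus 𝕜 q ∨ γ = QSphere.gammaMinus 𝕜 q) → ∀ α : ℝ,
      ∃! σ : QSphere.TwoTensors 𝕜 N q →ₗ[QSphere.Sphere 𝕜 N q] QSphere.TwoTensors 𝕜 N q,
        QSphere.IsBraiding α γ σ) ∧
    (∀ (γ : Fin N → QSphere.OneForms 𝕜 N q),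
      (γ = QSphere.gammaPlus 𝕜 q ∨ γ = QSphere.gammaMinus 𝕜 q) → ∀ (α : ℝ)
      (σ : QSphere.TwoTensors 𝕜 N q →ₗ[QSphere.Sphere 𝕜 N q] QSphere.TwoTensors 𝕜 N q),
      QSphere.IsBraiding α γ σ →
        (((∀ i j, QSphere.idSub σ (QSphere.tensorI 𝕜 q i j) = 0) ∧
          QSphere.idSub σ (QSphere.tensorII 𝕜 N q) = 0) ↔ α = q) ∧
        ((∃ S, QSphere.IsAntisymCalculus σ S) ↔ α = q) ∧
        ((∃ S, QSphere.IsAntisymCalculus σ S ∧ QSphere.IsCovariant S) ↔ α = q)) ∧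
    (∃ (L : Type u) (_ : Ring L) (_ : Algebra 𝕜 L)
      (U : QSphere.HigherCalculus
        (QSphere.diff 𝕜 q : QSphere.Sphere 𝕜 N q →ₗ[𝕜] QSphere.OneForms 𝕜 N q) L),
      U.IsUniversal ∧ QSphere.IsCovariant U ∧
      ∀ t : QSphere.TwoTensors 𝕜 N q, U.wedge t = 0 ↔
        t ∈ Submodule.span (QSphere.Sphere 𝕜 N q)
          (Set.range (fun p : Fin N × Fin N => QSphere.tensorI 𝕜 q p.1 p.2) ∪
            {QSphere.tensorII 𝕜 N q})) := by
  refine ⟨fun γ hγ α => QSphere.existsUnique_isBraiding hq hq1 hN hγ α, fun γ hγ α σ hσ => ?_, ?_⟩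
  -- A calculus on the quotient kills [II], and in degree two the quotient kills only ker(id - σ),
  -- so σ fixes [II].
  · have only_if : (∃ S, QSphere.IsAntisymCalculus σ S) → α = q := by
      rintro ⟨S, h₀, h₁⟩
      refine hσ.eq_of_fixed_tensorII hq hq1 hN hγ
        ((QSphere.ExteriorAlg.wedge₂_eq_zero_iff hσ.right_linear).1 ?_)
      have e₀ : S.i₀ = QSphere.ExteriorAlg.ι₀ σ := AlgHom.ext h₀
      have e₁ : S.i₁ = QSphere.ExteriorAlg.ι₁ σ := LinearMap.ext h₁
      have e := S.wedge_tensorII hq hq1 hN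
      simp only [QSphere.HigherCalculus.wedge, e₀, e₁] at e
      exact e
    have if_ : α = q → ∃ S, QSphere.IsAntisymCalculus σ S ∧ QSphere.IsCovariant S := by
      rintro rfl
      have h := hσ.isUniversalBraiding hq hq1 hN hγ
      exact ⟨h.calculus hq hq1 hN, ⟨fun _ => rfl, fun _ => rfl⟩, h.isCovariant hq hq1 hN⟩
    refine ⟨⟨fun h => hσ.eq_of_fixed_tensorII hq hq1 hN hγ h.2, ?_⟩,
      ⟨only_if, fun h => (if_ h).imp fun _ => And.left⟩,
      ⟨fun h => only_if (h.imp fun _ => And.left), if_⟩⟩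
    rintro rfl
    have h := hσ.isUniversalBraiding hq hq1 hN hγ
    exact ⟨fun i j => QSphere.tensorI_mem (K := LinearMap.ker (QSphere.idSub σ)) hq hq1 hN
      h.idSub_mem h.tensorII i j, h.tensorII⟩
  -- The universal calculus is built from the γ⁻ twist, whose fixed points are directly the left
  -- span of [I] and [II].
  · have hp := QSphere.isParam_minus 𝕜 hq hq1 hN
    obtain ⟨τ, hτ⟩ := hp.exists_isTwist
    have h := hτ.isUniversalBraiding hp hN hτ.right_linear fun _ => Iff.rfl
    refine ⟨QSphere.ExteriorAlg τ, inferInstance, inferInstance, h.calculus hq hq1 hN,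
      h.calculus_isUniversal hq hq1 hN, h.isCovariant hq hq1 hN, fun t => ?_⟩
    rw [h.calculus_wedge_eq_zero_iff, ← hτ.fixed_iff hq hq1 hN, LinearMap.sub_apply,
      LinearMap.id_apply, sub_eq_zero, eq_comm]
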